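/- All graphs are finite and simple. A graph is \emph{triangle-free} if it has no three pairwise adjacent vertices, and \emph{$P_7$-free} if it has no induced subgraph isomorphic to the path $P_7$ on seven vertices. A \emph{$3$-colouring} of $G$ is a map $f:V(G)\to\{1,2,3\}$ with $f(u)\neq f(v)$ for every edge $uv$. Given lists $L(v)\subseteq\{1,2,3\}$ $(v\in V(G))$, a \emph{list-colouring} of $(G,L)$ is a $3$-colouring $f$ with $f(v)\in L(v)$ for every vertex $v$. Running times are counted on a random access machine with unit-cost operations (addition, truncated subtraction, multiplication, comparison, memory access) on words of $O(\log |V(G)|)$ bits; a graph is given by its number of vertices and its adjacency matrix, and the lists by one bit for each vertex and colour. (i) There is an algorithm that, given a $P_7$-free and triangle-free graph $G$, decides in $O(|V(G)|^7)$ time whether $G$ has a $3$-colouring, and, if a $3$-colouring exists, computes one in the same time. (ii) There is an algorithm that, given a $P_7$-free and triangle-free graph $G$ together with lists $L(v)\subseteq\{1,2,3\}$, $v\in V(G)$, decides in $O(|V(G)|^7)$ time whether $(G,L)$ has a list-colouring, and, if a list-colouring exists, computes one in the same time. -/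

import Mathlib

/-!
# List colourings, and a random access machine with a step count
-/

/-- `f` is a list-colouring of `G` for the lists `L`: it is proper and takes admissible values. -/
def IsListColouring {V : Type*} (G : SimpleGraph V) (L : V → Finset ℕ) (f : V → ℕ) : Prop :=
  (∀ v, f v ∈ L v) ∧ ∀ u v, G.Adj u v → f u ≠ f v

namespace RAM

/-- A machine state: registers, and a memory that is addressed by numbers. -/
structure State where
  reg : ℕ → ℕ
  mem : ℕ → ℕ

/-- Arithmetic expressions. `load a` is the content of the memory cell with address `a`;
`sub` is truncated; the comparisons `lt` and `eq` return `1` (true) or `0` (false). -/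
inductive Expr where
  | const (c : ℕ)
  | reg (i : ℕ)
  | load (a : Expr)
  | add (a b : Expr)
  | sub (a b : Expr)
  | mul (a b : Expr)
  | lt (a b : Expr)
  | eq (a b : Expr)

namespace Expr

/-- The value of an expression. -/
def eval (s : State) : Expr → ℕ
  | const c => c
  | reg i => s.reg i
  | load a => s.mem (a.eval s)
  | add a b => a.eval s + b.eval s
  | sub a b => a.eval s - b.eval s
  | mul a b => a.eval s * b.eval s
  | lt a b => if a.eval s < b.eval s then 1 else 0
  | eq a b => if a.eval s = b.eval s then 1 else 0

/-- The largest number that occurs while an expression is evaluated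
(including the addresses that are read). -/
def peak (s : State) : Expr → ℕ
  | const c => c
  | reg i => s.reg i
  | load a => max (s.mem (a.eval s)) (a.peak s)
  | add a b => max (a.eval s + b.eval s) (max (a.peak s) (b.peak s))
  | sub a b => max (a.peak s) (b.peak s)
  | mul a b => max (a.eval s * b.eval s) (max (a.peak s) (b.peak s))
  | lt a b => max 1 (max (a.peak s) (b.peak s))
  | eq a b => max 1 (max (a.peak s) (b.peak s))

/-- The number of elementary operations that the evaluation of an expression takes:
one for each constant, register access, memory access, arithmetic operation and comparison. -/
def cost : Expr → ℕ
  | const _ => 1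
  | reg _ => 1
  | load a => a.cost + 1
  | add a b => a.cost + b.cost + 1
  | sub a b => a.cost + b.cost + 1
  | mul a b => a.cost + b.cost + 1
  | lt a b => a.cost + b.cost + 1
  | eq a b => a.cost + b.cost + 1

end Expr

/-- Programs. A test succeeds if its value is not `0`. -/
inductive Prog where
  | skip
  | assign (i : ℕ) (e : Expr)
  | store (a e : Expr)
  | seq (p q : Prog)
  | branch (e : Expr) (p q : Prog)
  | loop (e : Expr) (p : Prog)

/-- `Exec B p s t s'`: the program `p`, started in the state `s`, halts after exactly `t` elementary
steps in the state `s'`, and no number that it handles (value or address) reaches `B`, so that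
`B = 2 ^ w` is a machine with words of `w` bits. A run that exceeds the word size is stuck. -/
inductive Exec (B : ℕ) : Prog → State → ℕ → State → Prop
  | skip (s : State) : Exec B .skip s 1 s
  | assign (s : State) (i : ℕ) (e : Expr) (he : e.peak s < B) :
      Exec B (.assign i e) s (e.cost + 1) ⟨Function.update s.reg i (e.eval s), s.mem⟩
  | store (s : State) (a e : Expr) (ha : a.peak s < B) (he : e.peak s < B) :
      Exec B (.store a e) s (a.cost + e.cost + 1)
        ⟨s.reg, Function.update s.mem (a.eval s) (e.eval s)⟩
  | seq {p q : Prog} {s s₁ s₂ : State} {t₁ t₂ : ℕ}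
      (hp : Exec B p s t₁ s₁) (hq : Exec B q s₁ t₂ s₂) : Exec B (.seq p q) s (t₁ + t₂) s₂
  | branch_true {e : Expr} {p q : Prog} {s s₁ : State} {t : ℕ} (he : e.peak s < B)
      (h : e.eval s ≠ 0) (hp : Exec B p s t s₁) : Exec B (.branch e p q) s (e.cost + 1 + t) s₁
  | branch_false {e : Expr} {p q : Prog} {s s₁ : State} {t : ℕ} (he : e.peak s < B)
      (h : e.eval s = 0) (hq : Exec B q s t s₁) : Exec B (.branch e p q) s (e.cost + 1 + t) s₁
  | loop_true {e : Expr} {p : Prog} {s s₁ s₂ : State} {t₁ t₂ : ℕ} (he : e.peak s < B)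
      (h : e.eval s ≠ 0) (hp : Exec B p s t₁ s₁) (hl : Exec B (.loop e p) s₁ t₂ s₂) :
      Exec B (.loop e p) s (e.cost + 1 + t₁ + t₂) s₂
  | loop_false {e : Expr} {p : Prog} {s : State} (he : e.peak s < B) (h : e.eval s = 0) :
      Exec B (.loop e p) s (e.cost + 1) s

/-- The machine is deterministic: the running time and the final state are unique. -/
theorem Exec.deterministic {B : ℕ} {p : Prog} {s s₁ s₂ : State} {t₁ t₂ : ℕ}
    (h₁ : Exec B p s t₁ s₁) (h₂ : Exec B p s t₂ s₂) : t₁ = t₂ ∧ s₁ = s₂ := by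
  induction h₁ generalizing t₂ s₂ with
  | skip => cases h₂; exact ⟨rfl, rfl⟩
  | assign => cases h₂; exact ⟨rfl, rfl⟩
  | store => cases h₂; exact ⟨rfl, rfl⟩
  | seq _ _ ihp ihq =>
    cases h₂ with
    | seq hp hq =>
      obtain ⟨rfl, rfl⟩ := ihp hp
      obtain ⟨rfl, rfl⟩ := ihq hq
      exact ⟨rfl, rfl⟩
  | branch_true _ h _ ih =>
    cases h₂ with
    | branch_true _ _ hp => obtain ⟨rfl, rfl⟩ := ih hp; exact ⟨rfl, rfl⟩
    | branch_false _ h' _ => exact absurd h' h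
  | branch_false _ h _ ih =>
    cases h₂ with
    | branch_true _ h' _ => exact absurd h h'
    | branch_false _ _ hp => obtain ⟨rfl, rfl⟩ := ih hp; exact ⟨rfl, rfl⟩
  | loop_true _ h _ _ ihp ihl =>
    cases h₂ with
    | loop_true _ _ hp hl =>
      obtain ⟨rfl, rfl⟩ := ihp hp
      obtain ⟨rfl, rfl⟩ := ihl hl
      exact ⟨rfl, rfl⟩
    | loop_false _ h' => exact absurd h' h
  | loop_false _ h =>
    cases h₂ with
    | loop_true _ h' _ _ => exact absurd h h'
    | loop_false => exact ⟨rfl, rfl⟩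

/-- The registers at the start: register `0` holds the number of vertices, all others hold `0`. -/
def inputReg (n : ℕ) : ℕ → ℕ := fun i => if i = 0 then n else 0

open Classical in
/-- The start state for the input `G`: cell `u * n + v` (with `u, v < n`) holds `1` if `u` and `v`
are adjacent in `G`; all other cells hold `0`. -/
noncomputable def graphInput {n : ℕ} (G : SimpleGraph (Fin n)) : State where
  reg := inputReg n
  mem := fun a => if ∃ u v : Fin n, a = u * n + v ∧ G.Adj u v then 1 else 0

open Classical in
/-- The start state for the input `(G, L)`: the adjacency matrix of `G` as in `graphInput`, followed
by three cells for each vertex: cell `n * n + 3 * v + c` (with `v < n`, `c < 3`) holds `1` if the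
colour `c + 1` is in the list of `v`; all other cells hold `0`. -/
noncomputable def listInput {n : ℕ} (G : SimpleGraph (Fin n)) (L : Fin n → Finset ℕ) : State where
  reg := inputReg n
  mem := fun a =>
    if (∃ u v : Fin n, a = u * n + v ∧ G.Adj u v) ∨
      (∃ (v : Fin n) (c : Fin 3), a = n * n + 3 * v + c ∧ (c : ℕ) + 1 ∈ L v) then 1 else 0

/-- The answer that the machine gives in register `0`: `1` for yes. -/
def Accepts (s : State) : Prop := s.reg 0 = 1

/-- The answer that the machine gives in register `0`: `0` for no. -/
def Rejects (s : State) : Prop := s.reg 0 = 0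

/-- The colouring that the machine has written: `n` consecutive memory cells, the first of which is
the cell whose address is in register `1`. -/
def outputColouring (n : ℕ) (s : State) : Fin n → ℕ := fun v => s.mem (s.reg 1 + v)

/-- On the input of size `n` that is given by the start state `s`, the program `p` halts within `T n`
steps on a machine with words of `O(log n)` bits (all numbers less than `(n + 2) ^ k`), and its
final state satisfies `Q`. -/
def HaltsWith (p : Prog) (T : ℕ → ℕ) (k n : ℕ) (s : State) (Q : State → Prop) : Prop :=
  ∃ t s', Exec ((n + 2) ^ k) p s t s' ∧ t ≤ T n ∧ Q s'

end RAM

/-!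
# A language of bounded loops and tables, and its compilation to the random access machine
-/

/-! Components are coloured separately. A vertex with a full list whose neighbourhood lies inside
that of another vertex may copy the colour of that vertex (`Pinning.Dead`; a tie-break keeps the
copying from being circular). So among the vertices with full lists only those with maximal
neighbourhoods matter. In each component a bounded number of vertices is pinned, their colours are
guessed, and one round of propagation follows. A vertex with at most two colours left becomes a
Boolean variable. It remains to choose the pins so that the other vertices that are not dead, the
free ones, are pairwise nonadjacent and constrain only pairs of their neighbours; then the rest is a
2-SAT instance.

Suppose that a component has no induced `C_5`. If it is not bipartite, its shortest odd closed walk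
has length seven, because a longer one contains an induced `P_7`, and four vertices of that cycle
dominate the component. If it is bipartite, fix an undominated vertex `w₀` on one side and split
every neighbourhood on this side into the parts inside and outside the neighbourhood of `w₀`. Two
vertices that are incomparable in both parts give a `P_7`. By `exists_forall_subset_or_subset` one
vertex is below all others in one of the parts, and so three vertices dominate the undominated
vertices of the side. Six pins therefore leave no free vertex at all
(`SimpleGraph.exists_C5_or_dominating`).

Suppose that there is an induced cycle `C` of length five. Two vertices `p` and `q` with neighbours
in `C` hit all edges outside the neighbourhood of `C` (`IsHub.exists_hitting_edges`), so the free
vertices are a stable set once `C`, `p` and `q` are pinned. Consider a proper colouring; on `C` it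
has the pattern `x, y, x, y, m`. A free vertex is troublesome if it has neighbours of one colour
that are of different kinds (outside the neighbourhood of `C` or inside; seeing a given colour on
`C` or not). One vertex of colour `x`, one of colour `y` and two of colour `m` hit all troublesome
vertices (`IsC5Coloured.exists_hitting`, `IsC5Coloured.exists_hitting_pair`). With these four pinned
as well, each remaining free vertex either has a colour that is excluded at all its neighbours, or
its neighbours fall into two recognizable classes and have equal colours exactly when they are in
the same class (`IsC5.hasPins`). The latter condition concerns pairs.

Running time: there are `n ^ 4` guesses of vertices and a constant number of guesses of colours, and
each costs `n ^ 3` for the transitive closure of the implications. The search for six dominating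
vertices also costs `n ^ 7`. Every colouring is verified before it is stored, so soundness does not
depend on the guess; the structure theory is needed for completeness, where a right guess must
exist. The algorithm is written in a language of bounded loops whose compiler is proved correct
(`Stmt.correct`), and the exponent of the running time is read off the syntax (`Stmt.deg`). -/

namespace RAM

/-- Bounds of loops and quantifiers: the input size or a constant. -/
inductive Bd where
  | size
  | lit (k : ℕ)

/-- Terms: constants, loop variables (de Bruijn indices), and table entries. -/
inductive Tm where
  | cst (k : ℕ)
  | var (i : ℕ)
  | get (id : ℕ) (a b c d : Tm)

/-- Formulas with bounded quantifiers; `adj` and `lst` read the input. -/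
inductive Fm where
  | lt (a b : Tm)
  | eq (a b : Tm)
  | adj (a b : Tm)
  | lst (a b : Tm)
  | neg (φ : Fm)
  | and (φ ψ : Fm)
  | ex (b : Bd) (φ : Fm)

/-- Statements: writing a table entry, conditionals and bounded loops. -/
inductive Stmt where
  | skip
  | store (id : ℕ) (a b c d v : Tm)
  | seq (p q : Stmt)
  | ite (φ : Fm) (p q : Stmt)
  | loop (b : Bd) (p : Stmt)

/-- The contents of the tables. -/
abbrev Tabs := ℕ → ℕ → ℕ → ℕ → ℕ → ℕ

/-- The value of a bound. -/
def Bd.val (n : ℕ) : Bd → ℕ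
  | size => n
  | lit k => k

/-- The value of a term. -/
def Tm.eval (env : List ℕ) (T : Tabs) : Tm → ℕ
  | cst k => k
  | var i => env.getD i 0
  | get id a b c d => T id (a.eval env T) (b.eval env T) (c.eval env T) (d.eval env T)

/-- The truth of a formula. -/
def Fm.eval (n : ℕ) (inp : ℕ → ℕ) (T : Tabs) : List ℕ → Fm → Prop
  | env, lt a b => a.eval env T < b.eval env T
  | env, eq a b => a.eval env T = b.eval env T
  | env, adj a b => inp (a.eval env T * n + b.eval env T) ≠ 0
  | env, lst a b => inp (n * n + 3 * a.eval env T + b.eval env T) ≠ 0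
  | env, neg φ => ¬ φ.eval n inp T env
  | env, and φ ψ => φ.eval n inp T env ∧ ψ.eval n inp T env
  | env, ex b φ => ∃ i < b.val n, φ.eval n inp T (i :: env)

/-- Writing one table entry. -/
def Tabs.set (T : Tabs) (id a b c d v : ℕ) : Tabs := fun id' a' b' c' d' =>
  if id' = id ∧ a' = a ∧ b' = b ∧ c' = c ∧ d' = d then v else T id' a' b' c' d'

/-- Bounded iteration. -/
def iter {α : Type*} (f : ℕ → α → α) : ℕ → α → α
  | 0, x => x
  | k + 1, x => f k (iter f k x)

open Classical in
/-- The effect of a statement on the tables. -/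
noncomputable def Stmt.sem (n : ℕ) (inp : ℕ → ℕ) : Stmt → List ℕ → Tabs → Tabs
  | skip, _, T => T
  | store id a b c d v, env, T =>
      T.set id (a.eval env T) (b.eval env T) (c.eval env T) (d.eval env T) (v.eval env T)
  | seq p q, env, T => q.sem n inp env (p.sem n inp env T)
  | ite φ p q, env, T => if φ.eval n inp T env then p.sem n inp env T else q.sem n inp env T
  | loop b p, env, T => iter (fun i T => p.sem n inp (i :: env) T) (b.val n) T

/-- Constants are small. -/
def Bd.wf : Bd → Bool
  | size => true
  | lit k => k < 32

/-- Constants are small and variables are bound (by `l` binders). -/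
def Tm.wf (l : ℕ) : Tm → Bool
  | cst k => k < 32
  | var i => i < l
  | get id a b c d => id < 32 && a.wf l && b.wf l && c.wf l && d.wf l

/-- Constants are small and variables are bound (by `l` binders). -/
def Fm.wf : ℕ → Fm → Bool
  | l, lt a b => a.wf l && b.wf l
  | l, eq a b => a.wf l && b.wf l
  | l, adj a b => a.wf l && b.wf l
  | l, lst a b => a.wf l && b.wf l
  | l, neg φ => φ.wf l
  | l, and φ ψ => φ.wf l && ψ.wf l
  | l, ex b φ => b.wf && φ.wf (l + 1)

/-- Constants are small and variables are bound (by `l` binders). -/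
def Stmt.wf : ℕ → Stmt → Bool
  | _, skip => true
  | l, store id a b c d v => id < 32 && a.wf l && b.wf l && c.wf l && d.wf l && v.wf l
  | l, seq p q => p.wf l && q.wf l
  | l, ite φ p q => φ.wf l && p.wf l && q.wf l
  | l, loop b p => b.wf && p.wf (l + 1)

/-- The base of the number system in which table addresses are written. -/
def rad (n : ℕ) : ℕ := n + 32

/-- The address of a table entry. -/
def addr (n id a b c d : ℕ) : ℕ :=
  ((((id + 1) * rad n + a) * rad n + b) * rad n + c) * rad n + d

/-- The leading digit `id + 1` is at most `32` and the other digits are below the base. This bound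
is what the word size has to cover. -/
theorem addr_lt {n id a b c d : ℕ} (hid : id < 32) (ha : a < rad n) (hb : b < rad n)
    (hc : c < rad n) (hd : d < rad n) : addr n id a b c d < 33 * rad n ^ 4 := by
  unfold addr
  have step : ∀ {x y e : ℕ}, x + 1 ≤ y → e < rad n → x * rad n + e + 1 ≤ y * rad n := by
    intro x y e h he
    calc x * rad n + e + 1 ≤ x * rad n + rad n := by omega
      _ = (x + 1) * rad n := by ring
      _ ≤ y * rad n := Nat.mul_le_mul_right _ h
  have h1 : (id + 1) * rad n + a + 1 ≤ 33 * rad n := step (by omega) ha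
  have := step (step (step h1 hb) hc) hd
  calc _ < 33 * rad n * rad n * rad n * rad n := by omega
    _ = _ := by ring

/-- The leading digit is `id + 1` rather than `id`, hence never zero. So all tables lie above the
cells below `rad n ^ 4`, which are reserved for the input. -/
theorem le_addr (n id a b c d : ℕ) : rad n ^ 4 ≤ addr n id a b c d := by
  unfold addr
  have step : ∀ {x y e : ℕ}, y ≤ x → y * rad n ≤ x * rad n + e := fun h =>
    (Nat.mul_le_mul_right _ h).trans (Nat.le_add_right _ _)
  have := step (e := d) (step (e := c) (step (e := b) (step (e := a) (Nat.le_add_left 1 id))))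
  calc rad n ^ 4 = 1 * rad n * rad n * rad n * rad n := by ring
    _ ≤ _ := this

theorem addr_inj {n id a b c d id' a' b' c' d' : ℕ} (ha : a < rad n) (hb : b < rad n)
    (hc : c < rad n) (hd : d < rad n) (ha' : a' < rad n) (hb' : b' < rad n)
    (hc' : c' < rad n) (hd' : d' < rad n) (h : addr n id a b c d = addr n id' a' b' c' d') :
    id = id' ∧ a = a' ∧ b = b' ∧ c = c' ∧ d = d' := by
  unfold addr at h
  have step : ∀ {x y e e' : ℕ}, e < rad n → e' < rad n → x * rad n + e = y * rad n + e' →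
      x = y ∧ e = e' := by
    intro x y e e' he he' h
    have h1 : (x * rad n + e) / rad n = x := by
      rw [mul_comm, Nat.mul_add_div (by omega), Nat.div_eq_of_lt he, add_zero]
    have h2 : (y * rad n + e') / rad n = y := by
      rw [mul_comm, Nat.mul_add_div (by omega), Nat.div_eq_of_lt he', add_zero]
    have hxy : x = y := by rw [← h1, h, h2]
    subst hxy
    exact ⟨rfl, by omega⟩
  obtain ⟨h, h4⟩ := step hd hd' h
  obtain ⟨h, h3⟩ := step hc hc' h
  obtain ⟨h, h2⟩ := step hb hb' h
  obtain ⟨h, h1⟩ := step ha ha' h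
  exact ⟨by omega, h1, h2, h3, h4⟩

/-- The register that holds the size of the word base. -/
def radE : Expr := .add (.reg 0) (.const 32)

/-- The address of a table entry as an expression. -/
def addrE (id : ℕ) (a b c d : Expr) : Expr :=
  .add (.mul (.add (.mul (.add (.mul (.add (.mul (.const (id + 1)) radE) a) radE) b) radE) c)
    radE) d

/-- The register of the loop variable that is bound at depth `l`. -/
def vreg (l : ℕ) : ℕ := 2 * l + 2

/-- The register of the truth value that is computed at depth `l`. -/
def treg (l : ℕ) : ℕ := 2 * l + 3

/-- Compilation of bounds. -/
def Bd.comp : Bd → Expr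
  | size => .reg 0
  | lit k => .const k

/-- Compilation of terms. -/
def Tm.comp (l : ℕ) : Tm → Expr
  | cst k => .const k
  | var i => .reg (vreg (l - 1 - i))
  | get id a b c d => .load (addrE id (a.comp l) (b.comp l) (c.comp l) (d.comp l))

/-- Compilation of formulas: the truth value is left in register `treg l`. -/
def Fm.comp : ℕ → Fm → Prog
  | l, lt a b => .assign (treg l) (.lt (a.comp l) (b.comp l))
  | l, eq a b => .assign (treg l) (.eq (a.comp l) (b.comp l))
  | l, adj a b => .assign (treg l)
      (.lt (.const 0) (.load (.add (.mul (a.comp l) (.reg 0)) (b.comp l))))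
  | l, lst a b => .assign (treg l) (.lt (.const 0) (.load (.add (.add (.mul (.reg 0) (.reg 0))
      (.mul (.const 3) (a.comp l))) (b.comp l))))
  | l, neg φ => .seq (φ.comp l) (.assign (treg l) (.sub (.const 1) (.reg (treg l))))
  | l, and φ ψ => .seq (φ.comp l) (.branch (.reg (treg l)) (ψ.comp l) .skip)
  | l, ex b φ => .seq (.assign (treg l) (.const 0)) (.seq (.assign (vreg l) (.const 0))
      (.loop (.lt (.reg (vreg l)) b.comp) (.seq (.seq (φ.comp (l + 1))
        (.branch (.reg (treg (l + 1))) (.assign (treg l) (.const 1)) .skip))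
          (.assign (vreg l) (.add (.reg (vreg l)) (.const 1))))))

/-- Compilation of statements. -/
def Stmt.comp : ℕ → Stmt → Prog
  | _, skip => .skip
  | l, store id a b c d v =>
      .store (addrE id (a.comp l) (b.comp l) (c.comp l) (d.comp l)) (v.comp l)
  | l, seq p q => .seq (p.comp l) (q.comp l)
  | l, ite φ p q => .seq (φ.comp l) (.branch (.reg (treg l)) (p.comp l) (q.comp l))
  | l, loop b p => .seq (.assign (vreg l) (.const 0))
      (.loop (.lt (.reg (vreg l)) b.comp) (.seq (p.comp (l + 1))
        (.assign (vreg l) (.add (.reg (vreg l)) (.const 1)))))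

/-- The state `s` represents the loop variables `env` and the tables `T`. -/
structure Rep (n : ℕ) (inp : ℕ → ℕ) (env : List ℕ) (T : Tabs) (s : State) : Prop where
  reg0 : s.reg 0 = n
  var : ∀ i < env.length, s.reg (vreg (env.length - 1 - i)) = env.getD i 0
  envlt : ∀ i, env.getD i 0 < rad n
  input : ∀ a < rad n ^ 4, s.mem a = inp a
  inplt : ∀ a, inp a < rad n
  tab : ∀ id a b c d, id < 32 → a < rad n → b < rad n → c < rad n → d < rad n →
    s.mem (addr n id a b c d) = T id a b c d
  tablt : ∀ id a b c d, T id a b c d < rad n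

/-! ### Correctness of the compiled code within the word size -/

section Correct

variable {n : ℕ} {inp : ℕ → ℕ} {B : ℕ}

/-- The variables bound at depth less than `l` live in registers below `2 * l + 2`. All registers
from there on are scratch space for code at depth `l`. -/
theorem Rep.of_agree {env : List ℕ} {T : Tabs} {s s' : State} (h : Rep n inp env T s)
    (hm : s'.mem = s.mem) (hr : ∀ i < 2 * env.length + 2, s'.reg i = s.reg i) :
    Rep n inp env T s' where
  reg0 := by rw [hr 0 (by omega), h.reg0]
  var i hi := by rw [hr _ (by unfold vreg; omega), h.var i hi]
  envlt := h.envlt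
  input := by rw [hm]; exact h.input
  inplt := h.inplt
  tab := by rw [hm]; exact h.tab
  tablt := h.tablt

theorem Rep.cons {env : List ℕ} {T : Tabs} {s : State} {i : ℕ} (h : Rep n inp env T s)
    (hi : i < rad n) (hs : s.reg (vreg env.length) = i) : Rep n inp (i :: env) T s where
  reg0 := h.reg0
  var j hj := by
    rcases j with _ | j
    · simpa using hs
    · simp only [List.length_cons] at hj ⊢
      have := h.var j (by omega)
      rw [List.getD_cons_succ, ← this]
      congr 2
      omega
  envlt j := by
    rcases j with _ | j
    · simpa using hi
    · simpa using h.envlt j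
  input := h.input
  inplt := h.inplt
  tab := h.tab
  tablt := h.tablt

theorem Rep.tail {env : List ℕ} {T : Tabs} {s : State} {i : ℕ} (h : Rep n inp (i :: env) T s) :
    Rep n inp env T s where
  reg0 := h.reg0
  var j hj := by
    have := h.var (j + 1) (by simpa using hj)
    rw [List.getD_cons_succ] at this
    rw [← this]
    congr 2
    simp only [List.length_cons]
    omega
  envlt j := by simpa using h.envlt (j + 1)
  input := h.input
  inplt := h.inplt
  tab := h.tab
  tablt := h.tablt

theorem thirtytwo_le_rad (n : ℕ) : 32 ≤ rad n := Nat.le_add_left _ _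

theorem rad_le_pow (n : ℕ) : rad n ≤ rad n ^ 4 :=
  Nat.le_self_pow (by norm_num) _

theorem addrE_eval {s : State} {id : ℕ} {a b c d : Expr} (h0 : s.reg 0 = n) :
    (addrE id a b c d).eval s = addr n id (a.eval s) (b.eval s) (c.eval s) (d.eval s) := by
  simp [addrE, addr, radE, Expr.eval, rad, h0]

theorem addrE_peak {s : State} {id : ℕ} {a b c d : Expr} (h0 : s.reg 0 = n) (hid : id < 32)
    (hB : 33 * rad n ^ 4 ≤ B) (ha : a.eval s < rad n) (hb : b.eval s < rad n)
    (hc : c.eval s < rad n) (hd : d.eval s < rad n)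
    (ha' : a.peak s < B) (hb' : b.peak s < B)
    (hc' : c.peak s < B) (hd' : d.peak s < B) : (addrE id a b c d).peak s < B := by
  have h := addr_lt hid ha hb hc hd
  have hr := rad_le_pow n
  have h32 := thirtytwo_le_rad n
  have hpos : 1 ≤ rad n := by omega
  -- Every stage of the Horner scheme is at most the next one, so the final address bounds all
  -- intermediate values.
  have step : ∀ x e : ℕ, x ≤ x * rad n + e := fun x e => by nlinarith
  have h1 := step (((((id + 1) * rad n + a.eval s) * rad n + b.eval s) * rad n + c.eval s)) (d.eval s)
  have h2 := step (((((id + 1) * rad n + a.eval s) * rad n + b.eval s))) (c.eval s)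
  have h3 := step ((((id + 1) * rad n + a.eval s))) (b.eval s)
  have h4 := step (id + 1) (a.eval s)
  unfold addr at h
  have e1 : n + 32 = rad n := rfl
  simp only [addrE, radE, Expr.eval, Expr.peak, h0, e1, max_lt_iff]
  refine ⟨?_, ⟨?_, ⟨?_, ⟨?_, ⟨?_, ⟨?_, ⟨?_, ⟨?_, ?_, ?_, ?_, ?_⟩, ha'⟩, ?_, ?_, ?_⟩, hb'⟩, ?_, ?_, ?_⟩, hc'⟩,
    ?_, ?_, ?_⟩, hd'⟩ <;> omega

/-- The bound `rad n` on values is part of the induction: it makes every value a legal digit of an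
address, so table entries may serve as indices of other tables. -/
theorem Tm.correct {env : List ℕ} {T : Tabs} {s : State} (h : Rep n inp env T s)
    (hB : 33 * rad n ^ 4 ≤ B) (t : Tm) (ht : t.wf env.length) :
    (t.comp env.length).eval s = t.eval env T ∧ t.eval env T < rad n ∧
      (t.comp env.length).peak s < B := by
  have hr := rad_le_pow n
  have h32 := thirtytwo_le_rad n
  induction t with
  | cst k =>
    simp only [Tm.wf, decide_eq_true_eq] at ht
    refine ⟨rfl, by simp only [Tm.eval]; omega, by simp only [Tm.comp, Expr.peak]; omega⟩
  | var i =>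
    simp only [Tm.wf, decide_eq_true_eq] at ht
    have h1 := h.var i ht
    have h2 := h.envlt i
    refine ⟨h1, h2, ?_⟩
    simp only [Tm.comp, Expr.peak, h1]
    omega
  | get id a b c d iha ihb ihc ihd =>
    simp only [Tm.wf, Bool.and_eq_true, decide_eq_true_eq] at ht
    obtain ⟨⟨⟨⟨hid, ha⟩, hb⟩, hc⟩, hd⟩ := ht
    obtain ⟨ea, la, pa⟩ := iha ha
    obtain ⟨eb, lb, pb⟩ := ihb hb
    obtain ⟨ec, lc, pc⟩ := ihc hc
    obtain ⟨ed, ld, pd⟩ := ihd hd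
    have hval : (Tm.comp env.length (get id a b c d)).eval s = Tm.eval env T (get id a b c d) := by
      simp only [Tm.comp, Expr.eval, addrE_eval h.reg0, Tm.eval, ea, eb, ec, ed]
      exact h.tab id _ _ _ _ hid la lb lc ld
    refine ⟨hval, h.tablt _ _ _ _ _, ?_⟩
    have h3 := h.tablt id (a.eval env T) (b.eval env T) (c.eval env T) (d.eval env T)
    simp only [Tm.comp, Expr.eval, Tm.eval] at hval
    simp only [Tm.comp, Expr.peak, max_lt_iff, hval]
    refine ⟨by omega, addrE_peak h.reg0 hid hB ?_ ?_ ?_ ?_ pa pb pc pd⟩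
    · rw [ea]; exact la
    · rw [eb]; exact lb
    · rw [ec]; exact lc
    · rw [ed]; exact ld

/-- The cost of a quantifier or loop whose body has cost `c`. -/
def loopCost (N c : ℕ) : ℕ := N * (c + 20) + 20

/-- A bound for the running time of a compiled formula. -/
def Fm.cost (n : ℕ) : Fm → ℕ
  | lt a b => (a.comp 0).cost + (b.comp 0).cost + 2
  | eq a b => (a.comp 0).cost + (b.comp 0).cost + 2
  | adj a b => (a.comp 0).cost + (b.comp 0).cost + 10
  | lst a b => (a.comp 0).cost + (b.comp 0).cost + 20
  | neg φ => φ.cost n + 10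
  | and φ ψ => φ.cost n + ψ.cost n + 10
  | ex b φ => loopCost (b.val n) (φ.cost n)

/-- A bound for the running time of a compiled statement. -/
def Stmt.cost (n : ℕ) : Stmt → ℕ
  | skip => 1
  | store id a b c d v => (addrE id (a.comp 0) (b.comp 0) (c.comp 0) (d.comp 0)).cost +
      (v.comp 0).cost + 1
  | seq p q => p.cost n + q.cost n
  | ite φ p q => φ.cost n + p.cost n + q.cost n + 10
  | loop b p => loopCost (b.val n) (p.cost n)

theorem Tm.cost_comp (l : ℕ) (t : Tm) : (t.comp l).cost = (t.comp 0).cost := by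
  induction t with
  | cst k => rfl
  | var i => rfl
  | get id a b c d iha ihb ihc ihd =>
    simp only [Tm.comp, Expr.cost, addrE, iha, ihb, ihc, ihd]

theorem Bd.correct {env : List ℕ} {T : Tabs} {s : State} (h : Rep n inp env T s)
    (hB : 33 * rad n ^ 4 ≤ B) (b : Bd) (hb : b.wf) :
    b.comp.eval s = b.val n ∧ b.val n < rad n ∧ b.comp.peak s < B ∧ b.comp.cost = 1 := by
  have hr := rad_le_pow n
  have h32 := thirtytwo_le_rad n
  cases b with
  | size =>
    refine ⟨h.reg0, by simp [Bd.val, rad], ?_, rfl⟩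
    simp only [Bd.comp, Expr.peak, h.reg0]
    unfold rad at *
    omega
  | lit k =>
    simp only [Bd.wf, decide_eq_true_eq] at hb
    exact ⟨rfl, by simp only [Bd.val]; omega, by simp only [Bd.comp, Expr.peak]; omega, rfl⟩

theorem treg_ne_vreg (l l' : ℕ) : treg l ≠ vreg l' := by unfold treg vreg; omega

/-- A counting loop on the machine: the invariant `I` describes the state before round `i`. -/
theorem exec_count {env : List ℕ} (b : Bd) (hb : b.wf) (hB : 33 * rad n ^ 4 ≤ B)
    (body : Prog) (C : ℕ) (I : ℕ → State → Prop)
    (hI : ∀ i s, I i s → ∃ T, Rep n inp env T s)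
    (hI' : ∀ i s, I i s → ∀ x, I i ⟨Function.update s.reg (vreg env.length) x, s.mem⟩)
    (hbody : ∀ i s, i < b.val n → I i s → s.reg (vreg env.length) = i →
      ∃ t s', Exec B body s t s' ∧ t ≤ C ∧ I (i + 1) s' ∧
        s'.reg (vreg env.length) = s.reg (vreg env.length))
    (s : State) (hs : I 0 s) :
    ∃ t s', Exec B (.seq (.assign (vreg env.length) (.const 0))
      (.loop (.lt (.reg (vreg env.length)) b.comp)
        (.seq body (.assign (vreg env.length) (.add (.reg (vreg env.length)) (.const 1)))))) s t s' ∧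
      t ≤ b.val n * (C + 8) + 6 ∧ I (b.val n) s' := by
  have hr := rad_le_pow n
  have h32 := thirtytwo_le_rad n
  -- Induction on the number `k` of rounds that remain. A round costs `4` for the test and `4` for
  -- the increment besides the body; the last test and the initialization account for the final `6`.
  have key : ∀ k i s, i + k = b.val n → I i s → s.reg (vreg env.length) = i →
      ∃ t s', Exec B (.loop (.lt (.reg (vreg env.length)) b.comp)
        (.seq body (.assign (vreg env.length) (.add (.reg (vreg env.length)) (.const 1))))) s t s' ∧
      t ≤ k * (C + 8) + 4 ∧ I (b.val n) s' := by
    intro k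
    induction k with
    | zero =>
      intro i s hik hIs hreg
      obtain ⟨T, hT⟩ := hI i s hIs
      obtain ⟨e1, e2, e3, e4⟩ := Bd.correct hT hB b hb
      refine ⟨_, s, Exec.loop_false ?_ ?_, ?_, ?_⟩
      · simp only [Expr.peak, hreg, max_lt_iff]
        omega
      · simp only [Expr.eval, e1, hreg]
        rw [if_neg (by omega)]
      · simp only [Expr.cost, e4]
        omega
      · have : i = b.val n := by omega
        rw [← this]; exact hIs
    | succ k ih =>
      intro i s hik hIs hreg
      obtain ⟨T, hT⟩ := hI i s hIs
      obtain ⟨e1, e2, e3, e4⟩ := Bd.correct hT hB b hb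
      obtain ⟨t, s₁, hex, ht, hI1, hreg1⟩ := hbody i s (by omega) hIs hreg
      have hI2 := hI' _ _ hI1 (i + 1)
      obtain ⟨t', s₂, hex', ht', hI3⟩ := ih (i + 1) _ (by omega) hI2 (by simp)
      have hasg : Exec B (.assign (vreg env.length) (.add (.reg (vreg env.length)) (.const 1))) s₁ 4
          ⟨Function.update s₁.reg (vreg env.length) (i + 1), s₁.mem⟩ := by
        have := Exec.assign (B := B) s₁ (vreg env.length)
          (.add (.reg (vreg env.length)) (.const 1)) (by
            simp only [Expr.peak, Expr.eval, hreg1, hreg, max_lt_iff]; omega)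
        simpa only [Expr.eval, Expr.cost, hreg1, hreg] using this
      refine ⟨_, s₂, Exec.loop_true ?_ ?_ (Exec.seq hex hasg) hex', ?_, hI3⟩
      · simp only [Expr.peak, hreg, max_lt_iff]
        omega
      · simp only [Expr.eval, e1, hreg]
        rw [if_pos (by omega)]
        norm_num
      · simp only [Expr.cost, e4]
        have : (k + 1) * (C + 8) = k * (C + 8) + (C + 8) := by ring
        omega
  obtain ⟨t, s', hex, ht, hI3⟩ := key (b.val n) 0 _ (by omega) (hI' 0 s hs 0) (by simp)
  have hasg : Exec B (.assign (vreg env.length) (.const 0)) s 2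
      ⟨Function.update s.reg (vreg env.length) 0, s.mem⟩ :=
    Exec.assign s _ _ (by simp only [Expr.peak]; omega)
  exact ⟨_, s', Exec.seq hasg hex, by omega, hI3⟩

theorem Rep.update {env : List ℕ} {T : Tabs} {s : State} (h : Rep n inp env T s) {r x : ℕ}
    (hr : 2 * env.length + 2 ≤ r) : Rep n inp env T ⟨Function.update s.reg r x, s.mem⟩ :=
  h.of_agree rfl fun i hi => by
    have : i ≠ r := by omega
    simp [this]

-- Besides the truth value, the induction records that the memory and all registers below the
-- scratch space are unchanged. Hence the representation of the tables survives for the second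
-- conjunct and for every round of a quantifier.
open Classical in
theorem Fm.correct (hB : 33 * rad n ^ 4 ≤ B) {T : Tabs} (φ : Fm) :
    ∀ {env : List ℕ} {s : State}, Rep n inp env T s → φ.wf env.length →
    ∃ t s', Exec B (φ.comp env.length) s t s' ∧ t ≤ φ.cost n ∧ s'.mem = s.mem ∧
      (∀ i < 2 * env.length + 2, s'.reg i = s.reg i) ∧
      s'.reg (treg env.length) = if φ.eval n inp T env then 1 else 0 := by
  have hr := rad_le_pow n
  have h32 := thirtytwo_le_rad n
  have hup : ∀ (env : List ℕ) (s : State) (x : ℕ),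
      (∀ i < 2 * env.length + 2, Function.update s.reg (treg env.length) x i = s.reg i) := by
    intro env s x i hi
    have : i ≠ treg env.length := by unfold treg; omega
    simp [this]
  have hn : n < rad n := by simp [rad]
  have sq : rad n * rad n ≤ rad n ^ 4 := by
    calc rad n * rad n = rad n ^ 2 := by ring
      _ ≤ rad n ^ 4 := Nat.pow_le_pow_right (by omega) (by norm_num)
  induction φ with
  | lt a b =>
    intro env s h hw
    simp only [Fm.wf, Bool.and_eq_true] at hw
    obtain ⟨ea, la, pa⟩ := Tm.correct h hB a hw.1
    obtain ⟨eb, lb, pb⟩ := Tm.correct h hB b hw.2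
    refine ⟨_, _, Exec.assign _ _ _ ?_, ?_, rfl, hup env s _, ?_⟩
    · simp only [Expr.peak, max_lt_iff]; omega
    · simp only [Expr.cost, Fm.cost, Tm.cost_comp env.length a, Tm.cost_comp env.length b]; omega
    · simp only [Function.update_self, Expr.eval, ea, eb, Fm.eval]
      congr
  | eq a b =>
    intro env s h hw
    simp only [Fm.wf, Bool.and_eq_true] at hw
    obtain ⟨ea, la, pa⟩ := Tm.correct h hB a hw.1
    obtain ⟨eb, lb, pb⟩ := Tm.correct h hB b hw.2
    refine ⟨_, _, Exec.assign _ _ _ ?_, ?_, rfl, hup env s _, ?_⟩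
    · simp only [Expr.peak, max_lt_iff]; omega
    · simp only [Expr.cost, Fm.cost, Tm.cost_comp env.length a, Tm.cost_comp env.length b]; omega
    · simp only [Function.update_self, Expr.eval, ea, eb, Fm.eval]
      congr
  | adj a b =>
    intro env s h hw
    simp only [Fm.wf, Bool.and_eq_true] at hw
    obtain ⟨ea, la, pa⟩ := Tm.correct h hB a hw.1
    obtain ⟨eb, lb, pb⟩ := Tm.correct h hB b hw.2
    -- The arguments need not be vertices. Being below `rad n`, they still address a cell of the
    -- region in which the memory is the input.
    have hlt : a.eval env T * n + b.eval env T < rad n ^ 4 := by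
      refine lt_of_lt_of_le ?_ sq
      have := Nat.mul_le_mul_right n la.le
      unfold rad at *
      nlinarith
    refine ⟨_, _, Exec.assign _ _ _ ?_, ?_, rfl, hup env s _, ?_⟩
    · have := h.inplt (a.eval env T * n + b.eval env T)
      have : a.eval env T * n < rad n ^ 4 := by omega
      simp only [Expr.peak, Expr.eval, max_lt_iff, ea, eb, h.reg0, h.input _ hlt]
      omega
    · simp only [Expr.cost, Fm.cost, Tm.cost_comp env.length a, Tm.cost_comp env.length b]; omega
    · simp only [Function.update_self, Expr.eval, ea, eb, Fm.eval, h.reg0, h.input _ hlt,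
        Nat.pos_iff_ne_zero]
      congr
  | lst a b =>
    intro env s h hw
    simp only [Fm.wf, Bool.and_eq_true] at hw
    obtain ⟨ea, la, pa⟩ := Tm.correct h hB a hw.1
    obtain ⟨eb, lb, pb⟩ := Tm.correct h hB b hw.2
    have hlt : n * n + 3 * a.eval env T + b.eval env T < rad n ^ 4 := by
      refine lt_of_lt_of_le ?_ sq
      unfold rad at *
      nlinarith
    refine ⟨_, _, Exec.assign _ _ _ ?_, ?_, rfl, hup env s _, ?_⟩
    · have := h.inplt (n * n + 3 * a.eval env T + b.eval env T)
      have : n * n < rad n ^ 4 := by omega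
      simp only [Expr.peak, Expr.eval, max_lt_iff, ea, eb, h.reg0, h.input _ hlt]
      omega
    · simp only [Expr.cost, Fm.cost, Tm.cost_comp env.length a, Tm.cost_comp env.length b]; omega
    · simp only [Function.update_self, Expr.eval, ea, eb, Fm.eval, h.reg0, h.input _ hlt,
        Nat.pos_iff_ne_zero]
      congr
  | neg φ ih =>
    intro env s h hw
    obtain ⟨t, s', hex, ht, hm, hreg, hv⟩ := ih h hw
    refine ⟨_, _, Exec.seq hex (Exec.assign _ _ _ ?_), ?_, hm,
      fun i hi => (hup env s' _ i hi).trans (hreg i hi), ?_⟩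
    · simp only [Expr.peak, hv, max_lt_iff]; split_ifs <;> omega
    · simp only [Expr.cost, Fm.cost]; omega
    · simp only [Function.update_self, Expr.eval, hv, Fm.eval]
      by_cases hφ : φ.eval n inp T env <;> simp [hφ]
  | and φ ψ ihφ ihψ =>
    intro env s h hw
    simp only [Fm.wf, Bool.and_eq_true] at hw
    obtain ⟨t, s', hex, ht, hm, hreg, hv⟩ := ihφ h hw.1
    by_cases hφ : φ.eval n inp T env
    · obtain ⟨t', s'', hex', ht', hm', hreg', hv'⟩ := ihψ (h.of_agree hm hreg) hw.2
      refine ⟨_, _, Exec.seq hex (Exec.branch_true ?_ ?_ hex'), ?_, hm'.trans hm,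
        fun i hi => (hreg' i hi).trans (hreg i hi), ?_⟩
      · simp only [Expr.peak, hv]; split_ifs <;> omega
      · simp [Expr.eval, hv, hφ]
      · simp only [Expr.cost, Fm.cost]; omega
      · simp only [hv', Fm.eval, hφ, true_and]
    · refine ⟨_, _, Exec.seq hex (Exec.branch_false ?_ ?_ (Exec.skip _)), ?_, hm, hreg, ?_⟩
      · simp only [Expr.peak, hv]; split_ifs <;> omega
      · simp [Expr.eval, hv, hφ]
      · simp only [Expr.cost, Fm.cost]; omega
      · simp only [hv, Fm.eval, hφ, false_and]
  | ex b φ ih =>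
    intro env s h hw
    simp only [Fm.wf, Bool.and_eq_true] at hw
    -- Before round `i` the truth register holds the value of the quantifier restricted to indices
    -- below `i`; the loop has no early exit.
    set I : ℕ → State → Prop := fun i s₁ => s₁.mem = s.mem ∧
      (∀ j < 2 * env.length + 2, s₁.reg j = s.reg j) ∧
      s₁.reg (treg env.length) = if ∃ j < i, φ.eval n inp T (j :: env) then 1 else 0 with hIdef
    have hvar : ∀ (s₁ : State) (x : ℕ), (∀ j < 2 * env.length + 2, s₁.reg j = s.reg j) →
        ∀ j < 2 * env.length + 2, Function.update s₁.reg (vreg env.length) x j = s.reg j := by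
      intro s₁ x h1 j hj
      have : j ≠ vreg env.length := by unfold vreg; omega
      rw [Function.update_of_ne this, h1 j hj]
    have hcount := exec_count (n := n) (inp := inp) (B := B) (env := env) b hw.1 hB
      (.seq (φ.comp (env.length + 1)) (.branch (.reg (treg (env.length + 1)))
        (.assign (treg env.length) (.const 1)) .skip)) (φ.cost n + 5) I
      (fun i s₁ h1 => ⟨T, h.of_agree h1.1 h1.2.1⟩)
      (fun i s₁ h1 x => ⟨h1.1, hvar s₁ x h1.2.1, by
        change Function.update s₁.reg _ _ _ = _
        rw [Function.update_of_ne (treg_ne_vreg _ _)]; exact h1.2.2⟩)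
      (by
        rintro i s₁ hi ⟨hm, hreg, hval⟩ hvr
        have hrep := h.of_agree hm hreg
        have hbd := (Bd.correct h hB b hw.1).2.1
        have hcons := hrep.cons (by omega : i < rad n) hvr
        obtain ⟨t, s₂, hex, ht, hm2, hreg2, hv2⟩ := ih hcons hw.2
        simp only [List.length_cons] at hex hreg2 hv2
        have hv : s₂.reg (vreg env.length) = i := by
          rw [hreg2 _ (by unfold vreg; omega), hvr]
        have htr : s₂.reg (treg env.length) = s₁.reg (treg env.length) :=
          hreg2 _ (by unfold treg; omega)
        by_cases hφ : φ.eval n inp T (i :: env)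
        · refine ⟨_, _, Exec.seq hex (Exec.branch_true ?_ ?_ (Exec.assign _ _ _ ?_)), ?_,
            ⟨hm2.trans hm, ?_, ?_⟩, ?_⟩
          · simp only [Expr.peak, hv2]; split_ifs <;> omega
          · simp [Expr.eval, hv2, hφ]
          · simp only [Expr.peak]; omega
          · simp only [Expr.cost]; omega
          · intro j hj
            have : j ≠ treg env.length := by unfold treg; omega
            change Function.update s₂.reg _ _ _ = _
            rw [Function.update_of_ne this, hreg2 j (by omega), hreg j hj]
          · simp only [Function.update_self, Expr.eval]
            rw [if_pos ⟨i, by omega, hφ⟩]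
          · change Function.update s₂.reg _ _ _ = _
            rw [Function.update_of_ne (treg_ne_vreg _ _).symm, hv, hvr]
        · refine ⟨_, _, Exec.seq hex (Exec.branch_false ?_ ?_ (Exec.skip _)), ?_,
            ⟨hm2.trans hm, fun j hj => (hreg2 j (by omega)).trans (hreg j hj), ?_⟩, ?_⟩
          · simp only [Expr.peak, hv2]; split_ifs <;> omega
          · simp [Expr.eval, hv2, hφ]
          · simp only [Expr.cost]; omega
          · rw [htr, hval]
            congr 1
            apply propext
            constructor
            · rintro ⟨j, hj, h⟩; exact ⟨j, by omega, h⟩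
            · rintro ⟨j, hj, h⟩
              rcases Nat.lt_succ_iff_lt_or_eq.1 hj with h1 | rfl
              · exact ⟨j, h1, h⟩
              · exact absurd h hφ
          · rw [hv, hvr])
      ⟨Function.update s.reg (treg env.length) 0, s.mem⟩
      ⟨rfl, hup env s 0, by simp⟩
    obtain ⟨t, s', hex, ht, hm, hreg, hval⟩ := hcount
    have hasg : Exec B (.assign (treg env.length) (.const 0)) s 2
        ⟨Function.update s.reg (treg env.length) 0, s.mem⟩ :=
      Exec.assign s _ _ (by simp only [Expr.peak]; omega)
    refine ⟨_, s', Exec.seq hasg hex, ?_, hm, hreg, hval.trans (by simp only [Fm.eval]; congr)⟩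
    simp only [Fm.cost, loopCost]
    have : b.val n * (φ.cost n + 5 + 8) ≤ b.val n * (φ.cost n + 20) :=
      Nat.mul_le_mul_left _ (by omega)
    omega

theorem Rep.set {env : List ℕ} {T : Tabs} {s : State} (h : Rep n inp env T s)
    {id a b c d v : ℕ} (ha : a < rad n) (hb : b < rad n) (hc : c < rad n)
    (hd : d < rad n) (hv : v < rad n) :
    Rep n inp env (T.set id a b c d v)
      ⟨s.reg, Function.update s.mem (addr n id a b c d) v⟩ where
  reg0 := h.reg0
  var := h.var
  envlt := h.envlt
  input x hx := by
    have := le_addr n id a b c d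
    change Function.update s.mem _ _ _ = _
    rw [Function.update_of_ne (by omega), h.input x hx]
  inplt := h.inplt
  tab id' a' b' c' d' hid' ha' hb' hc' hd' := by
    by_cases hsame : id' = id ∧ a' = a ∧ b' = b ∧ c' = c ∧ d' = d
    · obtain ⟨rfl, rfl, rfl, rfl, rfl⟩ := hsame
      simp [Tabs.set]
    · change Function.update s.mem _ _ _ = _
      rw [Function.update_of_ne, h.tab _ _ _ _ _ hid' ha' hb' hc' hd', Tabs.set, if_neg hsame]
      exact fun he => hsame (addr_inj ha' hb' hc' hd' ha hb hc hd he)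
  tablt id' a' b' c' d' := by
    unfold Tabs.set
    split_ifs
    · exact hv
    · exact h.tablt _ _ _ _ _

-- In a loop the counter is pushed onto `env` for the body and dropped afterwards (`Rep.cons`,
-- `Rep.tail`), so the induction hypothesis at the next depth yields an invariant at the present
-- one.
open Classical in
theorem Stmt.correct (hB : 33 * rad n ^ 4 ≤ B) (p : Stmt) :
    ∀ {env : List ℕ} {T : Tabs} {s : State}, Rep n inp env T s → p.wf env.length →
    ∃ t s', Exec B (p.comp env.length) s t s' ∧ t ≤ p.cost n ∧
      Rep n inp env (p.sem n inp env T) s' ∧ (∀ i < 2 * env.length + 2, s'.reg i = s.reg i) := by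
  induction p with
  | skip => exact fun h hw => ⟨1, _, Exec.skip _, le_rfl, h, fun _ _ => rfl⟩
  | store id a b c d v =>
    intro env T s h hw
    simp only [Stmt.wf, Bool.and_eq_true, decide_eq_true_eq] at hw
    obtain ⟨⟨⟨⟨⟨hid, ha⟩, hb⟩, hc⟩, hd⟩, hv⟩ := hw
    obtain ⟨ea, la, pa⟩ := Tm.correct h hB a ha
    obtain ⟨eb, lb, pb⟩ := Tm.correct h hB b hb
    obtain ⟨ec, lc, pc⟩ := Tm.correct h hB c hc
    obtain ⟨ed, ld, pd⟩ := Tm.correct h hB d hd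
    obtain ⟨ev, lv, pv⟩ := Tm.correct h hB v hv
    refine ⟨_, _, Exec.store _ _ _ ?_ pv, ?_, ?_, fun _ _ => rfl⟩
    · refine addrE_peak h.reg0 hid hB ?_ ?_ ?_ ?_ pa pb pc pd
      · rw [ea]; exact la
      · rw [eb]; exact lb
      · rw [ec]; exact lc
      · rw [ed]; exact ld
    · simp only [Stmt.cost, addrE, Expr.cost, Tm.cost_comp env.length a, Tm.cost_comp env.length b,
        Tm.cost_comp env.length c, Tm.cost_comp env.length d, Tm.cost_comp env.length v]
      omega
    · rw [addrE_eval h.reg0, ea, eb, ec, ed, ev]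
      exact h.set la lb lc ld lv
  | seq p q ihp ihq =>
    intro env T s h hw
    simp only [Stmt.wf, Bool.and_eq_true] at hw
    obtain ⟨t, s', hex, ht, hrep, hreg⟩ := ihp h hw.1
    obtain ⟨t', s'', hex', ht', hrep', hreg'⟩ := ihq hrep hw.2
    exact ⟨_, s'', Exec.seq hex hex', by simp only [Stmt.cost]; omega, hrep',
      fun i hi => (hreg' i hi).trans (hreg i hi)⟩
  | ite φ p q ihp ihq =>
    intro env T s h hw
    simp only [Stmt.wf, Bool.and_eq_true] at hw
    have hr := rad_le_pow n
    have h32 := thirtytwo_le_rad n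
    obtain ⟨t, s', hex, ht, hm, hreg, hv⟩ := Fm.correct hB φ h hw.1.1
    have hrep := h.of_agree hm hreg
    by_cases hφ : φ.eval n inp T env
    · obtain ⟨t', s'', hex', ht', hrep', hreg'⟩ := ihp hrep hw.1.2
      refine ⟨_, s'', Exec.seq hex (Exec.branch_true ?_ ?_ hex'), ?_, ?_,
        fun i hi => (hreg' i hi).trans (hreg i hi)⟩
      · simp only [Expr.peak, hv]; split_ifs; omega
      · simp [Expr.eval, hv, hφ]
      · simp only [Expr.cost, Stmt.cost]; omega
      · simpa only [Stmt.sem, if_pos hφ] using hrep'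
    · obtain ⟨t', s'', hex', ht', hrep', hreg'⟩ := ihq hrep hw.2
      refine ⟨_, s'', Exec.seq hex (Exec.branch_false ?_ ?_ hex'), ?_, ?_,
        fun i hi => (hreg' i hi).trans (hreg i hi)⟩
      · simp only [Expr.peak, hv]; split_ifs; omega
      · simp [Expr.eval, hv, hφ]
      · simp only [Expr.cost, Stmt.cost]; omega
      · simpa only [Stmt.sem, if_neg hφ] using hrep'
  | loop b p ih =>
    intro env T s h hw
    simp only [Stmt.wf, Bool.and_eq_true] at hw
    have hbd := (Bd.correct h hB b hw.1).2.1
    obtain ⟨t, s', hex, ht, hrep, hreg⟩ := exec_count (n := n) (inp := inp) (B := B) (env := env)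
      b hw.1 hB (p.comp (env.length + 1)) (p.cost n)
      (fun i s₁ => Rep n inp env (iter (fun i T => p.sem n inp (i :: env) T) i T) s₁ ∧
        ∀ j < 2 * env.length + 2, s₁.reg j = s.reg j)
      (fun i s₁ h1 => ⟨_, h1.1⟩)
      (fun i s₁ h1 x => ⟨h1.1.update (by unfold vreg; omega), fun j hj => by
        have : j ≠ vreg env.length := by unfold vreg; omega
        simp only [Function.update_of_ne this, h1.2 j hj]⟩)
      (by
        rintro i s₁ hi ⟨hrep, hreg⟩ hvr
        obtain ⟨t, s₂, hex, ht, hrep2, hreg2⟩ := ih (hrep.cons (by omega : i < rad n) hvr) hw.2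
        simp only [List.length_cons] at hex hreg2
        exact ⟨t, s₂, hex, ht, ⟨hrep2.tail, fun j hj => (hreg2 j (by omega)).trans (hreg j hj)⟩,
          hreg2 _ (by unfold vreg; omega)⟩)
      s ⟨h, fun _ _ => rfl⟩
    refine ⟨t, s', hex, ?_, hrep, hreg⟩
    simp only [Stmt.cost, loopCost]
    have : b.val n * (p.cost n + 8) ≤ b.val n * (p.cost n + 20) := Nat.mul_le_mul_left _ (by omega)
    omega

end Correct

/-! ### Polynomial bounds for the running time -/

/-- The exponent of a bound: how it contributes to the running time. -/
def Bd.deg : Bd → ℕ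
  | size => 1
  | lit _ => 0

/-- The degree of the polynomial that bounds the running time of a formula. -/
def Fm.deg : Fm → ℕ
  | neg φ => φ.deg
  | and φ ψ => max φ.deg ψ.deg
  | ex b φ => b.deg + φ.deg
  | _ => 0

/-- The degree of the polynomial that bounds the running time of a statement. -/
def Stmt.deg : Stmt → ℕ
  | seq p q => max p.deg q.deg
  | ite φ p q => max φ.deg (max p.deg q.deg)
  | loop b p => b.deg + p.deg
  | _ => 0

theorem poly_weaken {K d d' n : ℕ} (h : d ≤ d') : K * (n + 1) ^ d ≤ K * (n + 1) ^ d' :=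
  Nat.mul_le_mul_left _ (Nat.pow_le_pow_right (by omega) h)

/-- A loop over the input size raises the exponent by one, and a loop of constant length only
changes the factor. So the degree counts nested loops and quantifiers over the input size. -/
theorem loopCost_le (b : Bd) {f : ℕ → ℕ} {d : ℕ} (h : ∃ K, ∀ n, f n ≤ K * (n + 1) ^ d) :
    ∃ K, ∀ n, loopCost (b.val n) (f n) ≤ K * (n + 1) ^ (b.deg + d) := by
  obtain ⟨K, hK⟩ := h
  have h1 : ∀ n e, 1 ≤ (n + 1) ^ e := fun n e => Nat.one_le_pow _ _ (by omega)
  have hbv : ∃ M, ∀ n, b.val n ≤ M * (n + 1) ^ b.deg := by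
    cases b with
    | size => exact ⟨1, fun n => by simp [Bd.val, Bd.deg]⟩
    | lit k => exact ⟨k, fun n => by simp [Bd.val, Bd.deg]⟩
  obtain ⟨M, hM⟩ := hbv
  refine ⟨M * (K + 20) + 20, fun n => ?_⟩
  have h2 : f n + 20 ≤ (K + 20) * (n + 1) ^ d := by nlinarith [hK n, h1 n d]
  calc loopCost (b.val n) (f n) = b.val n * (f n + 20) + 20 := rfl
    _ ≤ (M * (n + 1) ^ b.deg) * ((K + 20) * (n + 1) ^ d) + 20 * (n + 1) ^ (b.deg + d) :=
      Nat.add_le_add (Nat.mul_le_mul (hM n) h2) (by nlinarith [h1 n (b.deg + d)])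
    _ = (M * (K + 20) + 20) * (n + 1) ^ (b.deg + d) := by rw [pow_add]; ring

theorem Fm.cost_le (φ : Fm) : ∃ K, ∀ n, φ.cost n ≤ K * (n + 1) ^ φ.deg := by
  have h1 : ∀ n e, 1 ≤ (n + 1) ^ e := fun n e => Nat.one_le_pow _ _ (by omega)
  induction φ with
  | lt a b | eq a b | adj a b | lst a b =>
    exact ⟨_, fun n => by simp only [Fm.cost, Fm.deg, pow_zero, mul_one]; exact le_rfl⟩
  | neg φ ih =>
    obtain ⟨K, hK⟩ := ih
    refine ⟨K + 10, fun n => ?_⟩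
    simp only [Fm.cost, Fm.deg]
    nlinarith [hK n, h1 n φ.deg]
  | and φ ψ ihφ ihψ =>
    obtain ⟨K, hK⟩ := ihφ
    obtain ⟨K', hK'⟩ := ihψ
    refine ⟨K + K' + 10, fun n => ?_⟩
    simp only [Fm.cost, Fm.deg]
    have e1 := (hK n).trans (poly_weaken (le_max_left φ.deg ψ.deg))
    have e2 := (hK' n).trans (poly_weaken (le_max_right φ.deg ψ.deg))
    nlinarith [h1 n (max φ.deg ψ.deg)]
  | ex b φ ih => exact loopCost_le b ih

theorem Stmt.cost_le (p : Stmt) : ∃ K, ∀ n, p.cost n ≤ K * (n + 1) ^ p.deg := by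
  have h1 : ∀ n e, 1 ≤ (n + 1) ^ e := fun n e => Nat.one_le_pow _ _ (by omega)
  induction p with
  | skip | store =>
    exact ⟨_, fun n => by simp only [Stmt.cost, Stmt.deg, pow_zero, mul_one]; exact le_rfl⟩
  | seq p q ihp ihq =>
    obtain ⟨K, hK⟩ := ihp
    obtain ⟨K', hK'⟩ := ihq
    refine ⟨K + K', fun n => ?_⟩
    simp only [Stmt.cost, Stmt.deg]
    have e1 := (hK n).trans (poly_weaken (le_max_left p.deg q.deg))
    have e2 := (hK' n).trans (poly_weaken (le_max_right p.deg q.deg))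
    rw [add_mul]
    omega
  | ite φ p q ihp ihq =>
    obtain ⟨K, hK⟩ := ihp
    obtain ⟨K', hK'⟩ := ihq
    obtain ⟨K'', hK''⟩ := φ.cost_le
    refine ⟨K'' + K + K' + 10, fun n => ?_⟩
    simp only [Stmt.cost, Stmt.deg]
    have e1 := (hK n).trans (poly_weaken (d' := max φ.deg (max p.deg q.deg)) (by simp))
    have e2 := (hK' n).trans (poly_weaken (d' := max φ.deg (max p.deg q.deg)) (by simp))
    have e3 := (hK'' n).trans (poly_weaken (d' := max φ.deg (max p.deg q.deg)) (by simp))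
    nlinarith [h1 n (max φ.deg (max p.deg q.deg))]
  | loop b p ih => exact loopCost_le b ih

end RAM

/-!
# Domination in families with two set systems, and induced paths
-/

/-- In a finite family with two set systems such that any two members are comparable in one of
the systems, one member is below every other one in one of the systems. -/
theorem exists_forall_subset_or_subset {ι α β : Type*} [DecidableEq ι] (R : ι → Finset α)
    (O : ι → Finset β) : ∀ (k : ℕ) (s : Finset ι), s.card = k → s.Nonempty →
    (∀ i ∈ s, ∀ j ∈ s, R i ⊆ R j ∨ R j ⊆ R i ∨ O i ⊆ O j ∨ O j ⊆ O i) →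
    ∃ i ∈ s, ∀ j ∈ s, R i ⊆ R j ∨ O i ⊆ O j := by
  classical
  intro k
  induction k with
  | zero => intro s hs hne; simp_all
  | succ k ih =>
    intro s hs hne h
    -- The members whose first set is minimal under inclusion. If they all have the same first set,
    -- any of them is below everything in the first system.
    set M := s.filter fun i => ∀ j ∈ s, R j ⊆ R i → R i ⊆ R j with hM
    have hMin : ∀ j ∈ s, ∃ i ∈ M, R i ⊆ R j := by
      intro j hj
      obtain ⟨i, hi, hmin⟩ := (s.filter fun i => R i ⊆ R j).exists_min_image (fun i => (R i).card)
        ⟨j, by simp [hj]⟩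
      simp only [Finset.mem_filter] at hi hmin
      refine ⟨i, ?_, hi.2⟩
      simp only [hM, Finset.mem_filter]
      refine ⟨hi.1, fun l hl hli => ?_⟩
      have := hmin l ⟨hl, hli.trans hi.2⟩
      exact (Finset.eq_of_subset_of_card_le hli this).symm.subset
    have hMne : M.Nonempty := by
      obtain ⟨j, hj⟩ := hne
      obtain ⟨i, hi, _⟩ := hMin j hj
      exact ⟨i, hi⟩
    obtain ⟨b, hb, hbmax⟩ := M.exists_max_image (fun i => (O i).card) hMne
    have hbs : b ∈ s := (Finset.mem_filter.1 hb).1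
    have hbm := (Finset.mem_filter.1 hb).2
    by_cases hall : ∀ i ∈ M, R i = R b
    · refine ⟨b, hbs, fun j hj => Or.inl ?_⟩
      obtain ⟨i, hi, hij⟩ := hMin j hj
      rw [← hall i hi]
      exact hij
    · push Not at hall
      obtain ⟨a, ha, hab⟩ := hall
      have has : a ∈ s := (Finset.mem_filter.1 ha).1
      have ham := (Finset.mem_filter.1 ha).2
      -- Minimal members with different first sets are incomparable in the first system, hence
      -- comparable in the second one, where `b` has a largest set.
      have key : ∀ c ∈ M, R c ≠ R b → O c ⊆ O b := by
        intro c hc hcb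
        have hcs : c ∈ s := (Finset.mem_filter.1 hc).1
        have hcm := (Finset.mem_filter.1 hc).2
        rcases h c hcs b hbs with h1 | h1 | h1 | h1
        · exact absurd (h1.antisymm (hbm c hcs h1)) hcb
        · exact absurd ((hcm b hbs h1).antisymm h1) hcb
        · exact h1
        · exact (Finset.eq_of_subset_of_card_le h1 (hbmax c hc)).symm.subset
      have hne' : a ≠ b := fun hh => hab (by rw [hh])
      -- Induction without `b`. The resulting `w` is also below `b`, through `a`: if it is below `a`
      -- in the first system, it is minimal with the same first set as `a`, and `key` applies to
      -- `w`; otherwise its second set lies in that of `a`, and `key` applies to `a`.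
      obtain ⟨w, hw, hdom⟩ := ih (s.erase b) (by rw [Finset.card_erase_of_mem hbs]; omega)
        ⟨a, Finset.mem_erase.2 ⟨hne', has⟩⟩
        (fun i hi j hj => h i (Finset.mem_of_mem_erase hi) j (Finset.mem_of_mem_erase hj))
      have hws : w ∈ s := Finset.mem_of_mem_erase hw
      refine ⟨w, hws, fun j hj => ?_⟩
      by_cases hjb : j = b
      · subst hjb
        rcases hdom a (Finset.mem_erase.2 ⟨hne', has⟩) with h1 | h1
        · have hwa : R w = R a := h1.antisymm (ham w hws h1)
          refine Or.inr (key w ?_ (by rw [hwa]; exact hab))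
          simp only [hM, Finset.mem_filter]
          refine ⟨hws, fun l hl hlw => ?_⟩
          rw [hwa] at hlw ⊢
          exact ham l hl hlw
        · exact Or.inr (h1.trans (key a ha hab))
      · exact hdom j (Finset.mem_erase.2 ⟨hjb, hj⟩)

/-- Two elements that hit all members of a family with two set systems, if any two members are
comparable in one of the systems (where empty sets do not count). -/
theorem exists_hitting_pair {ι α : Type*} [DecidableEq ι] [DecidableEq α] (R O : ι → Finset α)
    (s : Finset ι) (hs : s.Nonempty) (hne : ∀ i ∈ s, (R i).Nonempty ∨ (O i).Nonempty)
    (h : ∀ i ∈ s, ∀ j ∈ s, i ≠ j → (R i).Nonempty ∧ R i ⊆ R j ∨ (R j).Nonempty ∧ R j ⊆ R i ∨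
      (O i).Nonempty ∧ O i ⊆ O j ∨ (O j).Nonempty ∧ O j ⊆ O i) :
    ∃ r o, ∀ j ∈ s, r ∈ R j ∨ o ∈ O j := by
  classical
  obtain ⟨F, hFpos, hFneg⟩ : ∃ F : (ι → Finset α) → ι → Finset (α ⊕ ι),
      (∀ R i, (R i).Nonempty → ∀ x, x ∈ F R i ↔ ∃ y ∈ R i, Sum.inl y = x) ∧
      (∀ R i, ¬ (R i).Nonempty → ∀ x, x ∈ F R i ↔ x = Sum.inr i) := by
    refine ⟨fun R i => if (R i).Nonempty then (R i).image Sum.inl else {Sum.inr i},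
      fun R i h x => ?_, fun R i h x => ?_⟩
    · simp [h]
    · simp [h]
  have hmono : ∀ (R : ι → Finset α) i j, (R i).Nonempty → R i ⊆ R j → F R i ⊆ F R j := by
    intro R i j h1 h2 x
    rw [hFpos R i h1, hFpos R j (h1.mono h2)]
    rintro ⟨y, hy, rfl⟩
    exact ⟨y, h2 hy, rfl⟩
  obtain ⟨w, hw, hdom⟩ := exists_forall_subset_or_subset (F R) (F O) _ s rfl hs (by
    intro i hi j hj
    by_cases hij : i = j
    · subst hij; exact Or.inl subset_rfl
    rcases h i hi j hj hij with h1 | h1 | h1 | h1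
    · exact Or.inl (hmono R i j h1.1 h1.2)
    · exact Or.inr (Or.inl (hmono R j i h1.1 h1.2))
    · exact Or.inr (Or.inr (Or.inl (hmono O i j h1.1 h1.2)))
    · exact Or.inr (Or.inr (Or.inr (hmono O j i h1.1 h1.2))))
  have hback : ∀ (R : ι → Finset α) x j, x ∈ R w → F R w ⊆ F R j → x ∈ R j := by
    intro R x j hx h1
    have h2 : Sum.inl x ∈ F R j := h1 ((hFpos R w ⟨x, hx⟩ _).2 ⟨x, hx, rfl⟩)
    by_cases h3 : (R j).Nonempty
    · simpa using (hFpos R j h3 _).1 h2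
    · simpa using (hFneg R j h3 _).1 h2
  have hempty : ∀ (R : ι → Finset α) j, ¬ (R w).Nonempty → F R w ⊆ F R j → j = w := by
    intro R j hw h1
    have h2 : Sum.inr w ∈ F R j := h1 ((hFneg R w hw _).2 rfl)
    by_cases h3 : (R j).Nonempty
    · simpa using (hFpos R j h3 _).1 h2
    · simpa [eq_comm] using (hFneg R j h3 _).1 h2
  by_cases hR : (R w).Nonempty
  · obtain ⟨r, hr⟩ := hR
    by_cases hO : (O w).Nonempty
    · obtain ⟨o, ho⟩ := hO
      exact ⟨r, o, fun j hj => (hdom j hj).imp (hback R r j hr) (hback O o j ho)⟩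
    · refine ⟨r, r, fun j hj => ?_⟩
      rcases hdom j hj with h1 | h1
      · exact Or.inl (hback R r j hr h1)
      · rw [hempty O j hO h1]; exact Or.inl hr
  · have hO := (hne w hw).resolve_left hR
    obtain ⟨o, ho⟩ := hO
    refine ⟨o, o, fun j hj => ?_⟩
    rcases hdom j hj with h1 | h1
    · rw [hempty R j hR h1]; exact Or.inr ho
    · exact Or.inr (hback O o j ho h1)

namespace SimpleGraph

variable {V : Type*} {G : SimpleGraph V}

/-- Seven vertices that induce a path. -/
structure IsP7 (G : SimpleGraph V) (a b c d e f g : V) : Prop where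
  ab : G.Adj a b
  bc : G.Adj b c
  cd : G.Adj c d
  de : G.Adj d e
  ef : G.Adj e f
  fg : G.Adj f g
  ac : ¬ G.Adj a c
  ad : ¬ G.Adj a d
  ae : ¬ G.Adj a e
  af : ¬ G.Adj a f
  ag : ¬ G.Adj a g
  bd : ¬ G.Adj b d
  be : ¬ G.Adj b e
  bf : ¬ G.Adj b f
  bg : ¬ G.Adj b g
  ce : ¬ G.Adj c e
  cf : ¬ G.Adj c f
  cg : ¬ G.Adj c g
  df : ¬ G.Adj d f
  dg : ¬ G.Adj d g
  eg : ¬ G.Adj e g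

/-- Distinctness of the seven vertices is automatic: equal vertices have equal neighbours, while
distinct vertices of `P_7` have different neighbourhoods. -/
theorem IsP7.isIndContained {a b c d e f g : V} (h : G.IsP7 a b c d e f g) :
    (pathGraph 7).IsIndContained G := by
  obtain ⟨ab, bc, cd, de, ef, fg, ac, ad, ae, af, ag, bd, be, bf, bg, ce, cf, cg, df, dg, eg⟩ := h
  set v : Fin 7 → V := ![a, b, c, d, e, f, g] with hv
  have hadj : ∀ i j : Fin 7, i < j → (G.Adj (v i) (v j) ↔ i.val + 1 = j.val) := by
    intro i j hij
    fin_cases i <;> fin_cases j <;> first | (exact absurd hij (by decide)) | simp_all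
  have hadj' : ∀ i j : Fin 7, G.Adj (v i) (v j) ↔ (i.val + 1 = j.val ∨ j.val + 1 = i.val) := by
    intro i j
    rcases lt_trichotomy i j with h | h | h
    · rw [hadj i j h]; have := Fin.lt_def.1 h; omega
    · subst h; simp
    · rw [G.adj_comm, hadj j i h]; have := Fin.lt_def.1 h; omega
  refine ⟨⟨⟨v, ?_⟩, ?_⟩⟩
  · have key : ∀ i j : Fin 7, i < j → v i ≠ v j := by
      intro i j hij he
      have hlt := Fin.lt_def.1 hij
      have hj := j.isLt
      by_cases h6 : j.val < 6
      · have h1 := (hadj' j ⟨j.val + 1, by omega⟩).2 (Or.inl rfl)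
        rw [← he, hadj'] at h1
        simp at h1
        omega
      · by_cases h0 : i.val = 0
        · have h1 := (hadj' i ⟨1, by omega⟩).2 (Or.inl (by simp [h0]))
          rw [he, hadj'] at h1
          simp at h1
          omega
        · have h1 := (hadj' i ⟨i.val - 1, by omega⟩).2 (Or.inr (by simp; omega))
          rw [he, hadj'] at h1
          simp at h1
          omega
    intro i j he
    rcases lt_trichotomy i j with h | h | h
    · exact absurd he (key i j h)
    · exact h
    · exact absurd he.symm (key j i h)
  · intro i j
    rw [pathGraph_adj]
    exact hadj' i j

/-- No three vertices are pairwise adjacent. -/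
theorem CliqueFree.not_adj {a b c : V} (h : G.CliqueFree 3) (hab : G.Adj a b) (hbc : G.Adj b c) :
    ¬ G.Adj a c := by
  classical
  intro hac
  exact h {a, b, c} (is3Clique_triple_iff.2 ⟨hab, hac, hbc⟩)

/-! ### Geodesics as induced paths -/

section Distance

theorem exists_adj_of_dist_eq_succ {w v : V} {k : ℕ} (h : G.dist w v = k + 1) :
    ∃ u, G.Adj u v ∧ G.dist w u = k := by
  have hr : G.Reachable w v := by
    by_contra hn
    rw [dist_eq_zero_of_not_reachable hn] at h
    omega
  obtain ⟨p, hp⟩ := hr.symm.exists_walk_length_eq_dist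
  rw [dist_comm, h] at hp
  cases p with
  | nil => simp at hp
  | cons hadj q =>
    rename_i u
    simp only [Walk.length_cons, Nat.add_right_cancel_iff] at hp
    refine ⟨u, hadj.symm, ?_⟩
    have h1 := dist_le q
    rw [dist_comm, hp] at h1
    have h2 : G.dist w v ≤ G.dist w u + 1 := by
      have := dist_le ((q.reverse).concat hadj.symm)
      simp only [Walk.length_concat, Walk.length_reverse, hp] at this
      have h3 : G.Reachable w u := q.reverse.reachable
      obtain ⟨p', hp'⟩ := h3.exists_walk_length_eq_dist
      have := dist_le (p'.concat hadj.symm)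
      simpa [hp'] using this
    omega

theorem dist_le_dist_succ {w u v : V} (hr : G.Reachable w u) (h : G.Adj u v) :
    G.dist w v ≤ G.dist w u + 1 := by
  obtain ⟨p', hp'⟩ := hr.exists_walk_length_eq_dist
  have := dist_le (p'.concat h)
  simpa [hp'] using this

theorem not_adj_of_dist {w u v : V} (hu : G.Reachable w u) (h : G.dist w u + 2 ≤ G.dist w v) :
    ¬ G.Adj u v := fun hadj => by
  have := dist_le_dist_succ hu hadj
  omega

/-- A geodesic is an induced path. If some distance exceeds five, going back along a geodesic gives
a vertex at distance exactly six, and the geodesic to it is a `P_7`. -/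
theorem dist_le_five (hP : ¬ (pathGraph 7).IsIndContained G) {w v : V} (hr : G.Reachable w v) :
    G.dist w v ≤ 5 := by
  by_contra hcon
  have : ∀ k x, G.Reachable w x → 6 + k = G.dist w x → ∃ u, G.Reachable w u ∧ G.dist w u = 6 := by
    intro k
    induction k with
    | zero => exact fun x hx hk => ⟨x, hx, hk.symm⟩
    | succ k ih =>
      intro x hx hk
      have hk' : G.dist w x = (6 + k) + 1 := by omega
      obtain ⟨u, huv, hu⟩ := exists_adj_of_dist_eq_succ hk'
      exact ih u (hx.trans huv.symm.reachable) hu.symm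
  obtain ⟨g, hg, h6⟩ := this (G.dist w v - 6) v hr (by omega)
  obtain ⟨f, fg, h5⟩ := exists_adj_of_dist_eq_succ h6
  obtain ⟨e, ef, h4⟩ := exists_adj_of_dist_eq_succ h5
  obtain ⟨d, de, h3⟩ := exists_adj_of_dist_eq_succ h4
  obtain ⟨c, cd, h2⟩ := exists_adj_of_dist_eq_succ h3
  obtain ⟨b, bc, h1⟩ := exists_adj_of_dist_eq_succ h2
  obtain ⟨a, ab, h0⟩ := exists_adj_of_dist_eq_succ h1
  have rf := hg.trans fg.symm.reachable
  have re := rf.trans ef.symm.reachable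
  have rd := re.trans de.symm.reachable
  have rc := rd.trans cd.symm.reachable
  have rb := rc.trans bc.symm.reachable
  have ra := rb.trans ab.symm.reachable
  exact hP (IsP7.isIndContained (a := a) (b := b) (c := c) (d := d) (e := e) (f := f) (g := g)
    { ab := ab, bc := bc, cd := cd, de := de, ef := ef, fg := fg
      ac := not_adj_of_dist ra (by omega), ad := not_adj_of_dist ra (by omega)
      ae := not_adj_of_dist ra (by omega), af := not_adj_of_dist ra (by omega)
      ag := not_adj_of_dist ra (by omega), bd := not_adj_of_dist rb (by omega)
      be := not_adj_of_dist rb (by omega), bf := not_adj_of_dist rb (by omega)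
      bg := not_adj_of_dist rb (by omega), ce := not_adj_of_dist rc (by omega)
      cf := not_adj_of_dist rc (by omega), cg := not_adj_of_dist rc (by omega)
      df := not_adj_of_dist rd (by omega), dg := not_adj_of_dist rd (by omega)
      eg := not_adj_of_dist re (by omega) })

end Distance

/-- A set of vertices whose neighbourhoods are maximal (up to equality), and pairwise distinct. -/
structure IsUndominated (G : SimpleGraph V) (U : Set V) : Prop where
  not_subset : ∀ w ∈ U, ∀ v ∈ U, w ≠ v → ∃ t, G.Adj w t ∧ ¬ G.Adj v t
  maximal : ∀ w ∈ U, ∀ v, (∀ t, G.Adj w t → G.Adj v t) → ∀ t, G.Adj v t → G.Adj w t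

/-! ### Domination in bipartite components -/

section Bipartite

variable {side : V → Bool} {ρ : V}

/-- The distance is even and at most five, so only distance four must be excluded. A geodesic `w b c
d v` can then be prolonged at both ends by neighbours of `w` and `v` that are not adjacent to `c`,
and the result is a `P_7`; sides take care of most nonadjacencies. -/
theorem exists_common_neighbour (hP : ¬ (pathGraph 7).IsIndContained G)
    (hside : ∀ u v, G.Reachable ρ u → G.Adj u v → side u ≠ side v) {U : Set V}
    (hU : G.IsUndominated U) {w v : V} (hw : w ∈ U) (hv : v ∈ U) (hρ : G.Reachable ρ w)
    (hr : G.Reachable w v) (hs : side w = side v) : w = v ∨ ∃ r, G.Adj w r ∧ G.Adj v r := by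
  have hd := dist_le_five hP hr
  have same : ∀ {x y : V}, G.Reachable ρ x → side x = side y → ¬ G.Adj x y :=
    fun hx h hadj => hside _ _ hx hadj h
  have flip : ∀ {x y : V}, G.Reachable ρ x → G.Adj x y → side y = !side x := by
    intro x y hx hxy
    have := hside x y hx hxy
    cases h1 : side x <;> cases h2 : side y <;> simp_all
  obtain h0 | h1 | h2 | h3 | h4 | h5 : G.dist w v = 0 ∨ G.dist w v = 1 ∨ G.dist w v = 2 ∨
      G.dist w v = 3 ∨ G.dist w v = 4 ∨ G.dist w v = 5 := by omega
  · exact Or.inl ((Reachable.dist_eq_zero_iff hr).1 h0)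
  · rw [dist_eq_one_iff_adj] at h1
    exact absurd h1 (same hρ hs)
  · obtain ⟨b, bv, h1⟩ := exists_adj_of_dist_eq_succ h2
    rw [dist_eq_one_iff_adj] at h1
    exact Or.inr ⟨b, h1, bv.symm⟩
  · obtain ⟨c, cv, h2⟩ := exists_adj_of_dist_eq_succ h3
    obtain ⟨b, bc, h1⟩ := exists_adj_of_dist_eq_succ h2
    rw [dist_eq_one_iff_adj] at h1
    have rb := hρ.trans h1.reachable
    have rc := rb.trans bc.reachable
    have e1 := flip hρ h1
    have e2 := flip rb bc
    have e3 := flip rc cv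
    cases hh : side w <;> simp_all
  · obtain ⟨d, dv, h3⟩ := exists_adj_of_dist_eq_succ h4
    obtain ⟨c, cd, h2⟩ := exists_adj_of_dist_eq_succ h3
    obtain ⟨b, bc, h1⟩ := exists_adj_of_dist_eq_succ h2
    have wb := dist_eq_one_iff_adj.1 h1
    have rb := wb.reachable
    have rc := rb.trans bc.reachable
    have rd := rc.trans cd.reachable
    have rv := rd.trans dv.reachable
    have rw' : G.Reachable w w := Reachable.refl _
    have hww : G.dist w w = 0 := dist_self
    -- Otherwise the neighbourhood of `w` is contained in that of `c`; by maximality they are equal,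
    -- and `d` would be adjacent to `w` although its distance is three.
    have hq : ∃ q, G.Adj w q ∧ ¬ G.Adj c q := by
      by_contra hcon
      push Not at hcon
      have hwd := hU.maximal w hw c hcon d cd
      exact not_adj_of_dist rw' (by omega) hwd
    obtain ⟨q, wq, cq⟩ := hq
    have hq1 : G.dist w q = 1 := dist_eq_one_iff_adj.2 wq
    have rq := wq.reachable
    have hq' : ∃ q, G.Adj v q ∧ ¬ G.Adj c q := by
      by_contra hcon
      push Not at hcon
      have hvb := hU.maximal v hv c hcon b bc.symm
      exact not_adj_of_dist rb (by omega) hvb.symm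
    obtain ⟨q', vq', cq'⟩ := hq'
    have rq' := rv.trans vq'.reachable
    have hq3 : 4 ≤ G.dist w q' + 1 := by
      have := dist_le_dist_succ rq' vq'.symm
      omega
    have s1 := flip hρ wb
    have s2 := flip (hρ.trans rb) bc
    have s3 := flip (hρ.trans rc) cd
    have s4 := flip hρ wq
    have s5 := flip (hρ.trans rv) vq'
    have n1 : ¬ G.Adj q b := same (hρ.trans rq) (by rw [s4, s1])
    have n2 : ¬ G.Adj q d := same (hρ.trans rq) (by simp [s4, s3, s2, s1])
    have n3 : ¬ G.Adj q q' := same (hρ.trans rq) (by rw [s4, s5, hs])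
    have n4 : ¬ G.Adj b q' := same (hρ.trans rb) (by rw [s1, s5, hs])
    have n5 : ¬ G.Adj d q' := same (hρ.trans rd) (by simp [s3, s2, s1, s5, hs])
    exact absurd (IsP7.isIndContained (a := q) (b := w) (c := b) (d := c) (e := d) (f := v) (g := q')
      { ab := wq.symm, bc := wb, cd := bc, de := cd, ef := dv, fg := vq'
        ac := n1, ad := fun h => cq h.symm, ae := n2
        af := not_adj_of_dist rq (by omega), ag := n3
        bd := not_adj_of_dist rw' (by omega), be := not_adj_of_dist rw' (by omega)
        bf := not_adj_of_dist rw' (by omega), bg := not_adj_of_dist rw' (by omega)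
        ce := not_adj_of_dist rb (by omega), cf := not_adj_of_dist rb (by omega)
        cg := n4, df := not_adj_of_dist rc (by omega), dg := cq', eg := n5 }) hP
  · obtain ⟨e, ev, h4⟩ := exists_adj_of_dist_eq_succ h5
    obtain ⟨d, de, h3⟩ := exists_adj_of_dist_eq_succ h4
    obtain ⟨c, cd, h2⟩ := exists_adj_of_dist_eq_succ h3
    obtain ⟨b, bc, h1⟩ := exists_adj_of_dist_eq_succ h2
    rw [dist_eq_one_iff_adj] at h1
    have rb := hρ.trans h1.reachable
    have rc := rb.trans bc.reachable
    have rd := rc.trans cd.reachable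
    have re := rd.trans de.reachable
    have e1 := flip hρ h1
    have e2 := flip rb bc
    have e3 := flip rc cd
    have e4 := flip rd de
    have e5 := flip re ev
    cases hh : side w <;> simp_all

/-- Each side of a bipartite component has three vertices that dominate all undominated vertices
of this side. -/
theorem exists_dominating_side [Finite V] (hP : ¬ (pathGraph 7).IsIndContained G)
    (hside : ∀ u v, G.Reachable ρ u → G.Adj u v → side u ≠ side v) {U : Set V}
    (hU : G.IsUndominated U) (x : Bool) : ∃ s₁ s₂ s₃, G.Reachable ρ s₁ ∧ G.Reachable ρ s₂ ∧
      G.Reachable ρ s₃ ∧ ∀ w ∈ U, G.Reachable ρ w → side w = x →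
      (w = s₁ ∨ w = s₂ ∨ w = s₃) ∨ (G.Adj w s₁ ∨ G.Adj w s₂ ∨ G.Adj w s₃) := by
  classical
  have := Fintype.ofFinite V
  by_cases hne : ∃ w₀ ∈ U, G.Reachable ρ w₀ ∧ side w₀ = x
  swap
  · exact ⟨ρ, ρ, ρ, .refl _, .refl _, .refl _, fun w hw hr hs => absurd ⟨w, hw, hr, hs⟩ hne⟩
  obtain ⟨w₀, hw₀, hr₀, hs₀⟩ := hne
  set s : Finset V := Finset.univ.filter fun w => w ∈ U ∧ G.Reachable ρ w ∧ side w = x ∧ w ≠ w₀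
    with hsdef
  by_cases hsne : s.Nonempty
  swap
  · refine ⟨w₀, w₀, w₀, hr₀, hr₀, hr₀, fun w hw hr hs => Or.inl (Or.inl ?_)⟩
    by_contra hcon
    exact hsne ⟨w, by simp [hsdef, hw, hr, hs, hcon]⟩
  -- The parts of a neighbourhood inside and outside that of `w₀`. If `i` and `j` are incomparable
  -- in both, then private elements give the induced path `q i r w₀ r' j q'`.
  set R : V → Finset V := fun w => Finset.univ.filter fun t => G.Adj w t ∧ G.Adj w₀ t
  set O : V → Finset V := fun w => Finset.univ.filter fun t => G.Adj w t ∧ ¬ G.Adj w₀ t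
  have same : ∀ {y z : V}, G.Reachable ρ y → side y = side z → ¬ G.Adj y z :=
    fun hx h hadj => hside _ _ hx hadj h
  have flip : ∀ {x y : V}, G.Reachable ρ x → G.Adj x y → side y = !side x := by
    intro x y hx hxy
    have := hside x y hx hxy
    cases h1 : side x <;> cases h2 : side y <;> simp_all
  obtain ⟨w, hw, hdom⟩ := exists_forall_subset_or_subset R O _ s rfl hsne (by
    intro i hi j hj
    by_contra hcon
    simp only [not_or, Finset.not_subset] at hcon
    obtain ⟨⟨r, hr1, hr2⟩, ⟨r', hr1', hr2'⟩, ⟨q, hq1, hq2⟩, ⟨q', hq1', hq2'⟩⟩ := hcon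
    simp only [R, O, Finset.mem_filter, Finset.mem_univ, true_and, not_and] at *
    simp only [hsdef, Finset.mem_filter, Finset.mem_univ, true_and] at hi hj
    obtain ⟨ir, iw⟩ := hr1
    obtain ⟨jr, jw⟩ := hr1'
    obtain ⟨iq, wq⟩ := hq1
    obtain ⟨jq, wq'⟩ := hq1'
    have n1 : ¬ G.Adj j r := fun h => hr2 h iw
    have n2 : ¬ G.Adj i r' := fun h => hr2' h jw
    have n3 : ¬ G.Adj j q := fun h => hq2 h wq
    have n4 : ¬ G.Adj i q' := fun h => hq2' h wq'
    have f1 := flip hi.2.1 ir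
    have f2 := flip hi.2.1 iq
    have f3 := flip hj.2.1 jr
    have f4 := flip hj.2.1 jq
    have ρr := hi.2.1.trans ir.reachable
    have ρq := hi.2.1.trans iq.reachable
    have ρr' := hj.2.1.trans jr.reachable
    have e1 := hi.2.2.1
    have e2 := hj.2.2.1
    exact hP (IsP7.isIndContained (a := q) (b := i) (c := r) (d := w₀) (e := r') (f := j) (g := q')
      { ab := iq.symm, bc := ir, cd := iw.symm, de := jw, ef := jr.symm, fg := jq
        ac := same ρq (by rw [f2, f1]), ad := fun h => wq h.symm
        ae := same ρq (by rw [f2, f3, e1, e2]), af := fun h => n3 h.symm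
        ag := same ρq (by rw [f2, f4, e1, e2])
        bd := same hi.2.1 (by rw [e1, hs₀]), be := n2
        bf := same hi.2.1 (by rw [e1, e2]), bg := n4
        ce := same ρr (by rw [f1, f3, e1, e2]), cf := fun h => n1 h.symm
        cg := same ρr (by rw [f1, f4, e1, e2])
        df := same hr₀ (by rw [e2, hs₀]), dg := wq'
        eg := same ρr' (by rw [f3, f4]) }))
  simp only [hsdef, Finset.mem_filter, Finset.mem_univ, true_and] at hw
  obtain ⟨hwU, hwr, hws, hww⟩ := hw
  -- Both parts of `w` are nonempty: the first by the common neighbour, the second because no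
  -- undominated neighbourhood contains another. One element of each, together with `w₀`, dominates
  -- the side.
  obtain ⟨r, wr, w0r⟩ := (exists_common_neighbour hP hside hU hwU hw₀ hwr
    (hwr.symm.trans hr₀) (by rw [hws, hs₀])).resolve_left hww
  obtain ⟨o, wo, w0o⟩ := hU.not_subset w hwU w₀ hw₀ hww
  refine ⟨w₀, r, o, hr₀, hwr.trans wr.reachable, hwr.trans wo.reachable, fun v hv hvr hvs => ?_⟩
  by_cases hv0 : v = w₀
  · exact Or.inl (Or.inl hv0)
  · rcases hdom v (by simp [hsdef, hv, hvr, hvs, hv0]) with h | h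
    · have := h (show r ∈ R w by simp [R, wr, w0r])
      simp only [R, Finset.mem_filter] at this
      exact Or.inr (Or.inr (Or.inl this.2.1))
    · have := h (show o ∈ O w by simp [O, wo, w0o])
      simp only [O, Finset.mem_filter] at this
      exact Or.inr (Or.inr (Or.inr this.2.1))

end Bipartite

end SimpleGraph

/-!
# Components without induced cycles of length five
-/

namespace SimpleGraph

variable {V : Type*} {G : SimpleGraph V}

/-- `G` has a closed walk of length `L` in the component of `ρ`. -/
def HasClosedWalk (G : SimpleGraph V) (ρ : V) (L : ℕ) : Prop :=
  ∃ g : ℕ → V, G.Reachable ρ (g 0) ∧ (∀ i < L, G.Adj (g i) (g (i + 1))) ∧ g L = g 0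

/-- Five vertices that induce a cycle. -/
structure IsC5 (G : SimpleGraph V) (a b c d e : V) : Prop where
  ab : G.Adj a b
  bc : G.Adj b c
  cd : G.Adj c d
  de : G.Adj d e
  ea : G.Adj e a
  ac : ¬ G.Adj a c
  bd : ¬ G.Adj b d
  ce : ¬ G.Adj c e
  da : ¬ G.Adj d a
  eb : ¬ G.Adj e b

/-- The side of a vertex is the parity of walks from `ρ`. Adjacent vertices on the same side would
close up to an odd walk from `ρ` to itself. -/
theorem exists_side_or_odd (ρ : V) :
    (∃ side : V → Bool, ∀ u v, G.Reachable ρ u → G.Adj u v → side u ≠ side v) ∨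
      ∃ L, Odd L ∧ G.HasClosedWalk ρ L := by
  classical
  by_cases h : ∃ p : G.Walk ρ ρ, Odd p.length
  · obtain ⟨p, hp⟩ := h
    refine Or.inr ⟨p.length, hp, p.getVert, by simp, fun i hi => p.adj_getVert_succ hi, by simp⟩
  · push Not at h
    refine Or.inl ⟨fun v => decide (∃ p : G.Walk ρ v, Even p.length), fun u v hu huv heq => ?_⟩
    by_cases hue : ∃ p : G.Walk ρ u, Even p.length
    · have hve : ∃ p : G.Walk ρ v, Even p.length := by simpa [hue] using heq.symm
      obtain ⟨p, hp⟩ := hue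
      obtain ⟨q, hq⟩ := hve
      apply h ((p.concat huv).append q.reverse)
      simp only [Walk.length_append, Walk.length_concat, Walk.length_reverse]
      grind
    · obtain ⟨p⟩ := hu
      have hve : ¬ ∃ p : G.Walk ρ v, Even p.length := by simpa [hue] using heq.symm
      apply hve
      refine ⟨p.concat huv, ?_⟩
      have : ¬ Even p.length := fun hp => hue ⟨p, hp⟩
      simp only [Walk.length_concat]
      grind

theorem HasClosedWalk.reachable {ρ : V} {L : ℕ} {g : ℕ → V} (h0 : G.Reachable ρ (g 0))
    (hadj : ∀ i < L, G.Adj (g i) (g (i + 1))) {i : ℕ} (hi : i ≤ L) : G.Reachable ρ (g i) := by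
  induction i with
  | zero => exact h0
  | succ i ih => exact (ih (by omega)).trans (hadj i (by omega)).reachable

/-- A chord splits the closed walk into two closed walks of total length `L + 2`. One of them is
odd, and both are shorter than `L`, against minimality. -/
theorem chord_not_adj {ρ : V} {L : ℕ} {g : ℕ → V} (hL : Odd L)
    (hmin : ∀ L' < L, Odd L' → ¬ G.HasClosedWalk ρ L') (h0 : G.Reachable ρ (g 0))
    (hadj : ∀ i < L, G.Adj (g i) (g (i + 1))) (hgL : g L = g 0) {i j : ℕ} (hij : i + 2 ≤ j)
    (hjL : j < L) (hjL' : j + 2 ≤ L + i) : ¬ G.Adj (g i) (g j) := by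
  intro h
  rcases Nat.even_or_odd (j - i) with he | ho
  · apply hmin (j - i + 1) (by omega) (by grind)
    refine ⟨fun k => if k ≤ j - i then g (i + k) else g i, ?_, fun k hk => ?_, by simp⟩
    · simpa using HasClosedWalk.reachable h0 hadj (i := i) (by omega)
    · by_cases hkj : k + 1 ≤ j - i
      · simp only [if_pos (show k ≤ j - i by omega), if_pos hkj]
        exact hadj (i + k) (by omega)
      · simp only [if_pos (show k ≤ j - i by omega), if_neg hkj]
        rw [show i + k = j by omega]
        exact h.symm
  · apply hmin (L - (j - i) + 1) (by omega) (by grind)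
    refine ⟨fun k => if k ≤ i then g k else g (k + (j - i) - 1), by simpa using h0,
      fun k hk => ?_, ?_⟩
    · by_cases hki : k + 1 ≤ i
      · simp only [if_pos (show k ≤ i by omega), if_pos hki]
        exact hadj k (by omega)
      · by_cases hki' : k = i
        · subst hki'
          simp only [le_refl, if_true, if_neg hki]
          rw [show k + 1 + (j - k) - 1 = j by omega]
          exact h
        · simp only [if_neg (show ¬ k ≤ i by omega), if_neg hki]
          rw [show k + 1 + (j - i) - 1 = (k + (j - i) - 1) + 1 by omega]
          exact hadj _ (by omega)
    · simp only [if_neg (show ¬ L - (j - i) + 1 ≤ i by omega), zero_le, if_true]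
      rw [show L - (j - i) + 1 + (j - i) - 1 = L by omega, hgL]

/-- A component with an odd closed walk contains an induced cycle of length five, or it has four
vertices that dominate it. -/
theorem exists_C5_or_dominating_of_odd (hT : G.CliqueFree 3)
    (hP : ¬ (pathGraph 7).IsIndContained G) {ρ : V} (hodd : ∃ L, Odd L ∧ G.HasClosedWalk ρ L) :
    (∃ a b c d e, G.Reachable ρ a ∧ G.IsC5 a b c d e) ∨
      ∃ s₁ s₂ s₃ s₄, G.Reachable ρ s₁ ∧ G.Reachable ρ s₂ ∧ G.Reachable ρ s₃ ∧ G.Reachable ρ s₄ ∧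
        ∀ v, G.Reachable ρ v → G.Adj v s₁ ∨ G.Adj v s₂ ∨ G.Adj v s₃ ∨ G.Adj v s₄ := by
  classical
  have hmin : ∀ L' < Nat.find hodd, Odd L' → ¬ G.HasClosedWalk ρ L' := fun L' h1 h2 h3 =>
    Nat.find_min hodd h1 ⟨h2, h3⟩
  obtain ⟨hL, g, h0, hadj, hgL⟩ := Nat.find_spec hodd
  set L := Nat.find hodd with hLdef
  have chord : ∀ {i j : ℕ}, i + 2 ≤ j → j < L → j + 2 ≤ L + i → ¬ G.Adj (g i) (g j) :=
    fun h1 h2 h3 => chord_not_adj hL hmin h0 hadj hgL h1 h2 h3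
  have hreach : ∀ i, i ≤ L → G.Reachable ρ (g i) := fun i hi =>
    HasClosedWalk.reachable h0 hadj hi
  obtain h1 | h3 | h5 | h7 | h9 : L = 1 ∨ L = 3 ∨ L = 5 ∨ L = 7 ∨ 9 ≤ L := by
    obtain ⟨k, hk⟩ := hL
    omega
  · rw [h1] at hadj hgL
    have := hadj 0 (by omega)
    rw [zero_add, hgL] at this
    exact absurd rfl this.ne
  · rw [h3] at hadj hgL
    have e3 := hadj 2 (by omega)
    rw [hgL] at e3
    exact absurd e3.symm (hT.not_adj (hadj 0 (by omega)) (hadj 1 (by omega)))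
  · left
    have e := hadj 4 (by omega)
    rw [show 4 + 1 = L by omega, hgL] at e
    refine ⟨g 0, g 1, g 2, g 3, g 4, h0, ⟨hadj 0 (by omega), hadj 1 (by omega), hadj 2 (by omega),
      hadj 3 (by omega), e, chord (by omega) (by omega) (by omega),
      chord (by omega) (by omega) (by omega), chord (by omega) (by omega) (by omega),
      fun h => chord (i := 0) (j := 3) (by omega) (by omega) (by omega) h.symm,
      fun h => chord (i := 1) (j := 4) (by omega) (by omega) (by omega) h.symm⟩⟩
  · right
    set c : Fin 7 → V := fun i => g i.val with hc
    have hcadj : ∀ i : Fin 7, G.Adj (c i) (c (i + 1)) := by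
      intro i
      have hi := i.isLt
      by_cases h6 : i.val = 6
      · have : i = 6 := Fin.ext h6
        subst this
        have e := hadj 6 (by omega)
        rw [show 6 + 1 = L by omega, hgL] at e
        exact e
      · have : (i + 1).val = i.val + 1 := by
          rw [Fin.val_add]
          simp only [Fin.isValue, Fin.coe_ofNat_eq_mod]
          omega
        simp only [hc, this]
        exact hadj i.val (by omega)
    have hcn : ∀ i j : Fin 7, j ≠ i + 1 → i ≠ j + 1 → ¬ G.Adj (c i) (c j) := by
      have key : ∀ i j : Fin 7, i < j → j ≠ i + 1 → i ≠ j + 1 → ¬ G.Adj (c i) (c j) := by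
        intro i j hij h1 h2
        have h3 : i.val + 2 ≤ j.val ∧ j.val ≤ i.val + 5 := by
          revert i j; decide
        exact chord h3.1 (by omega) (by omega)
      intro i j h1 h2
      rcases lt_trichotomy i j with h | h | h
      · exact key i j h h1 h2
      · subst h; simp
      · exact fun hh => key j i h h2 h1 hh.symm
    -- Only closed walks of length five have to be excluded, and minimality of `L = 7` does that
    -- without any distinctness of vertices.
    have no5 : ∀ a b c d e : V, G.Reachable ρ a → G.Adj a b → G.Adj b c → G.Adj c d →
        G.Adj d e → ¬ G.Adj e a := by
      intro a b c d e ha ab bc cd de ea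
      apply hmin 5 (by omega) (by decide)
      refine ⟨fun i => if i = 0 then a else if i = 1 then b else if i = 2 then c else if i = 3 then d
        else if i = 4 then e else a, by simpa using ha, fun i hi => ?_, by simp⟩
      interval_cases i <;> simp [ab, bc, cd, de, ea]
    -- Otherwise `v` followed by `c i, …, c (i + 5)` is an induced path; adjacency to the other
    -- vertices would close a triangle or a walk of length five.
    have hdom : ∀ (v : V) (i : Fin 7), G.Reachable ρ v → G.Adj v (c i) →
        G.Adj v (c (i + 2)) ∨ G.Adj v (c (i + 5)) := by
      intro v i hv hvi
      by_contra hcon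
      push Not at hcon
      have a0 := hcadj i
      have a1 := hcadj (i + 1)
      have a2 := hcadj (i + 2)
      have a3 := hcadj (i + 3)
      have a4 := hcadj (i + 4)
      have a5 := hcadj (i + 5)
      have a6 := hcadj (i + 6)
      simp only [add_assoc] at a1 a2 a3 a4 a5 a6
      rw [show ((6 : Fin 7) + 1) = 0 by decide, add_zero] at a6
      have n : ∀ x y : Fin 7, y ≠ x + 1 → x ≠ y + 1 → ¬ G.Adj (c (i + x)) (c (i + y)) := by
        intro x y h1 h2
        refine hcn _ _ (fun h => h1 ?_) (fun h => h2 ?_)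
        · rw [add_assoc] at h; exact add_left_cancel h
        · rw [add_assoc] at h; exact add_left_cancel h
      have n0 : ∀ y : Fin 7, y ≠ 1 → y ≠ 6 → ¬ G.Adj (c i) (c (i + y)) := by
        intro y h1 h2
        have := n 0 y (by simpa using h1) (by intro h; apply h2; revert h; revert y; decide)
        simpa using this
      exact hP (IsP7.isIndContained (a := v) (b := c i) (c := c (i + 1)) (d := c (i + 2))
        (e := c (i + 3)) (f := c (i + 4)) (g := c (i + 5))
        { ab := hvi, bc := a0, cd := a1, de := a2, ef := a3, fg := a4
          ac := hT.not_adj hvi a0, ad := hcon.1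
          ae := fun h => no5 v (c i) (c (i + 1)) (c (i + 2)) (c (i + 3)) hv hvi a0 a1 a2 h.symm
          af := fun h => no5 v (c i) (c (i + 6)) (c (i + 5)) (c (i + 4)) hv hvi a6.symm a5.symm
            a4.symm h.symm
          ag := hcon.2
          bd := n0 _ (by decide) (by decide), be := n0 _ (by decide) (by decide)
          bf := n0 _ (by decide) (by decide), bg := n0 _ (by decide) (by decide)
          ce := n _ _ (by decide) (by decide), cf := n _ _ (by decide) (by decide)
          cg := n _ _ (by decide) (by decide), df := n _ _ (by decide) (by decide)
          dg := n _ _ (by decide) (by decide), eg := n _ _ (by decide) (by decide) })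
    -- Having a neighbour on the cycle is passed on to neighbours: otherwise `u, v, c (i + 2), …, c
    -- (i + 6)` is an induced path. By connectedness the cycle dominates the component.
    have hstep : ∀ (u v : V) (i : Fin 7), G.Reachable ρ v → G.Adj v u → G.Adj v (c i) →
        G.Adj v (c (i + 2)) → ∃ k, G.Adj u (c k) := by
      intro u v i hv hvu hvi hvi2
      by_contra hcon
      push Not at hcon
      have n : ∀ x y : Fin 7, y ≠ x + 1 → x ≠ y + 1 → ¬ G.Adj (c (i + x)) (c (i + y)) := by
        intro x y h1 h2
        refine hcn _ _ (fun h => h1 ?_) (fun h => h2 ?_)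
        · rw [add_assoc] at h; exact add_left_cancel h
        · rw [add_assoc] at h; exact add_left_cancel h
      have a0 := hcadj i
      have a2 := hcadj (i + 2)
      have a3 := hcadj (i + 3)
      have a4 := hcadj (i + 4)
      have a5 := hcadj (i + 5)
      have a6 := hcadj (i + 6)
      simp only [add_assoc] at a2 a3 a4 a5 a6
      rw [show ((6 : Fin 7) + 1) = 0 by decide, add_zero] at a6
      exact hP (IsP7.isIndContained (a := u) (b := v) (c := c (i + 2)) (d := c (i + 3))
        (e := c (i + 4)) (f := c (i + 5)) (g := c (i + 6))
        { ab := hvu.symm, bc := hvi2, cd := a2, de := a3, ef := a4, fg := a5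
          ac := hcon _, ad := hcon _, ae := hcon _, af := hcon _, ag := hcon _
          bd := hT.not_adj hvi2 a2
          be := fun h => no5 v (c i) (c (i + 6)) (c (i + 5)) (c (i + 4)) hv hvi a6.symm a5.symm
            a4.symm h.symm
          bf := fun h => no5 v (c (i + 2)) (c (i + 3)) (c (i + 4)) (c (i + 5)) hv hvi2 a2 a3 a4 h.symm
          bg := hT.not_adj hvi a6.symm
          ce := n _ _ (by decide) (by decide), cf := n _ _ (by decide) (by decide)
          cg := n _ _ (by decide) (by decide), df := n _ _ (by decide) (by decide)
          dg := n _ _ (by decide) (by decide), eg := n _ _ (by decide) (by decide) })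
    have hcr : ∀ i : Fin 7, G.Reachable ρ (c i) := fun i => hreach i.val (by omega)
    have hall : ∀ v, G.Reachable ρ v → ∃ k, G.Adj v (c k) := by
      have key : ∀ (u v : V), G.Walk u v → G.Reachable ρ u → (∃ k, G.Adj u (c k)) →
          ∃ k, G.Adj v (c k) := by
        intro u v p
        induction p with
        | nil => exact fun _ h => h
        | cons hadj' q ih =>
          rename_i x y z
          rintro hx ⟨k, hk⟩
          refine ih (hx.trans hadj'.reachable) ?_
          rcases hdom x k hx hk with h | h
          · exact hstep y x k hx hadj' hk h
          · refine hstep y x (k + 5) hx hadj' h ?_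
            rw [add_assoc, show ((5 : Fin 7) + 2) = 0 by decide, add_zero]
            exact hk
      intro v hv
      obtain ⟨p⟩ := (hcr 0).symm.trans hv
      exact key _ _ p (hcr 0) ⟨1, hcadj 0⟩
    -- For every `k` the indices `0, 1, 4, 5` meet both `{k, k + 2}` and `{k, k + 5}` modulo seven.
    refine ⟨c 0, c 1, c 4, c 5, hcr _, hcr _, hcr _, hcr _, fun v hv => ?_⟩
    obtain ⟨k, hk⟩ := hall v hv
    have h2 := hdom v k hv hk
    fin_cases k <;> norm_num at hk h2 <;> tauto
  · exfalso
    have ch : ∀ i j : ℕ, i + 2 ≤ j → j ≤ 6 → ¬ G.Adj (g i) (g j) := fun i j h1 h2 =>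
      chord h1 (by omega) (by omega)
    exact hP (IsP7.isIndContained (a := g 0) (b := g 1) (c := g 2) (d := g 3) (e := g 4) (f := g 5)
      (g := g 6)
      { ab := hadj 0 (by omega), bc := hadj 1 (by omega), cd := hadj 2 (by omega)
        de := hadj 3 (by omega), ef := hadj 4 (by omega), fg := hadj 5 (by omega)
        ac := ch _ _ (by omega) (by omega), ad := ch _ _ (by omega) (by omega)
        ae := ch _ _ (by omega) (by omega), af := ch _ _ (by omega) (by omega)
        ag := ch _ _ (by omega) (by omega), bd := ch _ _ (by omega) (by omega)
        be := ch _ _ (by omega) (by omega), bf := ch _ _ (by omega) (by omega)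
        bg := ch _ _ (by omega) (by omega), ce := ch _ _ (by omega) (by omega)
        cf := ch _ _ (by omega) (by omega), cg := ch _ _ (by omega) (by omega)
        df := ch _ _ (by omega) (by omega), dg := ch _ _ (by omega) (by omega)
        eg := ch _ _ (by omega) (by omega) })

/-- A component contains an induced cycle of length five, or it has six vertices that dominate
its undominated vertices. -/
theorem exists_C5_or_dominating [Finite V] (hT : G.CliqueFree 3)
    (hP : ¬ (pathGraph 7).IsIndContained G) {U : Set V} (hU : G.IsUndominated U) (ρ : V) :
    (∃ a b c d e, G.Reachable ρ a ∧ G.IsC5 a b c d e) ∨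
      ∃ s : ℕ → V, (∀ j < 6, G.Reachable ρ (s j)) ∧
        ∀ v ∈ U, G.Reachable ρ v → ∃ j < 6, v = s j ∨ G.Adj v (s j) := by
  rcases exists_side_or_odd (G := G) ρ with ⟨side, hside⟩ | hodd
  · right
    obtain ⟨a, b, c, ra, rb, rc, h1⟩ := exists_dominating_side hP hside hU true
    obtain ⟨d, e, f, rd, re, rf, h2⟩ := exists_dominating_side hP hside hU false
    refine ⟨fun j => if j = 0 then a else if j = 1 then b else if j = 2 then c else
      if j = 3 then d else if j = 4 then e else f, fun j hj => ?_, fun v hv hr => ?_⟩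
    · interval_cases j <;> simpa
    · cases hs : side v with
      | true =>
        rcases h1 v hv hr hs with (h | h | h) | h | h | h
        · exact ⟨0, by omega, by simp [h]⟩
        · exact ⟨1, by omega, by simp [h]⟩
        · exact ⟨2, by omega, by simp [h]⟩
        · exact ⟨0, by omega, by simp [h]⟩
        · exact ⟨1, by omega, by simp [h]⟩
        · exact ⟨2, by omega, by simp [h]⟩
      | false =>
        rcases h2 v hv hr hs with (h | h | h) | h | h | h
        · exact ⟨3, by omega, by simp [h]⟩
        · exact ⟨4, by omega, by simp [h]⟩
        · exact ⟨5, by omega, by simp [h]⟩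
        · exact ⟨3, by omega, by simp [h]⟩
        · exact ⟨4, by omega, by simp [h]⟩
        · exact ⟨5, by omega, by simp [h]⟩
  · rcases exists_C5_or_dominating_of_odd hT hP hodd with h | ⟨a, b, c, d, ra, rb, rc, rd, h⟩
    · exact Or.inl h
    · refine Or.inr ⟨fun j => if j = 0 then a else if j = 1 then b else if j = 2 then c else d,
        fun j hj => ?_, fun v hv hr => ?_⟩
      · interval_cases j <;> simpa
      · rcases h v hr with h | h | h | h
        · exact ⟨0, by omega, by simp [h]⟩
        · exact ⟨1, by omega, by simp [h]⟩
        · exact ⟨2, by omega, by simp [h]⟩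
        · exact ⟨3, by omega, by simp [h]⟩

end SimpleGraph

/-!
# Components with an induced cycle of length five
-/

namespace SimpleGraph

variable {V : Type*} {G : SimpleGraph V}

/-- The vertex `u` has a neighbour in `C`. -/
def Touches (G : SimpleGraph V) (C : Set V) (u : V) : Prop := ∃ c ∈ C, G.Adj u c

/-- The properties of an induced cycle of length five that produce long induced paths. -/
structure IsHub (G : SimpleGraph V) (C : Set V) : Prop where
  arm : ∀ u, G.Touches C u → ∃ c ∈ C, ∃ d ∈ C, ∃ e ∈ C,
    G.Adj u c ∧ G.Adj c d ∧ G.Adj d e ∧ ¬ G.Adj u d ∧ ¬ G.Adj u e ∧ ¬ G.Adj c e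
  link : ∀ u v, G.Touches C u → G.Touches C v →
    (∃ c ∈ C, G.Adj u c ∧ G.Adj v c) ∨
    (∃ c ∈ C, ∃ d ∈ C, G.Adj u c ∧ G.Adj c d ∧ G.Adj d v ∧ ¬ G.Adj u d ∧ ¬ G.Adj c v) ∨
    (∃ c ∈ C, ∃ d ∈ C, ∃ e ∈ C, G.Adj u c ∧ G.Adj c d ∧ G.Adj d e ∧ G.Adj e v ∧ ¬ G.Adj u d ∧
      ¬ G.Adj u e ∧ ¬ G.Adj c e ∧ ¬ G.Adj c v ∧ ¬ G.Adj d v)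

theorem IsC5.rotate {a b c d e : V} (h : G.IsC5 a b c d e) : G.IsC5 b c d e a :=
  ⟨h.bc, h.cd, h.de, h.ea, h.ab, h.bd, h.ce, h.da, h.eb, h.ac⟩

theorem IsC5.reflect {a b c d e : V} (h : G.IsC5 a b c d e) : G.IsC5 d c b a e :=
  ⟨h.cd.symm, h.bc.symm, h.ab.symm, h.ea.symm, h.de.symm, fun h' => h.bd h'.symm, fun h' => h.ac h'.symm,
    fun h' => h.eb h'.symm, fun h' => h.da h'.symm, fun h' => h.ce h'.symm⟩

/-- For an arm, walk around the cycle from a neighbour of `u`: in one of the two directions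
triangle-freeness leaves the next two vertices nonadjacent to `u`. For a link, choose neighbours of
`u` and `v` on the cycle at the least distance, which is `0`, `1` or `2`; this choice makes the
connecting path induced. -/
theorem IsC5.isHub {a b c d e : V} (hT : G.CliqueFree 3) (h : G.IsC5 a b c d e) :
    G.IsHub {a, b, c, d, e} := by
  have sym : ∀ u v, G.Adj u v → G.Adj v u := fun _ _ h => h.symm
  have tri : ∀ u v w, G.Adj u v → G.Adj v w → ¬ G.Adj u w := fun _ _ _ h1 h2 => hT.not_adj h1 h2
  constructor
  · have key : ∀ (a b c d e u : V), G.IsC5 a b c d e → G.Adj u a →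
        ∃ c' ∈ ({a, b, c, d, e} : Set V), ∃ d' ∈ ({a, b, c, d, e} : Set V),
        ∃ e' ∈ ({a, b, c, d, e} : Set V), G.Adj u c' ∧ G.Adj c' d' ∧ G.Adj d' e' ∧ ¬ G.Adj u d' ∧
          ¬ G.Adj u e' ∧ ¬ G.Adj c' e' := by
      intro a b c d e u h hu
      obtain ⟨ab, bc, cd, de, ea, ac, bd, ce, da, eb⟩ := h
      by_cases huc : G.Adj u c
      · exact ⟨a, by simp, e, by simp, d, by simp, hu, ea.symm, de.symm, by grind, by grind, by grind⟩
      · exact ⟨a, by simp, b, by simp, c, by simp, hu, ab, bc, by grind, by grind, by grind⟩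
    have hset : ∀ a b c d e : V, ({a, b, c, d, e} : Set V) = {b, c, d, e, a} := by
      intro a b c d e; ext; simp; tauto
    rintro u ⟨v, hv, huv⟩
    simp only [Set.mem_insert_iff, Set.mem_singleton_iff] at hv
    rcases hv with rfl | rfl | rfl | rfl | rfl
    · exact key _ _ _ _ _ u h huv
    · rw [hset]; exact key _ _ _ _ _ u h.rotate huv
    · rw [hset, hset]; exact key _ _ _ _ _ u h.rotate.rotate huv
    · rw [hset, hset, hset]; exact key _ _ _ _ _ u h.rotate.rotate.rotate huv
    · rw [hset, hset, hset, hset]; exact key _ _ _ _ _ u h.rotate.rotate.rotate.rotate huv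
  · rintro u v ⟨c₁, hc₁, hu⟩ ⟨c₂, hc₂, hv⟩
    by_contra hcon
    simp only [not_or, not_exists, not_and] at hcon
    obtain ⟨h1, h2, h3⟩ := hcon
    -- The nonadjacencies demanded in a link may be dropped: a violation is a closer pair of
    -- attachments, which the earlier alternatives exclude, or a triangle.
    have h1' : ∀ c' ∈ ({a, b, c, d, e} : Set V), G.Adj u c' → ¬ G.Adj v c' := fun c' hc => h1 c' hc
    have h2' : ∀ c' ∈ ({a, b, c, d, e} : Set V), ∀ d' ∈ ({a, b, c, d, e} : Set V), G.Adj u c' →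
        G.Adj c' d' → ¬ G.Adj v d' := fun c' hc d' hd h4 h5 h6 =>
      h2 c' hc d' hd h4 h5 h6.symm (fun h7 => h1 d' hd h7 h6) (fun h7 => h1 c' hc h4 h7.symm)
    have h3' : ∀ c' ∈ ({a, b, c, d, e} : Set V), ∀ d' ∈ ({a, b, c, d, e} : Set V),
        ∀ e' ∈ ({a, b, c, d, e} : Set V), G.Adj u c' →
        G.Adj c' d' → G.Adj d' e' → ¬ G.Adj c' e' → ¬ G.Adj v e' := fun c' hc d' hd e' he h4 h5 h6 h7 h8 =>
      h3 c' hc d' hd e' he h4 h5 h6 h8.symm (fun h9 => h2' d' hd e' he h9 h6 h8)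
        (fun h9 => h1 e' he h9 h8) h7 (fun h9 => h1 c' hc h4 h9.symm)
        (fun h9 => h2' c' hc d' hd h4 h5 h9.symm)
    obtain ⟨ab, bc, cd, de, ea, ac, bd, ce, da, eb⟩ := h
    have n1 := h2' c₁ hc₁ c₂ hc₂ hu
    have n2 := fun d' hd' => h3' c₁ hc₁ d' hd' c₂ hc₂ hu
    have n3 := h1' c₁ hc₁ hu
    simp only [Set.mem_insert_iff, Set.mem_singleton_iff, forall_eq_or_imp, forall_eq] at hc₁ hc₂ n2
    rcases hc₁ with rfl | rfl | rfl | rfl | rfl <;> rcases hc₂ with rfl | rfl | rfl | rfl | rfl <;>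
      grind

namespace IsHub

variable {C : Set V} (hC : G.IsHub C) (hT : G.CliqueFree 3)
  (hP : ¬ (pathGraph 7).IsIndContained G)

include hC hT hP

/-- Otherwise the path `k₃ k₂ k₁ u`, continued by an arm of `u` into the hub, is a `P_7`. So a path
of three vertices outside the neighbourhood of the hub is attached at its third vertex whenever it
is attached at its first one. -/
theorem star {u k₁ k₂ k₃ : V} (hu : G.Touches C u) (h₁ : ¬ G.Touches C k₁) (h₂ : ¬ G.Touches C k₂)
    (h₃ : ¬ G.Touches C k₃) (hu1 : G.Adj u k₁) (h12 : G.Adj k₁ k₂) (h23 : G.Adj k₂ k₃) :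
    G.Adj u k₃ := by
  by_contra hcon
  obtain ⟨c, hc, d, hd, e, he, uc, cd, de, ud, ue, ce⟩ := hC.arm u hu
  have n : ∀ {k c}, ¬ G.Touches C k → c ∈ C → ¬ G.Adj k c := fun h hc h' => h ⟨_, hc, h'⟩
  exact hP (IsP7.isIndContained (a := k₃) (b := k₂) (c := k₁) (d := u) (e := c) (f := d) (g := e)
    { ab := h23.symm, bc := h12.symm, cd := hu1.symm, de := uc, ef := cd, fg := de
      ac := fun h => hT.not_adj h12 h23 h.symm, ad := fun h => hcon h.symm
      ae := n h₃ hc, af := n h₃ hd, ag := n h₃ he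
      bd := fun h => hT.not_adj hu1 h12 h.symm
      be := n h₂ hc, bf := n h₂ hd, bg := n h₂ he
      ce := n h₁ hc, cf := n h₁ hd, cg := n h₁ he, df := ud, dg := ue, eg := ce })

/-- Two paths from the outside to nonadjacent vertices that touch the hub. -/
theorem common_of_tail {y z w w' β : V} (hy : G.Touches C y) (hz : G.Touches C z)
    (hw : ¬ G.Touches C w) (hw' : ¬ G.Touches C w') (hβ : ¬ G.Touches C β) (yz : ¬ G.Adj y z)
    (wy : G.Adj w y) (wz' : G.Adj w' z) (wz : ¬ G.Adj w z) (wy' : ¬ G.Adj w' y)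
    (ww : ¬ G.Adj w w') (βw : G.Adj β w) (βz : ¬ G.Adj β z) (βw' : ¬ G.Adj β w') :
    ∃ c ∈ C, G.Adj y c ∧ G.Adj z c := by
  have n : ∀ {k c}, ¬ G.Touches C k → c ∈ C → ¬ G.Adj k c := fun h hc h' => h ⟨_, hc, h'⟩
  have n' : ∀ {k c}, ¬ G.Touches C k → c ∈ C → ¬ G.Adj c k := fun h hc h' => h ⟨_, hc, h'.symm⟩
  have s : ∀ {k c}, ¬ G.Adj k c → ¬ G.Adj c k := fun h h' => h h'.symm
  rcases hC.link y z hy hz with h | ⟨c, hc, d, hd, yc, cd, dz, yd, cz⟩ |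
      ⟨c, hc, d, hd, e, he, yc, cd, de, ez, yd, ye, ce, cz, dz⟩
  · exact h
  · exact absurd (IsP7.isIndContained (a := β) (b := w) (c := y) (d := c) (e := d) (f := z) (g := w')
      { ab := βw, bc := wy, cd := yc, de := cd, ef := dz, fg := wz'.symm
        ac := hT.not_adj βw wy, ad := n hβ hc, ae := n hβ hd, af := βz, ag := βw'
        bd := n hw hc, be := n hw hd, bf := wz, bg := ww
        ce := yd, cf := yz, cg := s wy', df := cz, dg := n' hw' hc, eg := n' hw' hd }) hP
  · exact absurd (IsP7.isIndContained (a := w) (b := y) (c := c) (d := d) (e := e) (f := z) (g := w')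
      { ab := wy, bc := yc, cd := cd, de := de, ef := ez, fg := wz'.symm
        ac := n hw hc, ad := n hw hd, ae := n hw he, af := wz, ag := ww
        bd := yd, be := ye, bf := yz, bg := s wy'
        ce := ce, cf := cz, cg := n' hw' hc, df := dz, dg := n' hw' hd, eg := n' hw' he }) hP

/-- By `common_of_tail` the vertices `y` and `z` have a common neighbour in `C`. Two nonadjacent
tail ends would then complete the induced path `β w y c z w' β'`. -/
theorem not_two_tails {y z w w' β β' : V} (hy : G.Touches C y) (hz : G.Touches C z)
    (hw : ¬ G.Touches C w) (hw' : ¬ G.Touches C w') (hβ : ¬ G.Touches C β) (hβ' : ¬ G.Touches C β')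
    (yz : ¬ G.Adj y z) (wy : G.Adj w y) (wz' : G.Adj w' z) (wz : ¬ G.Adj w z) (wy' : ¬ G.Adj w' y)
    (ww : ¬ G.Adj w w') (βw : G.Adj β w) (βz : ¬ G.Adj β z) (βw' : ¬ G.Adj β w')
    (βw'' : G.Adj β' w') (βy' : ¬ G.Adj β' y) (βw3 : ¬ G.Adj β' w) : G.Adj β β' := by
  by_contra hcon
  have n : ∀ {k c}, ¬ G.Touches C k → c ∈ C → ¬ G.Adj k c := fun h hc h' => h ⟨_, hc, h'⟩
  have n' : ∀ {k c}, ¬ G.Touches C k → c ∈ C → ¬ G.Adj c k := fun h hc h' => h ⟨_, hc, h'.symm⟩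
  have s : ∀ {k c}, ¬ G.Adj k c → ¬ G.Adj c k := fun h h' => h h'.symm
  obtain ⟨c, hc, yc, zc⟩ := hC.common_of_tail hT hP hy hz hw hw' hβ yz wy wz' wz wy' ww βw βz βw'
  exact hP (IsP7.isIndContained (a := β) (b := w) (c := y) (d := c) (e := z) (f := w') (g := β')
    { ab := βw, bc := wy, cd := yc, de := zc.symm, ef := wz'.symm, fg := βw''.symm
      ac := hT.not_adj βw wy, ad := n hβ hc, ae := βz, af := βw', ag := hcon
      bd := n hw hc, be := wz, bf := ww, bg := s βw3
      ce := yz, cf := s wy', cg := s βy', df := n' hw' hc, dg := n' hβ' hc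
      eg := fun h => hT.not_adj βw'' wz' h.symm })

/-- By `star`, an edge between `ab` and `a'b'` would make `x` adjacent to `a'` or `b'`. So if `x`
and `x'` were nonadjacent, they would carry the independent tails `a b` and `a' b'`, and
`not_two_tails` would join `b` to `b'`. -/
theorem private_adj {a b a' b' x x' : V} (ha : ¬ G.Touches C a) (hb : ¬ G.Touches C b)
    (ha' : ¬ G.Touches C a') (hb' : ¬ G.Touches C b') (hx : G.Touches C x) (hx' : G.Touches C x')
    (ab : G.Adj a b) (ab' : G.Adj a' b') (xa : G.Adj x a) (xa' : G.Adj x' a')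
    (n1 : ¬ G.Adj x a') (n2 : ¬ G.Adj x b') (n3 : ¬ G.Adj x' a) (n4 : ¬ G.Adj x' b) :
    G.Adj x x' := by
  by_contra hcon
  have st := fun {u k₁ k₂ k₃ : V} => hC.star hT hP (u := u) (k₁ := k₁) (k₂ := k₂) (k₃ := k₃)
  have m1 : ¬ G.Adj a a' := fun h => n2 (st hx ha ha' hb' xa h ab')
  have m2 : ¬ G.Adj b a' := fun h => n1 (st hx ha hb ha' xa ab h)
  have m3 : ¬ G.Adj a b' := fun h => n1 (st hx ha hb' ha' xa h ab'.symm)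
  have m4 : ¬ G.Adj b b' := fun h => n2 (st hx ha hb hb' xa ab h)
  exact m4 (hC.not_two_tails hT hP hx hx' ha ha' hb hb' hcon xa.symm xa'.symm
    (fun h => n3 h.symm) (fun h => n1 h.symm) m1 ab.symm (fun h => n4 h.symm) m2 ab'.symm
    (fun h => n2 h.symm) (fun h => m3 h.symm))

/-- Every edge of the component that avoids the neighbourhood of the hub has an end with a neighbour
that touches the hub. -/
theorem exists_touches_of_edge {ρ : V} (hρ : G.Touches C ρ) {v : V} (h : G.Reachable ρ v) :
    ¬ G.Touches C v → ∀ y, ¬ G.Touches C y → G.Adj v y →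
      ∃ u, G.Touches C u ∧ (G.Adj u v ∨ G.Adj u y) := by
  obtain ⟨p⟩ := h
  -- The claim moves along the walk from `x` to its successor `y`. If a touching vertex is adjacent
  -- to `x`, then `star` along `x, y, t` makes it adjacent to `t`, an end of the next edge.
  have key : ∀ (u v : V), G.Walk u v →
      (¬ G.Touches C u → ∀ y, ¬ G.Touches C y → G.Adj u y →
        ∃ x, G.Touches C x ∧ (G.Adj x u ∨ G.Adj x y)) →
      (¬ G.Touches C v → ∀ y, ¬ G.Touches C y → G.Adj v y →
        ∃ x, G.Touches C x ∧ (G.Adj x v ∨ G.Adj x y)) := by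
    intro u v p
    induction p with
    | nil => exact fun h => h
    | cons hadj q ih =>
      rename_i x y z
      intro hx
      refine ih fun hy t ht hyt => ?_
      by_cases hxt : G.Touches C x
      · exact ⟨x, hxt, Or.inl hadj⟩
      · obtain ⟨s, hs, h | h⟩ := hx hxt y hy hadj
        · exact ⟨s, hs, Or.inr (hC.star hT hP hs hxt hy ht h hadj hyt)⟩
        · exact ⟨s, hs, Or.inl h⟩
  exact key _ _ p (fun h => absurd hρ h)

/-- Two vertices that touch the hub hit all edges that avoid its neighbourhood. -/
theorem exists_hitting_edges [Finite V] {ρ : V} (hρ : G.Touches C ρ) :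
    ∃ p q, G.Touches C p ∧ G.Touches C q ∧ ∀ a b, G.Reachable ρ a → ¬ G.Touches C a →
      ¬ G.Touches C b → G.Adj a b → (G.Adj p a ∨ G.Adj p b) ∨ (G.Adj q a ∨ G.Adj q b) := by
  classical
  have := Fintype.ofFinite V
  set E : Finset (V × V) := Finset.univ.filter fun e => G.Reachable ρ e.1 ∧ ¬ G.Touches C e.1 ∧
    ¬ G.Touches C e.2 ∧ G.Adj e.1 e.2 with hE
  set H : V × V → Finset V := fun e => Finset.univ.filter fun u => G.Touches C u ∧
    (G.Adj u e.1 ∨ G.Adj u e.2) with hH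
  have memE : ∀ e, e ∈ E ↔ G.Reachable ρ e.1 ∧ ¬ G.Touches C e.1 ∧ ¬ G.Touches C e.2 ∧
    G.Adj e.1 e.2 := fun e => by simp [hE]
  have memH : ∀ e u, u ∈ H e ↔ G.Touches C u ∧ (G.Adj u e.1 ∨ G.Adj u e.2) := fun e => by simp [hH]
  -- Consequently three edges cannot have three mutually private attachments, for these would be a
  -- triangle.
  have hpriv : ∀ e ∈ E, ∀ e' ∈ E, ∀ x ∈ H e, ∀ x' ∈ H e', x ∉ H e' → x' ∉ H e → G.Adj x x' := by
    intro e he e' he' x hx x' hx' h1 h2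
    rw [memE] at he he'
    rw [memH] at hx hx'
    have h1 : ¬ (G.Adj x e'.1 ∨ G.Adj x e'.2) := fun h => h1 ((memH _ _).2 ⟨hx.1, h⟩)
    have h2 : ¬ (G.Adj x' e.1 ∨ G.Adj x' e.2) := fun h => h2 ((memH _ _).2 ⟨hx'.1, h⟩)
    obtain ⟨-, ea, eb, eab⟩ := he
    obtain ⟨-, ea', eb', eab'⟩ := he'
    push Not at h1 h2
    rcases hx.2 with hxa | hxb <;> rcases hx'.2 with hxa' | hxb'
    · exact hC.private_adj hT hP ea eb ea' eb' hx.1 hx'.1 eab eab' hxa hxa' h1.1 h1.2 h2.1 h2.2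
    · exact hC.private_adj hT hP ea eb eb' ea' hx.1 hx'.1 eab eab'.symm hxa hxb' h1.2 h1.1 h2.1 h2.2
    · exact hC.private_adj hT hP eb ea ea' eb' hx.1 hx'.1 eab.symm eab' hxb hxa' h1.1 h1.2 h2.2 h2.1
    · exact hC.private_adj hT hP eb ea eb' ea' hx.1 hx'.1 eab.symm eab'.symm hxb hxb' h1.2 h1.1
        h2.2 h2.1
  suffices h : ∃ p q, G.Touches C p ∧ G.Touches C q ∧ ∀ e ∈ E, p ∈ H e ∨ q ∈ H e by
    obtain ⟨p, q, hp, hq, h⟩ := h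
    refine ⟨p, q, hp, hq, fun a b h1 h2 h3 h4 => ?_⟩
    have := h (a, b) ((memE _).2 ⟨h1, h2, h3, h4⟩)
    simp only [memH] at this
    tauto
  by_cases hne : E.Nonempty
  swap
  · exact ⟨ρ, ρ, hρ, hρ, fun e he => absurd ⟨e, he⟩ hne⟩
  -- The smallest set of attachments; hence every edge that is missed by `p` has an attachment that
  -- `e₁` lacks.
  obtain ⟨e₁, he₁, hmin₁⟩ := E.exists_min_image (fun e => (H e).card) hne
  obtain ⟨p, hp⟩ : (H e₁).Nonempty := by
    obtain ⟨h1, h2, h3, h4⟩ := (memE _).1 he₁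
    obtain ⟨u, hu⟩ := hC.exists_touches_of_edge hT hP hρ h1 h2 _ h3 h4
    exact ⟨u, (memH _ _).2 hu⟩
  have hpt := ((memH _ _).1 hp).1
  by_cases hne₂ : (E.filter fun e => p ∉ H e).Nonempty
  swap
  · refine ⟨p, p, hpt, hpt, fun e he => Or.inl ?_⟩
    by_contra hcon
    exact hne₂ ⟨e, Finset.mem_filter.2 ⟨he, hcon⟩⟩
  have hnew : ∀ e ∈ E, p ∉ H e → ∃ s ∈ H e, s ∉ H e₁ := by
    intro e he hpe
    by_contra hcon
    push Not at hcon
    have h1 := Finset.eq_of_subset_of_card_le hcon (hmin₁ e he)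
    rw [h1] at hpe
    exact hpe hp
  -- The same choice again relative to `H e₁`: an edge that is missed by `p` and `q` has an
  -- attachment `s` outside `H e₁` and `H e₂`, and `p, q, s` are mutually private.
  obtain ⟨e₂, he₂, hmin₂⟩ := (E.filter fun e => p ∉ H e).exists_min_image
    (fun e => (H e \ H e₁).card) hne₂
  obtain ⟨he₂, hp₂⟩ := Finset.mem_filter.1 he₂
  obtain ⟨q, hq, hq₁⟩ := hnew e₂ he₂ hp₂
  have hqt := ((memH _ _).1 hq).1
  refine ⟨p, q, hpt, hqt, fun e₃ he₃ => ?_⟩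
  by_contra hcon
  push Not at hcon
  obtain ⟨hp₃, hq₃⟩ := hcon
  obtain ⟨s, hs, hs₁, hs₂⟩ : ∃ s ∈ H e₃, s ∉ H e₁ ∧ s ∉ H e₂ := by
    by_contra hcon
    push Not at hcon
    have hsub : H e₃ \ H e₁ ⊆ H e₂ \ H e₁ := by
      intro s hs
      rw [Finset.mem_sdiff] at hs ⊢
      exact ⟨hcon s hs.1 hs.2, hs.2⟩
    have h1 := Finset.eq_of_subset_of_card_le hsub
      (hmin₂ e₃ (Finset.mem_filter.2 ⟨he₃, hp₃⟩))
    have h2 : q ∈ H e₂ \ H e₁ := Finset.mem_sdiff.2 ⟨hq, hq₁⟩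
    rw [← h1, Finset.mem_sdiff] at h2
    exact hq₃ h2.1
  exact hT.not_adj (hpriv _ he₁ _ he₂ p hp q hq hp₂ hq₁) (hpriv _ he₂ _ he₃ q hq s hs hq₃ hs₂)
    (hpriv _ he₁ _ he₃ p hp s hs hp₃ hs₁)

end IsHub

end SimpleGraph

/-!
# Colourings of the neighbourhood of an induced cycle of length five
-/

namespace SimpleGraph

variable {V : Type*} {G : SimpleGraph V}

/-- The vertex `u` has a neighbour of colour `k` in `C`. -/
def Sees (G : SimpleGraph V) (C : Set V) (f : V → ℕ) (u : V) (k : ℕ) : Prop :=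
  ∃ c ∈ C, G.Adj u c ∧ f c = k

/-- A vertex outside the neighbourhood of `C` with no neighbour whose colour is determined by `C`. -/
structure IsLoose (G : SimpleGraph V) (C : Set V) (f : V → ℕ) (w : V) : Prop where
  not_touches : ¬ G.Touches C w
  sees : ∀ u, G.Adj w u → ∀ k l, G.Sees C f u k → G.Sees C f u l → k = l

/-- The vertex `w` has neighbours of colour `k` of two different kinds. -/
def IsMixed (G : SimpleGraph V) (C : Set V) (f : V → ℕ) (k m : ℕ) (w : V) : Prop :=
  (∃ u, G.Adj w u ∧ ¬ G.Touches C u ∧ f u = k) ∧ (∃ u, G.Adj w u ∧ G.Touches C u ∧ f u = k) ∨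
  (∃ u, G.Adj w u ∧ G.Sees C f u m ∧ f u = k) ∧
    (∃ u, G.Adj w u ∧ G.Touches C u ∧ ¬ G.Sees C f u m ∧ f u = k)

theorem IsMixed.exists_touches {C : Set V} {f : V → ℕ} {k m : ℕ} {w : V} (h : G.IsMixed C f k m w) :
    ∃ u, G.Adj w u ∧ G.Touches C u ∧ f u = k := by
  rcases h with ⟨-, h⟩ | ⟨-, u, h1, h2, -, h3⟩
  · exact h
  · exact ⟨u, h1, h2, h3⟩

namespace IsHub

variable {C : Set V} (hC : G.IsHub C) (hT : G.CliqueFree 3)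
  (hP : ¬ (pathGraph 7).IsIndContained G) {f : V → ℕ} (hf : ∀ u v, G.Adj u v → f u ≠ f v)

include hC hT hP hf

/-- A vertex with a neighbour of colour `k` outside the neighbourhood of the hub. -/
theorem common_of_inner {k : ℕ} {y z w w' α : V} (hy : G.Touches C y) (hz : G.Touches C z)
    (hw : ¬ G.Touches C w) (hw' : ¬ G.Touches C w') (hα : ¬ G.Touches C α) (fy : f y = k)
    (fz : f z = k) (fα : f α = k) (wy : G.Adj w y) (wz' : G.Adj w' z) (wz : ¬ G.Adj w z)
    (wy' : ¬ G.Adj w' y) (ww : ¬ G.Adj w w') (wα : G.Adj w α) :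
    ∃ c ∈ C, G.Adj y c ∧ G.Adj z c :=
  hC.common_of_tail hT hP hy hz hw hw' hα (fun h => hf _ _ h (fy.trans fz.symm)) wy wz' wz wy' ww
    wα.symm (fun h => hf _ _ h (fα.trans fz.symm))
    (fun h => wy' (hC.star hT hP hy hw hα hw' wy.symm wα h).symm)

/-- The inner neighbours `α` and `α'` end two tails. Equality of colours and `star` supply the
nonadjacencies, and `not_two_tails` then joins two vertices of the same colour. -/
theorem not_two_inner {k : ℕ} {y z w w' α α' : V} (hy : G.Touches C y) (hz : G.Touches C z)
    (hw : ¬ G.Touches C w) (hw' : ¬ G.Touches C w') (hα : ¬ G.Touches C α)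
    (hα' : ¬ G.Touches C α') (fy : f y = k) (fz : f z = k) (fα : f α = k) (fα' : f α' = k)
    (wy : G.Adj w y) (wz' : G.Adj w' z) (wz : ¬ G.Adj w z) (wy' : ¬ G.Adj w' y)
    (ww : ¬ G.Adj w w') (wα : G.Adj w α) (wα' : G.Adj w' α') : False :=
  hf α α' (hC.not_two_tails hT hP hy hz hw hw' hα hα' (fun h => hf _ _ h (fy.trans fz.symm)) wy wz'
    wz wy' ww wα.symm (fun h => hf _ _ h (fα.trans fz.symm))
    (fun h => wy' (hC.star hT hP hy hw hα hw' wy.symm wα h).symm) wα'.symm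
    (fun h => hf _ _ h (fα'.trans fy.symm))
    (fun h => wz (hC.star hT hP hz hw' hα' hw wz'.symm wα' h).symm)) (fα.trans fα'.symm)

end IsHub

/-- An induced cycle of length five with the colours `x, y, x, y, m`. -/
structure IsC5Coloured (G : SimpleGraph V) (f : V → ℕ) (a b c d e : V) : Prop
    extends G.IsC5 a b c d e where
  fac : f a = f c
  fbd : f b = f d

namespace IsC5Coloured

variable {f : V → ℕ} {a b c d e : V}

theorem reflect (h : G.IsC5Coloured f a b c d e) : G.IsC5Coloured f d c b a e :=
  ⟨h.toIsC5.reflect, h.fbd.symm, h.fac.symm⟩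

variable (h : G.IsC5Coloured f a b c d e) (hT : G.CliqueFree 3)
  (hP : ¬ (pathGraph 7).IsIndContained G) (hf : ∀ u v, G.Adj u v → f u ≠ f v)

include h hT hP hf

omit hT hP in
/-- Neighbours of loose vertices that see the colour of `e`. -/
theorem adj_iff_of_sees {w u : V} (hw : G.IsLoose {a, b, c, d, e} f w) (wu : G.Adj w u)
    (hu : G.Sees {a, b, c, d, e} f u (f e)) :
    G.Adj u e ∧ ¬ G.Adj u a ∧ ¬ G.Adj u b ∧ ¬ G.Adj u c ∧ ¬ G.Adj u d := by
  have hs := hw.sees u wu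
  have ea := hf _ _ h.ea
  have ed := hf _ _ h.de
  have hh := h.fac
  have hh' := h.fbd
  have n : ∀ v ∈ ({a, b, c, d, e} : Set V), G.Adj u v → f v = f e := fun v hv huv =>
    hs _ _ ⟨v, hv, huv, rfl⟩ hu
  have na : ¬ G.Adj u a := fun h => ea (n a (by simp) h).symm
  have nb : ¬ G.Adj u b := fun h => ed (by rw [← hh', n b (by simp) h])
  have nc : ¬ G.Adj u c := fun h => ea (by rw [hh, n c (by simp) h])
  have nd : ¬ G.Adj u d := fun h => ed (n d (by simp) h)
  refine ⟨?_, na, nb, nc, nd⟩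
  obtain ⟨v, hv, huv, -⟩ := hu
  simp only [Set.mem_insert_iff, Set.mem_singleton_iff] at hv
  rcases hv with rfl | rfl | rfl | rfl | rfl <;> tauto

omit hT hP in
/-- Neighbours of loose vertices of colour `f a` that do not see the colour of `e`. -/
theorem adj_or_of_not_sees {u : V}
    (hu : G.Touches {a, b, c, d, e} u) (hn : ¬ G.Sees {a, b, c, d, e} f u (f e)) (fu : f u = f a) :
    (G.Adj u b ∨ G.Adj u d) ∧ ¬ G.Adj u a ∧ ¬ G.Adj u c ∧ ¬ G.Adj u e := by
  have na : ¬ G.Adj u a := fun h => hf _ _ h fu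
  have nc : ¬ G.Adj u c := fun h' => hf _ _ h' (fu.trans h.fac)
  have ne : ¬ G.Adj u e := fun h => hn ⟨e, by simp, h, rfl⟩
  refine ⟨?_, na, nc, ne⟩
  obtain ⟨v, hv, huv⟩ := hu
  simp only [Set.mem_insert_iff, Set.mem_singleton_iff] at hv
  rcases hv with rfl | rfl | rfl | rfl | rfl <;> tauto

omit hT in
/-- If a loose vertex has neighbours of colour `f a` that see the colour of `e` and others that do
not, then the latter are adjacent to `b`. -/
theorem adj_of_mixed {w u v : V} (hw : G.IsLoose {a, b, c, d, e} f w) (wu : G.Adj w u)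
    (hu : G.Sees {a, b, c, d, e} f u (f e)) (fu : f u = f a) (wv : G.Adj w v)
    (hv : G.Touches {a, b, c, d, e} v) (hvn : ¬ G.Sees {a, b, c, d, e} f v (f e)) (fv : f v = f a) :
    G.Adj v b := by
  by_contra hcon
  obtain ⟨ue, ua, ub, uc, ud⟩ := h.adj_iff_of_sees hf hw wu hu
  obtain ⟨-, va, vc, ve⟩ := h.adj_or_of_not_sees hf hv hvn fv
  have n : ∀ v ∈ ({a, b, c, d, e} : Set V), ¬ G.Adj w v := fun v hv h' => hw.not_touches ⟨v, hv, h'⟩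
  have s : ∀ {k c}, ¬ G.Adj k c → ¬ G.Adj c k := fun h h' => h h'.symm
  exact hP (IsP7.isIndContained (a := v) (b := w) (c := u) (d := e) (e := a) (f := b) (g := c)
    { ab := wv.symm, bc := wu, cd := ue, de := h.ea, ef := h.ab, fg := h.bc
      ac := fun h' => hf _ _ h' (fv.trans fu.symm), ad := ve, ae := va, af := hcon, ag := vc
      bd := n e (by simp), be := n a (by simp), bf := n b (by simp), bg := n c (by simp)
      ce := ua, cf := ub, cg := uc, df := h.eb, dg := s h.ce, eg := h.ac })

-- Compares a vertex that sees the colour of `e` with one that does not: if each is private to one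
-- of two nonadjacent loose vertices, the piece `e a b` of the cycle connects them to an induced
-- path.
omit hT in
theorem not_private_of_sees {w w' u v : V} (hw : G.IsLoose {a, b, c, d, e} f w)
    (hw' : G.IsLoose {a, b, c, d, e} f w') (wu : G.Adj w u)
    (hu : G.Sees {a, b, c, d, e} f u (f e)) (fu : f u = f a) (wv' : G.Adj w' v)
    (fv : f v = f a) (vb : G.Adj v b) (ve : ¬ G.Adj v e) (wv : ¬ G.Adj w v) (wu' : ¬ G.Adj w' u)
    (ww : ¬ G.Adj w w') : False := by
  obtain ⟨ue, ua, ub, uc, ud⟩ := h.adj_iff_of_sees hf hw wu hu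
  have va : ¬ G.Adj v a := fun h => hf _ _ h fv
  have n : ∀ v ∈ ({a, b, c, d, e} : Set V), ¬ G.Adj w v := fun v hv h' => hw.not_touches ⟨v, hv, h'⟩
  have n' : ∀ v ∈ ({a, b, c, d, e} : Set V), ¬ G.Adj v w' := fun v hv h' =>
    hw'.not_touches ⟨v, hv, h'.symm⟩
  have s : ∀ {k c}, ¬ G.Adj k c → ¬ G.Adj c k := fun h h' => h h'.symm
  exact hP (IsP7.isIndContained (a := w) (b := u) (c := e) (d := a) (e := b) (f := v) (g := w')
    { ab := wu, bc := ue, cd := h.ea, de := h.ab, ef := vb.symm, fg := wv'.symm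
      ac := n e (by simp), ad := n a (by simp), ae := n b (by simp), af := wv, ag := ww
      bd := ua, be := ub, bf := fun h' => hf _ _ h' (fu.trans fv.symm), bg := s wu'
      ce := h.eb, cf := s ve, cg := n' e (by simp), df := s va, dg := n' a (by simp)
      eg := n' b (by simp) })

/-- One vertex of colour `f a` hits all loose vertices of a stable set that are mixed in this
colour. -/
theorem exists_hitting [Finite V] {U : Set V} (hU : ∀ w ∈ U, G.IsLoose {a, b, c, d, e} f w)
    (hind : ∀ w ∈ U, ∀ w' ∈ U, ¬ G.Adj w w') :
    ∃ z, ∀ w ∈ U, G.IsMixed {a, b, c, d, e} f (f a) (f e) w → G.Adj w z ∧ f z = f a := by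
  classical
  have := Fintype.ofFinite V
  set C : Set V := {a, b, c, d, e} with hCdef
  have hC : G.IsHub C := h.toIsC5.isHub hT
  set Z : Finset V := Finset.univ.filter fun z => G.Touches C z ∧ f z = f a with hZ
  set N : V → Finset V := fun z => Finset.univ.filter fun w => w ∈ U ∧
    G.IsMixed C f (f a) (f e) w ∧ G.Adj w z with hN
  have memZ : ∀ z, z ∈ Z ↔ G.Touches C z ∧ f z = f a := fun z => by simp [hZ]
  have memN : ∀ z w, w ∈ N z ↔ w ∈ U ∧ G.IsMixed C f (f a) (f e) w ∧ G.Adj w z :=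
    fun z w => by simp [hN]
  by_cases hne : Z.Nonempty
  swap
  · refine ⟨a, fun w _ hm => ?_⟩
    obtain ⟨u, -, h1, h2⟩ := hm.exists_touches
    exact absurd ⟨u, (memZ u).2 ⟨h1, h2⟩⟩ hne
  -- The vertex of colour `f a` that hits the most mixed vertices. If it missed one, then every
  -- touching neighbour of that one in this colour would in turn miss something that `z` hits.
  obtain ⟨z, hzZ, hmax⟩ := Z.exists_max_image (fun z => (N z).card) hne
  obtain ⟨hz, fz⟩ := (memZ z).1 hzZ
  refine ⟨z, fun w hw hm => ⟨?_, fz⟩⟩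
  by_contra wz
  -- a vertex that is hit by `z` only
  have hother : ∀ (w y : V), w ∈ U → G.IsMixed C f (f a) (f e) w → ¬ G.Adj w z → G.Adj w y →
      G.Touches C y → f y = f a →
      ∃ w' ∈ U, G.IsMixed C f (f a) (f e) w' ∧ G.Adj w' z ∧ ¬ G.Adj w' y := by
    intro w y hw hm wz wy hy fy
    by_contra hcon
    push Not at hcon
    have hsub : N z ⊆ N y := fun v hv => by
      rw [memN] at hv ⊢
      exact ⟨hv.1, hv.2.1, hcon v hv.1 hv.2.1 hv.2.2⟩
    have h1 := Finset.eq_of_subset_of_card_le hsub (hmax y ((memZ y).2 ⟨hy, fy⟩))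
    have h2 : w ∈ N y := (memN y w).2 ⟨hw, hm, wy⟩
    rw [← h1, memN] at h2
    exact wz h2.2.2
  -- colours seen by common neighbours
  have one : ∀ {w y}, w ∈ U → G.Adj w y → ∀ v ∈ C, ∀ v' ∈ C, G.Adj y v → G.Adj y v' → f v = f v' :=
    fun hw wy v hv v' hv' h1 h2 => (hU _ hw).sees _ wy _ _ ⟨v, hv, h1, rfl⟩ ⟨v', hv', h2, rfl⟩
  have common_sees : ∀ {w w' y z k}, w ∈ U → w' ∈ U → G.Adj w y → G.Adj w' z →
      (∃ c ∈ C, G.Adj y c ∧ G.Adj z c) → (G.Sees C f y k ↔ G.Sees C f z k) := by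
    rintro w w' y z k hw hw' wy wz ⟨v, hv, h1, h2⟩
    constructor
    · rintro ⟨v', hv', h3, h4⟩
      exact ⟨v, hv, h2, (one hw wy v hv v' hv' h1 h3).trans h4⟩
    · rintro ⟨v', hv', h3, h4⟩
      exact ⟨v, hv, h1, (one hw' wz v hv v' hv' h2 h3).trans h4⟩
  have nt : ∀ {w}, w ∈ U → ¬ G.Touches C w := fun hw => (hU _ hw).not_touches
  have sees_touches : ∀ {u k}, G.Sees C f u k → G.Touches C u := fun ⟨v, h1, h2, _⟩ => ⟨v, h1, h2⟩
  -- An inner neighbour of this colour forces `y` and `z` to have a common neighbour on the cycle.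
  -- Each of them sees only one colour there, so they are of the same kind.
  have inner : ∀ {w w' y z α}, w ∈ U → w' ∈ U → G.Touches C y → G.Touches C z → f y = f a →
      f z = f a → G.Adj w y → G.Adj w' z → ¬ G.Adj w z → ¬ G.Adj w' y → G.Adj w α →
      ¬ G.Touches C α → f α = f a → (G.Sees C f y (f e) ↔ G.Sees C f z (f e)) :=
    fun hw hw' hy hz fy fz wy wz' wz wy' wα hα fα => common_sees hw hw' wy wz'
      (hC.common_of_inner hT hP hf hy hz (nt hw) (nt hw') hα fy fz fα wy wz' wz wy'
        (hind _ hw _ hw') wα)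
  rcases hm with ⟨⟨α, wα, hα, fα⟩, y, wy, hy, fy⟩ | hm2
  · obtain ⟨w', hw', hm', wz', wy'⟩ := hother w y hw (Or.inl ⟨⟨α, wα, hα, fα⟩, y, wy, hy, fy⟩) wz wy hy fy
    have hyz := inner hw hw' hy hz fy fz wy wz' wz wy' wα hα fα
    rcases hm' with ⟨⟨α', wα', hα', fα'⟩, -⟩ | ⟨⟨u, wu, hu, fu⟩, v, wv, hv, hv', fv⟩
    · exact hC.not_two_inner hT hP hf hy hz (nt hw) (nt hw') hα hα' fy fz fα fα' wy wz' wz wy'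
        (hind _ hw _ hw') wα wα'
    · obtain ⟨z', hz', fz', wz'', hzz⟩ : ∃ z', G.Touches C z' ∧ f z' = f a ∧ G.Adj w' z' ∧
          ¬ (G.Sees C f z' (f e) ↔ G.Sees C f z (f e)) := by
        by_cases hs : G.Sees C f z (f e)
        · exact ⟨v, hv, fv, wv, fun h => hv' (h.2 hs)⟩
        · exact ⟨u, sees_touches hu, fu, wu, fun h => hs (h.1 hu)⟩
      have hwz' : G.Adj w z' := by
        by_contra hcon
        have := inner hw hw' hy hz' fy fz' wy wz'' hcon wy' wα hα fα
        tauto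
      obtain ⟨w'', hw'', hm'', wz3, wz4⟩ := hother w z' hw (Or.inl ⟨⟨α, wα, hα, fα⟩, y, wy, hy, fy⟩)
        wz hwz' hz' fz'
      exact hzz (inner hw hw'' hz' hz fz' fz hwz' wz3 wz wz4 wα hα fα)
  · obtain ⟨⟨u, wu, hu, fu⟩, v, wv, hv, hv', fv⟩ := hm2
    have hm : G.IsMixed C f (f a) (f e) w := Or.inr ⟨⟨u, wu, hu, fu⟩, v, wv, hv, hv', fv⟩
    -- Now `w` has touching neighbours of both kinds; `z` is compared with the one of the kind other
    -- than its own.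
    by_cases hs : G.Sees C f z (f e)
    · obtain ⟨w', hw', hm', wz', wv'⟩ := hother w v hw hm wz wv hv fv
      rcases hm' with ⟨⟨α', wα', hα', fα'⟩, -⟩ | ⟨-, -⟩
      · exact hv' ((inner hw' hw hz hv fz fv wz' wv wv' wz wα' hα' fα').1 hs)
      · have vb := h.adj_of_mixed hP hf (hU w hw) wu hu fu wv hv hv' fv
        have ve : ¬ G.Adj v e := (h.adj_or_of_not_sees hf hv hv' fv).2.2.2
        exact h.not_private_of_sees hP hf (hU w' hw') (hU w hw) wz' hs fz wv fv vb ve wv' wz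
          (hind _ hw' _ hw)
    · have hu' := sees_touches hu
      obtain ⟨w', hw', hm', wz', wu'⟩ := hother w u hw hm wz wu hu' fu
      rcases hm' with ⟨⟨α', wα', hα', fα'⟩, -⟩ | ⟨⟨u', wu1, hu1, fu1⟩, -⟩
      · exact hs ((inner hw' hw hz hu' fz fu wz' wu wu' wz wα' hα' fα').2 hu)
      · have zb := h.adj_of_mixed hP hf (hU w' hw') wu1 hu1 fu1 wz' hz hs fz
        have ze : ¬ G.Adj z e := (h.adj_or_of_not_sees hf hz hs fz).2.2.2
        exact h.not_private_of_sees hP hf (hU w hw) (hU w' hw') wu hu fu wz' fz zb ze wz wu'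
          (hind _ hw _ hw')

/-- Two vertices of colour `f e` hit all loose vertices of a stable set that are mixed in this
colour. -/
theorem exists_hitting_pair [Finite V] {U : Set V} (hU : ∀ w ∈ U, G.IsLoose {a, b, c, d, e} f w)
    (hind : ∀ w ∈ U, ∀ w' ∈ U, ¬ G.Adj w w') (hcol : ∀ u, f u = f a ∨ f u = f b ∨ f u = f e) :
    ∃ r o, ∀ w ∈ U, G.IsMixed {a, b, c, d, e} f (f e) (f a) w →
      G.Adj w r ∧ f r = f e ∨ G.Adj w o ∧ f o = f e := by
  classical
  have := Fintype.ofFinite V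
  set C : Set V := {a, b, c, d, e} with hCdef
  have hC : G.IsHub C := h.toIsC5.isHub hT
  set S : Finset V := Finset.univ.filter fun w => w ∈ U ∧ G.IsMixed C f (f e) (f a) w with hS
  -- The touching neighbours of colour `f e`, split according to whether they see `f a`. If two
  -- mixed vertices were incomparable in both parts, every occurring kind would have a private
  -- representative, and each combination of the two forms of being mixed leads to a contradiction.
  set R : V → Finset V := fun w => Finset.univ.filter fun u => G.Adj w u ∧ G.Touches C u ∧
    G.Sees C f u (f a) ∧ f u = f e with hR
  set O : V → Finset V := fun w => Finset.univ.filter fun u => G.Adj w u ∧ G.Touches C u ∧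
    ¬ G.Sees C f u (f a) ∧ f u = f e with hO
  have memS : ∀ w, w ∈ S ↔ w ∈ U ∧ G.IsMixed C f (f e) (f a) w := fun w => by simp [hS]
  have memR : ∀ w u, u ∈ R w ↔ G.Adj w u ∧ G.Touches C u ∧ G.Sees C f u (f a) ∧ f u = f e :=
    fun w u => by simp [hR]
  have memO : ∀ w u, u ∈ O w ↔ G.Adj w u ∧ G.Touches C u ∧ ¬ G.Sees C f u (f a) ∧ f u = f e :=
    fun w u => by simp [hO]
  by_cases hne : S.Nonempty
  swap
  · exact ⟨a, a, fun w hw hm => absurd ⟨w, (memS w).2 ⟨hw, hm⟩⟩ hne⟩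
  suffices hh : ∃ r o, ∀ w ∈ S, r ∈ R w ∨ o ∈ O w by
    obtain ⟨r, o, hh⟩ := hh
    refine ⟨r, o, fun w hw hm => ?_⟩
    have := hh w ((memS w).2 ⟨hw, hm⟩)
    rw [memR, memO] at this
    tauto
  refine _root_.exists_hitting_pair R O S hne (fun w hw => ?_) (fun w hw w' hw' hne => ?_)
  · obtain ⟨u, h1, h2, h3⟩ := ((memS w).1 hw).2.exists_touches
    by_cases hs : G.Sees C f u (f a)
    · exact Or.inl ⟨u, (memR _ _).2 ⟨h1, h2, hs, h3⟩⟩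
    · exact Or.inr ⟨u, (memO _ _).2 ⟨h1, h2, hs, h3⟩⟩
  · by_contra hcon
    simp only [not_or, not_and, Finset.not_subset] at hcon
    obtain ⟨hR1, hR2, hO1, hO2⟩ := hcon
    obtain ⟨hwU, hm⟩ := (memS w).1 hw
    obtain ⟨hwU', hm'⟩ := (memS w').1 hw'
    have one : ∀ {w y}, w ∈ U → G.Adj w y → ∀ v ∈ C, ∀ v' ∈ C, G.Adj y v → G.Adj y v' → f v = f v' :=
      fun hw wy v hv v' hv' h1 h2 => (hU _ hw).sees _ wy _ _ ⟨v, hv, h1, rfl⟩ ⟨v', hv', h2, rfl⟩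
    have common_sees : ∀ {w w' y z k}, w ∈ U → w' ∈ U → G.Adj w y → G.Adj w' z →
        (∃ c ∈ C, G.Adj y c ∧ G.Adj z c) → (G.Sees C f y k ↔ G.Sees C f z k) := by
      rintro w w' y z k hw hw' wy wz ⟨v, hv, h1, h2⟩
      constructor
      · rintro ⟨v', hv', h3, h4⟩
        exact ⟨v, hv, h2, (one hw wy v hv v' hv' h1 h3).trans h4⟩
      · rintro ⟨v', hv', h3, h4⟩
        exact ⟨v, hv, h1, (one hw' wz v hv v' hv' h2 h3).trans h4⟩
    have nt : ∀ {w}, w ∈ U → ¬ G.Touches C w := fun hw => (hU _ hw).not_touches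
    have sees_touches : ∀ {u k}, G.Sees C f u k → G.Touches C u := fun ⟨v, h1, h2, _⟩ => ⟨v, h1, h2⟩
    have ww := hind w hwU w' hwU'
    -- private neighbours
    have pR : ∀ w w' : V, ((R w).Nonempty → ∃ x ∈ R w, x ∉ R w') →
        (∃ u, G.Adj w u ∧ G.Sees C f u (f a) ∧ f u = f e) →
        ∃ u, G.Adj w u ∧ ¬ G.Adj w' u ∧ G.Touches C u ∧ G.Sees C f u (f a) ∧ f u = f e := by
      rintro w w' h1 ⟨u, wu, hu, fu⟩
      obtain ⟨x, hx, hx'⟩ := h1 ⟨u, (memR _ _).2 ⟨wu, sees_touches hu, hu, fu⟩⟩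
      rw [memR] at hx hx'
      exact ⟨x, hx.1, fun h' => hx' ⟨h', hx.2⟩, hx.2⟩
    have pO : ∀ w w' : V, ((O w).Nonempty → ∃ x ∈ O w, x ∉ O w') →
        (∃ u, G.Adj w u ∧ G.Touches C u ∧ ¬ G.Sees C f u (f a) ∧ f u = f e) →
        ∃ u, G.Adj w u ∧ ¬ G.Adj w' u ∧ G.Touches C u ∧ ¬ G.Sees C f u (f a) ∧ f u = f e := by
      rintro w w' h1 ⟨u, wu, ht, hu, fu⟩
      obtain ⟨x, hx, hx'⟩ := h1 ⟨u, (memO _ _).2 ⟨wu, ht, hu, fu⟩⟩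
      rw [memO] at hx hx'
      exact ⟨x, hx.1, fun h' => hx' ⟨h', hx.2⟩, hx.2⟩
    have pA : ∀ w w' : V, ((R w).Nonempty → ∃ x ∈ R w, x ∉ R w') →
        ((O w).Nonempty → ∃ x ∈ O w, x ∉ O w') →
        (∃ u, G.Adj w u ∧ G.Touches C u ∧ f u = f e) →
        ∃ u, G.Adj w u ∧ ¬ G.Adj w' u ∧ G.Touches C u ∧ f u = f e := by
      rintro w w' h1 h2 ⟨u, wu, ht, fu⟩
      by_cases hs : G.Sees C f u (f a)
      · obtain ⟨u, h3, h4, h5, -, h6⟩ := pR w w' h1 ⟨u, wu, hs, fu⟩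
        exact ⟨u, h3, h4, h5, h6⟩
      · obtain ⟨u, h3, h4, h5, -, h6⟩ := pO w w' h2 ⟨u, wu, ht, hs, fu⟩
        exact ⟨u, h3, h4, h5, h6⟩
    -- An inner neighbour on one side makes `y` share a vertex of the cycle with both `r` and `o`,
    -- although these are of different kinds.
    have mixed : ∀ w w' : V, w ∈ U → w' ∈ U → ¬ G.Adj w w' →
        ((R w).Nonempty → ∃ x ∈ R w, x ∉ R w') → ((O w).Nonempty → ∃ x ∈ O w, x ∉ O w') →
        ((R w').Nonempty → ∃ x ∈ R w', x ∉ R w) → ((O w').Nonempty → ∃ x ∈ O w', x ∉ O w) →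
        (∃ α, G.Adj w α ∧ ¬ G.Touches C α ∧ f α = f e) →
        (∃ u, G.Adj w u ∧ G.Touches C u ∧ f u = f e) →
        (∃ u, G.Adj w' u ∧ G.Sees C f u (f a) ∧ f u = f e) →
        (∃ u, G.Adj w' u ∧ G.Touches C u ∧ ¬ G.Sees C f u (f a) ∧ f u = f e) → False := by
      rintro w w' hwU hwU' ww hR1 hO1 hR2 hO2 ⟨α, wα, hα, fα⟩ hu hr ho
      obtain ⟨y, wy, wy', hy, fy⟩ := pA w w' hR1 hO1 hu
      obtain ⟨r, wr, wr', hr, hrs, fr⟩ := pR w' w hR2 hr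
      obtain ⟨o, wo, wo', ho, hos, fo⟩ := pO w' w hO2 ho
      have c1 := common_sees (k := f a) hwU hwU' wy wr (hC.common_of_inner hT hP hf hy hr (nt hwU)
        (nt hwU') hα fy fr fα wy wr wr' wy' ww wα)
      have c2 := common_sees (k := f a) hwU hwU' wy wo (hC.common_of_inner hT hP hf hy ho (nt hwU)
        (nt hwU') hα fy fo fα wy wo wo' wy' ww wα)
      exact hos (c2.1 (c1.2 hrs))
    have hmt := hm.exists_touches
    have hmt' := hm'.exists_touches
    rcases hm with ⟨⟨α, wα, hα, fα⟩, -⟩ | ⟨hsr, hso⟩ <;>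
      rcases hm' with ⟨⟨α', wα', hα', fα'⟩, -⟩ | ⟨hsr', hso'⟩
    · obtain ⟨y, wy, wy', hy, fy⟩ := pA w w' hR1 hO1 hmt
      obtain ⟨z, wz, wz', hz, fz⟩ := pA w' w hR2 hO2 hmt'
      exact hC.not_two_inner hT hP hf hy hz (nt hwU) (nt hwU') hα hα' fy fz fα fα' wy wz wz' wy' ww
        wα wα'
    · exact mixed w w' hwU hwU' ww hR1 hO1 hR2 hO2 ⟨α, wα, hα, fα⟩ hmt hsr' hso'
    · exact mixed w' w hwU' hwU (fun h => ww h.symm) hR2 hO2 hR1 hO1 ⟨α', wα', hα', fα'⟩ hmt' hsr hso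
    · obtain ⟨r, wr, wr', hr, hrs, fr⟩ := pR w w' hR1 hsr
      obtain ⟨o, wo, wo', ho, hos, fo⟩ := pO w w' hO1 hso
      obtain ⟨r', wr₁, wr₁', hr', hrs', fr'⟩ := pR w' w hR2 hsr'
      obtain ⟨o', wo₁, wo₁', ho', hos', fo'⟩ := pO w' w hO2 hso'
      have s : ∀ {k c}, ¬ G.Adj k c → ¬ G.Adj c k := fun h h' => h h'.symm
      have n : ∀ {k c}, k ∈ U → c ∈ C → ¬ G.Adj k c := fun h hc h' => nt h ⟨_, hc, h'⟩
      have n' : ∀ {k c}, k ∈ U → c ∈ C → ¬ G.Adj c k := fun h hc h' => nt h ⟨_, hc, h'.symm⟩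
      have same : ∀ {u v}, f u = f e → f v = f e → ¬ G.Adj u v :=
        fun h1 h2 h3 => hf _ _ h3 (h1.trans h2.symm)
      have only : ∀ {w u}, w ∈ U → G.Adj w u → G.Sees C f u (f a) → (G.Adj u a ∨ G.Adj u c) ∧
          ¬ G.Adj u b ∧ ¬ G.Adj u d := by
        rintro w u hw wu ⟨v, hv, uv, fv⟩
        have fab := hf _ _ h.ab
        have fae := hf _ _ h.ea
        have h1 : ∀ v' ∈ C, G.Adj u v' → f v' = f a := fun v' hv' h' =>
          (one hw wu v' hv' v hv h' uv).trans fv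
        refine ⟨?_, fun h' => fab (h1 b (by simp [hCdef]) h').symm,
          fun h' => fab ((h1 d (by simp [hCdef]) h').symm.trans h.fbd.symm)⟩
        simp only [hCdef, Set.mem_insert_iff, Set.mem_singleton_iff] at hv
        have fbd := h.fbd
        rcases hv with rfl | rfl | rfl | rfl | rfl
        · exact Or.inl uv
        · exact absurd fv.symm fab
        · exact Or.inr uv
        · exact absurd (fbd.trans fv).symm fab
        · exact absurd fv fae
      -- On the cycle, `r` and `r'` are attached to `a` or `c` only. A common attachment gives a
      -- path that ends in the private neighbours of the other kind.
      have case1 : ∀ v ∈ C, f v = f a → G.Adj r v → G.Adj r' v → False := by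
        intro v hv fv rv rv'
        exact hP (IsP7.isIndContained (a := o) (b := w) (c := r) (d := v) (e := r') (f := w') (g := o')
          { ab := wo.symm, bc := wr, cd := rv, de := rv'.symm, ef := wr₁.symm, fg := wo₁
            ac := same fo fr, ad := fun h' => hos ⟨v, hv, h', fv⟩, ae := same fo fr'
            af := s wo', ag := same fo fo'
            bd := n hwU hv, be := wr₁', bf := ww, bg := wo₁'
            ce := same fr fr', cf := s wr', cg := same fr fo', df := n' hwU' hv
            dg := fun h' => hos' ⟨v, hv, h'.symm, fv⟩, eg := same fr' fo' })
      -- With different attachments the path runs through `a b c`, and the neighbours of the other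
      -- kind are not needed.
      have case2 : ∀ w w' r r', w ∈ U → w' ∈ U → ¬ G.Adj w w' → G.Adj w r → G.Adj w' r' →
          ¬ G.Adj w r' → ¬ G.Adj w' r → ¬ G.Adj r r' → ¬ G.Adj r c → ¬ G.Adj r' a →
          ¬ G.Adj r b → ¬ G.Adj r' b → G.Adj r a → G.Adj r' c → False := by
        intro w w' r r' hw hw' ww wr wr' n1 n2 n3 n4 n5 n6 n7 ra rc
        exact hP (IsP7.isIndContained (a := w) (b := r) (c := a) (d := b) (e := c) (f := r') (g := w')
          { ab := wr, bc := ra, cd := h.ab, de := h.bc, ef := rc.symm, fg := wr'.symm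
            ac := n hw (by simp [hCdef]), ad := n hw (by simp [hCdef])
            ae := n hw (by simp [hCdef]), af := n1, ag := ww
            bd := n6, be := n4, bf := n3, bg := s n2
            ce := h.ac, cf := s n5, cg := n' hw' (by simp [hCdef]), df := s n7
            dg := n' hw' (by simp [hCdef]), eg := n' hw' (by simp [hCdef]) })
      obtain ⟨h1, h2, -⟩ := only hwU wr hrs
      obtain ⟨h3, h4, -⟩ := only hwU' wr₁ hrs'
      by_cases ra : G.Adj r a
      · by_cases ra' : G.Adj r' a
        · exact case1 a (by simp [hCdef]) rfl ra ra'
        · have rc' := h3.resolve_left ra'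
          by_cases rc : G.Adj r c
          · exact case1 c (by simp [hCdef]) h.fac.symm rc rc'
          · exact case2 w w' r r' hwU hwU' ww wr wr₁ wr₁' wr' (same fr fr') rc ra' h2 h4 ra rc'
      · have rc := h1.resolve_left ra
        by_cases rc' : G.Adj r' c
        · exact case1 c (by simp [hCdef]) h.fac.symm rc rc'
        · have ra' := h3.resolve_right rc'
          exact case2 w' w r' r hwU' hwU (fun h => ww h.symm) wr₁ wr wr' wr₁' (same fr' fr) rc' ra h4
            h2 ra' rc

end IsC5Coloured

end SimpleGraph

/-!
# The pinned vertices of a component with an induced cycle of length five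
-/

namespace SimpleGraph

variable {V : Type*} {G : SimpleGraph V}

/-- A partition of the neighbours of `w` into two classes. -/
def InClass (G : SimpleGraph V) (C : Set V) (f : V → ℕ) (m m' : ℕ) (w u : V) : Prop :=
  ((∃ v, G.Adj w v ∧ ¬ G.Touches C v) ∧ G.Touches C u) ∨
  (¬ (∃ v, G.Adj w v ∧ ¬ G.Touches C v) ∧
    (((∃ v, G.Adj w v ∧ G.Sees C f v m) ∧ G.Sees C f u m) ∨
     (¬ (∃ v, G.Adj w v ∧ G.Sees C f v m) ∧ G.Sees C f u m')))

/-- The colour of `w` can be chosen last: one colour is excluded at all its neighbours, or the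
colours of the neighbours are given by the two classes. -/
def IsSettled (G : SimpleGraph V) (C : Set V) (f : V → ℕ) (p q : V) (m m' : ℕ) (w : V) : Prop :=
  (∃ k < 3, ∀ u, G.Adj w u → ∃ s, (s ∈ C ∨ s = p ∨ s = q) ∧ G.Adj u s ∧ f s = k) ∨
  ∀ u v, G.Adj w u → G.Adj w v → ((G.InClass C f m m' w u ↔ G.InClass C f m m' w v) ↔ f u = f v)

/-- Conclusion of the analysis of a component with the cycle `C` and the colouring `f`. -/
def HasPins (G : SimpleGraph V) (C : Set V) (f : V → ℕ) (p q ρ : V) : Prop :=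
  ∃ z₁ z₂ z₃ z₄, G.Reachable ρ z₁ ∧ G.Reachable ρ z₂ ∧ G.Reachable ρ z₃ ∧ G.Reachable ρ z₄ ∧
    ∃ m < 3, ∃ m' < 3, ∀ w, G.Reachable ρ w → G.IsLoose C f w → ¬ G.Adj w p → ¬ G.Adj w q →
      ¬ G.Adj w z₁ → ¬ G.Adj w z₂ → ¬ G.Adj w z₃ → ¬ G.Adj w z₄ → G.IsSettled C f p q m m' w

/-- The two vertices `p` and `q` hit all edges of the component that avoid the neighbourhood of
`C`. -/
def HitsEdges (G : SimpleGraph V) (C : Set V) (p q ρ : V) : Prop :=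
  ∀ a b, G.Reachable ρ a → ¬ G.Touches C a → ¬ G.Touches C b → G.Adj a b →
    (G.Adj p a ∨ G.Adj p b) ∨ (G.Adj q a ∨ G.Adj q b)

/-- Loose vertices away from `p` and `q` are a stable set, so the hitting lemmas apply in each of
the three colours. A vertex that is adjacent to none of the resulting pins is mixed in no colour,
which says that the relevant classes of its neighbours share no colour. -/
theorem IsC5Coloured.hasPins [Finite V] {f : V → ℕ} {a b c d e p q ρ : V}
    (h : G.IsC5Coloured f a b c d e) (hT : G.CliqueFree 3)
    (hP : ¬ (pathGraph 7).IsIndContained G) (hf : ∀ u v, G.Adj u v → f u ≠ f v)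
    (hf3 : ∀ v, f v < 3) (hp : G.Touches {a, b, c, d, e} p) (hq : G.Touches {a, b, c, d, e} q)
    (hpq : G.HitsEdges {a, b, c, d, e} p q ρ) : G.HasPins {a, b, c, d, e} f p q ρ := by
  classical
  have hC := h.toIsC5.isHub hT
  have hset : ({d, c, b, a, e} : Set V) = {a, b, c, d, e} := by ext; simp; tauto
  have fab := hf _ _ h.ab
  have fde := hf _ _ h.de
  have fea := hf _ _ h.ea
  have fbd := h.fbd
  have hcol : ∀ u, f u = f a ∨ f u = f b ∨ f u = f e := by
    intro u
    have := hf3 u; have := hf3 a; have := hf3 b; have := hf3 e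
    omega
  obtain ⟨C, hCeq⟩ : ∃ C : Set V, C = {a, b, c, d, e} := ⟨_, rfl⟩
  set U : Set V := {w | G.Reachable ρ w ∧ G.IsLoose {a, b, c, d, e} f w ∧ ¬ G.Adj w p ∧
    ¬ G.Adj w q} with hU
  have hUl : ∀ w ∈ U, G.IsLoose {a, b, c, d, e} f w := fun w hw => hw.2.1
  have hind : ∀ w ∈ U, ∀ w' ∈ U, ¬ G.Adj w w' := by
    intro w hw w' hw' hadj
    have := hpq w w' hw.1 hw.2.1.not_touches hw'.2.1.not_touches hadj
    have h1 := hw.2.2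
    have h2 := hw'.2.2
    simp only [G.adj_comm p, G.adj_comm q] at this
    tauto
  obtain ⟨z₁, hz₁⟩ := h.exists_hitting hT hP hf hUl hind
  -- Reflecting the cycle exchanges the roles of the colours `f a` and `f b`.
  obtain ⟨z₂, hz₂⟩ := h.reflect.exists_hitting hT hP hf (U := U) (by rw [hset]; exact hUl) hind
  obtain ⟨z₃, z₄, hz₃⟩ := h.exists_hitting_pair hT hP hf hUl hind hcol
  rw [hset] at hz₂
  rw [← hCeq] at hz₁ hz₂ hz₃ hU hUl hC hp hq ⊢
  -- The pins must lie in the component; one that is adjacent to nothing in `U` may be replaced by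
  -- `ρ`.
  have hreach : ∀ z, ∃ z', G.Reachable ρ z' ∧ ∀ w ∈ U, G.Adj w z → G.Adj w z' := by
    intro z
    by_cases hz : ∃ w ∈ U, G.Adj w z
    · obtain ⟨w, hw, hwz⟩ := hz
      exact ⟨z, hw.1.trans hwz.reachable, fun _ _ h => h⟩
    · exact ⟨ρ, .refl _, fun w hw h => absurd ⟨w, hw, h⟩ hz⟩
  obtain ⟨y₁, r₁, hy₁⟩ := hreach z₁
  obtain ⟨y₂, r₂, hy₂⟩ := hreach z₂
  obtain ⟨y₃, r₃, hy₃⟩ := hreach z₃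
  obtain ⟨y₄, r₄, hy₄⟩ := hreach z₄
  refine ⟨y₁, y₂, y₃, y₄, r₁, r₂, r₃, r₄, f e, hf3 e, f a, hf3 a, fun w rw lw np nq n₁ n₂ n₃ n₄ => ?_⟩
  have hwU : w ∈ U := ⟨rw, hCeq ▸ lw, np, nq⟩
  have nm₁ : ¬ G.IsMixed C f (f a) (f e) w := fun h => n₁ (hy₁ w hwU (hz₁ w hwU h).1)
  have nm₂ : ¬ G.IsMixed C f (f b) (f e) w := fun h' =>
    n₂ (hy₂ w hwU (hz₂ w hwU (h.fbd ▸ h')).1)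
  have nm₃ : ¬ G.IsMixed C f (f e) (f a) w := fun h => (hz₃ w hwU h).elim
    (fun h => n₃ (hy₃ w hwU h.1)) (fun h => n₄ (hy₄ w hwU h.1))
  have sees_ne : ∀ {u k}, G.Sees C f u k → f u ≠ k := by
    rintro u k ⟨v, -, huv, rfl⟩
    exact hf _ _ huv
  -- The neighbours of `w` use at most two colours. If both classes are nonempty and have no colour
  -- in common, each is therefore monochromatic.
  have concl : (∀ u v, G.Adj w u → G.Adj w v → G.InClass C f (f e) (f a) w u →
      ¬ G.InClass C f (f e) (f a) w v → f u ≠ f v) →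
      (∃ u, G.Adj w u ∧ G.InClass C f (f e) (f a) w u) →
      (∃ u, G.Adj w u ∧ ¬ G.InClass C f (f e) (f a) w u) → G.IsSettled C f p q (f e) (f a) w := by
    rintro hne ⟨u₀, wu₀, hu₀⟩ ⟨v₀, wv₀, hv₀⟩
    refine Or.inr fun u v wu wv => ?_
    have c := hne u₀ v₀ wu₀ wv₀ hu₀ hv₀
    have t1 := hf _ _ wu₀; have t2 := hf _ _ wv₀; have t3 := hf _ _ wu; have t4 := hf _ _ wv
    have b1 := hf3 u₀; have b2 := hf3 v₀; have b3 := hf3 u; have b4 := hf3 v; have b5 := hf3 w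
    by_cases hu : G.InClass C f (f e) (f a) w u <;> by_cases hv : G.InClass C f (f e) (f a) w v
    · have := hne u v₀ wu wv₀ hu hv₀; have := hne v v₀ wv wv₀ hv hv₀
      simp only [hu, hv, true_iff]; omega
    · have := hne u v wu wv hu hv
      simp only [hu, hv]; simpa
    · have := hne v u wv wu hv hu
      simp only [hu, hv]; simpa using this.symm
    · have := hne u₀ u wu₀ wu hu₀ hu; have := hne u₀ v wu₀ wv hu₀ hv
      simp only [hu, hv, true_iff]; omega
  by_cases inn : ∃ v, G.Adj w v ∧ ¬ G.Touches C v
  · have cls : ∀ u, G.InClass C f (f e) (f a) w u ↔ G.Touches C u := fun u => by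
      simp only [InClass, inn, not_true, false_and, or_false, true_and]
    simp only [cls] at concl
    by_cases hout : ∃ u, G.Adj w u ∧ G.Touches C u
    · refine concl (fun u v wu wv hu hv huv => ?_) hout inn
      have : ∀ k m, f u = k → G.IsMixed C f k m w := fun k m hk =>
        Or.inl ⟨⟨v, wv, hv, huv.symm.trans hk⟩, u, wu, hu, hk⟩
      rcases hcol u with h1 | h1 | h1
      · exact nm₁ (this _ _ h1)
      · exact nm₂ (this _ _ h1)
      · exact nm₃ (this _ _ h1)
    -- All neighbours of `w` avoid the neighbourhood of the cycle. Whichever of `p` and `q` hits the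
    -- edge `w v₀` is adjacent to `v₀`, hence by `star` to all neighbours of `w`, and its colour is
    -- excluded there.
    · obtain ⟨v₀, wv₀, hv₀⟩ := inn
      push Not at hout
      have hw := lw.not_touches
      have key : ∀ s, G.Touches C s → G.Adj s v₀ → ∀ u, G.Adj w u → G.Adj u s := fun s hs h1 u wu =>
        (hC.star hT hP hs hv₀ hw (hout u wu) h1 wv₀.symm wu).symm
      rw [← hCeq] at hpq
      rcases hpq w v₀ rw hw hv₀ wv₀ with (h1 | h1) | h1 | h1
      · exact absurd h1.symm np
      · exact Or.inl ⟨f p, hf3 p, fun u wu => ⟨p, by simp, key p hp h1 u wu, rfl⟩⟩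
      · exact absurd h1.symm nq
      · exact Or.inl ⟨f q, hf3 q, fun u wu => ⟨q, by simp, key q hq h1 u wu, rfl⟩⟩
  · have tch : ∀ u, G.Adj w u → G.Touches C u := fun u wu => by
      by_contra hcon
      exact inn ⟨u, wu, hcon⟩
    have safe : ∀ k < 3, (∀ u, G.Adj w u → G.Sees C f u k) → G.IsSettled C f p q (f e) (f a) w := by
      intro k hk hall
      refine Or.inl ⟨k, hk, fun u wu => ?_⟩
      obtain ⟨s, h1, h2, h3⟩ := hall u wu
      exact ⟨s, Or.inl h1, h2, h3⟩
    by_cases gam : ∃ v, G.Adj w v ∧ G.Sees C f v (f e)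
    · have cls : ∀ u, G.InClass C f (f e) (f a) w u ↔ G.Sees C f u (f e) := fun u => by
        simp only [InClass, inn, gam, not_true, not_false_iff, false_and, or_false, true_and, false_or]
      simp only [cls] at concl
      by_cases hout : ∃ u, G.Adj w u ∧ ¬ G.Sees C f u (f e)
      · refine concl (fun u v wu wv hu hv huv => ?_) gam hout
        have : ∀ k, f u = k → G.IsMixed C f k (f e) w := fun k hk =>
          Or.inr ⟨⟨u, wu, hu, hk⟩, v, wv, tch v wv, hv, huv.symm.trans hk⟩
        rcases hcol u with h1 | h1 | h1
        · exact nm₁ (this _ h1)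
        · exact nm₂ (this _ h1)
        · exact sees_ne hu h1
      · push Not at hout
        exact safe _ (hf3 e) hout
    · have cls : ∀ u, G.InClass C f (f e) (f a) w u ↔ G.Sees C f u (f a) := fun u => by
        simp only [InClass, inn, gam, not_false_iff, false_and, true_and, false_or]
      simp only [cls] at concl
      have hb : ∀ u, G.Adj w u → ¬ G.Sees C f u (f a) → G.Sees C f u (f b) := by
        intro u wu hu
        obtain ⟨s, hs, us⟩ := tch u wu
        refine ⟨s, hs, us, ?_⟩
        rcases hcol s with h1 | h1 | h1
        · exact absurd ⟨s, hs, us, h1⟩ hu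
        · exact h1
        · exact absurd ⟨u, wu, s, hs, us, h1⟩ gam
      by_cases h1 : ∃ u, G.Adj w u ∧ G.Sees C f u (f a)
      · by_cases h2 : ∃ u, G.Adj w u ∧ ¬ G.Sees C f u (f a)
        · refine concl (fun u v wu wv hu hv huv => ?_) h1 h2
          rcases hcol u with h3 | h3 | h3
          · exact sees_ne hu h3
          · exact sees_ne (hb v wv hv) (huv.symm.trans h3)
          · exact nm₃ (Or.inr ⟨⟨u, wu, hu, h3⟩, v, wv, tch v wv, hv, huv.symm.trans h3⟩)
        · push Not at h2
          exact safe _ (hf3 a) h2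
      · push Not at h1
        exact safe _ (hf3 b) fun u wu => hb u wu (h1 u wu)

/-- A proper colouring of a five-cycle with three colours uses one colour exactly once; a rotation
puts this vertex last. -/
theorem IsC5.hasPins [Finite V] {f : V → ℕ} {a b c d e p q ρ : V}
    (h : G.IsC5 a b c d e) (hT : G.CliqueFree 3)
    (hP : ¬ (pathGraph 7).IsIndContained G) (hf : ∀ u v, G.Adj u v → f u ≠ f v)
    (hf3 : ∀ v, f v < 3) (hp : G.Touches {a, b, c, d, e} p) (hq : G.Touches {a, b, c, d, e} q)
    (hpq : G.HitsEdges {a, b, c, d, e} p q ρ) : G.HasPins {a, b, c, d, e} f p q ρ := by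
  have hset : ∀ a b c d e : V, ({a, b, c, d, e} : Set V) = {b, c, d, e, a} := by
    intro a b c d e; ext; simp; tauto
  have key : ∀ a b c d e : V, G.IsC5 a b c d e → G.Touches {a, b, c, d, e} p →
      G.Touches {a, b, c, d, e} q → G.HitsEdges {a, b, c, d, e} p q ρ → f a = f c → f b = f d →
      G.HasPins {a, b, c, d, e} f p q ρ := fun a b c d e h hp hq hpq h1 h2 =>
    IsC5Coloured.hasPins ⟨h, h1, h2⟩ hT hP hf hf3 hp hq hpq
  have h1 := hf _ _ h.ab; have h2 := hf _ _ h.bc; have h3 := hf _ _ h.cd; have h4 := hf _ _ h.de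
  have h5 := hf _ _ h.ea
  have b1 := hf3 a; have b2 := hf3 b; have b3 := hf3 c; have b4 := hf3 d; have b5 := hf3 e
  obtain hh | hh | hh | hh | hh : (f a = f c ∧ f b = f d) ∨ (f b = f d ∧ f c = f e) ∨
      (f c = f e ∧ f d = f a) ∨ (f d = f a ∧ f e = f b) ∨ (f e = f b ∧ f a = f c) := by omega
  · exact key _ _ _ _ _ h hp hq hpq hh.1 hh.2
  · rw [hset] at *
    exact key _ _ _ _ _ h.rotate hp hq hpq hh.1 hh.2
  · rw [hset, hset] at *
    exact key _ _ _ _ _ h.rotate.rotate hp hq hpq hh.1 hh.2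
  · rw [hset, hset, hset] at *
    exact key _ _ _ _ _ h.rotate.rotate.rotate hp hq hpq hh.1 hh.2
  · rw [hset, hset, hset, hset] at *
    exact key _ _ _ _ _ h.rotate.rotate.rotate.rotate hp hq hpq hh.1 hh.2

end SimpleGraph

/-!
# Derived formulas and statements
-/

namespace RAM

namespace Fm

/-- Disjunction. -/
def or (φ ψ : Fm) : Fm := neg (and (neg φ) (neg ψ))

/-- Implication. -/
def imp (φ ψ : Fm) : Fm := neg (and φ (neg ψ))

/-- Equivalence. -/
def iff (φ ψ : Fm) : Fm := and (imp φ ψ) (imp ψ φ)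

/-- Bounded universal quantification. -/
def all (b : Bd) (φ : Fm) : Fm := neg (ex b (neg φ))

/-- A term is not zero. -/
def tt (t : Tm) : Fm := neg (eq t (.cst 0))

variable {n : ℕ} {inp : ℕ → ℕ} {T : Tabs} {env : List ℕ}

theorem eval_lt (a b : Tm) : (lt a b).eval n inp T env ↔ a.eval env T < b.eval env T := Iff.rfl

theorem eval_eq (a b : Tm) : (eq a b).eval n inp T env ↔ a.eval env T = b.eval env T := Iff.rfl

theorem eval_adj (a b : Tm) : (adj a b).eval n inp T env ↔
    inp (a.eval env T * n + b.eval env T) ≠ 0 := Iff.rfl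

theorem eval_neg (φ : Fm) : (neg φ).eval n inp T env ↔ ¬ φ.eval n inp T env := Iff.rfl

theorem eval_and (φ ψ : Fm) :
    (and φ ψ).eval n inp T env ↔ φ.eval n inp T env ∧ ψ.eval n inp T env := Iff.rfl

theorem eval_ex (b : Bd) (φ : Fm) :
    (ex b φ).eval n inp T env ↔ ∃ i < b.val n, φ.eval n inp T (i :: env) := Iff.rfl

theorem eval_or (φ ψ : Fm) :
    (or φ ψ).eval n inp T env ↔ φ.eval n inp T env ∨ ψ.eval n inp T env := by
  simp only [or, eval_neg, eval_and]; tauto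

theorem eval_imp (φ ψ : Fm) :
    (imp φ ψ).eval n inp T env ↔ (φ.eval n inp T env → ψ.eval n inp T env) := by
  simp only [imp, eval_neg, eval_and]; tauto

theorem eval_iff (φ ψ : Fm) :
    (iff φ ψ).eval n inp T env ↔ (φ.eval n inp T env ↔ ψ.eval n inp T env) := by
  simp only [iff, eval_imp, eval_and]; tauto

theorem eval_all (b : Bd) (φ : Fm) :
    (all b φ).eval n inp T env ↔ ∀ i < b.val n, φ.eval n inp T (i :: env) := by
  simp only [all, eval_neg, eval_ex, not_exists, not_and, not_not]

theorem eval_tt (t : Tm) : (tt t).eval n inp T env ↔ t.eval env T ≠ 0 := Iff.rfl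

end Fm

/-- The table `j` occurs in a term. -/
def Tm.uses (j : ℕ) : Tm → Bool
  | cst _ => false
  | var _ => false
  | get id a b c d => id == j || a.uses j || b.uses j || c.uses j || d.uses j

/-- The table `j` occurs in a formula. -/
def Fm.uses (j : ℕ) : Fm → Bool
  | lt a b => a.uses j || b.uses j
  | eq a b => a.uses j || b.uses j
  | adj a b => a.uses j || b.uses j
  | lst a b => a.uses j || b.uses j
  | neg φ => φ.uses j
  | and φ ψ => φ.uses j || ψ.uses j
  | ex _ φ => φ.uses j

/-- A statement may write to the table `j`. -/
def Stmt.writes (j : ℕ) : Stmt → Bool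
  | skip => false
  | store id _ _ _ _ _ => id == j
  | seq p q => p.writes j || q.writes j
  | ite _ p q => p.writes j || q.writes j
  | loop _ p => p.writes j

/-! ### Frame properties and invariants of iterations -/

section Frame

variable {n : ℕ} {inp : ℕ → ℕ} {j : ℕ} {T T' : Tabs}

theorem Tm.eval_congr {env : List ℕ} {t : Tm} (ht : t.uses j = false)
    (h : ∀ i, i ≠ j → T i = T' i) : t.eval env T = t.eval env T' := by
  induction t with
  | cst | var => rfl
  | get id a b c d iha ihb ihc ihd =>
    simp only [uses, Bool.or_eq_false_iff, beq_eq_false_iff_ne] at ht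
    obtain ⟨⟨⟨⟨h0, ha⟩, hb⟩, hc⟩, hd⟩ := ht
    simp only [eval, iha ha, ihb hb, ihc hc, ihd hd, h id h0]

theorem Fm.eval_congr {env : List ℕ} {φ : Fm} (hφ : φ.uses j = false)
    (h : ∀ i, i ≠ j → T i = T' i) : φ.eval n inp T env ↔ φ.eval n inp T' env := by
  induction φ generalizing env with
  | lt a b | eq a b | adj a b | lst a b =>
    simp only [uses, Bool.or_eq_false_iff] at hφ
    simp only [eval, Tm.eval_congr hφ.1 h, Tm.eval_congr hφ.2 h]
  | neg φ ih => simp only [eval, ih hφ]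
  | and φ ψ ihφ ihψ =>
    simp only [uses, Bool.or_eq_false_iff] at hφ
    simp only [eval, ihφ hφ.1, ihψ hφ.2]
  | ex b φ ih => simp only [eval, ih hφ]

theorem iter_induction {α : Type*} {f : ℕ → α → α} {k : ℕ} {x : α} (P : α → Prop) (h0 : P x)
    (h : ∀ i < k, ∀ y, P y → P (f i y)) : P (iter f k x) := by
  induction k with
  | zero => exact h0
  | succ k ih => exact h k (by omega) _ (ih fun i hi => h i (by omega))

/-- The form in which searches are shown to succeed: round `i₀` produces `Q`, later rounds do not
destroy it, and `P` is the invariant under which rounds can be analysed. -/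
theorem iter_reaches {α : Type*} {f : ℕ → α → α} {k : ℕ} {x : α} (P Q : α → Prop) (h0 : P x)
    (hP : ∀ i < k, ∀ y, P y → P (f i y)) (hQ : ∀ i < k, ∀ y, P y → Q y → Q (f i y)) {i₀ : ℕ}
    (hi₀ : i₀ < k) (h : ∀ y, P y → Q (f i₀ y)) : Q (iter f k x) := by
  have hPk : ∀ m ≤ k, P (iter f m x) := fun m hm =>
    iter_induction P h0 fun i hi => hP i (by omega)
  have key : ∀ m, i₀ < m → m ≤ k → Q (iter f m x) := by
    intro m
    induction m with
    | zero => intro h; omega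
    | succ m ih =>
      intro h1 h2
      by_cases h3 : i₀ = m
      · subst h3; exact h _ (hPk _ (by omega))
      · exact hQ m (by omega) _ (hPk m (by omega)) (ih (by omega) (by omega))
  exact key k hi₀ le_rfl

theorem Stmt.sem_of_not_writes {p : Stmt} (hp : p.writes j = false) {env : List ℕ} :
    p.sem n inp env T j = T j := by
  induction p generalizing env T with
  | skip => rfl
  | store id a b c d v =>
    simp only [writes, beq_eq_false_iff_ne] at hp
    funext a' b' c' d'
    simp only [sem, Tabs.set]
    rw [if_neg]
    exact fun h => hp h.1.symm
  | seq p q ihp ihq =>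
    simp only [writes, Bool.or_eq_false_iff] at hp
    simp only [sem, ihq hp.2, ihp hp.1]
  | ite φ p q ihp ihq =>
    simp only [writes, Bool.or_eq_false_iff] at hp
    simp only [sem]
    split_ifs
    · exact ihp hp.1
    · exact ihq hp.2
  | loop b p ih =>
    exact iter_induction (fun T' : Tabs => T' j = T j) rfl fun i _ y hy => (ih hp).trans hy

end Frame

/-! ### Tabulation of formulas and nested loops -/

section Fill

open Classical in
/-- Tables with new values on a set of cells. -/
noncomputable def Tabs.upd (T : Tabs) (id : ℕ) (S : ℕ → ℕ → ℕ → ℕ → Prop)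
    (W : ℕ → ℕ → ℕ → ℕ → ℕ) : Tabs := fun j a b c d =>
  if j = id ∧ S a b c d then W a b c d else T j a b c d

theorem Tabs.upd_of_ne {T : Tabs} {id j : ℕ} {S : ℕ → ℕ → ℕ → ℕ → Prop}
    {W : ℕ → ℕ → ℕ → ℕ → ℕ} (h : j ≠ id) : T.upd id S W j = T j := by
  funext a b c d
  simp [Tabs.upd, h]

/-- The values `W` do not depend on the round or on the table being written, so the order of the
rounds is irrelevant and overlapping writes agree. -/
theorem iter_upd {f : ℕ → Tabs → Tabs} {T : Tabs} {id : ℕ} {S : ℕ → ℕ → ℕ → ℕ → ℕ → Prop}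
    {W : ℕ → ℕ → ℕ → ℕ → ℕ} (k : ℕ)
    (h : ∀ i, ∀ T', (∀ j, j ≠ id → T' j = T j) → f i T' = T'.upd id (S i) W) :
    iter f k T = T.upd id (fun a b c d => ∃ i < k, S i a b c d) W := by
  induction k with
  | zero => funext j a b c d; simp [iter, Tabs.upd]
  | succ k ih =>
    rw [iter, ih, h k _ fun j hj => Tabs.upd_of_ne hj]
    funext j a b c d
    by_cases hj : j = id
    · by_cases h1 : S k a b c d
      · have h2 : ∃ i < k + 1, S i a b c d := ⟨k, by omega, h1⟩
        simp only [Tabs.upd]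
        rw [if_pos ⟨hj, h1⟩, if_pos ⟨hj, h2⟩]
      · have h2 : (∃ i < k + 1, S i a b c d) ↔ ∃ i < k, S i a b c d := by
          constructor
          · rintro ⟨i, hi, h3⟩
            refine ⟨i, ?_, h3⟩
            by_contra h4
            rw [show i = k by omega] at h3
            exact h1 h3
          · rintro ⟨i, hi, h3⟩
            exact ⟨i, by omega, h3⟩
        simp only [Tabs.upd]
        rw [if_neg (fun h => h1 h.2)]
        by_cases h3 : ∃ i < k, S i a b c d
        · rw [if_pos ⟨hj, h3⟩, if_pos ⟨hj, h2.2 h3⟩]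
        · rw [if_neg (fun h => h3 h.2), if_neg (fun h => h3 (h2.1 h.2))]
    · simp [Tabs.upd, hj]

/-- Tabulation of a formula with four parameters. -/
def Stmt.fill (id : ℕ) (b₁ b₂ b₃ b₄ : Bd) (φ : Fm) : Stmt :=
  loop b₁ (loop b₂ (loop b₃ (loop b₄ (ite φ
    (store id (.var 3) (.var 2) (.var 1) (.var 0) (.cst 1))
    (store id (.var 3) (.var 2) (.var 1) (.var 0) (.cst 0))))))

open Classical in
theorem Stmt.fill_sem {n : ℕ} {inp : ℕ → ℕ} {env : List ℕ} {T : Tabs} {id : ℕ} {b₁ b₂ b₃ b₄ : Bd}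
    {φ : Fm} (hφ : φ.uses id = false) : (fill id b₁ b₂ b₃ b₄ φ).sem n inp env T =
      T.upd id (fun a b c d => a < b₁.val n ∧ b < b₂.val n ∧ c < b₃.val n ∧ d < b₄.val n)
        (fun a b c d => if φ.eval n inp T (d :: c :: b :: a :: env) then 1 else 0) := by
  set W : ℕ → ℕ → ℕ → ℕ → ℕ :=
    fun a b c d => if φ.eval n inp T (d :: c :: b :: a :: env) then 1 else 0 with hW
  have key : (fill id b₁ b₂ b₃ b₄ φ).sem n inp env T = T.upd id (fun a b c d =>
      ∃ i₁ < b₁.val n, ∃ i₂ < b₂.val n, ∃ i₃ < b₃.val n, ∃ i₄ < b₄.val n,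
        a = i₁ ∧ b = i₂ ∧ c = i₃ ∧ d = i₄) W := by
    refine iter_upd _ fun i₁ T₁ h₁ => ?_
    refine iter_upd _ fun i₂ T₂ h₂ => ?_
    refine iter_upd _ fun i₃ T₃ h₃ => ?_
    refine iter_upd _ fun i₄ T₄ h₄ => ?_
    have hT : ∀ j, j ≠ id → T₄ j = T j := fun j hj => by rw [h₄ j hj, h₃ j hj, h₂ j hj, h₁ j hj]
    have hev : φ.eval n inp T₄ (i₄ :: i₃ :: i₂ :: i₁ :: env) ↔
        φ.eval n inp T (i₄ :: i₃ :: i₂ :: i₁ :: env) := Fm.eval_congr hφ hT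
    funext j a b c d
    simp only [sem, hev]
    by_cases hj : j = id ∧ a = i₁ ∧ b = i₂ ∧ c = i₃ ∧ d = i₄
    · obtain ⟨rfl, rfl, rfl, rfl, rfl⟩ := hj
      by_cases h5 : φ.eval n inp T (d :: c :: b :: a :: env) <;>
        simp [Tabs.set, Tabs.upd, Tm.eval, hW, h5]
    · by_cases h5 : φ.eval n inp T (i₄ :: i₃ :: i₂ :: i₁ :: env) <;>
        simp [Tabs.set, Tabs.upd, Tm.eval, h5, hj]
  rw [key]
  congr 1
  funext a b c d
  simp only [eq_iff_iff]
  constructor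
  · rintro ⟨i₁, h1, i₂, h2, i₃, h3, i₄, h4, rfl, rfl, rfl, rfl⟩
    exact ⟨h1, h2, h3, h4⟩
  · rintro ⟨h1, h2, h3, h4⟩
    exact ⟨a, h1, b, h2, c, h3, d, h4, rfl, rfl, rfl, rfl⟩

theorem Stmt.fill_iff {n : ℕ} {inp : ℕ → ℕ} {env : List ℕ} {T : Tabs} {id : ℕ} {b₁ b₂ b₃ b₄ : Bd}
    {φ : Fm} (hφ : φ.uses id = false) {a b c d : ℕ} (ha : a < b₁.val n) (hb : b < b₂.val n)
    (hc : c < b₃.val n) (hd : d < b₄.val n) :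
    (fill id b₁ b₂ b₃ b₄ φ).sem n inp env T id a b c d ≠ 0 ↔
      φ.eval n inp T (d :: c :: b :: a :: env) := by
  rw [fill_sem hφ]
  by_cases h : φ.eval n inp T (d :: c :: b :: a :: env) <;> simp [Tabs.upd, ha, hb, hc, hd, h]

/-- Nested loops. -/
def Stmt.nest : List Bd → Stmt → Stmt
  | [], p => p
  | b :: bs, p => loop b (nest bs p)

theorem Stmt.nest_induction {n : ℕ} {inp : ℕ → ℕ} {bs : List Bd} {p : Stmt} {env : List ℕ}
    {T : Tabs} (P : Tabs → Prop) (h0 : P T)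
    (h : ∀ vs : List ℕ, List.Forall₂ (fun v b => v < b.val n) vs bs → ∀ T, P T →
      P (p.sem n inp (vs.reverse ++ env) T)) : P ((nest bs p).sem n inp env T) := by
  induction bs generalizing env T with
  | nil => exact h [] .nil T h0
  | cons b bs ih =>
    refine iter_induction P h0 fun i hi T' hT' => ih hT' fun vs hvs T'' hT'' => ?_
    have := h (i :: vs) (.cons hi hvs) T'' hT''
    simpa using this

theorem Stmt.nest_reaches {n : ℕ} {inp : ℕ → ℕ} {bs : List Bd} {p : Stmt} {env : List ℕ}
    {T : Tabs} (P Q : Tabs → Prop) (h0 : P T)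
    (hP : ∀ vs : List ℕ, List.Forall₂ (fun v b => v < b.val n) vs bs → ∀ T, P T →
      P (p.sem n inp (vs.reverse ++ env) T))
    (hQ : ∀ vs : List ℕ, List.Forall₂ (fun v b => v < b.val n) vs bs → ∀ T, P T → Q T →
      Q (p.sem n inp (vs.reverse ++ env) T))
    (vs : List ℕ) (hvs : List.Forall₂ (fun v b => v < b.val n) vs bs)
    (h : ∀ T, P T → Q (p.sem n inp (vs.reverse ++ env) T)) : Q ((nest bs p).sem n inp env T) := by
  induction hvs generalizing env T with
  | nil => exact h T h0
  | @cons v b vs bs hv hvs ih =>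
    have hP' : ∀ i < b.val n, ∀ us : List ℕ, List.Forall₂ (fun v b => v < b.val n) us bs → ∀ T, P T →
        P (p.sem n inp (us.reverse ++ i :: env) T) := fun i hi us hus T hT => by
      simpa using hP (i :: us) (.cons hi hus) T hT
    have hQ' : ∀ i < b.val n, ∀ us : List ℕ, List.Forall₂ (fun v b => v < b.val n) us bs → ∀ T, P T →
        Q T → Q (p.sem n inp (us.reverse ++ i :: env) T) := fun i hi us hus T hT hT' => by
      simpa using hQ (i :: us) (.cons hi hus) T hT hT'
    refine iter_reaches P Q h0 (fun i hi T' hT' => nest_induction P hT' (hP' i hi))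
      (fun i hi T' hT' hQT => ?_) hv fun T' hT' => ih hT' (hP' v hv) (hQ' v hv) fun T'' hT'' => by
        simpa using h T'' hT''
    exact (nest_induction (fun T => P T ∧ Q T) ⟨hT', hQT⟩ fun us hus T'' hT'' =>
      ⟨hP' i hi us hus T'' hT''.1, hQ' i hi us hus T'' hT''.1 hT''.2⟩).2

end Fill

end RAM

/-!
# Transitive closure and assignments for clauses with two literals
-/

namespace RAM

/-- Connection by a path with all intermediate vertices in `K`. -/
inductive PathIn {α : Type*} (r : α → α → Prop) (K : Set α) : α → α → Prop
  | base {x y : α} (h : r x y) : PathIn r K x y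
  | trans {x k y : α} (h₁ : PathIn r K x k) (hk : k ∈ K) (h₂ : PathIn r K k y) : PathIn r K x y

/-- A path through `k` can be cut at its first and last visit to `k`; the outer pieces have no
intermediate visit to `k`. -/
theorem PathIn.of_insert {α : Type*} {r : α → α → Prop} {K : Set α} {k x y : α}
    (h : PathIn r (insert k K) x y) :
    PathIn r K x y ∨ PathIn r K x k ∧ PathIn r K k y := by
  induction h with
  | base h => exact Or.inl (.base h)
  | @trans x m y h₁ hm h₂ ih₁ ih₂ =>
    rcases hm with rfl | hm
    · have h1 : PathIn r K x m := ih₁.elim id And.left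
      have h2 : PathIn r K m y := ih₂.elim id And.right
      exact Or.inr ⟨h1, h2⟩
    · rcases ih₁ with h1 | ⟨h1, h2⟩ <;> rcases ih₂ with h3 | ⟨h3, h4⟩
      · exact Or.inl (.trans h1 hm h3)
      · exact Or.inr ⟨.trans h1 hm h3, h4⟩
      · exact Or.inr ⟨h1, .trans h2 hm h3⟩
      · exact Or.inr ⟨h1, h4⟩

theorem PathIn.of_transGen {α : Type*} {r : α → α → Prop} {K : Set α} (hK : ∀ x y, r x y → y ∈ K)
    {x y : α} (h : Relation.TransGen r x y) : PathIn r K x y := by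
  induction h with
  | single h => exact .base h
  | tail _ h ih =>
    rename_i b c hb
    rcases Relation.TransGen.tail'_iff.1 hb with ⟨d, -, hd⟩
    exact .trans ih (hK d b hd) (.base h)

theorem PathIn.mono {α : Type*} {r : α → α → Prop} {K K' : Set α} (hK : K ⊆ K') {x y : α}
    (h : PathIn r K x y) : PathIn r K' x y := by
  induction h with
  | base h => exact .base h
  | trans _ hk _ ih₁ ih₂ => exact .trans ih₁ (hK hk) ih₂

theorem iter_induction_on {α : Type*} {f : ℕ → α → α} {k : ℕ} {x : α} (P : ℕ → α → Prop)
    (h0 : P 0 x) (h : ∀ i < k, ∀ y, P i y → P (i + 1) (f i y)) : P k (iter f k x) := by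
  induction k with
  | zero => exact h0
  | succ k ih => exact h k (by omega) _ (ih fun i hi => h i (by omega))

/-- One table as a relation on pairs below the bounds. -/
def Tabs.rel (T : Tabs) (id N M : ℕ) (x y : ℕ × ℕ) : Prop :=
  x.1 < N ∧ x.2 < M ∧ y.1 < N ∧ y.2 < M ∧ T id x.1 x.2 y.1 y.2 ≠ 0

/-- The step of the computation of the transitive closure. -/
def Stmt.warshallStep (id : ℕ) : Stmt :=
  ite (.and (.tt (.get id (.var 3) (.var 2) (.var 5) (.var 4)))
    (.tt (.get id (.var 5) (.var 4) (.var 1) (.var 0))))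
    (store id (.var 3) (.var 2) (.var 1) (.var 0) (.cst 1)) skip

/-- The transitive closure of a relation on pairs. -/
def Stmt.warshall (id : ℕ) (b : Bd) : Stmt :=
  loop .size (loop b (nest [.size, b, .size, b] (warshallStep id)))

/-! ### Transitive closure by Warshall's method -/

section Warshall

variable {n : ℕ} {inp : ℕ → ℕ} {env : List ℕ} {T : Tabs} {id : ℕ} {b : Bd}

theorem forall₂_four {R : ℕ → Bd → Prop} {vs : List ℕ} {b₁ b₂ b₃ b₄ : Bd}
    (h : List.Forall₂ R vs [b₁, b₂, b₃, b₄]) :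
    ∃ v₁ v₂ v₃ v₄, vs = [v₁, v₂, v₃, v₄] ∧ R v₁ b₁ ∧ R v₂ b₂ ∧ R v₃ b₃ ∧ R v₄ b₄ := by
  cases h with | cons h1 h => cases h with | cons h2 h => cases h with | cons h3 h =>
    cases h with | cons h4 h => cases h; exact ⟨_, _, _, _, rfl, h1, h2, h3, h4⟩

theorem Stmt.warshallStep_rel {N M k kb u c v c' : ℕ} {x y : ℕ × ℕ}
    (h : ((warshallStep id).sem n inp (c' :: v :: c :: u :: kb :: k :: env) T).rel id N M x y) :
    T.rel id N M x y ∨ x = (u, c) ∧ y = (v, c') ∧ T id u c k kb ≠ 0 ∧ T id k kb v c' ≠ 0 := by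
  simp only [warshallStep, sem, Fm.eval_and, Fm.eval_tt, Tm.eval, List.getD_cons_zero,
    List.getD_cons_succ] at h
  split_ifs at h with h1
  · by_cases h2 : x = (u, c) ∧ y = (v, c')
    · exact Or.inr ⟨h2.1, h2.2, h1⟩
    · left
      obtain ⟨x1, x2⟩ := x
      obtain ⟨y1, y2⟩ := y
      simp only [Tabs.rel, Tabs.set] at h ⊢
      obtain ⟨a1, a2, a3, a4, a5⟩ := h
      rw [if_neg] at a5
      · exact ⟨a1, a2, a3, a4, a5⟩
      · rintro ⟨-, rfl, rfl, rfl, rfl⟩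
        exact h2 ⟨rfl, rfl⟩
  · exact Or.inl h

theorem Stmt.warshallStep_mono {N M k kb u c v c' : ℕ} {x y : ℕ × ℕ} (h : T.rel id N M x y) :
    ((warshallStep id).sem n inp (c' :: v :: c :: u :: kb :: k :: env) T).rel id N M x y := by
  simp only [warshallStep, sem, Fm.eval_and, Fm.eval_tt, Tm.eval, List.getD_cons_zero,
    List.getD_cons_succ]
  split_ifs with h1
  · obtain ⟨a1, a2, a3, a4, a5⟩ := h
    refine ⟨a1, a2, a3, a4, ?_⟩
    simp only [Tabs.set]
    split_ifs
    · exact one_ne_zero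
    · exact a5
  · exact h

theorem Stmt.warshallStep_new {N M k kb u c v c' : ℕ} (h1 : T.rel id N M (u, c) (k, kb))
    (h2 : T.rel id N M (k, kb) (v, c')) :
    ((warshallStep id).sem n inp (c' :: v :: c :: u :: kb :: k :: env) T).rel id N M
      (u, c) (v, c') := by
  obtain ⟨a1, a2, a3, a4, a5⟩ := h1
  obtain ⟨c1, c2, c3, c4, c5⟩ := h2
  simp only [warshallStep, sem, Fm.eval_and, Fm.eval_tt, Tm.eval, List.getD_cons_zero,
    List.getD_cons_succ]
  simp only at a5 c5
  rw [if_pos ⟨a5, c5⟩]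
  refine ⟨a1, a2, c3, c4, ?_⟩
  simp [Tabs.set]

/-- The table is overwritten in place. Nothing wrong is added, because each new pair composes two
pairs of the closure. Nothing is missed, because before the round for `(k, kb)` all pairs joined by
a path with intermediate points lexicographically below `(k, kb)` are present; entries are never
removed. -/
theorem Stmt.warshall_rel (x y : ℕ × ℕ) :
    ((warshall id b).sem n inp env T).rel id n (b.val n) x y ↔
      Relation.TransGen (T.rel id n (b.val n)) x y := by
  set r := T.rel id n (b.val n) with hr
  constructor
  · suffices h : ∀ x y, ((warshall id b).sem n inp env T).rel id n (b.val n) x y →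
        Relation.TransGen r x y from h x y
    refine iter_induction (fun T' : Tabs => ∀ x y, T'.rel id n (b.val n) x y →
      Relation.TransGen r x y) (fun x y h => .single h) fun k hk T₁ h₁ => ?_
    refine iter_induction (fun T' : Tabs => ∀ x y, T'.rel id n (b.val n) x y →
      Relation.TransGen r x y) h₁ fun kb hkb T₂ h₂ => ?_
    refine nest_induction (fun T' : Tabs => ∀ x y, T'.rel id n (b.val n) x y →
      Relation.TransGen r x y) h₂ fun vs hvs T₃ h₃ x y hxy => ?_
    obtain ⟨u, c, v, c', rfl, hu, hc, hv, hc'⟩ := forall₂_four hvs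
    rcases warshallStep_rel hxy with h | ⟨rfl, rfl, h4, h5⟩
    · exact h₃ x y h
    · have h₃ : ∀ x y, T₃.rel id n (b.val n) x y → Relation.TransGen r x y := h₃
      have e₁ : T₃.rel id n (b.val n) (u, c) (k, kb) := ⟨hu, hc, hk, hkb, h4⟩
      have e₂ : T₃.rel id n (b.val n) (k, kb) (v, c') := ⟨hk, hkb, hv, hc', h5⟩
      exact (h₃ _ _ e₁).trans (h₃ _ _ e₂)
  · intro h
    have hp : PathIn r {z | z.1 < n ∧ z.2 < b.val n} x y :=
      PathIn.of_transGen (fun x y (h : r x y) => And.intro h.2.2.1 h.2.2.2.1) h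
    revert x y
    suffices h : ∀ x y, PathIn r {z | z.1 < n ∧ z.2 < b.val n} x y →
        ((warshall id b).sem n inp env T).rel id n (b.val n) x y from fun x y _ h' => h x y h'
    refine iter_induction_on (fun i (T' : Tabs) => ∀ x y,
      PathIn r {z | z.1 < i ∧ z.2 < b.val n} x y → T'.rel id n (b.val n) x y) ?_ fun k hk T₁ h₁ => ?_
    · intro x y h
      induction h with
      | base h => exact h
      | trans _ hk => exact absurd hk.1 (by omega)
    have key : ∀ x y, PathIn r {z | z.1 < k ∧ z.2 < b.val n ∨ z.1 = k ∧ z.2 < b.val n} x y →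
        (iter (fun i T => (nest [.size, b, .size, b] (warshallStep id)).sem n inp
          (i :: k :: env) T) (b.val n) T₁).rel id n (b.val n) x y := by
      refine iter_induction_on (fun i (T' : Tabs) => ∀ x y,
        PathIn r {z | z.1 < k ∧ z.2 < b.val n ∨ z.1 = k ∧ z.2 < i} x y → T'.rel id n (b.val n) x y)
        ?_ fun kb hkb T₂ h₂ x y hxy => ?_
      · intro x y h
        refine h₁ x y (h.mono ?_)
        rintro z (hz | hz)
        · exact hz
        · exact absurd hz.2 (by omega)
      have hmono : ∀ x y, T₂.rel id n (b.val n) x y →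
          ((nest [.size, b, .size, b] (warshallStep id)).sem n inp (kb :: k :: env) T₂).rel id n
            (b.val n) x y := by
        intro x y h
        refine nest_induction (fun T' : Tabs => T'.rel id n (b.val n) x y) h fun vs hvs T' hT' => ?_
        obtain ⟨u, c, v, c', rfl, -⟩ := forall₂_four hvs
        exact warshallStep_mono hT'
      have hins : {z : ℕ × ℕ | z.1 < k ∧ z.2 < b.val n ∨ z.1 = k ∧ z.2 < kb + 1} ⊆
          insert (k, kb) {z : ℕ × ℕ | z.1 < k ∧ z.2 < b.val n ∨ z.1 = k ∧ z.2 < kb} := by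
        rintro ⟨z1, z2⟩ hz
        simp only [Set.mem_ofPred_eq, Set.mem_insert_iff, Prod.mk.injEq] at hz ⊢
        omega
      rcases (hxy.mono hins).of_insert with h | ⟨h3, h4⟩
      · exact hmono x y (h₂ x y h)
      · have h3 := h₂ _ _ h3
        have h4 := h₂ _ _ h4
        obtain ⟨u, c⟩ := x
        obtain ⟨v, c'⟩ := y
        -- The two halves of the path stay in the table throughout the round, so they are still
        -- there when the cell for `(u, c)` and `(v, c')` is visited.
        refine nest_reaches (fun T' : Tabs => T'.rel id n (b.val n) (u, c) (k, kb) ∧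
          T'.rel id n (b.val n) (k, kb) (v, c')) (fun T' : Tabs => T'.rel id n (b.val n) (u, c) (v, c'))
          ⟨h3, h4⟩ (fun vs hvs T' hT' => ?_) (fun vs hvs T' hT' hQ => ?_) [u, c, v, c'] ?_
          fun T' hT' => ?_
        · obtain ⟨u, c, v, c', rfl, -⟩ := forall₂_four hvs
          exact ⟨warshallStep_mono hT'.1, warshallStep_mono hT'.2⟩
        · obtain ⟨u, c, v, c', rfl, -⟩ := forall₂_four hvs
          exact warshallStep_mono hQ
        · exact .cons h3.1 (.cons h3.2.1 (.cons h4.2.2.1 (.cons h4.2.2.2.1 .nil)))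
        · exact warshallStep_new hT'.1 hT'.2
    intro x y hxy
    refine key x y (hxy.mono ?_)
    rintro z ⟨h5, h6⟩
    simp only [Set.mem_ofPred_eq]
    omega

end Warshall

/-- Make a literal of the variable `v` (loop variable `0`) true, with all its consequences. -/
def Stmt.literal (R A c : ℕ) : Stmt :=
  seq (store A (.var 0) (.cst c) (.cst 0) (.cst 0) (.cst 1))
    (loop .size (loop (.lit 2) (ite (.tt (.get R (.var 2) (.cst c) (.var 1) (.var 0)))
      (store A (.var 1) (.var 0) (.cst 0) (.cst 0) (.cst 1)) skip)))

/-- A truth assignment that is closed under the implications in the table `R`. -/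
def Stmt.assignment (R A : ℕ) : Stmt :=
  seq (fill A .size (.lit 2) (.lit 1) (.lit 1) (.lt (.cst 0) (.cst 0)))
    (loop .size (ite (.and (.eq (.get A (.var 0) (.cst 0) (.cst 0) (.cst 0)) (.cst 0))
        (.eq (.get A (.var 0) (.cst 1) (.cst 0) (.cst 0)) (.cst 0)))
      (ite (.tt (.get R (.var 0) (.cst 0) (.var 0) (.cst 1))) (literal R A 1) (literal R A 0)) skip))

/-! ### Solving 2-SAT from the closed implication relation -/

section Assignment

variable {n : ℕ} {inp : ℕ → ℕ} {env : List ℕ} {T : Tabs} {R A : ℕ}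

theorem Stmt.literal_iff (hRA : R ≠ A) {v c u d : ℕ} (hu : u < n) (hd : d < 2) :
    (literal R A c).sem n inp (v :: env) T A u d 0 0 ≠ 0 ↔
      T A u d 0 0 ≠ 0 ∨ (u = v ∧ d = c) ∨ T R v c u d ≠ 0 := by
  set T₁ := T.set A v c 0 0 1 with hT₁
  have hR : T₁ R = T R := by
    funext a b c d
    simp [hT₁, Tabs.set, hRA]
  have key : (literal R A c).sem n inp (v :: env) T = T₁.upd A
      (fun a b c' d => ∃ i < n, ∃ j < 2, T R v c i j ≠ 0 ∧ a = i ∧ b = j ∧ c' = 0 ∧ d = 0)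
      (fun _ _ _ _ => 1) := by
    have h0 : (store A (.var 0) (.cst c) (.cst 0) (.cst 0) (.cst 1)).sem n inp (v :: env) T = T₁ := rfl
    simp only [literal, sem] at h0 ⊢
    rw [h0]
    refine iter_upd _ fun i T₂ h₂ => ?_
    refine iter_upd _ fun j T₃ h₃ => ?_
    have h4 : T₃ R = T R := by rw [h₃ R hRA, h₂ R hRA, hR]
    simp only [Fm.eval_tt, Tm.eval, List.getD_cons_zero, List.getD_cons_succ, h4]
    funext j' a b c' d
    by_cases h5 : T R v c i j = 0
    · simp [Tabs.upd, h5]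
    · simp [Tabs.upd, h5, Tabs.set]
  rw [key]
  simp only [Tabs.upd, hT₁, Tabs.set]
  by_cases h1 : T R v c u d = 0
  · rw [if_neg]
    · by_cases h2 : u = v ∧ d = c
      · simp [h2]
      · simp [h2, h1]
    · rintro ⟨-, i, -, j, -, h2, rfl, rfl, -⟩
      exact h2 h1
  · rw [if_pos ⟨trivial, u, hu, d, hd, h1, rfl, rfl, trivial, trivial⟩]
    simp [h1]

theorem Stmt.literal_of_ne {v c j : ℕ} (hj : j ≠ A) :
    (literal R A c).sem n inp (v :: env) T j = T j := by
  apply sem_of_not_writes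
  simp [literal, writes, hj.symm]

/-- The invariant is a partial assignment without contradictions that is closed under implications.
For an undecided variable a literal that does not imply its own negation is set together with its
consequences. Two contradictory consequences would, by contraposition and transitivity, make the
literal imply its negation; a conflict with an older value would, by contraposition, have decided
the variable already. -/
theorem Stmt.assignment_spec (hRA : R ≠ A)
    (htrans : ∀ u b v c w d, u < n → b < 2 → v < n → c < 2 → w < n → d < 2 → T R u b v c ≠ 0 →
      T R v c w d ≠ 0 → T R u b w d ≠ 0)
    (hskew : ∀ u b v c, u < n → b < 2 → v < n → c < 2 → T R u b v c ≠ 0 →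
      T R v (1 - c) u (1 - b) ≠ 0)
    (hsat : ∀ v < n, T R v 0 v 1 ≠ 0 → T R v 1 v 0 = 0) :
    let T' := (assignment R A).sem n inp env T
    (∀ v < n, T' A v 0 0 0 ≠ 0 ∨ T' A v 1 0 0 ≠ 0) ∧
    (∀ v < n, ∀ b < 2, T' A v b 0 0 ≠ 0 → T' A v (1 - b) 0 0 = 0) ∧
    ∀ u < n, ∀ b < 2, ∀ v < n, ∀ c < 2, T' A u b 0 0 ≠ 0 → T R u b v c ≠ 0 → T' A v c 0 0 ≠ 0 := by
  intro T'
  set T₀ := (fill A .size (.lit 2) (.lit 1) (.lit 1) (.lt (.cst 0) (.cst 0))).sem n inp env T with hT₀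
  have h0 : ∀ v < n, ∀ b < 2, T₀ A v b 0 0 = 0 := by
    intro v hv b hb
    by_contra hcon
    have := (fill_iff (by rfl) (by exact hv) (by exact hb) (by exact one_pos) (by exact one_pos)).1 hcon
    simp [Fm.eval, Tm.eval] at this
  have hR0 : T₀ R = T R := sem_of_not_writes (by simp [fill, writes, hRA.symm])
  suffices h : (T' R = T R ∧ ∀ v < n, T' A v 0 0 0 ≠ 0 ∨ T' A v 1 0 0 ≠ 0) ∧
      (∀ v < n, ∀ b < 2, T' A v b 0 0 ≠ 0 → T' A v (1 - b) 0 0 = 0) ∧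
      ∀ u < n, ∀ b < 2, ∀ v < n, ∀ c < 2, T' A u b 0 0 ≠ 0 → T R u b v c ≠ 0 → T' A v c 0 0 ≠ 0 from
    ⟨h.1.2, h.2⟩
  refine iter_induction_on (fun i (T' : Tabs) =>
      (T' R = T R ∧ ∀ v < i, T' A v 0 0 0 ≠ 0 ∨ T' A v 1 0 0 ≠ 0) ∧
      (∀ v < n, ∀ b < 2, T' A v b 0 0 ≠ 0 → T' A v (1 - b) 0 0 = 0) ∧
      ∀ u < n, ∀ b < 2, ∀ v < n, ∀ c < 2, T' A u b 0 0 ≠ 0 → T R u b v c ≠ 0 → T' A v c 0 0 ≠ 0)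
    ⟨⟨hR0, fun v hv => absurd hv (by omega)⟩, fun v hv b hb h => absurd (h0 v hv b hb) h,
      fun u hu b hb v hv c hc h => absurd (h0 u hu b hb) h⟩ fun v hv T₁ ⟨⟨h1, h2⟩, h3, h4⟩ => ?_
  replace hv : v < n := hv
  simp only [sem, Fm.eval_and, Fm.eval_eq, Fm.eval_tt, Tm.eval, List.getD_cons_zero]
  split_ifs with h5 h6
  all_goals try
    (refine ⟨⟨h1, fun u hu => ?_⟩, h3, h4⟩
     by_cases h7 : u = v
     · subst h7; tauto
     · exact h2 u (by omega))
  all_goals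
    rw [h1] at h6
    -- Adding either literal keeps the invariant as long as it does not imply its negation; `hsat`
    -- provides such a literal.
    have gen : ∀ c < 2, T R v c v (1 - c) = 0 →
        ((literal R A c).sem n inp (v :: env) T₁ R = T R ∧
          ∀ u < v + 1, (literal R A c).sem n inp (v :: env) T₁ A u 0 0 0 ≠ 0 ∨
            (literal R A c).sem n inp (v :: env) T₁ A u 1 0 0 ≠ 0) ∧
        (∀ u < n, ∀ b < 2, (literal R A c).sem n inp (v :: env) T₁ A u b 0 0 ≠ 0 →
          (literal R A c).sem n inp (v :: env) T₁ A u (1 - b) 0 0 = 0) ∧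
        ∀ u < n, ∀ b < 2, ∀ w < n, ∀ d < 2, (literal R A c).sem n inp (v :: env) T₁ A u b 0 0 ≠ 0 →
          T R u b w d ≠ 0 → (literal R A c).sem n inp (v :: env) T₁ A w d 0 0 ≠ 0 := by
      intro c hc hcc
      have hl : ∀ u < n, ∀ d < 2, (literal R A c).sem n inp (v :: env) T₁ A u d 0 0 ≠ 0 ↔
          T₁ A u d 0 0 ≠ 0 ∨ (u = v ∧ d = c) ∨ T R v c u d ≠ 0 := fun u hu d hd => by
        rw [literal_iff hRA hu hd, h1]
      have hun : ∀ b < 2, T₁ A v b 0 0 = 0 := by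
        intro b hb
        interval_cases b
        · exact h5.1
        · exact h5.2
      have dn : ∀ b < 2, 1 - (1 - b) = b := fun b hb => by omega
      refine ⟨⟨(literal_of_ne hRA).trans h1, fun u hu => ?_⟩, fun u hu b hb h7 => ?_,
        fun u hu b hb w hw d hd h7 h8 => ?_⟩
      · by_cases huv : u = v
        · subst huv
          interval_cases c
          · left; rw [hl u hv 0 (by omega)]; simp
          · right; rw [hl u hv 1 (by omega)]; simp
        · rw [hl u (by omega) 0 (by omega), hl u (by omega) 1 (by omega)]
          rcases h2 u (by omega) with h | h
          · exact Or.inl (Or.inl h)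
          · exact Or.inr (Or.inl h)
      · by_contra h8
        have h8 := (hl u hu (1 - b) (by omega)).1 h8
        rw [hl u hu b hb] at h7
        -- consequences of the chosen literal are not contradicted
        have old : ∀ b < 2, T₁ A u b 0 0 ≠ 0 → T R v c u (1 - b) = 0 := by
          intro b hb h9
          by_contra h10
          have := hskew _ _ _ _ hv hc hu (by omega) h10
          rw [dn b hb] at this
          exact h4 u hu b hb v hv (1 - c) (by omega) h9 this (hun _ (by omega))
        rcases h7 with h7 | ⟨rfl, rfl⟩ | h7 <;> rcases h8 with h8 | ⟨h8, h8'⟩ | h8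
        · exact h8 (h3 u hu b hb h7)
        · subst h8; exact h7 (hun b hb)
        · exact h8 (old b hb h7)
        · exact h8 (hun _ (by omega))
        · omega
        · exact h8 hcc
        · have := old (1 - b) (by omega) h8
          rw [dn b hb] at this
          exact h7 this
        · subst h8
          rw [← h8', dn b hb] at hcc
          rw [← h8'] at h7
          exact h7 hcc
        · have h9 := hskew _ _ _ _ hv hc hu (by omega) h8
          rw [dn b hb] at h9
          exact htrans _ _ _ _ _ _ hv hc hu hb hv (by omega) h7 h9 hcc
      · rw [hl w hw d hd]
        rcases (hl u hu b hb).1 h7 with h9 | ⟨rfl, rfl⟩ | h9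
        · exact Or.inl (h4 u hu b hb w hw d hd h9 h8)
        · exact Or.inr (Or.inr h8)
        · exact Or.inr (Or.inr (htrans _ _ _ _ _ _ hv hc hu hb hw hd h9 h8))
  · exact gen 1 (by omega) (hsat v hv h6)
  · exact gen 0 (by omega) (not_not.1 h6)

end Assignment

end RAM

/-!
# Colourings from pinned vertices
-/

/-- Eleven pinned vertices with their colours, and the two colours that define the classes. The
first five pinned vertices are a cycle, if there is one. -/
structure Pinning (V : Type*) where
  vert : ℕ → V
  col : ℕ → ℕ
  fst : ℕ
  snd : ℕ

namespace Pinning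

variable {V : Type*} (G : SimpleGraph V) (L : V → ℕ → Prop)

/-- The neighbourhood of `v` is contained in the neighbourhood of `u`. -/
def Sub (v u : V) : Prop := G.Reachable v u ∧ ∀ t, G.Adj v t → G.Adj u t

/-- All three colours are in the list. -/
def Full (v : V) : Prop := ∀ c < 3, L v c

/-- The vertex `v` can be coloured like another one with a larger neighbourhood. -/
def Dead [LT V] (v : V) : Prop :=
  Full L v ∧ ∃ u, u ≠ v ∧ Sub G v u ∧ (¬ Sub G u v ∨ ¬ Full L u ∨ v < u)

theorem Sub.refl {G : SimpleGraph V} (v : V) : Sub G v v := ⟨.refl _, fun _ h => h⟩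

theorem Sub.trans {G : SimpleGraph V} {u v w : V} (h₁ : Sub G u v) (h₂ : Sub G v w) : Sub G u w :=
  ⟨h₁.1.trans h₂.1, fun t ht => h₂.2 t (h₁.2 t ht)⟩

/-- Order the candidates by size of the neighbourhood, then those without a full list above those
with one, then by index. Each alternative in `Dead` leads to a larger key, so a candidate with
maximal key is not dead. -/
theorem exists_not_dead [Finite V] [LinearOrder V] (v : V) : ∃ u, ¬ Dead G L u ∧ Sub G v u := by
  classical
  have := Fintype.ofFinite V
  set key : V → ℕ ×ₗ ℕ ×ₗ V := fun u => toLex ((Finset.univ.filter fun t => G.Adj u t).card,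
    toLex (if Full L u then 0 else 1, u)) with hkey
  obtain ⟨u, hu, hmax⟩ := (Finset.univ.filter fun u => Sub G v u).exists_max_image key
    ⟨v, by simpa using Sub.refl v⟩
  simp only [Finset.mem_filter, Finset.mem_univ, true_and] at hu hmax
  refine ⟨u, ?_, hu⟩
  rintro ⟨hf, w, hwu, huw, h⟩
  have h1 := hmax w (hu.trans huw)
  have hsub : (Finset.univ.filter fun t => G.Adj u t) ⊆ Finset.univ.filter fun t => G.Adj w t := by
    intro t
    simpa using huw.2 t
  have hle := Finset.card_le_card hsub
  rw [← not_lt] at h1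
  apply h1
  simp only [hkey, Prod.Lex.toLex_lt_toLex, if_pos hf]
  rcases hle.lt_or_eq with hlt | heq
  · exact Or.inl hlt
  · have hwu' : Sub G w u := ⟨huw.1.symm, fun t ht => by
      have h2 := Finset.eq_of_subset_of_card_le hsub heq.ge
      have h3 : t ∈ Finset.univ.filter fun t => G.Adj w t := by simpa using ht
      rw [← h2] at h3
      simpa using h3⟩
    refine Or.inr ⟨heq, ?_⟩
    by_cases hw : Full L w
    · simp only [hwu', not_true, hw, false_or] at h
      simp [hw, h]
    · simp [hw]

/-- A neighbour `t` is demanded because `Sub` includes reachability: only a nonempty contained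
neighbourhood forces both vertices into one component. The tie-break by index excludes two survivors
with the same neighbourhood. -/
theorem isUndominated [LinearOrder V] :
    G.IsUndominated {v | ¬ Dead G L v ∧ Full L v ∧ ∃ t, G.Adj v t} := by
  have key : ∀ w, ¬ Dead G L w → Full L w → (∃ t, G.Adj w t) → ∀ v, v ≠ w →
      (∀ t, G.Adj w t → G.Adj v t) → Sub G w v ∧ Sub G v w ∧ Full L v ∧ ¬ w < v := by
    rintro w h1 h2 ⟨t, ht⟩ v hne h
    have hs : Sub G w v := ⟨ht.reachable.trans (h t ht).symm.reachable, h⟩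
    have h3 : ¬ (¬ Sub G v w ∨ ¬ Full L v ∨ w < v) := fun h3 => h1 ⟨h2, v, hne, hs, h3⟩
    simp only [not_or, not_not] at h3
    exact ⟨hs, h3⟩
  constructor
  · rintro w ⟨hw1, hw2, hw3⟩ v ⟨hv1, hv2, hv3⟩ hne
    by_contra hcon
    push Not at hcon
    obtain ⟨h1, h2, -, h3⟩ := key w hw1 hw2 hw3 v hne.symm hcon
    exact hv1 ⟨hv2, w, hne, h2, Or.inr (Or.inr (lt_of_le_of_ne (not_lt.1 h3) hne.symm))⟩
  · rintro w ⟨hw1, hw2, hw3⟩ v h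
    by_cases hne : v = w
    · subst hne; exact fun t ht => ht
    · exact (key w hw1 hw2 hw3 v hne h).2.1.2

variable (P : Pinning V)

/-- The colours that are left by the lists and the pinned vertices. -/
def Dom₀ (v : V) (c : ℕ) : Prop :=
  L v c ∧ ∀ j < 11, (P.vert j = v → P.col j = c) ∧ (G.Adj v (P.vert j) → P.col j ≠ c)

/-- The colours that are left after one more step of propagation. -/
def Dom (v : V) (c : ℕ) : Prop :=
  P.Dom₀ G L v c ∧ ¬ ∃ u, G.Adj v u ∧ ∀ c' < 3, P.Dom₀ G L u c' → c' = c

/-- At most two colours are left. -/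
def Act (v : V) : Prop := ∃ c < 3, ¬ P.Dom G L v c

/-- The vertex has a neighbour on the cycle. -/
def Tou (u : V) : Prop := ∃ j < 5, G.Adj u (P.vert j)

/-- The vertex has a neighbour of colour `c` on the cycle. -/
def See (u : V) (c : ℕ) : Prop := ∃ j < 5, G.Adj u (P.vert j) ∧ P.col j = c

/-- The two classes of neighbours of `w`. -/
def Cls (w u : V) : Prop :=
  ((∃ v, G.Adj w v ∧ ¬ P.Tou G v) ∧ P.Tou G u) ∨
  (¬ (∃ v, G.Adj w v ∧ ¬ P.Tou G v) ∧
    (((∃ v, G.Adj w v ∧ P.See G v P.fst) ∧ P.See G u P.fst) ∨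
     (¬ (∃ v, G.Adj w v ∧ P.See G v P.fst) ∧ P.See G u P.snd)))

/-- The vertices `w` whose colour is chosen last and that impose conditions on their neighbours. -/
def Cand [LT V] (w : V) : Prop :=
  ¬ Dead G L w ∧ (∀ c < 3, P.Dom G L w c) ∧ ¬ ∃ m < 3, ∀ u, G.Adj w u → ¬ P.Dom G L u m

/-- The smallest (`b = 0`) and the largest (`b = 1`) colour that is left. -/
def Val (v : V) (b c : ℕ) : Prop :=
  P.Dom G L v c ∧ ∀ c' < 3, P.Dom G L v c' → (b = 0 → ¬ c' < c) ∧ (b = 1 → ¬ c < c')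

/-- The colours `c` and `d` of `u` and `v` exclude each other. -/
def Bad [LT V] (u : V) (c : ℕ) (v : V) (d : ℕ) : Prop :=
  (G.Adj u v ∧ c = d) ∨
    ∃ w, P.Cand G L w ∧ G.Adj w u ∧ G.Adj w v ∧ ((P.Cls G w u ↔ P.Cls G w v) ↔ ¬ c = d)

/-- The vertices whose colours are found by the 2-SAT algorithm. -/
def Ok [LT V] (ρ v : V) : Prop := P.Act G L v ∧ ¬ Dead G L v ∧ G.Reachable ρ v

/-- The implications between the choices of the smallest and largest colours. -/
def Imp [LT V] (ρ u : V) (b : ℕ) (v : V) (b'' : ℕ) : Prop :=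
  P.Ok G L ρ u ∧ P.Ok G L ρ v ∧ ∃ b' < 2, ¬ b' = b'' ∧ ∃ c < 3, ∃ d < 3, P.Val G L u b c ∧
    P.Val G L v b' d ∧ P.Bad G L u c v d

variable {G L P}

theorem Val.unique {v : V} {b c c' : ℕ} (hb : b < 2) (hc : c < 3) (hc' : c' < 3)
    (h : P.Val G L v b c) (h' : P.Val G L v b c') : c = c' := by
  have h1 := h.2 c' hc' h'.1
  have h2 := h'.2 c hc h.1
  interval_cases b <;> simp at h1 h2 <;> omega

theorem Bad.symm [LT V] {u v : V} {c d : ℕ} (h : P.Bad G L u c v d) : P.Bad G L v d u c := by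
  rcases h with ⟨h1, h2⟩ | ⟨w, h1, h2, h3, h4⟩
  · exact Or.inl ⟨h1.symm, h2.symm⟩
  · refine Or.inr ⟨w, h1, h3, h2, ?_⟩
    rw [eq_comm (a := d), iff_comm (a := P.Cls G w v)]
    exact h4

/-- An implication says that bit `b` of `u` clashes with the bit of `v` opposite to the conclusion.
Clashing is symmetric, so the contrapositive is an implication as well. -/
theorem Imp.skew [LT V] {ρ u v : V} {b c : ℕ} (hb : b < 2) (hc : c < 2)
    (h : P.Imp G L ρ u b v c) : P.Imp G L ρ v (1 - c) u (1 - b) := by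
  obtain ⟨h1, h2, b', h3, h4, c', hc', d, hd, h5, h6, h7⟩ := h
  refine ⟨h2, h1, b, hb, by omega, d, hd, c', hc', ?_, h5, h7.symm⟩
  rwa [show 1 - c = b' by omega]

/-! ### A colouring satisfies the 2-SAT instance -/

section Complete

variable [LT V] {f : V → ℕ} {ρ : V}

/-- The hypothetical colouring agrees with the lists and the pinned vertices. -/
structure Agrees (G : SimpleGraph V) (L : V → ℕ → Prop) (P : Pinning V) (f : V → ℕ) : Prop where
  lt : ∀ v, f v < 3
  list : ∀ v, L v (f v)
  ne : ∀ u v, G.Adj u v → f u ≠ f v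
  pin : ∀ j < 11, f (P.vert j) = P.col j

omit [LT V] in
theorem Agrees.dom₀ (h : P.Agrees G L f) (v : V) : P.Dom₀ G L v (f v) :=
  ⟨h.list v, fun j hj => ⟨fun h1 => by rw [← h1, h.pin j hj], fun h1 h2 => h.ne _ _ h1 (by
    rw [h.pin j hj, h2])⟩⟩

omit [LT V] in
theorem Agrees.dom (h : P.Agrees G L f) (v : V) : P.Dom G L v (f v) :=
  ⟨h.dom₀ v, fun ⟨u, h1, h2⟩ => h.ne _ _ h1 (h2 _ (h.lt u) (h.dom₀ u)).symm⟩

-- At most two of three colours are left, so the colour that `f` uses is the smallest or the largest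
-- of them; one bit suffices.
omit [LT V] in
theorem Agrees.exists_val (h : P.Agrees G L f) {v : V} (hv : P.Act G L v) :
    ∃ b < 2, P.Val G L v b (f v) := by
  obtain ⟨c, hc, hcv⟩ := hv
  have h1 := h.dom v
  have h2 := h.lt v
  have h3 : ∀ c' < 3, P.Dom G L v c' → c' ≠ c := fun c' _ h' he => hcv (he ▸ h')
  by_cases h4 : ∃ c' < 3, P.Dom G L v c' ∧ c' < f v
  · obtain ⟨d, hd, hdv, hlt⟩ := h4
    refine ⟨1, by omega, h1, fun c' hc' h5 => ⟨by omega, fun _ => ?_⟩⟩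
    have := h3 _ hc' h5; have := h3 _ hd hdv; have := h3 _ h2 h1
    omega
  · push Not at h4
    exact ⟨0, by omega, h1, fun c' hc' h5 => ⟨fun _ => by have := h4 c' hc' h5; omega, by omega⟩⟩

/-- The classes describe the colours of the neighbours of the vertices that are coloured last. -/
def Fits (G : SimpleGraph V) (L : V → ℕ → Prop) (P : Pinning V) (f : V → ℕ) : Prop :=
  ∀ w, P.Cand G L w → ∀ u v, G.Adj w u → G.Adj w v → P.Ok G L ρ u → P.Ok G L ρ v →
    ((P.Cls G w u ↔ P.Cls G w v) ↔ f u = f v)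

theorem Agrees.not_bad (h : P.Agrees G L f) (hfit : Fits (ρ := ρ) G L P f) {u v : V}
    (hu : P.Ok G L ρ u) (hv : P.Ok G L ρ v) : ¬ P.Bad G L u (f u) v (f v) := by
  rintro (⟨h1, h2⟩ | ⟨w, h1, h2, h3, h4⟩)
  · exact h.ne _ _ h1 h2
  · rw [hfit w h1 u v h2 h3 hu hv] at h4
    tauto

/-- The bits that describe `f` are a satisfying assignment; this certifies that no variable is
equivalent to its negation. -/
theorem Agrees.exists_bit (h : P.Agrees G L f) (hfit : Fits (ρ := ρ) G L P f) :
    ∃ β : V → ℕ, (∀ v, β v < 2) ∧ ∀ u b v c, c < 2 → P.Imp G L ρ u b v c → b = β u → c = β v := by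
  classical
  refine ⟨fun v => if hv : P.Act G L v then (h.exists_val hv).choose else 0, fun v => ?_, ?_⟩
  · dsimp only
    split_ifs with hv
    · exact (h.exists_val hv).choose_spec.1
    · omega
  · rintro u b v c hc ⟨hu, hv, b', hb', hbc, c', hc', d, hd, hvu, hvv, hbad⟩ hb
    simp only [dif_pos hu.1, dif_pos hv.1] at hb ⊢
    have hu' := (h.exists_val hu.1).choose_spec
    have hv' := (h.exists_val hv.1).choose_spec
    set bu := (h.exists_val hu.1).choose
    set bv := (h.exists_val hv.1).choose
    by_contra hne
    have hbv : b' = bv := by omega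
    subst hb
    rw [hbv] at hvv
    have e1 := hvu.unique hu'.1 hc' (h.lt u) hu'.2
    have e2 := hvv.unique hv'.1 hd (h.lt v) hv'.2
    rw [e1, e2] at hbad
    exact h.not_bad hfit hu hv hbad

end Complete

/-! ### A truth assignment yields a colouring -/

section Colour

variable [LT V] {f : V → ℕ} {ρ : V} {A : V → ℕ → Prop}

variable (G L P) in
/-- The colours of the vertices that are chosen by the 2-SAT algorithm. -/
def ColA (A : V → ℕ → Prop) (v : V) (c : ℕ) : Prop := ∃ b < 2, A v b ∧ P.Val G L v b c

variable (G L P) in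
/-- The colours that may be chosen if `v` is not dead. -/
def ColB (A : V → ℕ → Prop) (v : V) (c : ℕ) : Prop :=
  (P.Act G L v → P.ColA G L A v c) ∧
    (¬ P.Act G L v → ¬ ∃ u, G.Adj v u ∧ P.Act G L u ∧ ¬ Dead G L u ∧ P.ColA G L A u c)

variable (G L P) in
/-- The result of the 2-SAT algorithm. -/
structure IsAssignment (ρ : V) (A : V → ℕ → Prop) : Prop where
  total : ∀ v, A v 0 ∨ A v 1
  excl : ∀ v, ∀ b < 2, A v b → ¬ A v (1 - b)
  closed : ∀ u, ∀ b < 2, ∀ v, ∀ c < 2, A u b → P.Imp G L ρ u b v c → A v c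

theorem IsAssignment.not_bad (hA : P.IsAssignment G L ρ A) {u v : V} {c d : ℕ}
    (hu : P.Ok G L ρ u) (hv : P.Ok G L ρ v) (hc : c < 3) (hd : d < 3) (huc : P.ColA G L A u c)
    (hvd : P.ColA G L A v d) : ¬ P.Bad G L u c v d := by
  intro hbad
  obtain ⟨b, hb, h1, h2⟩ := huc
  obtain ⟨b', hb', h3, h4⟩ := hvd
  exact hA.excl v b' hb' h3 (hA.closed u b hb v (1 - b') (by omega) h1
    ⟨hu, hv, b', hb', by omega, c, hc, d, hd, h2, h4, hbad⟩)

omit [LT V] in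
theorem exists_val (hD : ∀ v, ∃ c < 3, P.Dom G L v c) (v : V) {b : ℕ} (hb : b < 2) :
    ∃ c < 3, P.Val G L v b c := by
  classical
  obtain ⟨c, hc, hv⟩ := hD v
  have hne : ((Finset.range 3).filter fun c => P.Dom G L v c).Nonempty := ⟨c, by simp [hc, hv]⟩
  interval_cases b
  · obtain ⟨d, hd, hmin⟩ := Finset.exists_min_image _ id hne
    simp only [Finset.mem_filter, Finset.mem_range, id] at hd hmin
    exact ⟨d, hd.1, hd.2, fun c' hc' h => ⟨fun _ => not_lt.2 (hmin c' ⟨hc', h⟩), by omega⟩⟩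
  · obtain ⟨d, hd, hmax⟩ := Finset.exists_max_image _ id hne
    simp only [Finset.mem_filter, Finset.mem_range, id] at hd hmax
    exact ⟨d, hd.1, hd.2, fun c' hc' h => ⟨by omega, fun _ => not_lt.2 (hmax c' ⟨hc', h⟩)⟩⟩

/-- A free vertex that is not a candidate has a colour excluded at all its neighbours. At a
candidate, neighbours with different chosen colours lie in different classes, and there are only two
classes, so the relevant neighbours cannot use all three colours. -/
theorem IsAssignment.exists_colB (hA : P.IsAssignment G L ρ A)
    (hD : ∀ v, ∃ c < 3, P.Dom G L v c) {v : V} (hv : G.Reachable ρ v) (hvd : ¬ Dead G L v) :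
    ∃ c < 3, P.ColB G L A v c := by
  by_cases hact : P.Act G L v
  · rcases hA.total v with h | h
    · obtain ⟨c, hc, h1⟩ := exists_val hD v (b := 0) (by omega)
      exact ⟨c, hc, fun _ => ⟨0, by omega, h, h1⟩, fun h2 => absurd hact h2⟩
    · obtain ⟨c, hc, h1⟩ := exists_val hD v (b := 1) (by omega)
      exact ⟨c, hc, fun _ => ⟨1, by omega, h, h1⟩, fun h2 => absurd hact h2⟩
  · by_cases hcand : P.Cand G L v
    · by_contra hcon
      have key : ∀ c < 3, ∃ u, G.Adj v u ∧ P.Ok G L ρ u ∧ P.ColA G L A u c := by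
        intro c hc
        by_contra h
        refine hcon ⟨c, hc, fun h1 => absurd h1 hact, fun _ ⟨u, h1, h2, h3, h4⟩ => h ?_⟩
        exact ⟨u, h1, ⟨h2, h3, hv.trans h1.reachable⟩, h4⟩
      have diff : ∀ c < 3, ∀ d < 3, c ≠ d → ∀ u u', G.Adj v u → P.Ok G L ρ u → P.ColA G L A u c →
          G.Adj v u' → P.Ok G L ρ u' → P.ColA G L A u' d → ¬ (P.Cls G v u ↔ P.Cls G v u') := by
        intro c hc d hd hcd u u' h1 h2 h3 h4 h5 h6 h7
        refine hA.not_bad h2 h5 hc hd h3 h6 (Or.inr ⟨v, hcand, h1, h4, ?_⟩)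
        simp [h7, hcd]
      obtain ⟨u₀, a0, b0, c0⟩ := key 0 (by omega)
      obtain ⟨u₁, a1, b1, c1⟩ := key 1 (by omega)
      obtain ⟨u₂, a2, b2, c2⟩ := key 2 (by omega)
      have d1 := diff 0 (by omega) 1 (by omega) (by omega) u₀ u₁ a0 b0 c0 a1 b1 c1
      have d2 := diff 0 (by omega) 2 (by omega) (by omega) u₀ u₂ a0 b0 c0 a2 b2 c2
      have d3 := diff 1 (by omega) 2 (by omega) (by omega) u₁ u₂ a1 b1 c1 a2 b2 c2
      tauto
    · simp only [Act, not_exists, not_and, not_not] at hact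
      simp only [Cand, not_and, not_not] at hcand
      obtain ⟨m, hm, h1⟩ := hcand hvd hact
      refine ⟨m, hm, fun ⟨c, hc, h2⟩ => absurd (hact c hc) h2, fun _ ⟨u, h2, h3, h4, h5⟩ => ?_⟩
      obtain ⟨b, -, -, h6⟩ := h5
      exact h1 u h2 h6.1

/-- The colours of the representatives are a colouring of the component. -/
theorem IsAssignment.colouring (hA : P.IsAssignment G L ρ A)
    (hind : ∀ w w', G.Reachable ρ w → ¬ Dead G L w → ¬ Dead G L w' → ¬ P.Act G L w →
      ¬ P.Act G L w' → ¬ G.Adj w w')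
    {col : V → ℕ} (hcol : ∀ v, G.Reachable ρ v → ¬ Dead G L v → col v < 3 ∧ P.ColB G L A v (col v))
    {rep : V → V} (hrep : ∀ v, ¬ Dead G L (rep v) ∧ Sub G v (rep v) ∧ (¬ Dead G L v → rep v = v))
    {v : V} (hv : G.Reachable ρ v) : col (rep v) < 3 ∧ L v (col (rep v)) ∧
      ∀ u, G.Adj v u → col (rep u) ≠ col (rep v) := by
  have hr : ∀ v, G.Reachable ρ v → G.Reachable ρ (rep v) := fun v hv => hv.trans (hrep v).2.1.1
  have hdom : ∀ v, G.Reachable ρ v → ¬ Dead G L v → P.Dom G L v (col v) := by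
    intro v hv hvd
    by_cases hact : P.Act G L v
    · obtain ⟨b, -, -, h⟩ := (hcol v hv hvd).2.1 hact
      exact h.1
    · simp only [Act, not_exists, not_and, not_not] at hact
      exact hact _ (hcol v hv hvd).1
  have h3 := hcol (rep v) (hr v hv) (hrep v).1
  refine ⟨h3.1, ?_, fun u hvu => ?_⟩
  · by_cases hd : Dead G L v
    · exact hd.1 _ h3.1
    · have := hdom (rep v) (hr v hv) (hrep v).1
      rw [(hrep v).2.2 hd] at this ⊢
      exact this.1.1
  · have hu := hv.trans hvu.reachable
    have h4 := hcol (rep u) (hr u hu) (hrep u).1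
    -- Passing to a representative enlarges the neighbourhood, so the edge `v u` is moved one end at
    -- a time.
    have hadj : G.Adj (rep v) (rep u) :=
      ((hrep u).2.1.2 _ ((hrep v).2.1.2 u hvu).symm).symm
    intro heq
    -- Two variables are separated by the 2-SAT clauses, a variable and a free vertex by the choice
    -- of the free colour, and two free vertices are nonadjacent.
    by_cases a1 : P.Act G L (rep v) <;> by_cases a2 : P.Act G L (rep u)
    · exact hA.not_bad ⟨a1, (hrep v).1, hr v hv⟩ ⟨a2, (hrep u).1, hr u hu⟩ h3.1 h4.1 (h3.2.1 a1)
        (h4.2.1 a2) (Or.inl ⟨hadj, heq.symm⟩)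
    · exact h4.2.2 a2 ⟨rep v, hadj.symm, a1, (hrep v).1, heq ▸ h3.2.1 a1⟩
    · exact h3.2.2 a1 ⟨rep u, hadj, a2, (hrep u).1, heq ▸ h4.2.1 a2⟩
    · exact hind _ _ (hr v hv) (hrep v).1 (hrep u).1 a1 a2 hadj

end Colour

end Pinning

/-!
# Existence of suitable pinned vertices
-/

namespace Pinning

variable {V : Type*} (G : SimpleGraph V) (L : V → ℕ → Prop)

/-- The first six vertices dominate all vertices of the component that impose conditions. -/
def IsDominatingRow [LT V] (ρ : V) (s : ℕ → V) : Prop :=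
  ∀ v, G.Reachable ρ v → ¬ Dead G L v → Full L v → ∃ j < 6, v = s j ∨ G.Adj v (s j)

/-- The first five vertices are a cycle, and the next two hit all edges that avoid its
neighbourhood. -/
def IsCycleRow (ρ : V) (s : ℕ → V) : Prop :=
  G.IsC5 (s 0) (s 1) (s 2) (s 3) (s 4) ∧ (∃ j < 5, G.Adj (s 5) (s j)) ∧
    (∃ j < 5, G.Adj (s 6) (s j)) ∧ ∀ a b, G.Reachable ρ a → (¬ ∃ j < 5, G.Adj a (s j)) →
      (¬ ∃ j < 5, G.Adj b (s j)) → G.Adj a b →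
      (G.Adj (s 5) a ∨ G.Adj (s 5) b) ∨ (G.Adj (s 6) a ∨ G.Adj (s 6) b)

theorem exists_lt_five {p : ℕ → Prop} : (∃ j < 5, p j) ↔ p 0 ∨ p 1 ∨ p 2 ∨ p 3 ∨ p 4 := by
  constructor
  · rintro ⟨j, hj, h⟩
    interval_cases j <;> tauto
  · rintro (h | h | h | h | h)
    exacts [⟨0, by omega, h⟩, ⟨1, by omega, h⟩, ⟨2, by omega, h⟩, ⟨3, by omega, h⟩, ⟨4, by omega, h⟩]

theorem touches_iff {a b c d e u : V} : G.Touches {a, b, c, d, e} u ↔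
    G.Adj u a ∨ G.Adj u b ∨ G.Adj u c ∨ G.Adj u d ∨ G.Adj u e := by
  simp [SimpleGraph.Touches]

theorem sees_iff {f : V → ℕ} {a b c d e u : V} {k : ℕ} : G.Sees {a, b, c, d, e} f u k ↔
    (G.Adj u a ∧ f a = k) ∨ (G.Adj u b ∧ f b = k) ∨ (G.Adj u c ∧ f c = k) ∨ (G.Adj u d ∧ f d = k) ∨
      (G.Adj u e ∧ f e = k) := by
  simp [SimpleGraph.Sees]

variable {G L}

/-- If `ρ` is isolated, it is its own dominating row. Otherwise every vertex of the component has a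
neighbour, as the set in `isUndominated` requires. -/
theorem exists_row [Finite V] [LinearOrder V] (hT : G.CliqueFree 3)
    (hP : ¬ (SimpleGraph.pathGraph 7).IsIndContained G) (ρ : V) :
    (∃ s : ℕ → V, (∀ j < 6, G.Reachable ρ (s j)) ∧ IsDominatingRow G L ρ s) ∨
      ∃ a b c d e, G.Reachable ρ a ∧ G.IsC5 a b c d e := by
  rcases SimpleGraph.exists_C5_or_dominating hT hP (isUndominated G L) ρ with h | ⟨s, hs, h⟩
  · exact Or.inr h
  left
  by_cases hρ : ∃ t, G.Adj ρ t
  · refine ⟨s, hs, fun v hv hd hf => h v ⟨hd, hf, ?_⟩ hv⟩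
    obtain ⟨p⟩ := hv.symm
    cases p with
    | nil => exact hρ
    | cons h' _ => exact ⟨_, h'⟩
  · refine ⟨fun _ => ρ, fun j _ => .refl _, fun v hv _ _ => ⟨0, by omega, Or.inl ?_⟩⟩
    obtain ⟨p⟩ := hv
    cases p with
    | nil => rfl
    | cons h' _ => exact absurd ⟨_, h'⟩ hρ

theorem exists_hitting_row [Finite V] (hT : G.CliqueFree 3)
    (hP : ¬ (SimpleGraph.pathGraph 7).IsIndContained G) {s : ℕ → V}
    (h : G.IsC5 (s 0) (s 1) (s 2) (s 3) (s 4)) : ∃ p q, ∀ s' : ℕ → V, (∀ j < 5, s' j = s j) →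
      s' 5 = p → s' 6 = q → IsCycleRow G (s 0) s' := by
  have ht : G.Touches {s 0, s 1, s 2, s 3, s 4} (s 0) := (touches_iff G).2 (Or.inr (Or.inl h.ab))
  obtain ⟨p, q, hp, hq, hpq⟩ := (h.isHub hT).exists_hitting_edges hT hP ht
  simp only [touches_iff] at hp hq hpq
  refine ⟨p, q, fun s' hs hp' hq' => ?_⟩
  simp only [IsCycleRow, exists_lt_five, hs 0 (by omega), hs 1 (by omega), hs 2 (by omega),
    hs 3 (by omega), hs 4 (by omega), hp', hq']
  exact ⟨h, hp, hq, hpq⟩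

/-- The vertex `w` is not pinned and has no pinned neighbour, if all colours are left. -/
theorem Agrees.not_pinned {P : Pinning V} {f : V → ℕ} (h : P.Agrees G L f) {w : V}
    (hw : ∀ c < 3, P.Dom G L w c) {j : ℕ} (hj : j < 11) :
    w ≠ P.vert j ∧ ¬ G.Adj w (P.vert j) := by
  constructor
  · intro he
    have h1 := ((hw 0 (by omega)).1.2 j hj).1 he.symm
    have h2 := ((hw 1 (by omega)).1.2 j hj).1 he.symm
    omega
  · intro ha
    have h3 := h.lt (P.vert j)
    rw [h.pin j hj] at h3
    exact ((hw _ h3).1.2 j hj).2 ha rfl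

/-- The conclusion of the search for pinned vertices. -/
structure IsGood [LT V] (G : SimpleGraph V) (L : V → ℕ → Prop) (ρ : V) (f : V → ℕ) (P : Pinning V) :
    Prop where
  agrees : P.Agrees G L f
  fits : Fits (ρ := ρ) G L P f
  indep : ∀ w w', G.Reachable ρ w → ¬ Dead G L w → ¬ Dead G L w' → ¬ P.Act G L w →
      ¬ P.Act G L w' → ¬ G.Adj w w'

/-- A free vertex has a full list; if it is not dead, it is pinned or adjacent to a pin and so has
lost a colour after all. Hence there is no such vertex in the component, and the conditions on free
vertices hold vacuously. -/
theorem IsDominatingRow.exists_good [LT V] {ρ : V} {s : ℕ → V} (h : IsDominatingRow G L ρ s)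
    {f : V → ℕ} (hf3 : ∀ v, f v < 3) (hfL : ∀ v, L v (f v)) (hf : ∀ u v, G.Adj u v → f u ≠ f v) :
    ∃ P : Pinning V, (∀ j < 7, P.vert j = s j) ∧ P.vert 7 = ρ ∧
      (∀ j, P.col j < 3) ∧ P.fst < 3 ∧ P.snd < 3 ∧ IsGood G L ρ f P := by
  -- The last four pins carry no information here; they are filled with `ρ`, so that pin `7` still
  -- names the component.
  set P : Pinning V := ⟨fun j => if j < 7 then s j else ρ, fun j => f (if j < 7 then s j else ρ),
    0, 0⟩ with hPdef
  have hag : P.Agrees G L f := ⟨hf3, hfL, hf, fun j _ => rfl⟩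
  have hfree : ∀ w, G.Reachable ρ w → ¬ Dead G L w → ¬ ∀ c < 3, P.Dom G L w c := by
    intro w hw hd hfree
    obtain ⟨j, hj, h1⟩ := h w hw hd fun c hc => (hfree c hc).1.1
    have h2 := hag.not_pinned hfree (j := j) (by omega)
    have h3 : P.vert j = s j := by simp [hPdef, show j < 7 by omega]
    rw [h3] at h2
    exact h1.elim h2.1 h2.2
  refine ⟨P, fun j hj => by simp [hPdef, hj], by simp [hPdef], fun j => hf3 _, by simp [hPdef],
    by simp [hPdef], hag, fun w hw u v hu _ hou _ => ?_, fun w w' hw hd _ ha _ _ => ?_⟩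
  · exact absurd hw.2.1 (hfree w (hou.2.2.trans hu.symm.reachable) hw.1)
  · refine hfree w hw hd fun c hc => ?_
    by_contra hcon
    exact ha ⟨c, hc, hcon⟩

/-- The pins are the cycle, `p`, `q` and the four vertices from `HasPins`, coloured by `f`. A vertex
that keeps all colours after propagation is loose and adjacent to no pin, hence settled; the first
alternative of being settled contradicts being a candidate, and the second is what the classes must
satisfy. -/
theorem IsCycleRow.exists_good [LT V] [Finite V] (hT : G.CliqueFree 3)
    (hP : ¬ (SimpleGraph.pathGraph 7).IsIndContained G) {ρ : V} {s : ℕ → V}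
    (h : IsCycleRow G ρ s)
    {f : V → ℕ} (hf3 : ∀ v, f v < 3) (hfL : ∀ v, L v (f v)) (hf : ∀ u v, G.Adj u v → f u ≠ f v) :
    ∃ P : Pinning V, (∀ j < 7, P.vert j = s j) ∧ G.Reachable ρ (P.vert 7) ∧
      (∀ j, P.col j < 3) ∧ P.fst < 3 ∧ P.snd < 3 ∧ IsGood G L ρ f P := by
  obtain ⟨hc, hp, hq, hpq⟩ := h
  have hpins : G.HasPins {s 0, s 1, s 2, s 3, s 4} f (s 5) (s 6) ρ := by
    refine hc.hasPins hT hP hf hf3 ?_ ?_ fun a b h1 h2 h3 h4 => hpq a b h1 ?_ ?_ h4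
    · rw [touches_iff]; exact exists_lt_five.1 hp
    · rw [touches_iff]; exact exists_lt_five.1 hq
    · rw [exists_lt_five, ← touches_iff]; exact h2
    · rw [exists_lt_five, ← touches_iff]; exact h3
  obtain ⟨z₁, z₂, z₃, z₄, r₁, -, -, -, m, hm, m', hm', hset⟩ := hpins
  set P : Pinning V := ⟨fun j => if j < 7 then s j else if j = 7 then z₁ else if j = 8 then z₂ else
    if j = 9 then z₃ else z₄, fun j => f (if j < 7 then s j else if j = 7 then z₁ else
    if j = 8 then z₂ else if j = 9 then z₃ else z₄), m, m'⟩ with hPdef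
  have hag : P.Agrees G L f := ⟨hf3, hfL, hf, fun j _ => rfl⟩
  have hv : ∀ j < 7, P.vert j = s j := fun j hj => by simp [hPdef, hj]
  have hcl : ∀ j < 7, P.col j = f (s j) := fun j hj => by simp [hPdef, hj]
  have htou : ∀ u, P.Tou G u ↔ G.Touches {s 0, s 1, s 2, s 3, s 4} u := fun u => by
    simp [Tou, exists_lt_five, touches_iff, hv]
  have hsee : ∀ u k, P.See G u k ↔ G.Sees {s 0, s 1, s 2, s 3, s 4} f u k := fun u k => by
    simp [See, exists_lt_five, sees_iff, hv, hcl]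
  have hcls : ∀ w u, P.Cls G w u ↔ G.InClass {s 0, s 1, s 2, s 3, s 4} f m m' w u := fun w u => by
    simp only [Cls, htou, hsee, SimpleGraph.InClass, show P.fst = m from rfl, show P.snd = m' from rfl]
  have hdom : ∀ u k, G.Sees {s 0, s 1, s 2, s 3, s 4} f u k → ∀ c, P.Dom₀ G L u c → c ≠ k := by
    rintro u k hs c hc rfl
    rw [← hsee] at hs
    obtain ⟨j, hj, h1, h2⟩ := hs
    exact (hc.2 j (by omega)).2 h1 h2
  have hloose : ∀ w, (∀ c < 3, P.Dom G L w c) → G.IsLoose {s 0, s 1, s 2, s 3, s 4} f w := by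
    intro w hw
    refine ⟨fun ht => ?_, fun u hwu k l hk hl => ?_⟩
    · rw [← htou] at ht
      obtain ⟨j, hj, h1⟩ := ht
      exact (hag.not_pinned hw (j := j) (by omega)).2 h1
    · by_contra hkl
      have hk3 : k < 3 := by obtain ⟨v, -, -, rfl⟩ := hk; exact hf3 v
      have hl3 : l < 3 := by obtain ⟨v, -, -, rfl⟩ := hl; exact hf3 v
      -- Colours are `0, 1, 2`, so `3 - k - l` is the third one. It is the only colour that `u` may
      -- have, and propagation removes it from `w`.
      refine (hw (3 - k - l) (by omega)).2 ⟨u, hwu, fun c hc hd => ?_⟩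
      have := hdom u k hk c hd
      have := hdom u l hl c hd
      omega
  have hz : ∀ w, (∀ c < 3, P.Dom G L w c) → ¬ G.Adj w (s 5) ∧ ¬ G.Adj w (s 6) ∧ ¬ G.Adj w z₁ ∧
      ¬ G.Adj w z₂ ∧ ¬ G.Adj w z₃ ∧ ¬ G.Adj w z₄ := by
    intro w hw
    have h1 := fun (j : ℕ) (hj : j < 11) => (hag.not_pinned hw hj).2
    exact ⟨h1 5 (by omega), h1 6 (by omega), h1 7 (by omega), h1 8 (by omega), h1 9 (by omega),
      h1 10 (by omega)⟩
  refine ⟨P, hv, r₁, fun j => hf3 _, hm, hm', hag, fun w hw u v hu hv' hou _ => ?_,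
    fun w w' hw _ _ ha ha' hadj => ?_⟩
  · obtain ⟨n1, n2, n3, n4, n5, n6⟩ := hz w hw.2.1
    rcases hset w (hou.2.2.trans hu.symm.reachable) (hloose w hw.2.1) n1 n2 n3 n4 n5 n6 with
      ⟨k, hk, hsafe⟩ | hfit
    · refine absurd ⟨k, hk, fun u hu hd => ?_⟩ hw.2.2
      obtain ⟨t, ht, h1, h2⟩ := hsafe u hu
      have : ∃ j < 7, t = s j := by
        simp only [Set.mem_insert_iff, Set.mem_singleton_iff] at ht
        rcases ht with (rfl | rfl | rfl | rfl | rfl) | rfl | rfl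
        exacts [⟨0, by omega, rfl⟩, ⟨1, by omega, rfl⟩, ⟨2, by omega, rfl⟩, ⟨3, by omega, rfl⟩,
          ⟨4, by omega, rfl⟩, ⟨5, by omega, rfl⟩, ⟨6, by omega, rfl⟩]
      obtain ⟨j, hj, rfl⟩ := this
      exact (hd.1.2 j (by omega)).2 (by rw [hv j hj]; exact h1) (by rw [hcl j hj]; exact h2)
    · rw [hcls, hcls]
      exact hfit u v hu hv'
  · have free : ∀ w, ¬ P.Act G L w → ∀ c < 3, P.Dom G L w c := fun w ha c hc => by
      by_contra hcon
      exact ha ⟨c, hc, hcon⟩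
    have f1 := free w ha
    have f2 := free w' ha'
    have n1 := hz w f1
    have n2 := hz w' f2
    have t1 := (hloose w f1).not_touches
    have t2 := (hloose w' f2).not_touches
    rw [touches_iff, ← exists_lt_five (p := fun j => G.Adj w (s j))] at t1
    rw [touches_iff, ← exists_lt_five (p := fun j => G.Adj w' (s j))] at t2
    rcases hpq w w' hw t1 t2 hadj with (h | h) | h | h
    · exact n1.1 h.symm
    · exact n2.1 h.symm
    · exact n1.2.1 h.symm
    · exact n2.2.1 h.symm

end Pinning

/-!
# The program
-/

namespace RAM

namespace Table

/-- Lists. -/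
abbrev lst : ℕ := 0
/-- Connection by paths. -/
abbrev con : ℕ := 1
/-- Inclusion of neighbourhoods. -/
abbrev sub : ℕ := 2
/-- Dead vertices. -/
abbrev dead : ℕ := 3
/-- Vertices for which `row` is set. -/
abbrev has : ℕ := 4
/-- The seven vertices that are pinned without a search. -/
abbrev row : ℕ := 5
/-- Vertices for which `cyc` is set. -/
abbrev hasCyc : ℕ := 6
/-- Induced cycles of length five. -/
abbrev cyc : ℕ := 7
/-- The table `row` for all vertices of the component. -/
abbrev base : ℕ := 8
/-- The colours of the pinned vertices and the two colours that define the classes. -/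
abbrev col : ℕ := 9
/-- The pinned vertices. -/
abbrev pin : ℕ := 10
/-- Colours that are left by the lists and the pinned vertices. -/
abbrev dom₀ : ℕ := 11
/-- Colours that are left after propagation. -/
abbrev dom : ℕ := 12
/-- Classes. -/
abbrev cls : ℕ := 13
/-- Vertices that impose conditions. -/
abbrev cand : ℕ := 14
/-- Implications. -/
abbrev imp : ℕ := 15
/-- Truth values. -/
abbrev asg : ℕ := 16
/-- Possible colours. -/
abbrev colB : ℕ := 17
/-- Chosen colours. -/
abbrev colV : ℕ := 18
/-- Representatives. -/
abbrev rep : ℕ := 19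
/-- Vertices for which `out` is set. -/
abbrev solved : ℕ := 20
/-- The result. -/
abbrev out : ℕ := 21
/-- The answer. -/
abbrev flag : ℕ := 22

end Table

open Stmt Fm Tm

/-- An entry of a table with one parameter. -/
def Tm.get₁ (id : ℕ) (a : Tm) : Tm := get id a (cst 0) (cst 0) (cst 0)

/-- An entry of a table with two parameters. -/
def Tm.get₂ (id : ℕ) (a b : Tm) : Tm := get id a b (cst 0) (cst 0)

/-- Writing to a table with one parameter. -/
def Stmt.store₁ (id : ℕ) (a t : Tm) : Stmt := store id a (cst 0) (cst 0) (cst 0) t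

/-- Writing to a table with two parameters. -/
def Stmt.store₂ (id : ℕ) (a b t : Tm) : Stmt := store id a b (cst 0) (cst 0) t

/-- Two vertices are connected. -/
def conF (a b : Tm) : Fm := tt (get Table.con a (cst 0) b (cst 0))

/-- All colours are in the list of `a` (a term below one more binder). -/
def fullF (a : Tm) : Fm := all (.lit 3) (tt (get₂ Table.lst a (var 0)))

/-- The lists, given by a formula. -/
def lstP (φ : Fm) : Stmt := fill Table.lst .size (.lit 3) (.lit 1) (.lit 1) φ

/-- Connection by paths. -/
def conP : Stmt := seq
  (fill Table.con .size (.lit 1) .size (.lit 1) (or (eq (var 3) (var 1)) (adj (var 3) (var 1))))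
  (warshall Table.con (.lit 1))

/-- Inclusion of neighbourhoods. -/
def subP : Stmt := fill Table.sub .size .size (.lit 1) (.lit 1) (and (conF (var 3) (var 2))
  (all .size (imp (adj (var 4) (var 0)) (adj (var 3) (var 0)))))

/-- Dead vertices. -/
def deadP : Stmt := fill Table.dead .size (.lit 1) (.lit 1) (.lit 1) (and (fullF (var 4))
  (ex .size (and (neg (eq (var 0) (var 4))) (and (tt (get₂ Table.sub (var 4) (var 0)))
    (or (neg (tt (get₂ Table.sub (var 0) (var 4)))) (or (neg (fullF (var 1)))
      (lt (var 4) (var 0))))))))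

/-- Representatives. -/
def repP : Stmt := nest [.size, .size] (ite (and (neg (tt (get₁ Table.dead (var 0))))
  (and (tt (get₂ Table.sub (var 1) (var 0)))
    (imp (neg (tt (get₁ Table.dead (var 1)))) (eq (var 0) (var 1)))))
  (store₁ Table.rep (var 1) (var 0)) skip)

/-- The vertices `var 5`, …, `var 0` dominate the component of the first one. -/
def domRowF : Fm := all .size (imp (conF (var 6) (var 0)) (imp (neg (tt (get₁ Table.dead (var 0))))
  (imp (fullF (var 1)) (or (or (eq (var 0) (var 6)) (adj (var 0) (var 6)))
    (or (or (eq (var 0) (var 5)) (adj (var 0) (var 5)))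
      (or (or (eq (var 0) (var 4)) (adj (var 0) (var 4)))
        (or (or (eq (var 0) (var 3)) (adj (var 0) (var 3)))
          (or (or (eq (var 0) (var 2)) (adj (var 0) (var 2)))
            (or (eq (var 0) (var 1)) (adj (var 0) (var 1)))))))))))

/-- The search for dominating vertices. -/
def domRowP : Stmt := nest [.size, .size, .size, .size, .size, .size] (ite domRowF
  (seq (store₂ Table.row (var 5) (cst 0) (var 5)) (seq (store₂ Table.row (var 5) (cst 1) (var 4))
    (seq (store₂ Table.row (var 5) (cst 2) (var 3)) (seq (store₂ Table.row (var 5) (cst 3) (var 2))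
      (seq (store₂ Table.row (var 5) (cst 4) (var 1)) (seq (store₂ Table.row (var 5) (cst 5) (var 0))
        (seq (store₂ Table.row (var 5) (cst 6) (var 5)) (store₁ Table.has (var 5) (cst 1)))))))))
  skip)

/-- The vertices `var 4`, …, `var 0` induce a cycle. -/
def cycF : Fm := and (adj (var 4) (var 3)) (and (adj (var 3) (var 2)) (and (adj (var 2) (var 1))
  (and (adj (var 1) (var 0)) (and (adj (var 0) (var 4)) (and (neg (adj (var 4) (var 2)))
    (and (neg (adj (var 3) (var 1))) (and (neg (adj (var 2) (var 0)))
      (and (neg (adj (var 1) (var 4))) (neg (adj (var 0) (var 3)))))))))))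

/-- The search for induced cycles. -/
def cycP : Stmt := nest [.size, .size, .size, .size, .size] (ite cycF
  (seq (store₂ Table.cyc (var 4) (cst 0) (var 4)) (seq (store₂ Table.cyc (var 4) (cst 1) (var 3))
    (seq (store₂ Table.cyc (var 4) (cst 2) (var 2)) (seq (store₂ Table.cyc (var 4) (cst 3) (var 1))
      (seq (store₂ Table.cyc (var 4) (cst 4) (var 0)) (store₁ Table.hasCyc (var 4) (cst 1)))))))
  skip)

/-- The term `t` has a neighbour on the cycle of `a` (terms below one more binder). -/
def touF (a t : Tm) : Fm := ex (.lit 5) (adj t (get₂ Table.cyc a (var 0)))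

/-- The vertices `var 1` and `var 0` hit all edges outside the neighbourhood of the cycle of
`var 2`. -/
def hitF : Fm := and (touF (var 3) (var 2)) (and (touF (var 3) (var 1)) (all .size (all .size
  (imp (conF (var 4) (var 1)) (imp (neg (touF (var 5) (var 2))) (imp (neg (touF (var 5) (var 1)))
    (imp (adj (var 1) (var 0)) (or (or (adj (var 3) (var 1)) (adj (var 3) (var 0)))
      (or (adj (var 2) (var 1)) (adj (var 2) (var 0)))))))))))

/-- The search for two vertices that hit all edges outside the neighbourhood of a cycle. -/
def hitP : Stmt := nest [.size, .size, .size] (ite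
  (and (tt (get₁ Table.hasCyc (var 2))) (and (neg (tt (get₁ Table.has (var 2)))) hitF))
  (seq (loop (.lit 5) (store₂ Table.row (var 3) (var 0) (get₂ Table.cyc (var 3) (var 0))))
    (seq (store₂ Table.row (var 2) (cst 5) (var 1)) (seq (store₂ Table.row (var 2) (cst 6) (var 0))
      (store₁ Table.has (var 2) (cst 1))))) skip)

/-- The distribution of the rows in the component. -/
def baseP : Stmt := nest [.size, .size] (ite
  (and (conF (var 1) (var 0)) (and (tt (get₁ Table.has (var 0))) (all .size
    (imp (conF (var 2) (var 0)) (imp (tt (get₁ Table.has (var 0))) (neg (lt (var 0) (var 1))))))))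
  (loop (.lit 7) (store₂ Table.base (var 2) (var 0) (get₂ Table.row (var 1) (var 0)))) skip)

/-- The copies of the guesses. -/
def pinP : Stmt :=
  seq (store₁ Table.col (cst 0) (var 16)) (seq (store₁ Table.col (cst 1) (var 15))
  (seq (store₁ Table.col (cst 2) (var 14)) (seq (store₁ Table.col (cst 3) (var 13))
  (seq (store₁ Table.col (cst 4) (var 12)) (seq (store₁ Table.col (cst 5) (var 11))
  (seq (store₁ Table.col (cst 6) (var 10)) (seq (store₁ Table.col (cst 7) (var 9))
  (seq (store₁ Table.col (cst 8) (var 8)) (seq (store₁ Table.col (cst 9) (var 7))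
  (seq (store₁ Table.col (cst 10) (var 6)) (seq (store₁ Table.col (cst 11) (var 5))
  (seq (store₁ Table.col (cst 12) (var 4)) (seq (store₁ Table.pin (cst 7) (var 3))
  (seq (store₁ Table.pin (cst 8) (var 2)) (seq (store₁ Table.pin (cst 9) (var 1))
  (seq (store₁ Table.pin (cst 10) (var 0))
    (loop (.lit 7) (store₁ Table.pin (var 0) (get₂ Table.base (var 4) (var 0))))))))))))))))))))

/-- Colours that are left by the lists and the pinned vertices. -/
def dom₀P : Stmt := fill Table.dom₀ .size (.lit 3) (.lit 1) (.lit 1)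
  (and (tt (get₂ Table.lst (var 3) (var 2))) (all (.lit 11)
    (and (imp (eq (get₁ Table.pin (var 0)) (var 4)) (eq (get₁ Table.col (var 0)) (var 3)))
      (imp (adj (var 4) (get₁ Table.pin (var 0))) (neg (eq (get₁ Table.col (var 0)) (var 3)))))))

/-- Colours that are left after propagation. -/
def domP : Stmt := fill Table.dom .size (.lit 3) (.lit 1) (.lit 1)
  (and (tt (get₂ Table.dom₀ (var 3) (var 2))) (neg (ex .size (and (adj (var 4) (var 0))
    (all (.lit 3) (imp (tt (get₂ Table.dom₀ (var 1) (var 0))) (eq (var 0) (var 4))))))))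

/-- The term `t` (below one more binder) has a neighbour on the cycle. -/
def pinTouF (t : Tm) : Fm := ex (.lit 5) (adj t (get₁ Table.pin (var 0)))

/-- The term `t` (below one more binder) has a neighbour of colour number `c` on the cycle. -/
def pinSeeF (t : Tm) (c : ℕ) : Fm := ex (.lit 5) (and (adj t (get₁ Table.pin (var 0)))
  (eq (get₁ Table.col (var 0)) (get₁ Table.col (cst c))))

/-- Classes. -/
def clsP : Stmt := fill Table.cls .size .size (.lit 1) (.lit 1)
  (or (and (ex .size (and (adj (var 4) (var 0)) (neg (pinTouF (var 1))))) (pinTouF (var 3)))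
    (and (neg (ex .size (and (adj (var 4) (var 0)) (neg (pinTouF (var 1))))))
      (or (and (ex .size (and (adj (var 4) (var 0)) (pinSeeF (var 1) 11))) (pinSeeF (var 3) 11))
        (and (neg (ex .size (and (adj (var 4) (var 0)) (pinSeeF (var 1) 11))))
          (pinSeeF (var 3) 12)))))

/-- Vertices that impose conditions. -/
def candP : Stmt := fill Table.cand .size (.lit 1) (.lit 1) (.lit 1)
  (and (neg (tt (get₁ Table.dead (var 3)))) (and (all (.lit 3) (tt (get₂ Table.dom (var 4) (var 0))))
    (neg (ex (.lit 3) (all .size (imp (adj (var 5) (var 0))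
      (neg (tt (get₂ Table.dom (var 0) (var 1))))))))))

/-- At most two colours are left for `t` (below one more binder). -/
def actF (t : Tm) : Fm := ex (.lit 3) (neg (tt (get₂ Table.dom t (var 0))))

/-- The vertex number `i` gets its colour from the 2-SAT algorithm. -/
def okF (i : ℕ) : Fm := and (actF (var (i + 1))) (and (neg (tt (get₁ Table.dead (var i))))
  (conF (get₁ Table.pin (cst 7)) (var i)))

/-- The colour number `c` is the one that bit number `b` stands for at the vertex number `v`. -/
def valF (v b c : ℕ) : Fm := and (tt (get₂ Table.dom (var v) (var c))) (all (.lit 3)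
  (imp (tt (get₂ Table.dom (var (v + 1)) (var 0)))
    (and (imp (eq (var (b + 1)) (cst 0)) (neg (lt (var 0) (var (c + 1)))))
      (imp (eq (var (b + 1)) (cst 1)) (neg (lt (var (c + 1)) (var 0)))))))

/-- Implications. -/
def impP : Stmt := fill Table.imp .size (.lit 2) .size (.lit 2)
  (and (okF 3) (and (okF 1) (ex (.lit 2) (and (neg (eq (var 0) (var 1))) (ex (.lit 3) (ex (.lit 3)
    (and (valF 6 5 1) (and (valF 4 2 0) (or (and (adj (var 6) (var 4)) (eq (var 1) (var 0)))
      (ex .size (and (tt (get₁ Table.cand (var 0))) (and (adj (var 0) (var 7))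
        (and (adj (var 0) (var 5)) (iff (iff (tt (get₂ Table.cls (var 0) (var 7)))
          (tt (get₂ Table.cls (var 0) (var 5)))) (neg (eq (var 2) (var 1)))))))))))))))))

/-- The colour `c` is chosen for the vertex `v` (below one more binder). -/
def colAF (v c : ℕ) : Fm := ex (.lit 2) (and (tt (get₂ Table.asg (var v) (var 0))) (valF v 0 c))

/-- Possible colours. -/
def colBP : Stmt := fill Table.colB .size (.lit 3) (.lit 1) (.lit 1)
  (and (imp (actF (var 4)) (colAF 4 3)) (imp (neg (actF (var 4)))
    (neg (ex .size (and (adj (var 4) (var 0)) (and (actF (var 1))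
      (and (neg (tt (get₁ Table.dead (var 0)))) (colAF 1 4))))))))

/-- Chosen colours. -/
def colVP : Stmt := nest [.size, .lit 3] (ite (tt (get₂ Table.colB (var 1) (var 0)))
  (store₁ Table.colV (var 1) (var 0)) skip)

/-- The colour of the representative. -/
def outT (t : Tm) : Tm := get₁ Table.colV (get₁ Table.rep t)

/-- The chosen colours are a colouring of the component. -/
def verF : Fm := all .size (imp (conF (get₁ Table.pin (cst 7)) (var 0)) (and (lt (outT (var 0)) (cst 3))
  (and (tt (get₂ Table.lst (var 0) (outT (var 0))))
    (all .size (imp (adj (var 1) (var 0)) (neg (eq (outT (var 0)) (outT (var 1)))))))))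

/-- Storing a colour. -/
def outP : Stmt := ite (eq (outT (var 0)) (cst 0))
  (store Table.out (cst 0) (cst 0) (cst 0) (var 0) (cst 1))
  (ite (eq (outT (var 0)) (cst 1)) (store Table.out (cst 0) (cst 0) (cst 0) (var 0) (cst 2))
    (store Table.out (cst 0) (cst 0) (cst 0) (var 0) (cst 3)))

/-- The verification and storing of a colouring. -/
def recordP : Stmt := ite verF (loop .size (ite (conF (get₁ Table.pin (cst 7)) (var 0))
  (seq (store₁ Table.solved (var 0) (cst 1)) outP) skip)) skip

/-- The work that is done for one guess, before the verification. -/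
def guessP : Stmt := seq pinP (seq dom₀P (seq domP (seq clsP (seq candP (seq impP
  (seq (warshall Table.imp (.lit 2)) (seq (assignment Table.imp Table.asg) (seq colBP colVP))))))))

/-- The bounds of the guesses. -/
def guessB : List Bd := [.lit 3, .lit 3, .lit 3, .lit 3, .lit 3, .lit 3, .lit 3, .lit 3, .lit 3, .lit 3,
  .lit 3, .lit 3, .lit 3, .size, .size, .size, .size]

/-- The loop over all guesses. -/
def mainP : Stmt := nest guessB (seq guessP recordP)

/-- The computation before the loop over all guesses. -/
def prepP (φ : Fm) : Stmt := seq (lstP φ) (seq conP (seq subP (seq deadP (seq repP (seq domRowP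
  (seq cycP (seq hitP baseP)))))))

/-- The answer. -/
def flagP : Stmt := ite (all .size (tt (get₁ Table.solved (var 0))))
  (store Table.flag (cst 0) (cst 0) (cst 0) (cst 0) (cst 1)) skip

/-- The whole algorithm. -/
def colourP (φ : Fm) : Stmt := seq (prepP φ) (seq mainP flagP)

theorem colourP_wf (φ : Fm) (h : φ.wf 4) : (colourP φ).wf 0 := by
  have h1 : (seq conP (seq subP (seq deadP (seq repP (seq domRowP
    (seq cycP (seq hitP baseP))))))).wf 0 = true := by decide
  have h2 : (seq mainP flagP).wf 0 = true := by decide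
  simp only [colourP, prepP, lstP, fill, Stmt.wf] at h1 h2 ⊢
  simp_all [Tm.wf, Bd.wf]

/-- Degree seven occurs twice: six loops and one quantifier in the search for dominating vertices,
and four guessed vertices times the cubic work for one guess. -/
theorem colourP_deg (φ : Fm) (h : φ.deg = 0) : (colourP φ).deg ≤ 7 := by
  have h1 : (seq conP (seq subP (seq deadP (seq repP (seq domRowP
    (seq cycP (seq hitP baseP))))))).deg = 7 := by decide
  have h2 : (seq mainP flagP).deg = 7 := by decide
  have h3 : (lstP φ).deg = 1 := by simp [lstP, fill, Stmt.deg, h, Bd.deg]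
  simp only [colourP, prepP, Stmt.deg] at h1 h2 ⊢
  omega

end RAM

/-!
# The tables that are computed first
-/

namespace RAM

open Stmt Fm Tm

section Eval

variable {n : ℕ} {inp : ℕ → ℕ} {T : Tabs} {env : List ℕ}

theorem exists_lt_fin {k : ℕ} {p : ℕ → Prop} : (∃ i < k, p i) ↔ ∃ i : Fin k, p i :=
  ⟨fun ⟨i, h, hp⟩ => ⟨⟨i, h⟩, hp⟩, fun ⟨i, hp⟩ => ⟨i, i.2, hp⟩⟩

theorem forall_lt_fin {k : ℕ} {p : ℕ → Prop} : (∀ i < k, p i) ↔ ∀ i : Fin k, p i :=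
  ⟨fun h i => h i i.2, fun h i hi => h ⟨i, hi⟩⟩

theorem exists_fin {k i : ℕ} (h : i < k) : ∃ j : Fin k, (j : ℕ) = i := ⟨⟨i, h⟩, rfl⟩

theorem Tm.eval_get₁ (id : ℕ) (a : Tm) : (get₁ id a).eval env T = T id (a.eval env T) 0 0 0 := rfl

theorem Tm.eval_get₂ (id : ℕ) (a b : Tm) :
    (get₂ id a b).eval env T = T id (a.eval env T) (b.eval env T) 0 0 := rfl

theorem eval_conF (a b : Tm) :
    (conF a b).eval n inp T env ↔ T Table.con (a.eval env T) 0 (b.eval env T) 0 ≠ 0 := Iff.rfl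

theorem Stmt.sem_store₁ (id : ℕ) (a t : Tm) : (store₁ id a t).sem n inp env T =
    T.set id (a.eval env T) 0 0 0 (t.eval env T) := rfl

theorem Stmt.sem_store₂ (id : ℕ) (a b t : Tm) : (store₂ id a b t).sem n inp env T =
    T.set id (a.eval env T) (b.eval env T) 0 0 (t.eval env T) := rfl

theorem Stmt.sem_ite_pos {φ : Fm} {p q : Stmt} (h : φ.eval n inp T env) :
    (ite φ p q).sem n inp env T = p.sem n inp env T := if_pos h

theorem Stmt.sem_ite_neg {φ : Fm} {p q : Stmt} (h : ¬ φ.eval n inp T env) :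
    (ite φ p q).sem n inp env T = q.sem n inp env T := if_neg h

end Eval

variable {n : ℕ} {inp : ℕ → ℕ} {G : SimpleGraph (Fin n)} {L : Fin n → ℕ → Prop} {env : List ℕ}

/-- The input contains the adjacency matrix of `G`. -/
def IsMatrix (inp : ℕ → ℕ) (G : SimpleGraph (Fin n)) : Prop :=
  ∀ u v : Fin n, inp (u * n + v) ≠ 0 ↔ G.Adj u v

/-- The initial table contains the diagonal, so that the transitive closure is reachability and not
only the existence of a nontrivial walk. -/
theorem conP_con {T : Tabs} (hA : IsMatrix inp G) (u v : Fin n) :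
    conP.sem n inp env T Table.con u 0 v 0 ≠ 0 ↔ G.Reachable u v := by
  set T₁ := (fill Table.con .size (.lit 1) .size (.lit 1) (or (eq (var 3) (var 1))
    (adj (var 3) (var 1)))).sem n inp env T with hT₁
  have h1 : ∀ u v : Fin n, T₁.rel Table.con n 1 (u, 0) (v, 0) ↔ u = v ∨ G.Adj u v := by
    intro u v
    have : T₁ Table.con u 0 v 0 ≠ 0 ↔ u = v ∨ G.Adj u v := by
      rw [hT₁, fill_iff (by decide) (by exact u.2) (by exact one_pos) (by exact v.2)
        (by exact one_pos)]
      simp only [Fm.eval_or, Fm.eval_eq, Fm.eval_adj, Tm.eval, List.getD_cons_zero,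
        List.getD_cons_succ, Fin.val_inj, hA u v]
    simp [Tabs.rel, this]
  have h2 := warshall_rel (n := n) (inp := inp) (env := env) (T := T₁) (id := Table.con)
    (b := .lit 1) (u, 0) (v, 0)
  have h3 : conP.sem n inp env T Table.con u 0 v 0 ≠ 0 ↔
      (conP.sem n inp env T).rel Table.con n 1 (u, 0) (v, 0) := by
    simp [Tabs.rel]
  rw [h3]
  refine h2.trans ⟨fun h => ?_, fun h => ?_⟩
  · have key : ∀ x y, Relation.TransGen (T₁.rel Table.con n 1) x y → ∀ u v : Fin n, x = (u.val, 0) →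
        y = (v.val, 0) → G.Reachable u v := by
      intro x y h
      induction h with
      | single h =>
        rintro u v rfl rfl
        rcases (h1 u v).1 h with rfl | h
        · exact .refl _
        · exact h.reachable
      | @tail y z _ h ih =>
        rintro u v rfl rfl
        obtain ⟨y1, y2⟩ := y
        obtain ⟨w, rfl⟩ := exists_fin h.1
        have : y2 = 0 := by have := h.2.1; simp only at this; omega
        subst this
        refine (ih u w rfl rfl).trans ?_
        rcases (h1 w v).1 h with rfl | h
        · exact .refl _
        · exact h.reachable
    exact key _ _ h u v rfl rfl
  · clear h2 h3
    obtain ⟨p⟩ := h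
    induction p with
    | nil => exact .single ((h1 _ _).2 (Or.inl rfl))
    | cons hadj q ih => exact .head ((h1 _ _).2 (Or.inr hadj)) ih

theorem subP_sub {T : Tabs} (hA : IsMatrix inp G)
    (hcon : ∀ u v : Fin n, T Table.con u 0 v 0 ≠ 0 ↔ G.Reachable u v) (v u : Fin n) :
    subP.sem n inp env T Table.sub v u 0 0 ≠ 0 ↔ Pinning.Sub G v u := by
  rw [subP, fill_iff (by decide) (by exact v.2) (by exact u.2) (by exact one_pos)
    (by exact one_pos)]
  simp only [Fm.eval_and, Fm.eval_imp, Fm.eval_all, Fm.eval_adj, eval_conF, Tm.eval,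
    List.getD_cons_zero, List.getD_cons_succ, Bd.val, forall_lt_fin, hA _ _, hcon, Pinning.Sub]

theorem eval_fullF {T : Tabs} {v : Fin n} {t : Tm} {env : List ℕ}
    (hL : ∀ (v : Fin n) (c : Fin 3), T Table.lst v c 0 0 ≠ 0 ↔ L v c)
    (ht : ∀ c, t.eval (c :: env) T = v) : (fullF t).eval n inp T env ↔ Pinning.Full L v := by
  simp only [fullF, Fm.eval_all, Fm.eval_tt, Tm.eval_get₂, Tm.eval, ht, List.getD_cons_zero, Bd.val,
    forall_lt_fin, hL, Pinning.Full]

theorem deadP_dead {T : Tabs}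
    (hL : ∀ (v : Fin n) (c : Fin 3), T Table.lst v c 0 0 ≠ 0 ↔ L v c)
    (hsub : ∀ v u : Fin n, T Table.sub v u 0 0 ≠ 0 ↔ Pinning.Sub G v u) (v : Fin n) :
    deadP.sem n inp env T Table.dead v 0 0 0 ≠ 0 ↔ Pinning.Dead G L v := by
  rw [deadP, fill_iff (by decide) (by exact v.2) (by exact one_pos) (by exact one_pos)
    (by exact one_pos)]
  have h2 : (fullF (var 4)).eval n inp T (0 :: 0 :: 0 :: v :: env) ↔ Pinning.Full L v :=
    eval_fullF hL fun c => rfl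
  have h1 : ∀ u : Fin n, (fullF (var 1)).eval n inp T (u :: 0 :: 0 :: 0 :: v :: env) ↔
    Pinning.Full L u := fun u => eval_fullF hL fun c => rfl
  simp only [Fm.eval_and, Fm.eval_or, Fm.eval_neg, Fm.eval_ex, Fm.eval_eq, Fm.eval_lt, Fm.eval_tt,
    Tm.eval_get₂, Tm.eval, List.getD_cons_zero, List.getD_cons_succ, Bd.val, exists_lt_fin, hsub,
    h2, h1, Pinning.Dead, Fin.val_inj, Fin.val_fin_lt, ne_eq]

/-- Several admissible representatives may be written one after the other, and the last one stays.
The existence of at least one is `Pinning.exists_not_dead`; a vertex that is not dead accepts only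
itself. -/
theorem repP_rep {T : Tabs} (hdead : ∀ v : Fin n, T Table.dead v 0 0 0 ≠ 0 ↔ Pinning.Dead G L v)
    (hsub : ∀ v u : Fin n, T Table.sub v u 0 0 ≠ 0 ↔ Pinning.Sub G v u) (v : Fin n) :
    ∃ u : Fin n, repP.sem n inp env T Table.rep v 0 0 0 = u ∧ ¬ Pinning.Dead G L u ∧
      Pinning.Sub G v u ∧ (¬ Pinning.Dead G L v → u = v) := by
  obtain ⟨u₀, h1, h2, h3⟩ : ∃ u : Fin n, ¬ Pinning.Dead G L u ∧
      Pinning.Sub G v u ∧ (¬ Pinning.Dead G L v → u = v) := by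
    by_cases hv : Pinning.Dead G L v
    · obtain ⟨u, h1, h2⟩ := Pinning.exists_not_dead G L v
      exact ⟨u, h1, h2, fun h => absurd hv h⟩
    · exact ⟨v, hv, .refl v, fun _ => rfl⟩
  set φ := and (neg (tt (get₁ Table.dead (var 0)))) (and (tt (get₂ Table.sub (var 1) (var 0)))
    (imp (neg (tt (get₁ Table.dead (var 1)))) (eq (var 0) (var 1)))) with hφ
  have step : ∀ (T' : Tabs) (w u : Fin n), T' Table.dead = T Table.dead → T' Table.sub = T Table.sub →
      (φ.eval n inp T' (u.val :: w.val :: env) ↔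
        ¬ Pinning.Dead G L u ∧ Pinning.Sub G w u ∧ (¬ Pinning.Dead G L w → u = w)) := by
    intro T' w u h1 h2
    simp only [hφ, Fm.eval_and, Fm.eval_neg, Fm.eval_imp, Fm.eval_tt, Fm.eval_eq, Tm.eval_get₁,
      Tm.eval_get₂, Tm.eval, List.getD_cons_zero, List.getD_cons_succ, h1, h2, hdead, hsub,
      Fin.val_inj]
  refine nest_reaches (fun T' : Tabs => T' Table.dead = T Table.dead ∧ T' Table.sub = T Table.sub)
    (fun T' : Tabs => ∃ u : Fin n, T' Table.rep v 0 0 0 = u ∧ ¬ Pinning.Dead G L u ∧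
      Pinning.Sub G v u ∧ (¬ Pinning.Dead G L v → u = v)) ⟨rfl, rfl⟩ ?_ ?_ [v, u₀]
    (.cons v.2 (.cons u₀.2 .nil)) ?_
  · rintro vs hvs T' ⟨h4, h5⟩
    exact ⟨(sem_of_not_writes (by decide)).trans h4, (sem_of_not_writes (by decide)).trans h5⟩
  · rintro vs (_ | ⟨hw, _ | ⟨hu, _ | _⟩⟩) T' ⟨h4, h5⟩ hQ
    obtain ⟨w, rfl⟩ := exists_fin hw
    obtain ⟨u, rfl⟩ := exists_fin hu
    by_cases h6 : φ.eval n inp T' (u.val :: w.val :: env)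
    · rw [show [w.val, u.val].reverse ++ env = u.val :: w.val :: env from rfl, sem_ite_pos h6, sem_store₁]
      rw [step T' w u h4 h5] at h6
      by_cases hwv : w = v
      · subst hwv
        exact ⟨u, by simp [Tabs.set, Tm.eval], h6⟩
      · have : v.val ≠ w.val := fun h => hwv (Fin.ext h).symm
        simpa [Tabs.set, Tm.eval, this] using hQ
    · rw [show [w.val, u.val].reverse ++ env = u.val :: w.val :: env from rfl, sem_ite_neg h6]
      exact hQ
  · rintro T' ⟨h4, h5⟩
    have h6 := (step T' v u₀ h4 h5).2 ⟨h1, h2, h3⟩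
    rw [show [v.val, u₀.val].reverse ++ env = u₀.val :: v.val :: env from rfl, sem_ite_pos h6, sem_store₁]
    exact ⟨u₀, by simp [Tabs.set, Tm.eval], h1, h2, h3⟩

end RAM

/-!
# The tables of rows
-/

namespace RAM

open Stmt Fm Tm

section Eval

variable {n : ℕ} {inp : ℕ → ℕ} {T : Tabs} {env : List ℕ}

theorem Stmt.sem_seq (p q : Stmt) :
    (seq p q).sem n inp env T = q.sem n inp env (p.sem n inp env T) := rfl

theorem Stmt.sem_skip : skip.sem n inp env T = T := rfl

theorem Stmt.loop_store {b : Bd} {id : ℕ} {a₁ a₂ a₃ a₄ t : Tm} (W : ℕ → ℕ → ℕ → ℕ → ℕ)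
    (h₁ : a₁.uses id = false) (h₂ : a₂.uses id = false) (h₃ : a₃.uses id = false)
    (h₄ : a₄.uses id = false) (ht : t.uses id = false)
    (hW : ∀ i, t.eval (i :: env) T = W (a₁.eval (i :: env) T) (a₂.eval (i :: env) T)
      (a₃.eval (i :: env) T) (a₄.eval (i :: env) T)) :
    (loop b (store id a₁ a₂ a₃ a₄ t)).sem n inp env T = T.upd id (fun x₁ x₂ x₃ x₄ => ∃ i < b.val n,
      x₁ = a₁.eval (i :: env) T ∧ x₂ = a₂.eval (i :: env) T ∧ x₃ = a₃.eval (i :: env) T ∧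
        x₄ = a₄.eval (i :: env) T) W := by
  refine iter_upd _ fun i T' hT' => ?_
  simp only [sem, Tm.eval_congr h₁ hT', Tm.eval_congr h₂ hT', Tm.eval_congr h₃ hT',
    Tm.eval_congr h₄ hT', Tm.eval_congr ht hT', hW]
  funext j x₁ x₂ x₃ x₄
  simp only [Tabs.set, Tabs.upd]
  by_cases h : j = id ∧ x₁ = a₁.eval (i :: env) T ∧ x₂ = a₂.eval (i :: env) T ∧
    x₃ = a₃.eval (i :: env) T ∧ x₄ = a₄.eval (i :: env) T
  · rw [if_pos h, if_pos h]
    obtain ⟨-, rfl, rfl, rfl, rfl⟩ := h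
    rfl
  · rw [if_neg h, if_neg h]

end Eval

variable {n : ℕ} {inp : ℕ → ℕ} {G : SimpleGraph (Fin n)} {L : Fin n → ℕ → Prop} {env : List ℕ}

/-- If the entry of a vertex in the table `h` is set, then the table `r` contains `k` vertices with
a given property. -/
def IsRowTable (T : Tabs) (h r k : ℕ) (R : Fin n → (ℕ → Fin n) → Prop) : Prop :=
  ∀ u : Fin n, T h u 0 0 0 ≠ 0 → ∃ s : ℕ → Fin n, (∀ j < k, T r u j 0 0 = s j) ∧ R u s

theorem IsRowTable.mono {T : Tabs} {h r k : ℕ} {R R' : Fin n → (ℕ → Fin n) → Prop}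
    (hT : IsRowTable T h r k R) (hR : ∀ u s, R u s → R' u s) : IsRowTable T h r k R' := by
  intro u hu
  obtain ⟨s, h1, h2⟩ := hT u hu
  exact ⟨s, h1, hR u s h2⟩

theorem exists_lt_six {p : ℕ → Prop} :
    (∃ j < 6, p j) ↔ p 0 ∨ p 1 ∨ p 2 ∨ p 3 ∨ p 4 ∨ p 5 := by
  constructor
  · rintro ⟨j, hj, h⟩
    interval_cases j <;> tauto
  · rintro (h | h | h | h | h | h)
    exacts [⟨0, by omega, h⟩, ⟨1, by omega, h⟩, ⟨2, by omega, h⟩, ⟨3, by omega, h⟩,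
      ⟨4, by omega, h⟩, ⟨5, by omega, h⟩]

theorem eval_domRowF {T : Tabs} (hA : IsMatrix inp G)
    (hL : ∀ (v : Fin n) (c : Fin 3), T Table.lst v c 0 0 ≠ 0 ↔ L v c)
    (hcon : ∀ u v : Fin n, T Table.con u 0 v 0 ≠ 0 ↔ G.Reachable u v)
    (hdead : ∀ v : Fin n, T Table.dead v 0 0 0 ≠ 0 ↔ Pinning.Dead G L v) (s : ℕ → Fin n) :
    domRowF.eval n inp T ((s 5).val :: (s 4).val :: (s 3).val :: (s 2).val :: (s 1).val ::
      (s 0).val :: env) ↔ Pinning.IsDominatingRow G L (s 0) s := by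
  have h1 : ∀ v : Fin n, (fullF (var 1)).eval n inp T (v.val :: (s 5).val :: (s 4).val ::
    (s 3).val :: (s 2).val :: (s 1).val :: (s 0).val :: env) ↔ Pinning.Full L v :=
    fun v => eval_fullF hL fun c => rfl
  simp only [domRowF, Fm.eval_or, Fm.eval_neg, Fm.eval_all, Fm.eval_imp, Fm.eval_eq, Fm.eval_tt,
    Fm.eval_adj, eval_conF, Tm.eval_get₁, Tm.eval, List.getD_cons_zero, List.getD_cons_succ, Bd.val,
    forall_lt_fin, hA _ _, hcon, hdead, h1, Fin.val_inj, Pinning.IsDominatingRow, exists_lt_six]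

/-- The first half is an invariant of the search: whatever has been stored is a dominating row. The
second half says that the search cannot fail if there is such a row. -/
theorem domRowP_row {T : Tabs} (hA : IsMatrix inp G)
    (hL : ∀ (v : Fin n) (c : Fin 3), T Table.lst v c 0 0 ≠ 0 ↔ L v c)
    (hcon : ∀ u v : Fin n, T Table.con u 0 v 0 ≠ 0 ↔ G.Reachable u v)
    (hdead : ∀ v : Fin n, T Table.dead v 0 0 0 ≠ 0 ↔ Pinning.Dead G L v)
    (h0 : ∀ v : Fin n, T Table.has v 0 0 0 = 0) :
    IsRowTable (domRowP.sem n inp env T) Table.has Table.row 7 (Pinning.IsDominatingRow G L) ∧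
      ∀ s : ℕ → Fin n, Pinning.IsDominatingRow G L (s 0) s →
        domRowP.sem n inp env T Table.has (s 0) 0 0 0 ≠ 0 := by
  -- A dominating row has only six entries; the seventh repeats the first to match the length of a
  -- cycle row.
  have step : ∀ (v₀ v₁ v₂ v₃ v₄ v₅ : Fin n), ∃ s : ℕ → Fin n, s 0 = v₀ ∧ s 1 = v₁ ∧ s 2 = v₂ ∧
      s 3 = v₃ ∧ s 4 = v₄ ∧ s 5 = v₅ ∧ s 6 = v₀ := fun v₀ v₁ v₂ v₃ v₄ v₅ =>
    ⟨fun j => [v₀, v₁, v₂, v₃, v₄, v₅].getD j v₀, rfl, rfl, rfl, rfl, rfl, rfl, rfl⟩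
  set P : Tabs → Prop := fun T' => T' Table.lst = T Table.lst ∧ T' Table.con = T Table.con ∧
    T' Table.dead = T Table.dead with hPdef
  have hP : ∀ (env' : List ℕ) (p : Stmt) T', p.writes Table.lst = false →
      p.writes Table.con = false → p.writes Table.dead = false → P T' → P (p.sem n inp env' T') :=
    fun env' p T' h1 h2 h3 h => ⟨(sem_of_not_writes h1).trans h.1,
      (sem_of_not_writes h2).trans h.2.1, (sem_of_not_writes h3).trans h.2.2⟩
  have hF : ∀ (T' : Tabs) (s : ℕ → Fin n), P T' → (domRowF.eval n inp T' ((s 5).val :: (s 4).val ::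
      (s 3).val :: (s 2).val :: (s 1).val :: (s 0).val :: env) ↔
        Pinning.IsDominatingRow G L (s 0) s) := fun T' s h =>
    eval_domRowF hA (by rw [h.1]; exact hL) (by rw [h.2.1]; exact hcon) (by rw [h.2.2]; exact hdead) s
  constructor
  · refine (nest_induction (fun T' => P T' ∧
      IsRowTable T' Table.has Table.row 7 (Pinning.IsDominatingRow G L)) ⟨⟨rfl, rfl, rfl⟩,
        fun u hu => absurd (h0 u) hu⟩ ?_).2
    rintro vs (_ | ⟨h0, _ | ⟨h1, _ | ⟨h2, _ | ⟨h3, _ | ⟨h4, _ | ⟨h5, _ | _⟩⟩⟩⟩⟩⟩) T' ⟨hT', hrow⟩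
    refine ⟨hP _ _ _ (by decide) (by decide) (by decide) hT', ?_⟩
    obtain ⟨s, e0, e1, e2, e3, e4, e5, e6⟩ := step ⟨_, h0⟩ ⟨_, h1⟩ ⟨_, h2⟩ ⟨_, h3⟩ ⟨_, h4⟩ ⟨_, h5⟩
    rw [Fin.ext_iff] at e0 e1 e2 e3 e4 e5 e6
    simp only at e0 e1 e2 e3 e4 e5 e6
    simp only [List.reverse_cons, List.reverse_nil, List.nil_append, List.cons_append, ← e0, ← e1,
      ← e2, ← e3, ← e4, ← e5]
    by_cases h6 : Pinning.IsDominatingRow G L (s 0) s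
    · rw [sem_ite_pos ((hF T' s hT').2 h6)]
      simp only [Stmt.sem_seq, Stmt.sem_store₁, Stmt.sem_store₂, Tm.eval, List.getD_cons_zero,
        List.getD_cons_succ]
      intro u hu
      by_cases h7 : u = s 0
      · subst h7
        refine ⟨s, fun j hj => ?_, h6⟩
        interval_cases j <;> simp [Tabs.set, Table.row, Table.has, e6, e0]
      · have h8 : u.val ≠ (s 0).val := fun h => h7 (Fin.ext h)
        simp only [Tabs.set, h8, false_and, and_false, if_false] at hu ⊢
        exact hrow u hu
    · rw [sem_ite_neg (mt (hF T' s hT').1 h6)]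
      exact hrow
  · intro s hs
    refine nest_reaches P (fun T' : Tabs => T' Table.has (s 0) 0 0 0 ≠ 0) ⟨rfl, rfl, rfl⟩
      (fun vs _ T' => hP _ _ _ (by decide) (by decide) (by decide)) ?_ [(s 0).val, (s 1).val,
        (s 2).val, (s 3).val, (s 4).val, (s 5).val] (.cons (s 0).2 (.cons (s 1).2 (.cons (s 2).2
          (.cons (s 3).2 (.cons (s 4).2 (.cons (s 5).2 .nil)))))) ?_
    · rintro vs - T' - hQ
      by_cases h : domRowF.eval n inp T' (vs.reverse ++ env)
      · rw [sem_ite_pos h]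
        simp only [Stmt.sem_seq, Stmt.sem_store₁, Stmt.sem_store₂, Tm.eval]
        simp only [Tabs.set, Table.row, Table.has] at hQ ⊢
        split_ifs <;> simp_all
      · rwa [sem_ite_neg h]
    · intro T' hT'
      simp only [List.reverse_cons, List.reverse_nil, List.nil_append, List.cons_append]
      rw [sem_ite_pos ((hF T' s hT').2 hs)]
      simp [Stmt.sem_seq, Stmt.sem_store₁, Stmt.sem_store₂, Tm.eval, Tabs.set]

theorem eval_cycF {T : Tabs} (hA : IsMatrix inp G) (a b c d e : Fin n) :
    cycF.eval n inp T (e.val :: d.val :: c.val :: b.val :: a.val :: env) ↔ G.IsC5 a b c d e := by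
  simp only [cycF, Fm.eval_and, Fm.eval_neg, Fm.eval_adj, Tm.eval, List.getD_cons_zero,
    List.getD_cons_succ, hA _ _]
  exact ⟨fun ⟨h1, h2, h3, h4, h5, h6, h7, h8, h9, h10⟩ => ⟨h1, h2, h3, h4, h5, h6, h7, h8, h9, h10⟩,
    fun h => ⟨h.ab, h.bc, h.cd, h.de, h.ea, h.ac, h.bd, h.ce, h.da, h.eb⟩⟩

theorem cycP_cyc {T : Tabs} (hA : IsMatrix inp G) (h0 : ∀ v : Fin n, T Table.hasCyc v 0 0 0 = 0) :
    IsRowTable (cycP.sem n inp env T) Table.hasCyc Table.cyc 5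
      (fun u s => s 0 = u ∧ G.IsC5 (s 0) (s 1) (s 2) (s 3) (s 4)) ∧
      ∀ a b c d e, G.IsC5 a b c d e → cycP.sem n inp env T Table.hasCyc a 0 0 0 ≠ 0 := by
  constructor
  · refine nest_induction (fun T' => IsRowTable T' Table.hasCyc Table.cyc 5
      (fun u s => s 0 = u ∧ G.IsC5 (s 0) (s 1) (s 2) (s 3) (s 4))) (fun u hu => absurd (h0 u) hu) ?_
    rintro vs (_ | ⟨h0, _ | ⟨h1, _ | ⟨h2, _ | ⟨h3, _ | ⟨h4, _ | _⟩⟩⟩⟩⟩) T' hrow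
    obtain ⟨a, rfl⟩ := exists_fin h0
    obtain ⟨b, rfl⟩ := exists_fin h1
    obtain ⟨c, rfl⟩ := exists_fin h2
    obtain ⟨d, rfl⟩ := exists_fin h3
    obtain ⟨e, rfl⟩ := exists_fin h4
    simp only [List.reverse_cons, List.reverse_nil, List.nil_append, List.cons_append]
    by_cases h6 : G.IsC5 a b c d e
    · rw [sem_ite_pos ((eval_cycF hA a b c d e).2 h6)]
      simp only [Stmt.sem_seq, Stmt.sem_store₁, Stmt.sem_store₂, Tm.eval, List.getD_cons_zero,
        List.getD_cons_succ]
      intro u hu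
      by_cases h7 : u = a
      · subst h7
        refine ⟨fun j => [u, b, c, d, e].getD j u, fun j hj => ?_, rfl, h6⟩
        interval_cases j <;> simp [Tabs.set, Table.cyc, Table.hasCyc] <;> rfl
      · have h8 : u.val ≠ a.val := fun h => h7 (Fin.ext h)
        simp only [Tabs.set, h8, false_and, and_false, if_false] at hu ⊢
        exact hrow u hu
    · rw [sem_ite_neg (mt (eval_cycF hA a b c d e).1 h6)]
      exact hrow
  · intro a b c d e h
    refine nest_reaches (fun _ => True) (fun T' : Tabs => T' Table.hasCyc a 0 0 0 ≠ 0) trivial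
      (fun _ _ _ _ => trivial) ?_ [a.val, b.val, c.val, d.val, e.val]
        (.cons a.2 (.cons b.2 (.cons c.2 (.cons d.2 (.cons e.2 .nil))))) ?_
    · rintro vs - T' - hQ
      by_cases h : cycF.eval n inp T' (vs.reverse ++ env)
      · rw [sem_ite_pos h]
        simp only [Stmt.sem_seq, Stmt.sem_store₁, Stmt.sem_store₂, Tm.eval]
        simp only [Tabs.set, Table.cyc, Table.hasCyc] at hQ ⊢
        split_ifs <;> simp_all
      · rwa [sem_ite_neg h]
    · intro T' hT'
      simp only [List.reverse_cons, List.reverse_nil, List.nil_append, List.cons_append]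
      rw [sem_ite_pos ((eval_cycF hA a b c d e).2 h)]
      simp [Stmt.sem_seq, Stmt.sem_store₁, Stmt.sem_store₂, Tm.eval, Tabs.set]

theorem eval_hitF {T : Tabs} (hA : IsMatrix inp G)
    (hcon : ∀ u v : Fin n, T Table.con u 0 v 0 ≠ 0 ↔ G.Reachable u v) {u : Fin n} {s : ℕ → Fin n}
    (hs : ∀ j < 5, T Table.cyc u j 0 0 = s j) (h : G.IsC5 (s 0) (s 1) (s 2) (s 3) (s 4)) :
    hitF.eval n inp T ((s 6).val :: (s 5).val :: u.val :: env) ↔ Pinning.IsCycleRow G u s := by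
  have hs' : ∀ j : Fin 5, T Table.cyc u j 0 0 = s j := fun j => hs j j.2
  simp only [hitF, touF, Fm.eval_or, Fm.eval_neg, Fm.eval_all, Fm.eval_ex, Fm.eval_imp, Fm.eval_and,
    Fm.eval_adj, eval_conF, Tm.eval_get₂, Tm.eval, List.getD_cons_zero, List.getD_cons_succ, Bd.val,
    exists_lt_fin, forall_lt_fin, hs', hA _ _, hcon, Pinning.IsCycleRow, h, true_and]

/-- The search for `p` and `q` is exhaustive; by `Pinning.exists_hitting_row` it succeeds at every
vertex for which a cycle is stored and no row has been found yet. Older rows are kept. -/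
theorem hitP_row {T : Tabs} (hT : G.CliqueFree 3)
    (hP : ¬ (SimpleGraph.pathGraph 7).IsIndContained G) (hA : IsMatrix inp G)
    (hcon : ∀ u v : Fin n, T Table.con u 0 v 0 ≠ 0 ↔ G.Reachable u v)
    (hcyc : IsRowTable T Table.hasCyc Table.cyc 5
      (fun u s => s 0 = u ∧ G.IsC5 (s 0) (s 1) (s 2) (s 3) (s 4)))
    {R : Fin n → (ℕ → Fin n) → Prop} (hrow : IsRowTable T Table.has Table.row 7 R) :
    IsRowTable (hitP.sem n inp env T) Table.has Table.row 7
      (fun u s => R u s ∨ Pinning.IsCycleRow G u s) ∧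
      (∀ u : Fin n, T Table.has u 0 0 0 ≠ 0 → hitP.sem n inp env T Table.has u 0 0 0 ≠ 0) ∧
      ∀ u : Fin n, T Table.hasCyc u 0 0 0 ≠ 0 → hitP.sem n inp env T Table.has u 0 0 0 ≠ 0 := by
  set P : Tabs → Prop := fun T' => T' Table.con = T Table.con ∧ T' Table.hasCyc = T Table.hasCyc ∧
    T' Table.cyc = T Table.cyc with hPdef
  have hP' : ∀ (env' : List ℕ) (p : Stmt) T', p.writes Table.con = false →
      p.writes Table.hasCyc = false → p.writes Table.cyc = false → P T' → P (p.sem n inp env' T') :=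
    fun env' p T' h1 h2 h3 h => ⟨(sem_of_not_writes h1).trans h.1,
      (sem_of_not_writes h2).trans h.2.1, (sem_of_not_writes h3).trans h.2.2⟩
  set φ := and (tt (get₁ Table.hasCyc (var 2))) (and (neg (tt (get₁ Table.has (var 2)))) hitF)
  have hloop : ∀ (T' : Tabs) (env' : List ℕ) (u p q : ℕ), (loop (.lit 5) (store₂ Table.row (var 3)
      (var 0) (get₂ Table.cyc (var 3) (var 0)))).sem n inp (q :: p :: u :: env') T' =
      T'.upd Table.row (fun x₁ x₂ x₃ x₄ => ∃ i < 5, x₁ = u ∧ x₂ = i ∧ x₃ = 0 ∧ x₄ = 0)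
        (fun x₁ x₂ _ _ => T' Table.cyc x₁ x₂ 0 0) := fun T' env' u p q =>
    loop_store (fun x₁ x₂ _ _ => T' Table.cyc x₁ x₂ 0 0) (by decide) (by decide) (by decide)
      (by decide) (by decide) fun i => rfl
  have hmono : ∀ (u : Fin n) (vs : List ℕ), List.Forall₂ (fun v b => v < Bd.val n b) vs
      [.size, .size, .size] → ∀ T', T' Table.has u 0 0 0 ≠ 0 → (ite φ (seq (loop (.lit 5)
        (store₂ Table.row (var 3) (var 0) (get₂ Table.cyc (var 3) (var 0))))
      (seq (store₂ Table.row (var 2) (cst 5) (var 1)) (seq (store₂ Table.row (var 2) (cst 6) (var 0))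
      (store₁ Table.has (var 2) (cst 1))))) skip).sem n inp (vs.reverse ++ env) T' Table.has u 0 0 0
        ≠ 0 := by
    rintro u vs (_ | ⟨h0, _ | ⟨h1, _ | ⟨h2, _ | _⟩⟩⟩) T' hQ
    obtain ⟨a, rfl⟩ := exists_fin h0
    obtain ⟨b, rfl⟩ := exists_fin h1
    obtain ⟨c, rfl⟩ := exists_fin h2
    simp only [List.reverse_cons, List.reverse_nil, List.nil_append, List.cons_append]
    by_cases h : φ.eval n inp T' (c.val :: b.val :: a.val :: env)
    · rw [sem_ite_pos h]
      simp only [Stmt.sem_seq, Stmt.sem_store₁, Stmt.sem_store₂, Tm.eval, hloop]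
      simp only [Tabs.set, Tabs.upd, Table.row, Table.has] at hQ ⊢
      split_ifs <;> simp_all
    · rwa [sem_ite_neg h]
  refine ⟨?_, fun u hu => ?_, fun u hu => ?_⟩
  · refine (nest_induction (fun T' => P T' ∧ IsRowTable T' Table.has Table.row 7
      (fun u s => R u s ∨ Pinning.IsCycleRow G u s)) ⟨⟨rfl, rfl, rfl⟩,
        hrow.mono fun u s => Or.inl⟩ ?_).2
    rintro vs (_ | ⟨h0, _ | ⟨h1, _ | ⟨h2, _ | _⟩⟩⟩) T' ⟨hT', hrow⟩
    refine ⟨hP' _ _ _ (by decide) (by decide) (by decide) hT', ?_⟩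
    obtain ⟨u, rfl⟩ := exists_fin h0
    obtain ⟨p, rfl⟩ := exists_fin h1
    obtain ⟨q, rfl⟩ := exists_fin h2
    simp only [List.reverse_cons, List.reverse_nil, List.nil_append, List.cons_append]
    by_cases h6 : φ.eval n inp T' (q.val :: p.val :: u.val :: env)
    · rw [sem_ite_pos h6]
      obtain ⟨h7, h8, h9⟩ := h6
      replace h7 : T' Table.hasCyc u 0 0 0 ≠ 0 := h7
      rw [hT'.2.1] at h7
      obtain ⟨s, hs, hs0, hc⟩ := hcyc u h7
      obtain ⟨s', hs', hp, hq⟩ : ∃ s' : ℕ → Fin n, (∀ j < 5, s' j = s j) ∧ s' 5 = p ∧ s' 6 = q :=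
        ⟨fun j => if j < 5 then s j else if j = 5 then p else q, fun j hj => if_pos hj, rfl, rfl⟩
      have hcr : Pinning.IsCycleRow G u s' := by
        refine (eval_hitF hA (T := T') (env := env) (by rw [hT'.1]; exact hcon) (fun j hj => ?_)
          ?_).1 (by rw [hp, hq]; exact h9)
        · rw [hT'.2.2, hs j hj, hs' j hj]
        · rw [hs' 0 (by omega), hs' 1 (by omega), hs' 2 (by omega), hs' 3 (by omega),
            hs' 4 (by omega)]
          exact hc
      simp only [Stmt.sem_seq, Stmt.sem_store₁, Stmt.sem_store₂, Tm.eval, List.getD_cons_zero,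
        List.getD_cons_succ, hloop]
      intro w hw
      by_cases h10 : w = u
      · subst h10
        refine ⟨s', fun j hj => ?_, Or.inr hcr⟩
        by_cases h11 : j < 5
        · have h12 : j ≠ 5 := by omega
          have h13 : j ≠ 6 := by omega
          simp [Tabs.set, Tabs.upd, Table.row, Table.has, h11, h12, h13, hT'.2.2]
          rw [hs' j h11]
          exact hs j h11
        · obtain rfl | rfl : j = 5 ∨ j = 6 := by omega
          all_goals simp [Tabs.set, Table.row, Table.has, hp, hq]
      · have h8 : w.val ≠ u.val := fun h => h10 (Fin.ext h)
        simp only [Tabs.set, Tabs.upd, h8, false_and, and_false, exists_false, if_false] at hw ⊢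
        exact hrow w hw
    · rw [sem_ite_neg h6]
      exact hrow
  · exact nest_induction (fun T' : Tabs => T' Table.has u 0 0 0 ≠ 0) hu (hmono u)
  · obtain ⟨s, hs, hs0, hc⟩ := hcyc u hu
    obtain ⟨p, q, hpq⟩ := Pinning.exists_hitting_row hT hP hc
    refine nest_reaches P (fun T' : Tabs => T' Table.has u 0 0 0 ≠ 0) ⟨rfl, rfl, rfl⟩
      (fun vs _ T' => hP' _ _ _ (by decide) (by decide) (by decide))
      (fun vs hvs T' _ => hmono u vs hvs T') [u.val, p.val, q.val]
        (.cons u.2 (.cons p.2 (.cons q.2 .nil))) fun T' hT' => ?_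
    by_cases hhas : T' Table.has u 0 0 0 ≠ 0
    · exact hmono u [u.val, p.val, q.val] (.cons u.2 (.cons p.2 (.cons q.2 .nil))) T' hhas
    · obtain ⟨s', hs', hp, hq⟩ : ∃ s' : ℕ → Fin n, (∀ j < 5, s' j = s j) ∧ s' 5 = p ∧ s' 6 = q :=
        ⟨fun j => if j < 5 then s j else if j = 5 then p else q, fun j hj => if_pos hj, rfl, rfl⟩
      have h6 : φ.eval n inp T' (q.val :: p.val :: u.val :: env) := by
        refine ⟨?_, hhas, ?_⟩
        · change T' Table.hasCyc u 0 0 0 ≠ 0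
          rw [hT'.2.1]
          exact hu
        · rw [← hp, ← hq]
          refine (eval_hitF hA (by rw [hT'.1]; exact hcon) (fun j hj => ?_) ?_).2
            (hs0 ▸ hpq s' hs' hp hq)
          · rw [hT'.2.2, hs j hj, hs' j hj]
          · rw [hs' 0 (by omega), hs' 1 (by omega), hs' 2 (by omega), hs' 3 (by omega),
              hs' 4 (by omega)]
            exact hc
      simp only [List.reverse_cons, List.reverse_nil, List.nil_append, List.cons_append]
      rw [sem_ite_pos h6]
      simp [Stmt.sem_seq, Stmt.sem_store₁, Stmt.sem_store₂, Tm.eval, Tabs.set]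

/-- The least vertex with a row is the same for all vertices of a component. So the whole component
shares one row, and any vertex of it can serve to look the row up. -/
theorem baseP_base {T : Tabs}
    (hcon : ∀ u v : Fin n, T Table.con u 0 v 0 ≠ 0 ↔ G.Reachable u v) {v u₀ : Fin n}
    (hvu : G.Reachable v u₀) (hu₀ : T Table.has u₀ 0 0 0 ≠ 0) :
    ∃ u : Fin n, G.Reachable v u ∧ T Table.has u 0 0 0 ≠ 0 ∧
      (∀ w : Fin n, G.Reachable v w → T Table.has w 0 0 0 ≠ 0 → u ≤ w) ∧
      ∀ j < 7, baseP.sem n inp env T Table.base v j 0 0 = T Table.row u j 0 0 := by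
  classical
  set P : Tabs → Prop := fun T' => T' Table.con = T Table.con ∧ T' Table.has = T Table.has ∧
    T' Table.row = T Table.row with hPdef
  set M : Fin n → Fin n → Prop := fun v u => G.Reachable v u ∧ T Table.has u 0 0 0 ≠ 0 ∧
    ∀ w : Fin n, G.Reachable v w → T Table.has w 0 0 0 ≠ 0 → u ≤ w with hM
  obtain ⟨u₁, hu₁⟩ : ∃ u, M v u := by
    obtain ⟨u, h1, h2⟩ := (Finset.univ.filter fun u : Fin n => G.Reachable v u ∧
      T Table.has u 0 0 0 ≠ 0).exists_min_image id ⟨u₀, by simp [hvu, hu₀]⟩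
    simp only [Finset.mem_filter, Finset.mem_univ, true_and] at h1 h2
    exact ⟨u, h1.1, h1.2, fun w h3 h4 => h2 w ⟨h3, h4⟩⟩
  set φ := and (conF (var 1) (var 0)) (and (tt (get₁ Table.has (var 0))) (all .size
    (imp (conF (var 2) (var 0)) (imp (tt (get₁ Table.has (var 0))) (neg (lt (var 0) (var 1)))))))
    with hφ
  have step : ∀ (T' : Tabs) (w u : Fin n), P T' → (φ.eval n inp T' (u.val :: w.val :: env) ↔
      M w u) := by
    intro T' w u h
    simp only [hφ, Fm.eval_and, Fm.eval_all, Fm.eval_imp, Fm.eval_neg, Fm.eval_lt, eval_conF,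
      Fm.eval_tt, Tm.eval_get₁, Tm.eval, List.getD_cons_zero, List.getD_cons_succ, h.1, h.2.1, hcon,
      forall_lt_fin, Bd.val, Fin.val_fin_le, hM, not_lt]
  have hloop : ∀ (T' : Tabs) (u w : ℕ), (loop (.lit 7) (store₂ Table.base (var 2) (var 0)
      (get₂ Table.row (var 1) (var 0)))).sem n inp (u :: w :: env) T' =
      T'.upd Table.base (fun x₁ x₂ x₃ x₄ => ∃ i < 7, x₁ = w ∧ x₂ = i ∧ x₃ = 0 ∧ x₄ = 0)
        (fun _ x₂ _ _ => T' Table.row u x₂ 0 0) := fun T' u w =>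
    loop_store (fun _ x₂ _ _ => T' Table.row u x₂ 0 0) (by decide) (by decide) (by decide)
      (by decide) (by decide) fun i => rfl
  have new : ∀ (T' : Tabs) (w u : Fin n), P T' → M w u → ∃ u', M w u' ∧ ∀ j < 7, T'.upd Table.base
        (fun x₁ x₂ x₃ x₄ => ∃ i < 7, x₁ = w.val ∧ x₂ = i ∧ x₃ = 0 ∧ x₄ = 0)
        (fun _ x₂ _ _ => T' Table.row u x₂ 0 0) Table.base w j 0 0 = T Table.row u' j 0 0 := by
    intro T' w u h h6
    refine ⟨u, h6, fun j hj => ?_⟩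
    simp only [Tabs.upd, true_and, and_true, exists_eq_right', hj, if_true]
    rw [h.2.2]
  suffices h : ∃ u, M v u ∧ ∀ j < 7, baseP.sem n inp env T Table.base v j 0 0 =
      T Table.row u j 0 0 by
    obtain ⟨u, h1, h2⟩ := h
    exact ⟨u, h1.1, h1.2.1, h1.2.2, h2⟩
  refine nest_reaches P (fun T' : Tabs => ∃ u, M v u ∧ ∀ j < 7, T' Table.base v j 0 0 =
    T Table.row u j 0 0) ⟨rfl, rfl, rfl⟩ ?_ ?_ [v, u₁] (.cons v.2 (.cons u₁.2 .nil)) ?_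
  · rintro vs hvs T' ⟨h4, h5, h6⟩
    exact ⟨(sem_of_not_writes (by decide)).trans h4, (sem_of_not_writes (by decide)).trans h5,
      (sem_of_not_writes (by decide)).trans h6⟩
  · rintro vs (_ | ⟨hw, _ | ⟨hu, _ | _⟩⟩) T' hT' hQ
    obtain ⟨w, rfl⟩ := exists_fin hw
    obtain ⟨u, rfl⟩ := exists_fin hu
    simp only [List.reverse_cons, List.reverse_nil, List.nil_append, List.cons_append]
    by_cases h6 : φ.eval n inp T' (u.val :: w.val :: env)
    · rw [sem_ite_pos h6, hloop]
      rw [step T' w u hT'] at h6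
      by_cases hwv : w = v
      · subst hwv
        exact new T' w u hT' h6
      · have : v.val ≠ w.val := fun h => hwv (Fin.ext h).symm
        simpa only [Tabs.upd, this, false_and, and_false, exists_false, if_false] using hQ
    · rw [sem_ite_neg h6]
      exact hQ
  · intro T' hT'
    simp only [List.reverse_cons, List.reverse_nil, List.nil_append, List.cons_append]
    rw [sem_ite_pos ((step T' v u₁ hT').2 hu₁), hloop]
    exact new T' v u₁ hT' hu₁

end RAM

/-!
# The result of the preparation
-/

namespace RAM

open Stmt Fm Tm

variable {n : ℕ} {inp : ℕ → ℕ} {G : SimpleGraph (Fin n)} {L : Fin n → ℕ → Prop} {env : List ℕ}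

/-- The tables that are computed before the loop over all guesses are correct. -/
structure IsPrepared (G : SimpleGraph (Fin n)) (L : Fin n → ℕ → Prop) (T : Tabs) : Prop where
  lst : ∀ (v : Fin n) (c : Fin 3), T Table.lst v c 0 0 ≠ 0 ↔ L v c
  con : ∀ u v : Fin n, T Table.con u 0 v 0 ≠ 0 ↔ G.Reachable u v
  dead : ∀ v : Fin n, T Table.dead v 0 0 0 ≠ 0 ↔ Pinning.Dead G L v
  rep : ∀ v : Fin n, ∃ u : Fin n, T Table.rep v 0 0 0 = u ∧ ¬ Pinning.Dead G L u ∧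
    Pinning.Sub G v u ∧ (¬ Pinning.Dead G L v → u = v)
  base : ∀ v : Fin n, ∃ s : ℕ → Fin n, (Pinning.IsDominatingRow G L v s ∨
    Pinning.IsCycleRow G v s) ∧ ∀ w, G.Reachable v w → ∀ j < 7, T Table.base w j 0 0 = s j

theorem IsPrepared.sem {T : Tabs} (h : IsPrepared G L T) {p : Stmt}
    (h₁ : p.writes Table.lst = false) (h₂ : p.writes Table.con = false)
    (h₃ : p.writes Table.dead = false) (h₄ : p.writes Table.rep = false)
    (h₅ : p.writes Table.base = false) : IsPrepared G L (p.sem n inp env T) where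
  lst := by rw [sem_of_not_writes h₁]; exact h.lst
  con := by rw [sem_of_not_writes h₂]; exact h.con
  dead := by rw [sem_of_not_writes h₃]; exact h.dead
  rep := by rw [sem_of_not_writes h₄]; exact h.rep
  base := by rw [sem_of_not_writes h₅]; exact h.base

theorem IsDominatingRow.of_reachable {ρ u : Fin n} {s : ℕ → Fin n}
    (h : Pinning.IsDominatingRow G L ρ s) (hu : G.Reachable ρ u) :
    Pinning.IsDominatingRow G L u s := fun v hv => h v (hu.trans hv)

theorem IsCycleRow.of_reachable {ρ u : Fin n} {s : ℕ → Fin n}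
    (h : Pinning.IsCycleRow G ρ s) (hu : G.Reachable ρ u) : Pinning.IsCycleRow G u s :=
  ⟨h.1, h.2.1, h.2.2.1, fun a b ha => h.2.2.2 a b (hu.trans ha)⟩

theorem prepP_isPrepared {φ : Fm} (hT : G.CliqueFree 3)
    (hP : ¬ (SimpleGraph.pathGraph 7).IsIndContained G) (hA : IsMatrix inp G)
    (hφ : ∀ (T : Tabs) (v : Fin n) (c : Fin 3), φ.eval n inp T [0, 0, c, v] ↔ L v c)
    (hlst : φ.uses Table.lst = false) : IsPrepared G L ((prepP φ).sem n inp [] fun _ _ _ _ _ => 0) := by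
  have fr : ∀ {j : ℕ} {p : Stmt} {T : Tabs}, p.writes j = false → p.sem n inp [] T j = T j :=
    fun h => sem_of_not_writes h
  simp only [prepP, Stmt.sem_seq]
  set T₀ : Tabs := fun _ _ _ _ _ => 0
  set T₁ := (lstP φ).sem n inp [] T₀ with hT₁
  have lst₁ : ∀ (v : Fin n) (c : Fin 3), T₁ Table.lst v c 0 0 ≠ 0 ↔ L v c := by
    intro v c
    rw [hT₁, lstP, fill_iff hlst (by exact v.2) (by exact c.2) (by exact one_pos)
      (by exact one_pos), hφ]
  have z : ∀ {j : ℕ} {p : Stmt} {T : Tabs}, p.writes j = false → T j = (fun _ _ _ _ => 0) →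
    p.sem n inp [] T j = (fun _ _ _ _ => 0) := fun h h' => (fr h).trans h'
  have zhas : T₁ Table.has = fun _ _ _ _ => 0 := z rfl rfl
  have zcyc : T₁ Table.hasCyc = fun _ _ _ _ => 0 := z rfl rfl
  set T₂ := conP.sem n inp [] T₁ with hT₂
  have con₂ : ∀ u v : Fin n, T₂ Table.con u 0 v 0 ≠ 0 ↔ G.Reachable u v := conP_con hA
  set T₃ := subP.sem n inp [] T₂ with hT₃
  have sub₃ : ∀ v u : Fin n, T₃ Table.sub v u 0 0 ≠ 0 ↔ Pinning.Sub G v u := subP_sub hA con₂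
  have lst₃ : T₃ Table.lst = T₁ Table.lst := (fr (by decide)).trans (fr (by decide))
  set T₄ := deadP.sem n inp [] T₃ with hT₄
  have dead₄ : ∀ v : Fin n, T₄ Table.dead v 0 0 0 ≠ 0 ↔ Pinning.Dead G L v :=
    deadP_dead (by rw [lst₃]; exact lst₁) sub₃
  set T₅ := repP.sem n inp [] T₄ with hT₅
  have rep₅ := repP_rep (n := n) (inp := inp) (env := []) dead₄
    (by rw [show T₄ Table.sub = T₃ Table.sub from fr (by decide)]; exact sub₃)
  have lst₅ : T₅ Table.lst = T₁ Table.lst := ((fr (by decide)).trans (fr (by decide))).trans lst₃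
  have con₅ : T₅ Table.con = T₂ Table.con :=
    ((fr (by decide)).trans (fr (by decide))).trans (fr (by decide))
  have dead₅ : T₅ Table.dead = T₄ Table.dead := fr (by decide)
  have has₅ : T₅ Table.has = fun _ _ _ _ => 0 :=
    z (by decide) (z (by decide) (z (by decide) (z (by decide) zhas)))
  have hcyc₅ : T₅ Table.hasCyc = fun _ _ _ _ => 0 :=
    z (by decide) (z (by decide) (z (by decide) (z (by decide) zcyc)))
  set T₆ := domRowP.sem n inp [] T₅ with hT₆
  obtain ⟨row₆, dom₆⟩ := domRowP_row (n := n) (inp := inp) (env := []) (T := T₅) hA (L := L)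
    (by rw [lst₅]; exact lst₁) (by rw [con₅]; exact con₂) (by rw [dead₅]; exact dead₄)
    (by rw [has₅]; exact fun _ => rfl)
  rw [← hT₆] at row₆ dom₆
  set T₇ := cycP.sem n inp [] T₆ with hT₇
  obtain ⟨cyc₇, hcyc₇⟩ := cycP_cyc (n := n) (inp := inp) (env := []) (T := T₆) hA
    (by rw [show T₆ Table.hasCyc = T₅ Table.hasCyc from fr (by decide), hcyc₅]; exact fun _ => rfl)
  rw [← hT₇] at cyc₇ hcyc₇
  have con₇ : T₇ Table.con = T₂ Table.con := ((fr (by decide)).trans (fr (by decide))).trans con₅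
  have has₇ : T₇ Table.has = T₆ Table.has := fr (by decide)
  have row₇ : T₇ Table.row = T₆ Table.row := fr (by decide)
  set T₈ := hitP.sem n inp [] T₇ with hT₈
  obtain ⟨row₈, mono₈, has₈⟩ := hitP_row (n := n) (inp := inp) (env := []) (T := T₇) hT hP hA
    (by rw [con₇]; exact con₂) cyc₇ (R := Pinning.IsDominatingRow G L)
    (by unfold IsRowTable; rw [has₇, row₇]; exact row₆)
  rw [← hT₈] at row₈ mono₈ has₈
  have con₈ : T₈ Table.con = T₂ Table.con := (fr (by decide)).trans con₇
  refine ⟨?_, ?_, ?_, ?_, ?_⟩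
  · rw [fr (p := baseP) (j := Table.lst) (by decide), hT₈, fr (p := hitP) (by decide), hT₇,
      fr (p := cycP) (by decide), hT₆, fr (p := domRowP) (by decide), lst₅]
    exact lst₁
  · rw [fr (p := baseP) (j := Table.con) (by decide), con₈]
    exact con₂
  · rw [fr (p := baseP) (j := Table.dead) (by decide), hT₈, fr (p := hitP) (by decide), hT₇,
      fr (p := cycP) (by decide), hT₆, fr (p := domRowP) (by decide), dead₅]
    exact dead₄
  · rw [fr (p := baseP) (j := Table.rep) (by decide), hT₈, fr (p := hitP) (by decide), hT₇,
      fr (p := cycP) (by decide), hT₆, fr (p := domRowP) (by decide)]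
    exact rep₅
  -- Every component contains a vertex with a row: the first vertex of a dominating row, or a vertex
  -- on an induced cycle.
  · have key : ∀ v : Fin n, ∃ u : Fin n, G.Reachable v u ∧ T₈ Table.has u 0 0 0 ≠ 0 := by
      intro v
      rcases Pinning.exists_row hT hP v (L := L) with ⟨s, h1, h2⟩ | ⟨a, b, c, d, e, h1, h2⟩
      · refine ⟨s 0, h1 0 (by omega), mono₈ _ ?_⟩
        rw [has₇]
        exact dom₆ s (IsDominatingRow.of_reachable h2 (h1 0 (by omega)))
      · exact ⟨a, h1, has₈ _ (hcyc₇ a b c d e h2)⟩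
    have hbase : ∀ v : Fin n, _ := fun v =>
      baseP_base (n := n) (inp := inp) (env := []) (T := T₈) (G := G) (by rw [con₈]; exact con₂)
        (key v).choose_spec.1 (key v).choose_spec.2
    intro v
    obtain ⟨u, h1, h2, h3, -⟩ := hbase v
    obtain ⟨s, h5, h6⟩ := row₈ u h2
    refine ⟨s, h6.imp (fun h => IsDominatingRow.of_reachable h h1.symm)
      (fun h => IsCycleRow.of_reachable h h1.symm), fun w hw j hj => ?_⟩
    obtain ⟨u', h1', h2', h3', h4'⟩ := hbase w
    rw [h4' j hj, ← h5 j hj, le_antisymm (h3' u (hw.symm.trans h1) h2) (h3 u' (hw.trans h1') h2')]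

end RAM

/-!
# The work for one guess
-/

namespace RAM

open Stmt Fm Tm

variable {n : ℕ} {inp : ℕ → ℕ} {G : SimpleGraph (Fin n)} {L : Fin n → ℕ → Prop} {env : List ℕ}
  {P : Pinning (Fin n)} {T : Tabs}

/-- The tables contain the pinned vertices and their colours. -/
structure IsPinned (P : Pinning (Fin n)) (T : Tabs) : Prop where
  pin : ∀ j < 11, T Table.pin j 0 0 0 = P.vert j
  col : ∀ j < 11, T Table.col j 0 0 0 = P.col j
  fst : T Table.col 11 0 0 0 = P.fst
  snd : T Table.col 12 0 0 0 = P.snd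

theorem IsPinned.sem (h : IsPinned P T) {p : Stmt} (h₁ : p.writes Table.pin = false)
    (h₂ : p.writes Table.col = false) : IsPinned P (p.sem n inp env T) where
  pin := by rw [sem_of_not_writes h₁]; exact h.pin
  col := by rw [sem_of_not_writes h₂]; exact h.col
  fst := by rw [sem_of_not_writes h₂]; exact h.fst
  snd := by rw [sem_of_not_writes h₂]; exact h.snd

/-- The values of the loop variables for a guess. -/
def guess (P : Pinning (Fin n)) : List ℕ := [P.col 0, P.col 1, P.col 2, P.col 3, P.col 4, P.col 5,
  P.col 6, P.col 7, P.col 8, P.col 9, P.col 10, P.fst, P.snd, P.vert 7, P.vert 8, P.vert 9, P.vert 10]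

/-- Pin `7` is guessed and lies in the component in question; it selects the row from which the
first seven pins are copied. The other three vertices and all colours are loop variables. -/
theorem pinP_isPinned (hbase : ∀ j < 7, T Table.base (P.vert 7) j 0 0 = P.vert j) :
    IsPinned P (pinP.sem n inp ((guess P).reverse ++ env) T) := by
  simp only [guess, List.reverse_cons, List.reverse_nil, List.nil_append, List.cons_append, pinP,
    Stmt.sem_seq]
  generalize hT₁ : (store₁ Table.pin (cst 10) (var 0)).sem n inp _ _ = T₁
  have hb : T₁ Table.base = T Table.base := by
    rw [← hT₁]
    repeat rw [sem_of_not_writes (by decide)]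
  rw [show ∀ env', (loop (.lit 7) (store₁ Table.pin (var 0) (get₂ Table.base (var 4) (var 0)))).sem
    n inp env' T₁ = _ from fun env' => loop_store (fun x₁ _ _ _ => T₁ Table.base (env'.getD 3 0) x₁
      0 0) (by decide) (by decide) (by decide) (by decide) (by decide)
        fun i => by simp only [Tm.eval, Tm.eval_get₂, List.getD_cons_zero, List.getD_cons_succ]]
  simp only [Stmt.sem_store₁, Tm.eval, List.getD_cons_zero, List.getD_cons_succ] at hT₁ ⊢
  refine ⟨fun j hj => ?_, fun j hj => ?_, ?_, ?_⟩
  · by_cases h : j < 7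
    · simp only [Tabs.upd, Bd.val, and_true, exists_eq_right', h, if_true, hb]
      exact hbase j h
    · simp only [Tabs.upd, Bd.val, true_and, and_true, exists_eq_right', h, if_false]
      obtain rfl | rfl | rfl | rfl : j = 7 ∨ j = 8 ∨ j = 9 ∨ j = 10 := by omega
      all_goals simp [← hT₁, Tabs.set, Table.col, Table.pin]
  · rw [Tabs.upd_of_ne (by decide)]
    interval_cases j <;> simp [← hT₁, Tabs.set, Table.col, Table.pin]
  · rw [Tabs.upd_of_ne (by decide)]
    simp [← hT₁, Tabs.set, Table.col, Table.pin]
  · rw [Tabs.upd_of_ne (by decide)]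
    simp [← hT₁, Tabs.set, Table.col, Table.pin]

/-! ### The tables of one guess express the notions of `Pinning` -/

section Fill

variable (hA : IsMatrix inp G) (hpre : IsPrepared G L T) (hpin : IsPinned P T)

include hA hpre hpin

theorem dom₀P_dom₀ (v : Fin n) (c : Fin 3) :
    dom₀P.sem n inp env T Table.dom₀ v c 0 0 ≠ 0 ↔ P.Dom₀ G L v c := by
  have h1 : ∀ j : Fin 11, T Table.pin j 0 0 0 = P.vert j := fun j => hpin.pin j j.2
  have h2 : ∀ j : Fin 11, T Table.col j 0 0 0 = P.col j := fun j => hpin.col j j.2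
  rw [dom₀P, fill_iff (by decide) (by exact v.2) (by exact c.2) (by exact one_pos)
    (by exact one_pos)]
  simp only [Fm.eval_and, Fm.eval_imp, Fm.eval_all, Fm.eval_adj, Fm.eval_neg, Fm.eval_eq,
    Fm.eval_tt, Tm.eval_get₁, Tm.eval_get₂, Tm.eval, List.getD_cons_zero, List.getD_cons_succ,
    Bd.val, forall_lt_fin, hA _ _, h1, h2, hpre.lst, Pinning.Dom₀, Fin.val_inj, ne_eq]

omit hpre hpin in
theorem domP_dom (h : ∀ (v : Fin n) (c : Fin 3), T Table.dom₀ v c 0 0 ≠ 0 ↔ P.Dom₀ G L v c)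
    (v : Fin n) (c : Fin 3) : domP.sem n inp env T Table.dom v c 0 0 ≠ 0 ↔ P.Dom G L v c := by
  rw [domP, fill_iff (by decide) (by exact v.2) (by exact c.2) (by exact one_pos)
    (by exact one_pos)]
  simp only [Fm.eval_and, Fm.eval_imp, Fm.eval_all, Fm.eval_ex, Fm.eval_adj, Fm.eval_neg,
    Fm.eval_eq, Fm.eval_tt, Tm.eval_get₂, Tm.eval, List.getD_cons_zero, List.getD_cons_succ,
    Bd.val, forall_lt_fin, exists_lt_fin, hA _ _, h, Pinning.Dom, Fin.val_inj]

omit hpre in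
theorem clsP_cls (w u : Fin n) :
    clsP.sem n inp env T Table.cls w u 0 0 ≠ 0 ↔ P.Cls G w u := by
  have h1 : ∀ j : Fin 5, T Table.pin j 0 0 0 = P.vert j := fun j => hpin.pin j (by omega)
  have h2 : ∀ j : Fin 5, T Table.col j 0 0 0 = P.col j := fun j => hpin.col j (by omega)
  rw [clsP, fill_iff (by decide) (by exact w.2) (by exact u.2) (by exact one_pos)
    (by exact one_pos)]
  simp only [Fm.eval_and, Fm.eval_or, Fm.eval_ex, Fm.eval_adj, Fm.eval_neg, Fm.eval_eq, pinTouF,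
    pinSeeF, Tm.eval_get₁, Tm.eval, List.getD_cons_zero, List.getD_cons_succ,
    Bd.val, exists_lt_fin, hA _ _, h1, h2, hpin.fst, hpin.snd, Pinning.Cls, Pinning.Tou,
    Pinning.See]

omit hpin in
theorem candP_cand (h : ∀ (v : Fin n) (c : Fin 3), T Table.dom v c 0 0 ≠ 0 ↔ P.Dom G L v c)
    (w : Fin n) : candP.sem n inp env T Table.cand w 0 0 0 ≠ 0 ↔ P.Cand G L w := by
  rw [candP, fill_iff (by decide) (by exact w.2) (by exact one_pos) (by exact one_pos)
    (by exact one_pos)]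
  simp only [Fm.eval_and, Fm.eval_all, Fm.eval_ex, Fm.eval_adj, Fm.eval_neg, Fm.eval_imp,
    Fm.eval_tt, Tm.eval_get₁, Tm.eval_get₂, Tm.eval, List.getD_cons_zero, List.getD_cons_succ,
    Bd.val, exists_lt_fin, forall_lt_fin, hA _ _, h, hpre.dead, Pinning.Cand]

theorem impP_imp (hdom : ∀ (v : Fin n) (c : Fin 3), T Table.dom v c 0 0 ≠ 0 ↔ P.Dom G L v c)
    (hcls : ∀ w u : Fin n, T Table.cls w u 0 0 ≠ 0 ↔ P.Cls G w u)
    (hcand : ∀ w : Fin n, T Table.cand w 0 0 0 ≠ 0 ↔ P.Cand G L w) (u : Fin n) (b : Fin 2)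
    (v : Fin n) (b' : Fin 2) : impP.sem n inp env T Table.imp u b v b' ≠ 0 ↔
      P.Imp G L (P.vert 7) u b v b' := by
  have h7 : T Table.pin 7 0 0 0 = P.vert 7 := hpin.pin 7 (by omega)
  rw [impP, fill_iff (by decide) (by exact u.2) (by exact b.2) (by exact v.2) (by exact b'.2)]
  simp only [Fm.eval_and, Fm.eval_or, Fm.eval_all, Fm.eval_ex, Fm.eval_adj, Fm.eval_neg,
    Fm.eval_imp, Fm.eval_iff, Fm.eval_eq, Fm.eval_lt, Fm.eval_tt, okF, actF, valF, eval_conF,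
    Tm.eval_get₁, Tm.eval_get₂, Tm.eval, List.getD_cons_zero, List.getD_cons_succ,
    Bd.val, exists_lt_fin, forall_lt_fin, hA _ _, hdom, hcls, hcand, hpre.dead, hpre.con, h7,
    Pinning.Imp, Pinning.Ok, Pinning.Act, Pinning.Val, Pinning.Bad, Nat.reduceAdd]

omit hpin in
theorem colBP_colB (hdom : ∀ (v : Fin n) (c : Fin 3), T Table.dom v c 0 0 ≠ 0 ↔ P.Dom G L v c)
    (v : Fin n) (c : Fin 3) : colBP.sem n inp env T Table.colB v c 0 0 ≠ 0 ↔
      P.ColB G L (fun v b => T Table.asg v b 0 0 ≠ 0) v c := by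
  rw [colBP, fill_iff (by decide) (by exact v.2) (by exact c.2) (by exact one_pos)
    (by exact one_pos)]
  simp only [Fm.eval_and, Fm.eval_all, Fm.eval_ex, Fm.eval_adj, Fm.eval_neg,
    Fm.eval_imp, Fm.eval_eq, Fm.eval_lt, Fm.eval_tt, actF, colAF, valF,
    Tm.eval_get₁, Tm.eval_get₂, Tm.eval, List.getD_cons_zero, List.getD_cons_succ,
    Bd.val, exists_lt_fin, forall_lt_fin, hA _ _, hdom, hpre.dead,
    Pinning.Act, Pinning.Val, Pinning.ColA, Pinning.ColB, Nat.reduceAdd]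

end Fill

/-- The last possible colour that is found overwrites the earlier ones; any of them would do. -/
theorem colVP_colV {R : Fin n → ℕ → Prop}
    (h : ∀ (v : Fin n) (c : Fin 3), T Table.colB v c 0 0 ≠ 0 ↔ R v c) {v : Fin n}
    (hv : ∃ c < 3, R v c) : ∃ c < 3, colVP.sem n inp env T Table.colV v 0 0 0 = c ∧ R v c := by
  obtain ⟨c₀, hc₀, hR⟩ := hv
  set φ := tt (get₂ Table.colB (var 1) (var 0))
  have step : ∀ (T' : Tabs) (w : Fin n) (c : Fin 3), T' Table.colB = T Table.colB →
      (φ.eval n inp T' (c.val :: w.val :: env) ↔ R w c) := by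
    intro T' w c h1
    rw [← h, ← h1]
    rfl
  refine nest_reaches (fun T' : Tabs => T' Table.colB = T Table.colB)
    (fun T' : Tabs => ∃ c < 3, T' Table.colV v 0 0 0 = c ∧ R v c) rfl ?_ ?_ [v, c₀]
    (.cons v.2 (.cons hc₀ .nil)) ?_
  · rintro vs hvs T' h4
    exact (sem_of_not_writes (by decide)).trans h4
  · rintro vs (_ | ⟨hw, _ | ⟨hu, _ | _⟩⟩) T' hT' hQ
    obtain ⟨w, rfl⟩ := exists_fin hw
    obtain ⟨c, rfl⟩ := exists_fin hu
    simp only [List.reverse_cons, List.reverse_nil, List.nil_append, List.cons_append]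
    by_cases h6 : φ.eval n inp T' (c.val :: w.val :: env)
    · rw [sem_ite_pos h6, sem_store₁]
      rw [step T' w c hT'] at h6
      by_cases hwv : w = v
      · subst hwv
        exact ⟨c, c.2, by simp [Tabs.set, Tm.eval], h6⟩
      · have : v.val ≠ w.val := fun h => hwv (Fin.ext h).symm
        simpa [Tabs.set, Tm.eval, this] using hQ
    · rw [sem_ite_neg h6]
      exact hQ
  · intro T' hT'
    simp only [List.reverse_cons, List.reverse_nil, List.nil_append, List.cons_append]
    have h6 := (step T' v ⟨c₀, hc₀⟩ hT').2 hR
    simp only at h6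
    rw [sem_ite_pos h6, sem_store₁]
    exact ⟨c₀, hc₀, by simp [Tabs.set, Tm.eval], hR⟩

end RAM

/-!
# Correctness of the program
-/

namespace Pinning

variable {V : Type*} {G : SimpleGraph V} {L : V → ℕ → Prop} [LT V] {P : Pinning V} {f : V → ℕ}

theorem IsGood.of_reachable {ρ σ : V} (h : IsGood G L ρ f P) (hσ : G.Reachable ρ σ) :
    IsGood G L σ f P where
  agrees := h.agrees
  fits w hw u v h1 h2 hu hv :=
    h.fits w hw u v h1 h2 ⟨hu.1, hu.2.1, hσ.trans hu.2.2⟩ ⟨hv.1, hv.2.1, hσ.trans hv.2.2⟩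
  indep w w' hw := h.indep w w' (hσ.trans hw)

end Pinning

namespace RAM

open Stmt Fm Tm

variable {n : ℕ} {inp : ℕ → ℕ} {G : SimpleGraph (Fin n)} {L : Fin n → ℕ → Prop} {env : List ℕ}
  {P : Pinning (Fin n)} {T : Tabs}

/-- The hypothetical colouring enters only as a certificate: its bits are preserved by all derived
implications, so no literal is equivalent to its negation, which is what `assignment_spec` needs.
The table itself is computed without `f`. -/
theorem assignment_isAssignment {f : Fin n → ℕ} {ρ : Fin n} (hg : Pinning.IsGood G L ρ f P)
    (himp : ∀ (u : Fin n) (b : Fin 2) (v : Fin n) (c : Fin 2),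
      T Table.imp u b v c ≠ 0 ↔ P.Imp G L ρ u b v c) :
    P.IsAssignment G L ρ fun v b => (assignment Table.imp Table.asg).sem n inp env
      ((warshall Table.imp (.lit 2)).sem n inp env T) Table.asg v b 0 0 ≠ 0 := by
  set r := T.rel Table.imp n 2 with hr
  have hr' : ∀ x y, r x y → ∃ u v : Fin n, x.1 = u ∧ y.1 = v ∧ x.2 < 2 ∧ y.2 < 2 ∧
      P.Imp G L ρ u x.2 v y.2 := by
    rintro ⟨x1, x2⟩ ⟨y1, y2⟩ ⟨h1, h2, h3, h4, h5⟩
    exact ⟨⟨x1, h1⟩, ⟨y1, h3⟩, rfl, rfl, h2, h4, (himp ⟨x1, h1⟩ ⟨x2, h2⟩ ⟨y1, h3⟩ ⟨y2, h4⟩).1 h5⟩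
  have hr'' : ∀ (u v : Fin n) (b c : ℕ), b < 2 → c < 2 → P.Imp G L ρ u b v c → r (u, b) (v, c) :=
    fun u v b c hb hc h => ⟨u.2, hb, v.2, hc, (himp u ⟨b, hb⟩ v ⟨c, hc⟩).2 h⟩
  set T₁ := (warshall Table.imp (.lit 2)).sem n inp env T with hT₁
  have hW : ∀ u b v c, u < n → b < 2 → v < n → c < 2 →
      (T₁ Table.imp u b v c ≠ 0 ↔ Relation.TransGen r (u, b) (v, c)) := by
    intro u b v c hu hb hv hc
    refine Iff.trans ?_ (warshall_rel (n := n) (inp := inp) (env := env) (T := T)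
      (id := Table.imp) (b := .lit 2) (u, b) (v, c))
    exact ⟨fun h => ⟨hu, hb, hv, hc, h⟩, fun h => h.2.2.2.2⟩
  have hskew : ∀ x y, Relation.TransGen r x y →
      Relation.TransGen r (y.1, 1 - y.2) (x.1, 1 - x.2) := by
    have h1 : ∀ x y, r x y → r (y.1, 1 - y.2) (x.1, 1 - x.2) := by
      intro x y h
      obtain ⟨u, v, h1, h2, h3, h4, h5⟩ := hr' x y h
      rw [h1, h2]
      exact hr'' _ _ _ _ (by omega) (by omega) (h5.skew h3 h4)
    intro x y h
    induction h with
    | single h => exact .single (h1 _ _ h)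
    | tail _ h ih => exact .head (h1 _ _ h) ih
  obtain ⟨β, hβ, hβ'⟩ := hg.agrees.exists_bit hg.fits
  have hbit : ∀ x y, Relation.TransGen r x y → ∀ u v : Fin n, x.1 = u → y.1 = v → x.2 = β u →
      y.2 = β v := by
    have h1 : ∀ x y, r x y → ∀ u v : Fin n, x.1 = u → y.1 = v → x.2 = β u → y.2 = β v := by
      intro x y h u v hu hv hx
      obtain ⟨u', v', h1, h2, h3, h4, h5⟩ := hr' x y h
      obtain rfl : u = u' := Fin.ext (hu.symm.trans h1)
      obtain rfl : v = v' := Fin.ext (hv.symm.trans h2)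
      exact hβ' _ _ _ _ h4 h5 hx
    intro x y h
    induction h with
    | single h => exact h1 _ _ h
    | @tail y z _ h ih =>
      intro u v hu hv hx
      obtain ⟨w, -, hw, -⟩ := hr' y z h
      exact h1 _ _ h w v hw hv (ih u w hu hw hx)
  obtain ⟨htot, hex, hcl⟩ := assignment_spec (n := n) (inp := inp) (env := env) (T := T₁)
    (R := Table.imp) (A := Table.asg) (by decide)
    (fun u b v c w d hu hb hv hc hw hd h1 h2 => by
      rw [hW _ _ _ _ hu hb hv hc] at h1
      rw [hW _ _ _ _ hv hc hw hd] at h2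
      rw [hW _ _ _ _ hu hb hw hd]
      exact h1.trans h2)
    (fun u b v c hu hb hv hc h1 => by
      rw [hW _ _ _ _ hu hb hv hc] at h1
      rw [hW _ _ _ _ hv (by omega) hu (by omega)]
      exact hskew _ _ h1)
    (fun v hv h1 => by
      by_contra h2
      rw [hW _ _ _ _ hv (by omega) hv (by omega)] at h1
      replace h2 := (hW _ _ _ _ hv (by omega) hv (by omega)).1 h2
      have h3 := hβ ⟨v, hv⟩
      have h4 := hbit _ _ h1 ⟨v, hv⟩ ⟨v, hv⟩ rfl rfl
      have h5 := hbit _ _ h2 ⟨v, hv⟩ ⟨v, hv⟩ rfl rfl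
      simp only at h4 h5
      omega)
  refine ⟨fun v => htot v v.2, fun v b hb h h' => h' (hex v v.2 b hb h), ?_⟩
  intro u b hb v c hc h1 h2
  exact hcl u u.2 b hb v v.2 c hc h1
    ((hW _ _ _ _ u.2 hb v.2 hc).2 (.single (hr'' u v b c hb hc h2)))

/-- The colour that the tables contain for `v`. -/
def Tabs.colour (T : Tabs) (v : ℕ) : ℕ := T Table.colV (T Table.rep v 0 0 0) 0 0 0

theorem eval_verF (hA : IsMatrix inp G)
    (hcon : ∀ u v : Fin n, T Table.con u 0 v 0 ≠ 0 ↔ G.Reachable u v)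
    {ρ : Fin n} (hρ : T Table.pin 7 0 0 0 = ρ) : verF.eval n inp T env ↔ ∀ v, G.Reachable ρ v →
      T.colour v < 3 ∧ T Table.lst v (T.colour v) 0 0 ≠ 0 ∧
        ∀ u : Fin n, G.Adj v u → T.colour u ≠ T.colour v := by
  simp only [verF, outT, Fm.eval_all, Fm.eval_imp, Fm.eval_and, Fm.eval_lt, Fm.eval_tt, Fm.eval_adj,
    Fm.eval_neg, Fm.eval_eq, eval_conF, Tm.eval_get₁, Tm.eval_get₂, Tm.eval, List.getD_cons_zero,
    List.getD_cons_succ, Bd.val, forall_lt_fin, hA _ _, hρ, hcon, Tabs.colour, ne_eq]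

/-- For a good guess the steps from the pins to the 2-SAT solution produce a proper colouring of the
component. It need not be the colouring `f` that justified the guess. -/
theorem guessP_verF (hA : IsMatrix inp G) (hpre : IsPrepared G L T) {f : Fin n → ℕ}
    (hbase : ∀ j < 7, T Table.base (P.vert 7) j 0 0 = P.vert j)
    (hg : Pinning.IsGood G L (P.vert 7) f P) :
    verF.eval n inp (guessP.sem n inp ((guess P).reverse ++ env) T) ((guess P).reverse ++ env) := by
  set e := (guess P).reverse ++ env with he
  have fr : ∀ {j : ℕ} {p : Stmt} {T : Tabs}, p.writes j = false → p.sem n inp e T j = T j :=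
    fun h => sem_of_not_writes h
  simp only [guessP, Stmt.sem_seq]
  set T₁ := pinP.sem n inp e T with hT₁
  have pin₁ : IsPinned P T₁ := pinP_isPinned hbase
  have pre₁ : IsPrepared G L T₁ :=
    hpre.sem (by decide) (by decide) (by decide) (by decide) (by decide)
  set T₂ := dom₀P.sem n inp e T₁ with hT₂
  have dom₂ : ∀ (v : Fin n) (c : Fin 3), T₂ Table.dom₀ v c 0 0 ≠ 0 ↔ P.Dom₀ G L v c :=
    dom₀P_dom₀ hA pre₁ pin₁
  have pin₂ : IsPinned P T₂ := pin₁.sem (by decide) (by decide)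
  have pre₂ : IsPrepared G L T₂ :=
    pre₁.sem (by decide) (by decide) (by decide) (by decide) (by decide)
  set T₃ := domP.sem n inp e T₂ with hT₃
  have dom₃ : ∀ (v : Fin n) (c : Fin 3), T₃ Table.dom v c 0 0 ≠ 0 ↔ P.Dom G L v c :=
    domP_dom hA dom₂
  have pin₃ : IsPinned P T₃ := pin₂.sem (by decide) (by decide)
  have pre₃ : IsPrepared G L T₃ :=
    pre₂.sem (by decide) (by decide) (by decide) (by decide) (by decide)
  set T₄ := clsP.sem n inp e T₃ with hT₄
  have cls₄ : ∀ w u : Fin n, T₄ Table.cls w u 0 0 ≠ 0 ↔ P.Cls G w u := clsP_cls hA pin₃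
  have dom₄ : T₄ Table.dom = T₃ Table.dom := fr (by decide)
  have pin₄ : IsPinned P T₄ := pin₃.sem (by decide) (by decide)
  have pre₄ : IsPrepared G L T₄ :=
    pre₃.sem (by decide) (by decide) (by decide) (by decide) (by decide)
  set T₅ := candP.sem n inp e T₄ with hT₅
  have cand₅ : ∀ w : Fin n, T₅ Table.cand w 0 0 0 ≠ 0 ↔ P.Cand G L w :=
    candP_cand hA pre₄ (by rw [dom₄]; exact dom₃)
  have dom₅ : T₅ Table.dom = T₃ Table.dom := (fr (by decide)).trans dom₄
  have cls₅ : T₅ Table.cls = T₄ Table.cls := fr (by decide)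
  have pin₅ : IsPinned P T₅ := pin₄.sem (by decide) (by decide)
  have pre₅ : IsPrepared G L T₅ :=
    pre₄.sem (by decide) (by decide) (by decide) (by decide) (by decide)
  set T₆ := impP.sem n inp e T₅ with hT₆
  have imp₆ : ∀ (u : Fin n) (b : Fin 2) (v : Fin n) (b' : Fin 2), T₆ Table.imp u b v b' ≠ 0 ↔
      P.Imp G L (P.vert 7) u b v b' :=
    impP_imp hA pre₅ pin₅ (by rw [dom₅]; exact dom₃) (by rw [cls₅]; exact cls₄) cand₅
  have dom₆ : T₆ Table.dom = T₃ Table.dom := (fr (by decide)).trans dom₅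
  have pin₆ : IsPinned P T₆ := pin₅.sem (by decide) (by decide)
  have pre₆ : IsPrepared G L T₆ :=
    pre₅.sem (by decide) (by decide) (by decide) (by decide) (by decide)
  have hasg := assignment_isAssignment (n := n) (inp := inp) (env := e) (T := T₆) hg imp₆
  set T₇ := (warshall Table.imp (.lit 2)).sem n inp e T₆ with hT₇
  have dom₇ : T₇ Table.dom = T₃ Table.dom := (fr (by decide)).trans dom₆
  have pin₇ : IsPinned P T₇ := pin₆.sem (by decide) (by decide)
  have pre₇ : IsPrepared G L T₇ :=
    pre₆.sem (by decide) (by decide) (by decide) (by decide) (by decide)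
  set T₈ := (assignment Table.imp Table.asg).sem n inp e T₇ with hT₈
  have dom₈ : T₈ Table.dom = T₃ Table.dom := (fr (by decide)).trans dom₇
  have pin₈ : IsPinned P T₈ := pin₇.sem (by decide) (by decide)
  have pre₈ : IsPrepared G L T₈ :=
    pre₇.sem (by decide) (by decide) (by decide) (by decide) (by decide)
  set T₉ := colBP.sem n inp e T₈ with hT₉
  have colB₉ : ∀ (v : Fin n) (c : Fin 3), T₉ Table.colB v c 0 0 ≠ 0 ↔
      P.ColB G L (fun v b => T₈ Table.asg v b 0 0 ≠ 0) v c :=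
    colBP_colB hA pre₈ (by rw [dom₈]; exact dom₃)
  have pin₉ : IsPinned P T₉ := pin₈.sem (by decide) (by decide)
  have pre₉ : IsPrepared G L T₉ :=
    pre₈.sem (by decide) (by decide) (by decide) (by decide) (by decide)
  set T₁₀ := colVP.sem n inp e T₉ with hT₁₀
  have pin₁₀ : IsPinned P T₁₀ := pin₉.sem (by decide) (by decide)
  have pre₁₀ : IsPrepared G L T₁₀ :=
    pre₉.sem (by decide) (by decide) (by decide) (by decide) (by decide)
  choose rep hrep hrep' using pre₁₀.rep
  rw [eval_verF hA pre₁₀.con (pin₁₀.pin 7 (by omega))]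
  intro v hv
  obtain ⟨h1, h2, h3⟩ := hasg.colouring hg.indep (col := fun v => T₁₀ Table.colV v 0 0 0)
    (fun v hv hd => by
      obtain ⟨c, hc, h1, h2⟩ := colVP_colV (n := n) (inp := inp) (env := e) (T := T₉) colB₉
        (hasg.exists_colB (fun v => ⟨f v, hg.agrees.lt v, hg.agrees.dom v⟩) hv hd)
      rw [← hT₁₀] at h1
      rw [h1]
      exact ⟨hc, h2⟩) hrep' hv
  have h4 : ∀ v : Fin n, T₁₀.colour v = T₁₀ Table.colV (rep v) 0 0 0 := fun v => by
    rw [Tabs.colour, hrep]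
  refine ⟨by rw [h4]; exact h1, ?_, fun u hu => by rw [h4, h4]; exact h3 u hu⟩
  rw [h4]
  exact (pre₁₀.lst v ⟨_, h1⟩).2 h2

end RAM

/-!
# The loop over all guesses
-/

namespace RAM

open Stmt Fm Tm

variable {n : ℕ} {inp : ℕ → ℕ} {G : SimpleGraph (Fin n)} {L : Fin n → ℕ → Prop} {env : List ℕ}
  {P : Pinning (Fin n)} {T : Tabs}

/-- The colours that have been stored are a colouring of a union of components. -/
def IsSound (G : SimpleGraph (Fin n)) (L : Fin n → ℕ → Prop) (T : Tabs) : Prop :=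
  ∀ v : Fin n, T Table.solved v 0 0 0 ≠ 0 → (∃ c < 3, T Table.out 0 0 0 v = c + 1 ∧ L v c) ∧
    ∀ u : Fin n, G.Adj v u → T Table.solved u 0 0 0 ≠ 0 ∧ T Table.out 0 0 0 u ≠ T Table.out 0 0 0 v

/-- Terms have no arithmetic, so the shift from the colours `0, 1, 2` to `1, 2, 3` is made by cases.
-/
theorem outP_sem {i : ℕ} (h : T.colour i < 3) : outP.sem n inp (i :: env) T =
    T.set Table.out 0 0 0 i (T.colour i + 1) := by
  have h1 : ∀ k, (eq (outT (var 0)) (cst k)).eval n inp T (i :: env) ↔ T.colour i = k :=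
    fun k => Iff.rfl
  by_cases h0 : T.colour i = 0
  · rw [outP, sem_ite_pos ((h1 0).2 h0), h0]
    rfl
  rw [outP, sem_ite_neg (mt (h1 0).1 h0)]
  by_cases h2 : T.colour i = 1
  · rw [sem_ite_pos ((h1 1).2 h2), h2]
    rfl
  · rw [sem_ite_neg (mt (h1 1).1 h2), show T.colour i = 2 by omega]
    rfl

/-- The effect of storing the colours of the first `k` vertices. -/
structure IsRecorded (G : SimpleGraph (Fin n)) (ρ : Fin n) (k : ℕ) (T T' : Tabs) : Prop where
  other : ∀ j, j ≠ Table.solved → j ≠ Table.out → T' j = T j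
  new : ∀ v : Fin n, v < k → G.Reachable ρ v → T' Table.solved v 0 0 0 ≠ 0 ∧
    T' Table.out 0 0 0 v = T.colour v + 1
  old : ∀ v : Fin n, ¬ G.Reachable ρ v → T' Table.solved v 0 0 0 = T Table.solved v 0 0 0 ∧
    T' Table.out 0 0 0 v = T Table.out 0 0 0 v

theorem recordP_isRecorded (hcon : ∀ u v : Fin n, T Table.con u 0 v 0 ≠ 0 ↔ G.Reachable u v)
    {ρ : Fin n} (hρ : T Table.pin 7 0 0 0 = ρ) (h3 : ∀ v, G.Reachable ρ v → T.colour v < 3)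
    (hv : verF.eval n inp T env) : IsRecorded G ρ n T (recordP.sem n inp env T) := by
  rw [recordP, sem_ite_pos hv]
  refine iter_induction_on (fun i T' => IsRecorded G ρ i T T')
    ⟨fun _ _ _ => rfl, fun v hv => absurd hv (by omega), fun _ _ => ⟨rfl, rfl⟩⟩ ?_
  intro i hi T' hT'
  obtain ⟨w, rfl⟩ := exists_fin hi
  have hcol : ∀ (T'' : Tabs) (v : ℕ), (∀ j, j ≠ Table.solved → j ≠ Table.out → T'' j = T j) →
      T''.colour v = T.colour v := by
    intro T'' v h
    rw [Tabs.colour, h _ (by decide) (by decide), h _ (by decide) (by decide), Tabs.colour]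
  have hc : (conF (get₁ Table.pin (cst 7)) (var 0)).eval n inp T' (w :: env) ↔
      G.Reachable ρ w := by
    rw [← hcon, ← hT'.other Table.con (by decide) (by decide), ← hρ,
      ← hT'.other Table.pin (by decide) (by decide)]
    rfl
  by_cases hw : G.Reachable ρ w
  · rw [sem_ite_pos (hc.2 hw), sem_seq, sem_store₁]
    have h1 : ∀ j, j ≠ Table.solved → j ≠ Table.out → T'.set Table.solved w 0 0 0 1 j = T j := by
      intro j hj hj'
      rw [← hT'.other j hj hj']
      funext a b c d
      simp [Tabs.set, hj]
    simp only [Tm.eval, List.getD_cons_zero]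
    rw [outP_sem (by rw [hcol _ _ h1]; exact h3 w hw), hcol _ _ h1]
    refine ⟨fun j hj hj' => ?_, fun v hvw hv => ?_, fun v hv => ?_⟩
    · rw [← h1 j hj hj']
      funext a b c d
      simp [Tabs.set, hj']
    · by_cases hvw' : v = w
      · subst hvw'
        simp [Tabs.set, Table.solved, Table.out]
      · have h5 : v.val ≠ w.val := fun h => hvw' (Fin.ext h)
        have := hT'.new v (by omega) hv
        simpa [Tabs.set, h5, Table.solved, Table.out] using this
    · have h5 : v.val ≠ w.val := fun h => hv (Fin.ext h ▸ hw)
      have := hT'.old v hv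
      simpa [Tabs.set, h5, Table.solved, Table.out] using this
  · rw [sem_ite_neg (mt hc.1 hw), sem_skip]
    refine ⟨hT'.other, fun v hvw hv => hT'.new v ?_ hv, hT'.old⟩
    have : v.val ≠ w.val := fun h => hw (Fin.ext h ▸ hv)
    omega

theorem IsSound.sem (h : IsSound G L T) {p : Stmt}
    (h₁ : p.writes Table.solved = false) (h₂ : p.writes Table.out = false) :
    IsSound G L (p.sem n inp env T) := by
  unfold IsSound
  rw [sem_of_not_writes h₁, sem_of_not_writes h₂]
  exact h

/-- Nothing is assumed about the guess. A component is stored only after verification and then as a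
whole, so a later success may replace an earlier one without mixing two colourings. -/
theorem recordP_isSound (hA : IsMatrix inp G) (hpre : IsPrepared G L T) {ρ : Fin n}
    (hρ : T Table.pin 7 0 0 0 = ρ) (h : IsSound G L T) :
    IsSound G L (recordP.sem n inp env T) ∧ (∀ v : Fin n, T Table.solved v 0 0 0 ≠ 0 →
      recordP.sem n inp env T Table.solved v 0 0 0 ≠ 0) ∧
      (verF.eval n inp T env → ∀ v : Fin n, G.Reachable ρ v →
        recordP.sem n inp env T Table.solved v 0 0 0 ≠ 0) := by
  by_cases hv : verF.eval n inp T env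
  · have hv' := (eval_verF hA hpre.con hρ).1 hv
    have hrec := recordP_isRecorded hpre.con hρ (fun v hv => (hv' v hv).1) hv
    set T' := recordP.sem n inp env T
    refine ⟨fun v hs => ?_, fun v hs => ?_, fun _ v hr => (hrec.new v v.2 hr).1⟩
    · by_cases hr : G.Reachable ρ v
      · obtain ⟨h1, h2, h3⟩ := hv' v hr
        rw [(hrec.new v v.2 hr).2]
        refine ⟨⟨_, h1, rfl, (hpre.lst v ⟨_, h1⟩).1 h2⟩, fun u hu => ?_⟩
        have hur := hr.trans hu.reachable
        refine ⟨(hrec.new u u.2 hur).1, ?_⟩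
        rw [(hrec.new u u.2 hur).2]
        have := h3 u hu
        omega
      · rw [(hrec.old v hr).1] at hs
        obtain ⟨h1, h2⟩ := h v hs
        rw [(hrec.old v hr).2]
        refine ⟨h1, fun u hu => ?_⟩
        have hur : ¬ G.Reachable ρ u := fun h => hr (h.trans hu.symm.reachable)
        rw [(hrec.old u hur).1, (hrec.old u hur).2]
        exact h2 u hu
    · by_cases hr : G.Reachable ρ v
      · exact (hrec.new v v.2 hr).1
      · rw [(hrec.old v hr).1]
        exact hs
  · rw [recordP, sem_ite_neg hv]
    exact ⟨h, fun _ h => h, fun h => absurd h hv⟩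

theorem pinP_pin : pinP.sem n inp env T Table.pin 7 0 0 0 = env.getD 3 0 := by
  simp only [pinP, Stmt.sem_seq]
  generalize hT₁ : (store₁ Table.pin (cst 10) (var 0)).sem n inp _ _ = T₁
  rw [show (loop (.lit 7) (store₁ Table.pin (var 0) (get₂ Table.base (var 4) (var 0)))).sem
    n inp env T₁ = _ from loop_store (fun x₁ _ _ _ => T₁ Table.base (env.getD 3 0) x₁
      0 0) (by decide) (by decide) (by decide) (by decide) (by decide)
        fun i => by simp only [Tm.eval, Tm.eval_get₂, List.getD_cons_zero, List.getD_cons_succ]]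
  simp only [Stmt.sem_store₁, Tm.eval] at hT₁
  simp [← hT₁, Tabs.upd, Tabs.set, Tm.eval, Bd.val]

theorem guessP_pin : guessP.sem n inp env T Table.pin 7 0 0 0 = env.getD 3 0 := by
  rw [guessP, sem_seq, sem_of_not_writes (by decide), pinP_pin]

theorem guessB_getD {vs : List ℕ} (h : List.Forall₂ (fun v b => v < Bd.val n b) vs guessB) :
    (vs.reverse ++ env).getD 3 0 < n := by
  rcases h with _ | ⟨-, _ | ⟨-, _ | ⟨-, _ | ⟨-, _ | ⟨-, _ | ⟨-, _ | ⟨-, _ | ⟨-, _ | ⟨-, _ | ⟨-,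
    _ | ⟨-, _ | ⟨-, _ | ⟨-, _ | ⟨h, _ | ⟨-, _ | ⟨-, _ | ⟨-, _ | _⟩⟩⟩⟩⟩⟩⟩⟩⟩⟩⟩⟩⟩⟩⟩⟩⟩
  exact h

theorem step_isSound (hA : IsMatrix inp G) (hpre : IsPrepared G L T) (h : IsSound G L T)
    (he : env.getD 3 0 < n) :
    IsPrepared G L ((seq guessP recordP).sem n inp env T) ∧
      IsSound G L ((seq guessP recordP).sem n inp env T) ∧
      ∀ v : Fin n, T Table.solved v 0 0 0 ≠ 0 →
        (seq guessP recordP).sem n inp env T Table.solved v 0 0 0 ≠ 0 := by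
  have h1 : IsPrepared G L (guessP.sem n inp env T) :=
    hpre.sem (by decide) (by decide) (by decide) (by decide) (by decide)
  have h2 : IsSound G L (guessP.sem n inp env T) := h.sem (by decide) (by decide)
  obtain ⟨h3, h4, -⟩ := recordP_isSound (n := n) (inp := inp) (env := env) hA h1 (ρ := ⟨_, he⟩)
    guessP_pin h2
  refine ⟨hpre.sem (by decide) (by decide) (by decide) (by decide) (by decide), h3,
    fun v hv => h4 v ?_⟩
  rw [sem_of_not_writes (p := guessP) (by decide)]
  exact hv

theorem mainP_isSound (hA : IsMatrix inp G) (hpre : IsPrepared G L T) (h : IsSound G L T) :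
    IsSound G L (mainP.sem n inp [] T) :=
  (nest_induction (fun T => IsPrepared G L T ∧ IsSound G L T) ⟨hpre, h⟩ fun _ hvs _ hT =>
    have := step_isSound hA hT.1 hT.2 (guessB_getD hvs)
    ⟨this.1, this.2.1⟩).2

/-- A colouring of the graph provides a good pinning for the component of `v`. The loop comes to
this guess, the verification succeeds there, and marks in `solved` are never removed. -/
theorem mainP_solved (hT : G.CliqueFree 3) (hP : ¬ (SimpleGraph.pathGraph 7).IsIndContained G)
    (hA : IsMatrix inp G) (hpre : IsPrepared G L T) (h : IsSound G L T) {f : Fin n → ℕ}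
    (hf3 : ∀ v, f v < 3) (hfL : ∀ v, L v (f v)) (hf : ∀ u v, G.Adj u v → f u ≠ f v) (v : Fin n) :
    mainP.sem n inp [] T Table.solved v 0 0 0 ≠ 0 := by
  obtain ⟨s, hs, hbase⟩ := hpre.base v
  obtain ⟨P, hPs, h7, hcol, hfst, hsnd, hg⟩ : ∃ P : Pinning (Fin n), (∀ j < 7, P.vert j = s j) ∧
      G.Reachable v (P.vert 7) ∧ (∀ j, P.col j < 3) ∧ P.fst < 3 ∧ P.snd < 3 ∧
        Pinning.IsGood G L v f P := by
    rcases hs with hs | hs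
    · obtain ⟨P, h1, h2, h3⟩ := hs.exists_good hf3 hfL hf
      exact ⟨P, h1, h2 ▸ .refl _, h3⟩
    · exact hs.exists_good hT hP hf3 hfL hf
  refine nest_reaches (fun T' => IsPrepared G L T' ∧ IsSound G L T' ∧ T' Table.base = T Table.base)
    (fun T' => T' Table.solved v 0 0 0 ≠ 0) ⟨hpre, h, rfl⟩ ?_ ?_ (guess P)
    (.cons (hcol 0) (.cons (hcol 1) (.cons (hcol 2) (.cons (hcol 3) (.cons (hcol 4) (.cons (hcol 5)
      (.cons (hcol 6) (.cons (hcol 7) (.cons (hcol 8) (.cons (hcol 9) (.cons (hcol 10) (.cons hfst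
        (.cons hsnd (.cons (P.vert 7).2 (.cons (P.vert 8).2 (.cons (P.vert 9).2
          (.cons (P.vert 10).2 .nil))))))))))))))))) ?_
  · rintro vs hvs T' ⟨h1, h2, h3⟩
    obtain ⟨h4, h5, -⟩ := step_isSound (n := n) (inp := inp) hA h1 h2 (guessB_getD (env := []) hvs)
    exact ⟨h4, h5, (sem_of_not_writes (by decide)).trans h3⟩
  · rintro vs hvs T' ⟨h1, h2, -⟩ h3
    exact (step_isSound hA h1 h2 (guessB_getD (env := []) hvs)).2.2 v h3
  · rintro T' ⟨h1, h2, h3⟩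
    have hver := guessP_verF (n := n) (inp := inp) (env := []) (T := T') (P := P) (f := f) hA h1
      (fun j hj => by rw [h3, hbase _ h7 j hj, hPs j hj]) (hg.of_reachable h7)
    exact (recordP_isSound (ρ := P.vert 7) hA
      (h1.sem (by decide) (by decide) (by decide) (by decide) (by decide)) guessP_pin
      (h2.sem (by decide) (by decide))).2.2 hver v h7.symm

theorem colourP_spec {φ : Fm} (hT : G.CliqueFree 3)
    (hP : ¬ (SimpleGraph.pathGraph 7).IsIndContained G) (hA : IsMatrix inp G)
    (hφ : ∀ (T : Tabs) (v : Fin n) (c : Fin 3), φ.eval n inp T [0, 0, c, v] ↔ L v c)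
    (hlst : φ.uses Table.lst = false) :
    let T := (colourP φ).sem n inp [] fun _ _ _ _ _ => 0
    (T Table.flag 0 0 0 0 = 1 ∧ (∀ v : Fin n, ∃ c < 3, T Table.out 0 0 0 v = c + 1 ∧ L v c) ∧
      ∀ u v : Fin n, G.Adj u v → T Table.out 0 0 0 u ≠ T Table.out 0 0 0 v) ∨
    (T Table.flag 0 0 0 0 = 0 ∧ ¬ ∃ f : Fin n → ℕ, (∀ v, f v < 3) ∧ (∀ v, L v (f v)) ∧
      ∀ u v, G.Adj u v → f u ≠ f v) := by
  intro T
  have hpre : IsPrepared G L ((prepP φ).sem n inp [] fun _ _ _ _ _ => 0) :=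
    prepP_isPrepared hT hP hA hφ hlst
  have hs0 : IsSound G L ((prepP φ).sem n inp [] fun _ _ _ _ _ => 0) := by
    intro v hv
    rw [sem_of_not_writes (p := prepP φ) rfl] at hv
    exact absurd rfl hv
  have hf0 : mainP.sem n inp [] ((prepP φ).sem n inp [] fun _ _ _ _ _ => 0) Table.flag =
      fun _ _ _ _ => 0 := by
    rw [sem_of_not_writes (p := mainP) (by decide), sem_of_not_writes (p := prepP φ) rfl]
  have hs := mainP_isSound hA hpre hs0
  have hsolved := fun f hf3 hfL hf => mainP_solved hT hP hA hpre hs0 (f := f) hf3 hfL hf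
  have hTdef : T = flagP.sem n inp [] (mainP.sem n inp []
    ((prepP φ).sem n inp [] fun _ _ _ _ _ => 0)) := rfl
  have hout : T Table.out = mainP.sem n inp [] ((prepP φ).sem n inp [] fun _ _ _ _ _ => 0)
    Table.out := sem_of_not_writes (p := flagP) (by decide)
  clear_value T
  set T₁ := mainP.sem n inp [] ((prepP φ).sem n inp [] fun _ _ _ _ _ => 0)
  have hall : (all .size (tt (get₁ Table.solved (var 0)))).eval n inp T₁ [] ↔
      ∀ v : Fin n, T₁ Table.solved v 0 0 0 ≠ 0 := by
    simp only [Fm.eval_all, Fm.eval_tt, Tm.eval_get₁, Tm.eval, List.getD_cons_zero, Bd.val,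
      forall_lt_fin]
  by_cases h : ∀ v : Fin n, T₁ Table.solved v 0 0 0 ≠ 0
  · left
    rw [hout]
    refine ⟨?_, fun v => (hs v (h v)).1, fun u v huv => ((hs v (h v)).2 u huv.symm).2⟩
    rw [hTdef, flagP, sem_ite_pos (hall.2 h)]
    rfl
  · right
    refine ⟨?_, fun ⟨f, h1, h2, h3⟩ => h (hsolved f h1 h2 h3)⟩
    rw [hTdef, flagP, sem_ite_neg (mt hall.1 h), sem_skip, hf0]

end RAM

/-!
# The machine
-/

namespace RAM

open Stmt Fm Tm

/-- The machine program: the answer and the address of the colouring are put into registers. -/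
def colourProg (φ : Fm) : Prog :=
  .seq ((colourP φ).comp 0)
    (.seq (.assign 1 (addrE Table.out (.const 0) (.const 0) (.const 0) (.const 0)))
      (.assign 0 (.load (addrE Table.flag (.const 0) (.const 0) (.const 0) (.const 0)))))

/-- Here `n + 32 ≤ 2 ^ 4 * (n + 2)` and `33 ≤ 2 ^ 6`, whence the exponent `6 + 4 * 5`. The base `n +
2` is at least two even for the empty graph. -/
theorem le_word (n : ℕ) : 33 * rad n ^ 4 ≤ (n + 2) ^ 26 := by
  have h1 : rad n ≤ (n + 2) ^ 5 := by
    calc n + 32 ≤ 2 ^ 4 * (n + 2) := by omega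
      _ ≤ (n + 2) ^ 4 * (n + 2) := Nat.mul_le_mul_right _ (Nat.pow_le_pow_left (by omega) 4)
      _ = (n + 2) ^ 5 := by ring
  have h2 : 33 ≤ (n + 2) ^ 6 :=
    le_trans (by norm_num) (Nat.pow_le_pow_left (by omega : 2 ≤ n + 2) 6)
  calc 33 * rad n ^ 4 ≤ (n + 2) ^ 6 * ((n + 2) ^ 5) ^ 4 :=
        Nat.mul_le_mul h2 (Nat.pow_le_pow_left h1 4)
    _ = (n + 2) ^ 26 := by ring

/-- Both problems use the same program up to the formula `φ` that supplies the lists; it must be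
free of quantifiers over the input size and independent of the list table. -/
theorem colourProg_halts {φ : Fm} (hwf : φ.wf 4) (hdeg : φ.deg = 0)
    (hlst : φ.uses Table.lst = false) : ∃ K : ℕ, ∀ (n : ℕ) (G : SimpleGraph (Fin n))
      (L : Fin n → ℕ → Prop) (s : State), G.CliqueFree 3 →
      ¬ (SimpleGraph.pathGraph 7).IsIndContained G → s.reg = inputReg n → (∀ a, s.mem a ≤ 1) →
      (∀ a, rad n ^ 4 ≤ a → s.mem a = 0) → IsMatrix s.mem G →
      (∀ (T : Tabs) (v : Fin n) (c : Fin 3), φ.eval n s.mem T [0, 0, c, v] ↔ L v c) →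
      HaltsWith (colourProg φ) (fun n => K * (n + 1) ^ 7) 26 n s fun s' =>
        (s'.reg 0 = 1 ∧ (∀ v, ∃ c < 3, outputColouring n s' v = c + 1 ∧ L v c) ∧
          ∀ u v, G.Adj u v → outputColouring n s' u ≠ outputColouring n s' v) ∨
        (s'.reg 0 = 0 ∧ ¬ ∃ f : Fin n → ℕ, (∀ v, f v < 3) ∧ (∀ v, L v (f v)) ∧
          ∀ u v, G.Adj u v → f u ≠ f v) := by
  obtain ⟨K, hK⟩ := Stmt.cost_le (colourP φ)
  set eo := addrE Table.out (.const 0) (.const 0) (.const 0) (.const 0) with heo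
  set ef := addrE Table.flag (.const 0) (.const 0) (.const 0) (.const 0) with hef
  refine ⟨K + (eo.cost + 1 + ((Expr.load ef).cost + 1)), fun n G L s hT hP hreg hm1 hm0 hA hφ => ?_⟩
  have hr := thirtytwo_le_rad n
  have hrep : Rep n s.mem [] (fun _ _ _ _ _ => 0) s :=
    { reg0 := by rw [hreg]; rfl
      var := fun i hi => absurd hi (by simp)
      envlt := fun i => by simp only [List.getD_nil]; omega
      input := fun _ _ => rfl
      inplt := fun a => by have := hm1 a; omega
      tab := fun id a b c d _ _ _ _ _ => hm0 _ (le_addr n id a b c d)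
      tablt := fun _ _ _ _ _ => by omega }
  have hB := le_word n
  obtain ⟨t, s₁, hex, ht, hrep₁, -⟩ := Stmt.correct hB (colourP φ) hrep (colourP_wf φ hwf)
  have hr4 := rad_le_pow n
  have peak : ∀ (s : State) id, s.reg 0 = n → id < 32 →
      (addrE id (.const 0) (.const 0) (.const 0) (.const 0)).peak s < (n + 2) ^ 26 := by
    intro s id h0 hid
    refine addrE_peak h0 hid hB ?_ ?_ ?_ ?_ ?_ ?_ ?_ ?_ <;> simp only [Expr.eval, Expr.peak] <;> omega
  -- The output address is computed before register `0` is overwritten by the answer, because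
  -- addresses are computed from the value `n` in that register.
  have hex₁ := Exec.assign (B := (n + 2) ^ 26) s₁ 1 eo (peak _ _ hrep₁.reg0 (by decide))
  set s₂ : State := ⟨Function.update s₁.reg 1 (eo.eval s₁), s₁.mem⟩ with hs₂
  have h20 : s₂.reg 0 = n := by simp [hs₂, hrep₁.reg0]
  have h21 : s₂.reg 1 = addr n Table.out 0 0 0 0 := by
    simp [hs₂, heo, addrE_eval hrep₁.reg0, Expr.eval]
  have hload : (Expr.load ef).eval s₂ =
      (colourP φ).sem n s.mem [] (fun _ _ _ _ _ => 0) Table.flag 0 0 0 0 := by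
    rw [Expr.eval, hef, addrE_eval h20]
    exact hrep₁.tab _ _ _ _ _ (by decide) (by simp only [Expr.eval]; omega)
      (by simp only [Expr.eval]; omega) (by simp only [Expr.eval]; omega)
      (by simp only [Expr.eval]; omega)
  have hex₂ := Exec.assign (B := (n + 2) ^ 26) s₂ 0 (.load ef) (by
    have h1 := hrep₁.tablt Table.flag 0 0 0 0
    rw [← hload] at h1
    refine max_lt ?_ (peak _ _ h20 (by decide))
    simp only [Expr.eval] at h1
    omega)
  refine ⟨_, _, hex.seq (hex₁.seq hex₂), ?_, ?_⟩
  · have h1 : 1 ≤ (n + 1) ^ 7 := Nat.one_le_pow _ _ (by omega)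
    have h2 := (ht.trans (hK n)).trans (poly_weaken (colourP_deg φ hdeg))
    have h3 := Nat.mul_le_mul_left (eo.cost + 1 + ((Expr.load ef).cost + 1)) h1
    simp only [add_mul _ _ ((n + 1) ^ 7)] at h3 ⊢
    omega
  -- Colours are stored with the vertex as the last digit of the address, so they occupy consecutive
  -- cells from the address in register `1` on.
  · have hout : ∀ x, ∀ v : Fin n, outputColouring n ⟨Function.update s₂.reg 0 x, s₂.mem⟩ v =
        (colourP φ).sem n s.mem [] (fun _ _ _ _ _ => 0) Table.out 0 0 0 v := by
      intro x v
      rw [← hrep₁.tab _ _ _ _ _ (by decide) (by omega) (by omega) (by omega)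
        (by unfold rad; omega)]
      simp only [outputColouring]
      rw [Function.update_of_ne one_ne_zero, h21]
      simp only [addr, add_zero, hs₂]
    have hspec := colourP_spec hT hP hA hφ hlst
    simp only [hout, Function.update_self, hload]
    exact hspec

theorem isBigO_pow_seven (K : ℕ) : Asymptotics.IsBigO Filter.atTop
    (fun n : ℕ => ((K * (n + 1) ^ 7 : ℕ) : ℝ)) (fun n : ℕ => (n : ℝ) ^ 7) := by
  refine Asymptotics.IsBigO.of_bound (K * 2 ^ 7) ?_
  filter_upwards [Filter.eventually_ge_atTop 1] with n hn
  rw [Real.norm_of_nonneg (by positivity), Real.norm_of_nonneg (by positivity)]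
  have h : (n + 1) ^ 7 ≤ (2 * n) ^ 7 := Nat.pow_le_pow_left (by omega) 7
  rw [mul_assoc, ← mul_pow]
  exact_mod_cast Nat.mul_le_mul_left K h

/-! ### The encoding of graphs and lists -/

section Input

variable {n : ℕ}

theorem matrix_lt (u v : Fin n) : (u * n + v : ℕ) < n * n := by
  calc (u * n + v : ℕ) < u * n + n := by omega
    _ = (u + 1) * n := by ring
    _ ≤ n * n := Nat.mul_le_mul_right _ u.2

theorem matrix_inj {u v u' v' : Fin n} (h : (u * n + v : ℕ) = u' * n + v') : u = u' ∧ v = v' := by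
  have hn : 0 < n := by have := u.2; omega
  have h1 : ∀ u v : Fin n, (u * n + v : ℕ) / n = u := fun u v => by
    rw [mul_comm, Nat.mul_add_div hn, Nat.div_eq_of_lt v.2, add_zero]
  have h2 : u = u' := Fin.ext (by rw [← h1 u v, h, h1])
  subst h2
  exact ⟨rfl, Fin.ext (by omega)⟩

/-- The input ends below the region of the tables, which is therefore zero at the start, as the
empty tables require. -/
theorem input_lt (n : ℕ) : n * n + 3 * n < rad n ^ 4 := by
  have h1 : rad n ^ 2 ≤ rad n ^ 4 :=
    Nat.pow_le_pow_right (by have := thirtytwo_le_rad n; omega) (by omega)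
  have h2 : rad n ^ 2 = (n + 32) ^ 2 := rfl
  nlinarith

theorem graphInput_isMatrix (G : SimpleGraph (Fin n)) : IsMatrix (graphInput G).mem G := by
  intro u v
  have : (∃ u' v' : Fin n, (u * n + v : ℕ) = u' * n + v' ∧ G.Adj u' v') ↔ G.Adj u v := by
    constructor
    · rintro ⟨u', v', h, h'⟩
      obtain ⟨rfl, rfl⟩ := matrix_inj h
      exact h'
    · exact fun h => ⟨u, v, rfl, h⟩
  simp [graphInput, this]

theorem listInput_isMatrix (G : SimpleGraph (Fin n)) (L : Fin n → Finset ℕ) :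
    IsMatrix (listInput G L).mem G := by
  intro u v
  have h1 : (∃ u' v' : Fin n, (u * n + v : ℕ) = u' * n + v' ∧ G.Adj u' v') ↔ G.Adj u v := by
    constructor
    · rintro ⟨u', v', h, h'⟩
      obtain ⟨rfl, rfl⟩ := matrix_inj h
      exact h'
    · exact fun h => ⟨u, v, rfl, h⟩
  have h2 : ¬ ∃ (w : Fin n) (c : Fin 3), (u * n + v : ℕ) = n * n + 3 * w + c ∧
      (c : ℕ) + 1 ∈ L w := by
    rintro ⟨w, c, h, -⟩
    have := matrix_lt u v
    omega
  simp only [listInput]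
  split_ifs with h
  · simpa using h1.1 (h.resolve_right h2)
  · simpa using fun h' => h (Or.inl (h1.2 h'))

theorem listInput_list (G : SimpleGraph (Fin n)) (L : Fin n → Finset ℕ) (v : Fin n) (c : Fin 3) :
    (listInput G L).mem (n * n + 3 * v + c) ≠ 0 ↔ (c : ℕ) + 1 ∈ L v := by
  have h1 : ¬ ∃ u' v' : Fin n, (n * n + 3 * v + c : ℕ) = u' * n + v' ∧ G.Adj u' v' := by
    rintro ⟨u', v', h, -⟩
    have := matrix_lt u' v'
    omega
  have h2 : (∃ (w : Fin n) (d : Fin 3), (n * n + 3 * v + c : ℕ) = n * n + 3 * w + d ∧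
      (d : ℕ) + 1 ∈ L w) ↔ (c : ℕ) + 1 ∈ L v := by
    constructor
    · rintro ⟨w, d, h, h'⟩
      have e1 : v = w := Fin.ext (by omega)
      subst e1
      rwa [show (c : ℕ) = d by omega]
    · exact fun h => ⟨v, c, rfl, h⟩
  simp only [listInput]
  split_ifs with h
  · simpa using h2.1 (h.resolve_left h1)
  · simpa using fun h' => h (Or.inr (h2.2 h'))

end Input

end RAM

/-! ### Passage between the colours `1, 2, 3` and `0, 1, 2`, and the main theorem -/

theorem IsListColouring.exists_lt {V : Type*} {G : SimpleGraph V} {L : V → Finset ℕ} {f : V → ℕ}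
    (h : IsListColouring G L f) (hL : ∀ v, L v ⊆ {1, 2, 3}) : ∃ g : V → ℕ, (∀ v, g v < 3) ∧
      (∀ v, g v + 1 ∈ L v) ∧ ∀ u v, G.Adj u v → g u ≠ g v := by
  have h1 : ∀ v, f v = 1 ∨ f v = 2 ∨ f v = 3 := fun v => by simpa using hL v (h.1 v)
  refine ⟨fun v => f v - 1, fun v => ?_, fun v => ?_, fun u v huv => ?_⟩
  · have := h1 v
    dsimp only
    omega
  · have := h1 v
    rw [show f v - 1 + 1 = f v by omega]
    exact h.1 v
  · have := h1 u
    have := h1 v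
    have := h.2 u v huv
    dsimp only
    omega

theorem SimpleGraph.Colorable.exists_isListColouring {V : Type*} {G : SimpleGraph V}
    (h : G.Colorable 3) : ∃ f, IsListColouring G (fun _ => {1, 2, 3}) f := by
  obtain ⟨C⟩ := h
  refine ⟨fun v => (C v : ℕ) + 1, fun v => ?_, fun u v huv he => C.valid huv (Fin.ext (by
    dsimp only at he
    omega))⟩
  have := (C v).2
  simp only [Finset.mem_insert, Finset.mem_singleton]
  omega

theorem IsListColouring.colorable {V : Type*} {G : SimpleGraph V} {f : V → ℕ}
    (h : IsListColouring G (fun _ => {1, 2, 3}) f) : G.Colorable 3 := by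
  obtain ⟨g, h1, -, h2⟩ := h.exists_lt fun _ => subset_rfl
  exact ⟨SimpleGraph.Coloring.mk (fun v => ⟨g v, h1 v⟩) fun {u v} huv he =>
    h2 u v huv (congrArg Fin.val he)⟩

open RAM in
theorem isListColouring_outputColouring {n : ℕ} {G : SimpleGraph (Fin n)} {L : Fin n → Finset ℕ}
    {s : State} (h : ∀ v, ∃ c < 3, outputColouring n s v = c + 1 ∧ c + 1 ∈ L v)
    (h' : ∀ u v, G.Adj u v → outputColouring n s u ≠ outputColouring n s v) :
    IsListColouring G L (outputColouring n s) :=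
  ⟨fun v => by obtain ⟨c, -, h1, h2⟩ := h v; rwa [h1], h'⟩

theorem theorem1 :
    -- 3-colouring
    (∃ (p : RAM.Prog) (T : ℕ → ℕ) (k : ℕ),
      Asymptotics.IsBigO Filter.atTop (fun n : ℕ => (T n : ℝ)) (fun n : ℕ => (n : ℝ) ^ 7) ∧
      ∀ (n : ℕ) (G : SimpleGraph (Fin n)),
        G.CliqueFree 3 → ¬ (SimpleGraph.pathGraph 7).IsIndContained G →
        RAM.HaltsWith p T k n (RAM.graphInput G) (fun s =>
          (G.Colorable 3 → RAM.Accepts s ∧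
            IsListColouring G (fun _ => {1, 2, 3}) (RAM.outputColouring n s)) ∧
          (¬ G.Colorable 3 → RAM.Rejects s))) ∧
    -- list 3-colouring
    (∃ (p : RAM.Prog) (T : ℕ → ℕ) (k : ℕ),
      Asymptotics.IsBigO Filter.atTop (fun n : ℕ => (T n : ℝ)) (fun n : ℕ => (n : ℝ) ^ 7) ∧
      ∀ (n : ℕ) (G : SimpleGraph (Fin n)) (L : Fin n → Finset ℕ),
        G.CliqueFree 3 → ¬ (SimpleGraph.pathGraph 7).IsIndContained G →
        (∀ v, L v ⊆ {1, 2, 3}) →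
        RAM.HaltsWith p T k n (RAM.listInput G L) (fun s =>
          ((∃ f, IsListColouring G L f) → RAM.Accepts s ∧
            IsListColouring G L (RAM.outputColouring n s)) ∧
          ((¬ ∃ f, IsListColouring G L f) → RAM.Rejects s))) := by
  constructor
  -- Without lists the formula is identically true, so the list table is filled with all three
  -- colours and the input cells for lists are not read.
  · obtain ⟨K, hK⟩ := RAM.colourProg_halts (φ := .eq (.cst 0) (.cst 0)) rfl rfl rfl
    refine ⟨RAM.colourProg (.eq (.cst 0) (.cst 0)), _, 26, RAM.isBigO_pow_seven K,
      fun n G hT hP => ?_⟩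
    have hlt := RAM.input_lt n
    obtain ⟨t, s, h1, h2, h3⟩ := hK n G (fun _ c => c + 1 ∈ ({1, 2, 3} : Finset ℕ))
      (RAM.graphInput G) hT hP rfl
      (fun a => by simp only [RAM.graphInput]; split_ifs <;> omega)
      (fun a ha => by
        simp only [RAM.graphInput]
        refine if_neg ?_
        rintro ⟨u, v, h, -⟩
        have := RAM.matrix_lt u v
        omega)
      (RAM.graphInput_isMatrix G)
      (fun T v c => by
        have := c.2
        simp only [RAM.Fm.eval_eq, true_iff, Finset.mem_insert, Finset.mem_singleton]
        omega)
    refine ⟨t, s, h1, h2, ?_⟩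
    rcases h3 with ⟨h3, h4, h5⟩ | ⟨h3, h4⟩
    · have h6 := isListColouring_outputColouring h4 h5
      exact ⟨fun _ => ⟨h3, h6⟩, fun h => absurd h6.colorable h⟩
    · refine ⟨fun h => absurd ?_ h4, fun _ => h3⟩
      obtain ⟨f, hf⟩ := h.exists_isListColouring
      exact hf.exists_lt fun _ => subset_rfl
  -- While the list table is filled, the vertex is the outermost of the four loop variables and the
  -- colour is the next one.
  · obtain ⟨K, hK⟩ := RAM.colourProg_halts (φ := .lst (.var 3) (.var 2)) rfl rfl rfl
    refine ⟨RAM.colourProg (.lst (.var 3) (.var 2)), _, 26, RAM.isBigO_pow_seven K,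
      fun n G L hT hP hL => ?_⟩
    have hlt := RAM.input_lt n
    obtain ⟨t, s, h1, h2, h3⟩ := hK n G (fun v c => c + 1 ∈ L v) (RAM.listInput G L) hT hP rfl
      (fun a => by simp only [RAM.listInput]; split_ifs <;> omega)
      (fun a ha => by
        simp only [RAM.listInput]
        refine if_neg ?_
        rintro (⟨u, v, h, -⟩ | ⟨v, c, h, -⟩)
        · have := RAM.matrix_lt u v
          omega
        · omega)
      (RAM.listInput_isMatrix G L)
      (fun T v c => RAM.listInput_list G L v c)
    refine ⟨t, s, h1, h2, ?_⟩
    rcases h3 with ⟨h3, h4, h5⟩ | ⟨h3, h4⟩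
    · have h6 := isListColouring_outputColouring h4 h5
      exact ⟨fun _ => ⟨h3, h6⟩, fun h => absurd ⟨_, h6⟩ h⟩
    · exact ⟨fun ⟨f, hf⟩ => absurd (hf.exists_lt hL) h4, fun _ => h3⟩
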